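/- **Conventions.** Manifolds are smooth, finite dimensional, Hausdorff and second countable. For a Courant algebroid with metric $\langle\cdot,\cdot\rangle$ and anchor $\mathbf a$, the map $\mathbf a^*$ is dual to $\mathbf a$ with respect to the metric. On $\mathbb TM=TM\oplus T^*M$ the metric is $\langle X+\alpha,Y+\beta\rangle=\alpha(Y)+\beta(X)$; $\mathbb T_\gamma N$ denotes $TN\oplus T^*N$ with bracket $[\![X+\alpha,Y+\beta]\!]=[X,Y]+\mathcal L_X\beta-\iota_Yd\alpha+\iota_X\iota_Y\gamma$. The curvature $\gamma$ of an isotropic splitting $s$ is given by $\iota_X\iota_Y\iota_Z\gamma=\langle[\![s(X),s(Y)]\!],s(Z)\rangle$; the isomorphism with $\mathbb T_\gamma N$ given by $s$ is $\mathbf a\oplus s^*$. For a map $\mu:M\to N$ and $\omega\in\Omega^2(M)$, $R_{\mu,\omega}:\mathbb TM\dashrightarrow\mathbb T_\gamma N$ is the relation $$X-\iota_X\omega+\mu^*\alpha\ \sim\ \mu_*X+\alpha,\qquad X\in TM,\ \alpha\in T^*N .$$ A morphism of Manin pairs $R:(\mathbb E_1,E_1)\dashrightarrow(\mathbb E_2,E_2)$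 is a Dirac structure $R\subseteq\mathbb E_2\times\overline{\mathbb E_1}$ with support on the graph of a map $\mu$, with $R\circ E_1\subseteq E_2$ and $\ker R\cap E_1=0$; it is exact if $0\to\mathrm{ann}(T\mathrm{gr}\mu)\to R\to T\mathrm{gr}\mu\to0$ is exact. **Setting.** Let $\mathfrak d$ be a finite-dimensional real quadratic Lie algebra, $\mathfrak h\subseteq\mathfrak d$ a Lagrangian subalgebra, and let $\mathfrak d$ act on $N$ so that the action Courant algebroid $\mathfrak d\times N$ is exact. Let $s:TN\to\mathfrak d\times N$ be a $\mathfrak d$-invariant isotropic splitting, with curvature $\gamma$, and let $E\subseteq\mathbb T_\gamma N$ correspond to $\mathfrak h\times N$. Let $$R_{\mu,\omega}:(\mathbb TM,TM)\dashrightarrow(\mathbb T_\gamma N,E)\cong(\mathfrak d,\mathfrak h)\times N$$ be an exact morphism of Manin pairs, $\omega\in\Omega^2(M)$. Let $\mathfrak c\subseteq\mathfrak d$ be a coisotropic subalgebra and $i_N:S\to N$ an (injectively immersed) $\mathfrak c$-invariant submanifold on which $\mathfrak c$ acts transitively, i.e. $\mathbf a(\mathfrak c)_x=T_xS$ for all $x\in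 S$. Suppose that * the $\mathfrak c^\perp$-orbits in $S$ form a regular foliation with quotient $q_N:S\to N_{\mathfrak c,S}$ (a surjective submersion whose fibres are the orbits); * the graph of $\mu$ intersects $S\times M$ cleanly, so that $\mu^{-1}(S)$ is a manifold, with inclusion $i_M:\mu^{-1}(S)\to M$, and the orbits in $\mu^{-1}(S)$ of the induced action of $\mathfrak h\cap\mathfrak c^\perp$ form a regular foliation with quotient $q_M:\mu^{-1}(S)\to M_{\mathfrak c,S}$. Let $\mathfrak d_{\mathfrak c}=\mathfrak c/\mathfrak c^\perp$ and $\mathfrak h_{\mathfrak c}=(\mathfrak h\cap\mathfrak c)/(\mathfrak h\cap\mathfrak c^\perp)$. Let $R_{\mathfrak c,S}=R_2\circ R_{\mu,\omega}\circ R_1^\top:\mathbb TM_{\mathfrak c,S}\dashrightarrow\mathfrak d_{\mathfrak c}\times N_{\mathfrak c,S}$ be the reduced relation, where $R_2:\mathfrak d\times N\dashrightarrow\mathfrak d_{\mathfrak c}\times N_{\mathfrak c,S}$ is $(\xi,i_N(x))\sim(\xi+\mathfrak c^\perp,q_N(x))$ for $\xi\in\mathfrak c$, $x\in S$, and $R_1=R_{q_M}\circ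 R_{i_M}^\top$ with $R_f$ the relation $X+f^*\beta\sim f_*X+\beta$. Let $\theta\in\Omega^1(S,\mathfrak c^\perp)$ be a $\mathfrak c^\perp$-invariant connection 1-form for $q_N$: $\mathbf a(\theta(\mathbf a(\xi)))=\mathbf a(\xi)$ and $\mathcal L_{\mathbf a(\xi)}\theta+[\xi,\theta]=0$ for $\xi\in\mathfrak c^\perp$. Call $X\in TS$ horizontal if $\mathbf a(\theta(X))=0$. Define $\vartheta_s\in\Omega^1(S,(\mathfrak c^\perp)^*)$ by $\langle\xi,\vartheta_s\rangle=s^*\xi$, and let $$\langle\theta,\vartheta_s\rangle(X,Y)=\langle\theta(X),s(Y)\rangle-\langle\theta(Y),s(X)\rangle,\qquad \langle\theta,s\circ\mathbf a(\theta)\rangle(X,Y)=\langle\theta(X),s\mathbf a\theta(Y)\rangle-\langle\theta(Y),s\mathbf a\theta(X)\rangle .$$ **Statement.** 1. The action of $\mathfrak c$ on $S$ induces a unique action of $\mathfrak d_{\mathfrak c}$ on $N_{\mathfrak c,S}$, and $\mathfrak d_{\mathfrak c}\times N_{\mathfrak c,S}$ is an exact Courant algebroid. There is a unique bundle map $\tilde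 s_\theta:TN_{\mathfrak c,S}\to\mathfrak d_{\mathfrak c}\times N_{\mathfrak c,S}$ such that, for every horizontal $X\in TS$, the element $s(X)+\mathbf a^*(\iota_X\langle\theta,\vartheta_s\rangle)$ (where the covector $\iota_X\langle\theta,\vartheta_s\rangle$ on $S$ is extended arbitrarily to $N$) lies in $\mathfrak c$ and has class $\tilde s_\theta((q_N)_*X)$ modulo $\mathfrak c^\perp$; it is an isotropic splitting. With $\tilde\gamma_\theta\in\Omega^3(N_{\mathfrak c,S})$ its curvature, it identifies $\mathfrak d_{\mathfrak c}\times N_{\mathfrak c,S}\cong\mathbb T_{\tilde\gamma_\theta}N_{\mathfrak c,S}$ as Courant algebroids; let $E_{\mathfrak c,S}$ correspond to $\mathfrak h_{\mathfrak c}\times N_{\mathfrak c,S}$. 2. There are a unique smooth map $\tilde\mu:M_{\mathfrak c,S}\to N_{\mathfrak c,S}$ with $\tilde\mu\circ q_M=q_N\circ\mu|_{\mu^{-1}(S)}$ and a unique $\tilde\omega_\theta\in\Omega^2(M_{\mathfrak c,S})$ with $$q_M^*\tilde\omega_\theta=i_M^*\omega-\mu^*\bigl\langle\theta,\vartheta_s-\tfrac12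 s\circ\mathbf a(\theta)\bigr\rangle .$$ 3. Under the isomorphism in 1, the reduced relation $R_{\mathfrak c,S}$ is identified with $R_{\tilde\mu,\tilde\omega_\theta}$, and $$R_{\tilde\mu,\tilde\omega_\theta}:(\mathbb TM_{\mathfrak c,S},TM_{\mathfrak c,S})\dashrightarrow(\mathbb T_{\tilde\gamma_\theta}N_{\mathfrak c,S},E_{\mathfrak c,S})$$ is an exact morphism of Manin pairs. 4. If $s(TS)\subseteq\mathfrak c$, then $\mu^*\langle\theta,\vartheta_s-\frac12 s\circ\mathbf a(\theta)\rangle=0$, so that $q_M^*\tilde\omega_\theta=i_M^*\omega$ and $\tilde\omega_\theta$ does not depend on $\theta$. -/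

import Mathlib

open scoped Manifold ContDiff Topology

/-! ## Vector fields, forms, derivatives of functions -/

section Calculus

variable {E H : Type*} [NormedAddCommGroup E] [NormedSpace ℝ E] [TopologicalSpace H]
  (I : ModelWithCorners ℝ E H) {B : Type*} [TopologicalSpace B] [ChartedSpace H B]

/-- The vector field `X` is smooth. -/
def SmoothField [IsManifold I ∞ B] (X : ∀ x : B, TangentSpace I x) : Prop :=
  ContMDiff I I.tangent ∞ (fun x => (⟨x, X x⟩ : TangentBundle I B))

/-- The real function `f` is smooth. -/
def SmoothFun (f : B → ℝ) : Prop := ContMDiff I 𝓘(ℝ, ℝ) ∞ f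

/-- The derivative `v f` of the real function `f` along the tangent vector `v` at `x`. -/
noncomputable def dirDeriv (f : B → ℝ) (x : B) (v : TangentSpace I x) : ℝ :=
  mfderiv I 𝓘(ℝ, ℝ) f x v

/-- The fibre `T_x^* B` (fibres are finite dimensional). -/
abbrev CotangentFibre (x : B) : Type _ := Module.Dual ℝ (TangentSpace I x)

/-- The fibre `T_x B ⊕ T_x^* B` of the generalized tangent bundle. -/
abbrev GenTangent (x : B) : Type _ := TangentSpace I x × CotangentFibre I x

/-- The 1-form `α` is smooth: it takes smooth vector fields to smooth functions. -/
def SmoothOneForm [IsManifold I ∞ B] (α : ∀ x : B, CotangentFibre I x) : Prop :=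
  ∀ X : ∀ x : B, TangentSpace I x, SmoothField I X → SmoothFun I (fun x => α x (X x))

/-- `ω ∈ Ω²(B)`: alternating and smooth. -/
structure IsTwoForm [IsManifold I ∞ B]
    (φ : ∀ x : B, TangentSpace I x →ₗ[ℝ] TangentSpace I x →ₗ[ℝ] ℝ) : Prop where
  alt : ∀ x v, φ x v v = 0
  smooth : ∀ X Y : ∀ x : B, TangentSpace I x, SmoothField I X → SmoothField I Y →
    SmoothFun I (fun x => φ x (X x) (Y x))

/-- `γ ∈ Ω³(B)`: alternating and smooth. -/
structure IsThreeForm [IsManifold I ∞ B]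
    (γ : ∀ x : B, TangentSpace I x →ₗ[ℝ] TangentSpace I x →ₗ[ℝ] TangentSpace I x →ₗ[ℝ] ℝ) :
    Prop where
  alt₁₂ : ∀ x v w, γ x v v w = 0
  alt₂₃ : ∀ x v w, γ x v w w = 0
  smooth : ∀ X Y Z : ∀ x : B, TangentSpace I x, SmoothField I X → SmoothField I Y →
    SmoothField I Z → SmoothFun I (fun x => γ x (X x) (Y x) (Z x))

end Calculus

/-! ## Courant brackets, Dirac structures, Courant relations -/

/-- The structure maps of a Courant algebroid with fibres `V x` over `B`: the smooth sections, the
metric, the anchor and the Courant bracket. `bracket e₁ e₂ e₃` says that `⟦e₁, e₂⟧ = e₃`. This record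
only organizes the constructions below; it is used for the concrete Courant algebroids
`actionCourant`, `tangentCourant` and their products. -/
structure CourantData {E H : Type*} [NormedAddCommGroup E] [NormedSpace ℝ E] [TopologicalSpace H]
    (I : ModelWithCorners ℝ E H) {B : Type*} [TopologicalSpace B] [ChartedSpace H B]
    (V : B → Type*) [∀ x, AddCommGroup (V x)] [∀ x, Module ℝ (V x)] where
  smooth : (∀ x, V x) → Prop
  pairing : ∀ x, V x →ₗ[ℝ] V x →ₗ[ℝ] ℝ
  anchor : ∀ x, V x →ₗ[ℝ] TangentSpace I x
  bracket : (∀ x, V x) → (∀ x, V x) → (∀ x, V x) → Prop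

namespace CourantData

section General

variable {E H : Type*} [NormedAddCommGroup E] [NormedSpace ℝ E] [TopologicalSpace H]
  {I : ModelWithCorners ℝ E H} {B : Type*} [TopologicalSpace B] [ChartedSpace H B]
  {V : B → Type*} [∀ x, AddCommGroup (V x)] [∀ x, Module ℝ (V x)]
  (C : CourantData I V)

/-- `e = a^* β`, where `a^*` is dual to the anchor: `⟨e, e'⟩ = β (a e')` for all `e'`. -/
def IsCoanchor (x : B) (β : CotangentFibre I x) (e : V x) : Prop :=
  ∀ e' : V x, C.pairing x e e' = β (C.anchor x e')

/-- Exactness of `0 → T^*B → V → TB → 0`. -/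
structure IsExact : Prop where
  injective : ∀ x β, C.IsCoanchor x β 0 → β = 0
  range_le_ker : ∀ x β e, C.IsCoanchor x β e → C.anchor x e = 0
  ker_le_range : ∀ x e, C.anchor x e = 0 → ∃ β, C.IsCoanchor x β e
  surjective : ∀ x, Function.Surjective (C.anchor x)

/-- `E` is a Dirac structure with support on (the image of) `i : S → B`: a smooth Lagrangian
subbundle of `V|_S` that is closed under the Courant bracket. The rank is constant because `E` is
Lagrangian; smoothness says that each element of `E` is a value of a smooth section of `V` which
takes values in `E` on a neighbourhood in `S`. -/
structure IsDirac {S : Type*} [TopologicalSpace S] (i : S → B) (L : ∀ s, Set (V (i s))) :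
    Prop where
  lagrangian : ∀ s e, e ∈ L s ↔ ∀ e' ∈ L s, C.pairing (i s) e e' = 0
  subbundle : ∀ s, ∀ e ∈ L s, ∃ σ : ∀ x, V x, C.smooth σ ∧ σ (i s) = e ∧
    ∀ᶠ s' in 𝓝 s, σ (i s') ∈ L s'
  involutive : ∀ σ₁ σ₂ σ₃ : ∀ x, V x, C.smooth σ₁ → C.smooth σ₂ → C.bracket σ₁ σ₂ σ₃ →
    (∀ s, σ₁ (i s) ∈ L s) → (∀ s, σ₂ (i s) ∈ L s) → ∀ s, σ₃ (i s) ∈ L s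

/-- Exactness of `0 → ann(TS) → L → TS → 0` for a Dirac structure `L` with support on
`i : S → B`. -/
structure IsExactDirac {E' H' : Type*} [NormedAddCommGroup E'] [NormedSpace ℝ E']
    [TopologicalSpace H'] (J : ModelWithCorners ℝ E' H') {S : Type*} [TopologicalSpace S]
    [ChartedSpace H' S] (i : S → B) (L : ∀ s, Set (V (i s))) : Prop
    extends C.IsDirac i L where
  coanchor_mem : ∀ s (β : CotangentFibre I (i s)) e, (∀ v, β (mfderiv J I i s v) = 0) →
    C.IsCoanchor (i s) β e → e ∈ L s
  injective : ∀ s (β : CotangentFibre I (i s)), (∀ v, β (mfderiv J I i s v) = 0) →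
    C.IsCoanchor (i s) β 0 → β = 0
  ker_iff : ∀ s, ∀ e ∈ L s, C.anchor (i s) e = 0 ↔
    ∃ β : CotangentFibre I (i s), (∀ v, β (mfderiv J I i s v) = 0) ∧ C.IsCoanchor (i s) β e
  range_eq : ∀ s, C.anchor (i s) '' L s = Set.range (mfderiv J I i s)

/-- `s : TB → V` is an isotropic splitting (a smooth bundle map). -/
structure IsIsotropicSplitting [IsManifold I ∞ B] (s : ∀ x : B, TangentSpace I x →ₗ[ℝ] V x) : Prop where
  smooth : ∀ X : ∀ x : B, TangentSpace I x, SmoothField I X → C.smooth (fun x => s x (X x))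
  splits : ∀ x v, C.anchor x (s x v) = v
  isotropic : ∀ x v w, C.pairing x (s x v) (s x w) = 0

/-- `γ` is the curvature 3-form of `s`: `ι_X ι_Y ι_Z γ = ⟨⟦s X, s Y⟧, s Z⟩`. -/
structure IsCurvature [IsManifold I ∞ B] (s : ∀ x : B, TangentSpace I x →ₗ[ℝ] V x)
    (γ : ∀ x : B, TangentSpace I x →ₗ[ℝ] TangentSpace I x →ₗ[ℝ] TangentSpace I x →ₗ[ℝ] ℝ) :
    Prop where
  form : IsThreeForm I γ
  eq : ∀ X Y Z : ∀ x : B, TangentSpace I x,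
    SmoothField I X → SmoothField I Y → SmoothField I Z →
    ∀ σ, C.bracket (fun x => s x (X x)) (fun x => s x (Y x)) σ →
    ∀ x, γ x (Z x) (Y x) (X x) = C.pairing x (σ x) (s x (Z x))

/-- The map `a ⊕ s^* : V → TB ⊕ T^*B` (the inverse of `s ⊕ a^*` when `s` is an isotropic splitting
of an exact Courant algebroid). -/
noncomputable def splitMap (s : ∀ x : B, TangentSpace I x →ₗ[ℝ] V x) (x : B) : V x →ₗ[ℝ] GenTangent I x :=
  (C.anchor x).prod ((LinearMap.lcomp ℝ ℝ (s x)).comp (C.pairing x))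

/-- `Φ` is an isomorphism of Courant algebroids over the identity of `B`. -/
structure IsIso {V' : B → Type*} [∀ x, AddCommGroup (V' x)] [∀ x, Module ℝ (V' x)]
    (C' : CourantData I V') (Φ : ∀ x, V x →ₗ[ℝ] V' x) : Prop where
  bijective : ∀ x, Function.Bijective (Φ x)
  smooth : ∀ σ : ∀ x, V x, C.smooth σ ↔ C'.smooth (fun x => Φ x (σ x))
  pairing : ∀ x e e', C'.pairing x (Φ x e) (Φ x e') = C.pairing x e e'
  anchor : ∀ x e, C'.anchor x (Φ x e) = C.anchor x e
  bracket : ∀ σ₁ σ₂ σ₃ : ∀ x, V x, C.smooth σ₁ → C.smooth σ₂ →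
    (C.bracket σ₁ σ₂ σ₃ ↔
      C'.bracket (fun x => Φ x (σ₁ x)) (fun x => Φ x (σ₂ x)) (fun x => Φ x (σ₃ x)))

end General

section Product

variable {E₁ H₁ E₂ H₂ : Type*}
  [NormedAddCommGroup E₁] [NormedSpace ℝ E₁] [TopologicalSpace H₁]
  [NormedAddCommGroup E₂] [NormedSpace ℝ E₂] [TopologicalSpace H₂]
  {I₁ : ModelWithCorners ℝ E₁ H₁} {I₂ : ModelWithCorners ℝ E₂ H₂}
  {M₁ M₂ : Type*} [TopologicalSpace M₁] [ChartedSpace H₁ M₁]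
  [TopologicalSpace M₂] [ChartedSpace H₂ M₂]
  {V₁ : M₁ → Type*} [∀ x, AddCommGroup (V₁ x)] [∀ x, Module ℝ (V₁ x)]
  {V₂ : M₂ → Type*} [∀ x, AddCommGroup (V₂ x)] [∀ x, Module ℝ (V₂ x)]

/-- A finite sum `∑ j, f j • (a j, b j)` of pulled back sections `(a j, b j)` of the factors with
coefficients `f j` in the smooth functions on `M₂ × M₁`. All smooth sections of the exterior sum
of the two bundles have this form. -/
structure SectionSum (C₂ : CourantData I₂ V₂) (C₁ : CourantData I₁ V₁) where
  n : ℕ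
  f : Fin n → M₂ × M₁ → ℝ
  a : Fin n → ∀ x, V₂ x
  b : Fin n → ∀ x, V₁ x
  smooth_f : ∀ j, SmoothFun (I₂.prod I₁) (f j)
  smooth_a : ∀ j, C₂.smooth (a j)
  smooth_b : ∀ j, C₁.smooth (b j)

/-- The section of the exterior sum that a `SectionSum` represents. -/
def SectionSum.eval {C₂ : CourantData I₂ V₂} {C₁ : CourantData I₁ V₁} (σ : SectionSum C₂ C₁)
    (p : M₂ × M₁) : V₂ p.1 × V₁ p.2 :=
  ∑ j, σ.f j p • (σ.a j p.1, σ.b j p.2)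

/-- The metric of the product with the metric of the second factor negated. -/
def prodPairing (C₂ : CourantData I₂ V₂) (C₁ : CourantData I₁ V₁) (p : M₂ × M₁) :
    (V₂ p.1 × V₁ p.2) →ₗ[ℝ] (V₂ p.1 × V₁ p.2) →ₗ[ℝ] ℝ :=
  (C₂.pairing p.1).compl₁₂ (LinearMap.fst ℝ _ _) (LinearMap.fst ℝ _ _) -
    (C₁.pairing p.2).compl₁₂ (LinearMap.snd ℝ _ _) (LinearMap.snd ℝ _ _)

/-- The anchor of the product. -/
noncomputable def prodAnchor (C₂ : CourantData I₂ V₂) (C₁ : CourantData I₁ V₁) (p : M₂ × M₁) :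
    (V₂ p.1 × V₁ p.2) →ₗ[ℝ] TangentSpace (I₂.prod I₁) p :=
  ((C₂.anchor p.1).prodMap (C₁.anchor p.2) :
    (V₂ p.1 × V₁ p.2) →ₗ[ℝ] (TangentSpace I₂ p.1 × TangentSpace I₁ p.2))

/-- The Courant algebroid `𝔼₂ × \overline{𝔼₁}` over `M₂ × M₁`. Its bracket is componentwise on
pulled back sections `u, v` and is extended to all sections by the Leibniz rules, that is
`⟦f u, g v⟧ = f g ⟦u, v⟧ + f (a(u) g) v - g (a(v) f) u + g ⟨u, v⟩ a^* df`; it is written out here by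
pairing both sides with an arbitrary element `e`. -/
noncomputable def prodConj (C₂ : CourantData I₂ V₂) (C₁ : CourantData I₁ V₁) :
    CourantData (I₂.prod I₁) (fun p : M₂ × M₁ => V₂ p.1 × V₁ p.2) where
  smooth z := ∃ σ : SectionSum C₂ C₁, z = σ.eval
  pairing p := prodPairing C₂ C₁ p
  anchor p := prodAnchor C₂ C₁ p
  bracket z z' w := ∃ σ σ' : SectionSum C₂ C₁, z = σ.eval ∧ z' = σ'.eval ∧
    ∃ (c : Fin σ.n → Fin σ'.n → ∀ x, V₂ x) (d : Fin σ.n → Fin σ'.n → ∀ x, V₁ x),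
      (∀ j k, C₂.bracket (σ.a j) (σ'.a k) (c j k)) ∧
      (∀ j k, C₁.bracket (σ.b j) (σ'.b k) (d j k)) ∧
      ∀ (p : M₂ × M₁) (e : V₂ p.1 × V₁ p.2),
        prodPairing C₂ C₁ p (w p) e = ∑ j, ∑ k,
          (σ.f j p * σ'.f k p * prodPairing C₂ C₁ p (c j k p.1, d j k p.2) e
            + σ.f j p *
              dirDeriv (I₂.prod I₁) (σ'.f k) p (prodAnchor C₂ C₁ p (σ.a j p.1, σ.b j p.2)) *
              prodPairing C₂ C₁ p (σ'.a k p.1, σ'.b k p.2) e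
            - σ'.f k p *
              dirDeriv (I₂.prod I₁) (σ.f j) p (prodAnchor C₂ C₁ p (σ'.a k p.1, σ'.b k p.2)) *
              prodPairing C₂ C₁ p (σ.a j p.1, σ.b j p.2) e
            + σ'.f k p *
              prodPairing C₂ C₁ p (σ.a j p.1, σ.b j p.2) (σ'.a k p.1, σ'.b k p.2) *
              dirDeriv (I₂.prod I₁) (σ.f j) p (prodAnchor C₂ C₁ p e))

end Product

end CourantData

/-- Relations `𝔼₁ ⇢ 𝔼₂` between total spaces; `R u v` means `u ∼_R v`. -/
abbrev BundleRel {M₁ M₂ : Type*} (V₁ : M₁ → Type*) (V₂ : M₂ → Type*) : Type _ :=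
  (Σ x, V₁ x) → (Σ y, V₂ y) → Prop

section Morphisms

variable {E₁ H₁ E₂ H₂ : Type*}
  [NormedAddCommGroup E₁] [NormedSpace ℝ E₁] [TopologicalSpace H₁]
  [NormedAddCommGroup E₂] [NormedSpace ℝ E₂] [TopologicalSpace H₂]
  {I₁ : ModelWithCorners ℝ E₁ H₁} {I₂ : ModelWithCorners ℝ E₂ H₂}
  {M₁ M₂ : Type*} [TopologicalSpace M₁] [ChartedSpace H₁ M₁]
  [TopologicalSpace M₂] [ChartedSpace H₂ M₂]
  {V₁ : M₁ → Type*} [∀ x, AddCommGroup (V₁ x)] [∀ x, Module ℝ (V₁ x)]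
  {V₂ : M₂ → Type*} [∀ x, AddCommGroup (V₂ x)] [∀ x, Module ℝ (V₂ x)]

/-- The embedding of `M₁` onto the graph of `μ` in `M₂ × M₁`. -/
def graphMap (μ : M₁ → M₂) (m : M₁) : M₂ × M₁ := (μ m, m)

/-- The fibre of `R` over the point `(μ m, m)` of the graph of `μ`. -/
def graphFibre (μ : M₁ → M₂) (R : BundleRel V₁ V₂) (m : M₁) :
    Set (V₂ (graphMap μ m).1 × V₁ (graphMap μ m).2) :=
  {e | R ⟨m, e.2⟩ ⟨μ m, e.1⟩}

/-- `R : (𝔼₁, L₁) ⇢ (𝔼₂, L₂)` is an exact morphism of Manin pairs over the map `μ`. -/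
structure IsExactManinMorphism (C₁ : CourantData I₁ V₁) (L₁ : ∀ x, Set (V₁ x))
    (C₂ : CourantData I₂ V₂) (L₂ : ∀ x, Set (V₂ x)) (μ : M₁ → M₂) (R : BundleRel V₁ V₂) :
    Prop where
  manin₁ : C₁.IsDirac id L₁
  manin₂ : C₂.IsDirac id L₂
  smooth : ContMDiff I₁ I₂ ∞ μ
  support : ∀ u v, R u v → v.1 = μ u.1
  exactDirac : (C₂.prodConj C₁).IsExactDirac I₁ (graphMap μ) (graphFibre μ R)
  m1 : ∀ m, ∀ e₁ ∈ L₁ m, ∀ e₂, R ⟨m, e₁⟩ ⟨μ m, e₂⟩ → e₂ ∈ L₂ (μ m)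
  m2 : ∀ m, ∀ e₁ ∈ L₁ m, R ⟨m, e₁⟩ ⟨μ m, 0⟩ → e₁ = 0

end Morphisms

/-! ## Twisted exact Courant algebroids `𝕋_γ N` and the relations `R_{μ,ω}` -/

section Tangent

variable {E H : Type*} [NormedAddCommGroup E] [NormedSpace ℝ E] [TopologicalSpace H]
  (I : ModelWithCorners ℝ E H) {B : Type*} [TopologicalSpace B] [ChartedSpace H B]

/-- The `γ`-twisted Courant algebroid `TB ⊕ T^*B`, with
`⟦X + α, Y + β⟧ = [X, Y] + L_X β - ι_Y dα + ι_X ι_Y γ`; the 1-form on the right is written out by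
evaluating it on an arbitrary vector field `Z`. -/
noncomputable def tangentCourant [IsManifold I ∞ B]
    (γ : ∀ x : B, TangentSpace I x →ₗ[ℝ] TangentSpace I x →ₗ[ℝ] TangentSpace I x →ₗ[ℝ] ℝ) :
    CourantData I (fun x : B => GenTangent I x) where
  smooth z := SmoothField I (fun x => (z x).1) ∧ SmoothOneForm I (fun x => (z x).2)
  pairing x := (LinearMap.applyₗ.flip.compl₁₂ (LinearMap.snd ℝ _ _) (LinearMap.fst ℝ _ _) :
      GenTangent I x →ₗ[ℝ] GenTangent I x →ₗ[ℝ] ℝ) +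
    (LinearMap.applyₗ.compl₁₂ (LinearMap.fst ℝ _ _) (LinearMap.snd ℝ _ _) :
      GenTangent I x →ₗ[ℝ] GenTangent I x →ₗ[ℝ] ℝ)
  anchor _ := LinearMap.fst ℝ _ _
  bracket z z' w := ∀ x,
    (w x).1 = VectorField.mlieBracket I (fun y => (z y).1) (fun y => (z' y).1) x ∧
    ∀ Z : ∀ y : B, TangentSpace I y, SmoothField I Z →
      (w x).2 (Z x) =
        (dirDeriv I (fun y => (z' y).2 (Z y)) x (z x).1
          - (z' x).2 (VectorField.mlieBracket I (fun y => (z y).1) Z x))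
        - (dirDeriv I (fun y => (z y).2 (Z y)) x (z' x).1
          - dirDeriv I (fun y => (z y).2 ((z' y).1)) x (Z x)
          - (z x).2 (VectorField.mlieBracket I (fun y => (z' y).1) Z x))
        + γ x (z' x).1 (z x).1 (Z x)

/-- The Dirac structure `TB ⊆ TB ⊕ T^*B`. -/
def tangentDirac (x : B) : Set (GenTangent I x) := {e | e.2 = 0}

variable {I}
variable {E' H' : Type*} [NormedAddCommGroup E'] [NormedSpace ℝ E'] [TopologicalSpace H']
  {I' : ModelWithCorners ℝ E' H'} {B' : Type*} [TopologicalSpace B'] [ChartedSpace H' B']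

variable (I I') in
/-- The standard lift of a map: `X + f^* β ∼ f_* X + β`. -/
def stdLift (f : B → B') : BundleRel (fun x : B => GenTangent I x) (fun y : B' => GenTangent I' y) :=
  fun u v => ∃ (x : B) (X : TangentSpace I x) (β : CotangentFibre I' (f x)),
    u = ⟨x, X, β ∘ₗ (mfderiv I I' f x : TangentSpace I x →ₗ[ℝ] TangentSpace I' (f x))⟩ ∧
    v = ⟨f x, mfderiv I I' f x X, β⟩

variable (I I') in
/-- The relation `R_{μ,ω}`: `X - ι_X ω + μ^* α ∼ μ_* X + α`. -/
def formRel (μ : B → B') (φ : ∀ x : B, TangentSpace I x →ₗ[ℝ] TangentSpace I x →ₗ[ℝ] ℝ) :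
    BundleRel (fun x : B => GenTangent I x) (fun y : B' => GenTangent I' y) :=
  fun u v => ∃ (x : B) (X : TangentSpace I x) (α : CotangentFibre I' (μ x)),
    u = ⟨x, X, -(φ x X) +
      α ∘ₗ (mfderiv I I' μ x : TangentSpace I x →ₗ[ℝ] TangentSpace I' (μ x))⟩ ∧
    v = ⟨μ x, mfderiv I I' μ x X, α⟩

end Tangent

/-! ## Quadratic Lie algebras and coisotropic reduction -/

/-- An invariant non-degenerate symmetric bilinear form. -/
structure InvariantMetric (𝔡 : Type*) [LieRing 𝔡] [LieAlgebra ℝ 𝔡] where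
  form : LinearMap.BilinForm ℝ 𝔡
  symm : ∀ x y, form x y = form y x
  nondeg : ∀ x, (∀ y, form x y = 0) → x = 0
  inv : ∀ x y z, form ⁅x, y⁆ z = form x ⁅y, z⁆

namespace InvariantMetric

variable {𝔡 : Type*} [LieRing 𝔡] [LieAlgebra ℝ 𝔡] (D : InvariantMetric 𝔡)

/-- `𝔠^⊥`. -/
def perp (𝔠 : LieSubalgebra ℝ 𝔡) : Submodule ℝ 𝔡 := D.form.orthogonal 𝔠.toSubmodule

theorem mem_perp {𝔠 : LieSubalgebra ℝ 𝔡} {x : 𝔡} : x ∈ D.perp 𝔠 ↔ ∀ y ∈ 𝔠, D.form y x = 0 :=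
  Iff.rfl

/-- `𝔠 ∩ 𝔠^⊥`, as an ideal of `𝔠`; it is `𝔠^⊥` if `𝔠` is coisotropic. -/
def perpIdeal (𝔠 : LieSubalgebra ℝ 𝔡) : LieIdeal ℝ 𝔠 where
  toSubmodule := (D.perp 𝔠).comap 𝔠.toSubmodule.subtype
  lie_mem {x m} hm := fun y hy => by
    have h := D.inv y (x : 𝔡) (m : 𝔡)
    have h' : D.form ⁅y, (x : 𝔡)⁆ (m : 𝔡) = 0 := hm _ (𝔠.lie_mem hy x.2)
    exact h.symm.trans h'

theorem mem_perpIdeal {𝔠 : LieSubalgebra ℝ 𝔡} {x : 𝔠} :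
    x ∈ D.perpIdeal 𝔠 ↔ (x : 𝔡) ∈ D.perp 𝔠 := Iff.rfl

/-- The Lie algebra `𝔡_𝔠 = 𝔠 / 𝔠^⊥`. -/
abbrev Reduced (𝔠 : LieSubalgebra ℝ 𝔡) : Type _ := 𝔠 ⧸ D.perpIdeal 𝔠

/-- The projection `𝔠 → 𝔠 / 𝔠^⊥`. -/
def toReduced (𝔠 : LieSubalgebra ℝ 𝔡) (x : 𝔠) : D.Reduced 𝔠 := LieSubmodule.Quotient.mk x

end InvariantMetric

namespace InvariantMetric

variable {𝔡 : Type*} [LieRing 𝔡] [LieAlgebra ℝ 𝔡] (D : InvariantMetric 𝔡)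

/-- The bilinear form on `𝔠 / 𝔠^⊥` induced by the metric. -/
def reducedForm (𝔠 : LieSubalgebra ℝ 𝔡) : LinearMap.BilinForm ℝ (D.Reduced 𝔠) :=
  LinearMap.liftQ₂ (D.perpIdeal 𝔠).toSubmodule (D.perpIdeal 𝔠).toSubmodule
    (D.form.compl₁₂ 𝔠.toSubmodule.subtype 𝔠.toSubmodule.subtype)
    (fun x hx => LinearMap.ext fun y =>
      (D.symm (x : 𝔡) (y : 𝔡)).trans ((D.mem_perpIdeal.1 hx) (y : 𝔡) y.2))
    (fun _ hx => LinearMap.ext fun y => (D.mem_perpIdeal.1 hx) (y : 𝔡) y.2)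

theorem reducedForm_mk (𝔠 : LieSubalgebra ℝ 𝔡) (x y : 𝔠) :
    D.reducedForm 𝔠 (D.toReduced 𝔠 x) (D.toReduced 𝔠 y) = D.form x y := rfl

/-- The invariant metric on `𝔠 / 𝔠^⊥` induced by the metric. -/
def reduced (𝔠 : LieSubalgebra ℝ 𝔡) : InvariantMetric (D.Reduced 𝔠) where
  form := D.reducedForm 𝔠
  symm x y := by
    induction x using Submodule.Quotient.induction_on with | H x => ?_
    induction y using Submodule.Quotient.induction_on with | H y => ?_
    exact D.symm (x : 𝔡) (y : 𝔡)
  nondeg x hx := by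
    induction x using Submodule.Quotient.induction_on with | H x => ?_
    refine (Submodule.Quotient.mk_eq_zero _).2 ?_
    exact D.mem_perpIdeal.2 fun y hy =>
      (D.symm y (x : 𝔡)).trans (hx (D.toReduced 𝔠 ⟨y, hy⟩))
  inv x y z := by
    induction x using Submodule.Quotient.induction_on with | H x => ?_
    induction y using Submodule.Quotient.induction_on with | H y => ?_
    induction z using Submodule.Quotient.induction_on with | H z => ?_
    exact D.inv (x : 𝔡) (y : 𝔡) (z : 𝔡)

/-- `𝔥_𝔠 = (𝔥 ∩ 𝔠) / (𝔥 ∩ 𝔠^⊥)`, as a subset of `𝔠 / 𝔠^⊥`. -/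
def reducedSub (𝔠 𝔥 : LieSubalgebra ℝ 𝔡) : Set (D.Reduced 𝔠) :=
  {η | ∃ ξ : 𝔠, (ξ : 𝔡) ∈ 𝔥 ∧ D.toReduced 𝔠 ξ = η}

end InvariantMetric

/-! ## Lie algebra actions and action Courant algebroids -/

section Actions

variable {E H : Type*} [NormedAddCommGroup E] [NormedSpace ℝ E] [TopologicalSpace H]
  (I : ModelWithCorners ℝ E H) (𝔡 : Type*) [LieRing 𝔡] [LieAlgebra ℝ 𝔡]
  (N : Type*) [TopologicalSpace N] [ChartedSpace H N] [IsManifold I ∞ N]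

/-- An action of the Lie algebra `𝔡` on `N`: a homomorphism from `𝔡` to the smooth vector fields. -/
structure LieAction where
  field : 𝔡 →ₗ[ℝ] (∀ x : N, TangentSpace I x)
  smooth : ∀ ξ, SmoothField I (field ξ)
  map_lie : ∀ ξ η x, field ⁅ξ, η⁆ x = VectorField.mlieBracket I (field ξ) (field η) x

variable {I 𝔡 N}

/-- The action Courant algebroid `𝔡 × N`, with
`⟦f, g⟧ = [f, g] + L_{ρ(f)} g - L_{ρ(g)} f + ρ^* ⟨df, g⟩`; the bracket is written out by pairing
both sides with an arbitrary element `η`. -/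
noncomputable def actionCourant (D : InvariantMetric 𝔡) (ρ : LieAction I 𝔡 N) :
    CourantData I (fun _ : N => 𝔡) where
  smooth f := ∀ l : Module.Dual ℝ 𝔡, SmoothFun I (fun x => l (f x))
  pairing _ := D.form
  anchor x := (LinearMap.proj x).comp ρ.field
  bracket f g h := ∀ x η,
    D.form (h x) η = D.form ⁅f x, g x⁆ η
      + dirDeriv I (fun y => D.form (g y) η) x (ρ.field (f x) x)
      - dirDeriv I (fun y => D.form (f y) η) x (ρ.field (g x) x)
      + dirDeriv I (fun y => D.form (f y) (g x)) x (ρ.field η x)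

/-- The bundle map `s : TN → 𝔡 × N` is `𝔡`-invariant: `⟦ξ, s X⟧ = s [ρ(ξ), X]` for constant `ξ`,
where `⟦ξ, f⟧ = [ξ, f] + L_{ρ(ξ)} f`. -/
def IsInvariantSplitting (ρ : LieAction I 𝔡 N) (s : ∀ x : N, TangentSpace I x →ₗ[ℝ] 𝔡) : Prop :=
  ∀ (ξ : 𝔡) (X : ∀ x : N, TangentSpace I x), SmoothField I X → ∀ (x : N) (l : Module.Dual ℝ 𝔡),
    dirDeriv I (fun y => l (s y (X y))) x (ρ.field ξ x) + l ⁅ξ, s x (X x)⁆ =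
      l (s x (VectorField.mlieBracket I (ρ.field ξ) X x))

end Actions

/-! ## Orbits and quotients by orbits -/

section Orbits

variable {E H : Type*} [NormedAddCommGroup E] [NormedSpace ℝ E] [TopologicalSpace H]
  (I : ModelWithCorners ℝ E H) {S : Type*} [TopologicalSpace S] [ChartedSpace H S]
  {E' H' : Type*} [NormedAddCommGroup E'] [NormedSpace ℝ E'] [TopologicalSpace H']
  (J : ModelWithCorners ℝ E' H') {Q : Type*} [TopologicalSpace Q] [ChartedSpace H' Q]
  {ι : Type*}

/-- `y` is reached from `x` at time 1 along an integral curve of one of the generators. Here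
`G ξ x w` says that `w` is the value at `x` of the vector field generated by `ξ`. -/
def OrbitStep (G : ι → ∀ x : S, TangentSpace I x → Prop) (x y : S) : Prop :=
  ∃ (ξ : ι) (c : ℝ → S), c 0 = x ∧ c 1 = y ∧ ∀ t ∈ Set.Icc (0 : ℝ) 1,
    ∃ w : TangentSpace I (c t), G ξ (c t) w ∧
      HasMFDerivWithinAt 𝓘(ℝ, ℝ) I c (Set.Icc 0 1) t ((1 : ℝ →L[ℝ] ℝ).smulRight w)

/-- `q` is the quotient map of the regular foliation whose leaves are the orbits of the generators:
a surjective submersion whose fibres are the orbits, with tangent spaces spanned by the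
generators. -/
structure IsOrbitQuotient (G : ι → ∀ x : S, TangentSpace I x → Prop) (q : S → Q) : Prop where
  smooth : ContMDiff I J ∞ q
  surjective : Function.Surjective q
  submersion : ∀ x, Function.Surjective (mfderiv I J q x)
  ker_iff : ∀ x w, mfderiv I J q x w = 0 ↔ ∃ ξ, G ξ x w
  fibre_iff : ∀ x y, q x = q y ↔ Relation.EqvGen (OrbitStep I G) x y

end Orbits

/-! ## Reduction -/

section Reduction

variable {𝔡 : Type*} [LieRing 𝔡] [LieAlgebra ℝ 𝔡]
  {EN : Type*} [NormedAddCommGroup EN] [NormedSpace ℝ EN]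
  {N : Type*} [TopologicalSpace N] [ChartedSpace EN N] [IsManifold 𝓘(ℝ, EN) ∞ N]
  {EM : Type*} [NormedAddCommGroup EM] [NormedSpace ℝ EM]
  {M : Type*} [TopologicalSpace M] [ChartedSpace EM M]
  {ES : Type*} [NormedAddCommGroup ES] [NormedSpace ℝ ES]
  {S : Type*} [TopologicalSpace S] [ChartedSpace ES S]
  {EP : Type*} [NormedAddCommGroup EP] [NormedSpace ℝ EP]
  {P : Type*} [TopologicalSpace P] [ChartedSpace EP P]
  {EN' : Type*} [NormedAddCommGroup EN'] [NormedSpace ℝ EN']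
  {N' : Type*} [TopologicalSpace N'] [ChartedSpace EN' N']
  {EM' : Type*} [NormedAddCommGroup EM'] [NormedSpace ℝ EM']
  {M' : Type*} [TopologicalSpace M'] [ChartedSpace EM' M']

/-- `w ∈ TS` is the value of the vector field `ρ(ξ)`, for `ξ` in `K`. -/
def actionGen (ρ : LieAction 𝓘(ℝ, EN) 𝔡 N) (iN : S → N) (K : Submodule ℝ 𝔡) (ξ : 𝔡) (x : S)
    (w : TangentSpace 𝓘(ℝ, ES) x) : Prop :=
  ξ ∈ K ∧ mfderiv 𝓘(ℝ, ES) 𝓘(ℝ, EN) iN x w = ρ.field ξ (iN x)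

/-- `w ∈ TP`, `P = μ⁻¹(S) ⊆ M`, is the value of the vector field `ρ_R(ξ)` for `ξ` in `K`; it is
characterized by `ρ_R(ξ) ∼_R ξ`. -/
def momentGen (R : BundleRel (fun m : M => GenTangent 𝓘(ℝ, EM) m) (fun _ : N => 𝔡))
    (μ : M → N) (iM : P → M) (K : Submodule ℝ 𝔡) (ξ : 𝔡) (p : P)
    (w : TangentSpace 𝓘(ℝ, EP) p) : Prop :=
  ξ ∈ K ∧ R ⟨iM p, mfderiv 𝓘(ℝ, EP) 𝓘(ℝ, EM) iM p w, 0⟩ ⟨μ (iM p), ξ⟩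

/-- `(𝔠, S)` is reductive data for `R : (𝕋M, TM) ⇢ (𝔡, 𝔥) × N` over `μ`, and `𝔠` acts transitively
on `S`. Here `iN : S → N` is the submanifold, `iM : P → M` is the preimage `μ⁻¹(S)` with
`μP : P → S` the restriction of `μ`, and `qN : S → N'`, `qM : P → M'` are the quotients by the orbits
of `𝔠^⊥` and of `𝔥 ∩ 𝔠^⊥`. -/
structure IsTransitiveReductiveData (D : InvariantMetric 𝔡) (ρ : LieAction 𝓘(ℝ, EN) 𝔡 N)
    (𝔥 𝔠 : LieSubalgebra ℝ 𝔡) (μ : M → N)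
    (R : BundleRel (fun m : M => GenTangent 𝓘(ℝ, EM) m) (fun _ : N => 𝔡))
    (iN : S → N) (qN : S → N') (iM : P → M) (μP : P → S) (qM : P → M') : Prop where
  /-- `𝔠` is coisotropic -/
  coisotropic : D.perp 𝔠 ≤ 𝔠.toSubmodule
  /-- `S` is a submanifold of `N` -/
  smooth_iN : ContMDiff 𝓘(ℝ, ES) 𝓘(ℝ, EN) ∞ iN
  injective_iN : Function.Injective iN
  immersion_iN : ∀ x, Function.Injective (mfderiv 𝓘(ℝ, ES) 𝓘(ℝ, EN) iN x)
  /-- `S` is `𝔠`-invariant -/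
  invariant : ∀ ξ ∈ 𝔠, ∀ x, ∃ w, actionGen (ES := ES) ρ iN 𝔠.toSubmodule ξ x w
  /-- `𝔠` acts transitively on `S` -/
  transitive : ∀ x w, ∃ ξ, actionGen (ES := ES) ρ iN 𝔠.toSubmodule ξ x w
  /-- the graph of `μ` and `S × M` intersect cleanly in `P`: the intersection is a submanifold and
  its tangent spaces are the intersections of the tangent spaces -/
  smooth_iM : ContMDiff 𝓘(ℝ, EP) 𝓘(ℝ, EM) ∞ iM
  smooth_μP : ContMDiff 𝓘(ℝ, EP) 𝓘(ℝ, ES) ∞ μP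
  embedding : Topology.IsEmbedding (fun p => (μP p, iM p))
  range_iff : ∀ x m, (∃ p, μP p = x ∧ iM p = m) ↔ iN x = μ m
  immersion_iM : ∀ p, Function.Injective (mfderiv 𝓘(ℝ, EP) 𝓘(ℝ, EM) iM p)
  clean : ∀ p (w : TangentSpace 𝓘(ℝ, ES) (μP p)) (v : TangentSpace 𝓘(ℝ, EM) (iM p)),
    mfderiv 𝓘(ℝ, ES) 𝓘(ℝ, EN) iN (μP p) w = mfderiv 𝓘(ℝ, EM) 𝓘(ℝ, EN) μ (iM p) v →
    ∃ z : TangentSpace 𝓘(ℝ, EP) p, mfderiv 𝓘(ℝ, EP) 𝓘(ℝ, ES) μP p z = w ∧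
      mfderiv 𝓘(ℝ, EP) 𝓘(ℝ, EM) iM p z = v
  quotient_N : IsOrbitQuotient 𝓘(ℝ, ES) 𝓘(ℝ, EN') (actionGen ρ iN (D.perp 𝔠)) qN
  quotient_M : IsOrbitQuotient 𝓘(ℝ, EP) 𝓘(ℝ, EM')
    (momentGen R μ iM (𝔥.toSubmodule ⊓ D.perp 𝔠)) qM

/-- The relation `R_2 = R_𝔠 × (gr(qN) ∘ gr(iN)^⊤) : 𝔡 × N ⇢ 𝔡_𝔠 × N'`. -/
def reductionRel₂ (D : InvariantMetric 𝔡) (𝔠 : LieSubalgebra ℝ 𝔡) (iN : S → N) (qN : S → N') :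
    BundleRel (fun _ : N => 𝔡) (fun _ : N' => D.Reduced 𝔠) :=
  fun u v => ∃ (x : S) (ξ : 𝔠), u = ⟨iN x, ξ⟩ ∧ v = ⟨qN x, D.toReduced 𝔠 ξ⟩

/-- The relation `R_1 = R_{qM} ∘ R_{iM}^⊤ : 𝕋M ⇢ 𝕋M'`. -/
def reductionRel₁ (iM : P → M) (qM : P → M') :
    BundleRel (fun m : M => GenTangent 𝓘(ℝ, EM) m) (fun m : M' => GenTangent 𝓘(ℝ, EM') m) :=
  fun u v => ∃ t : Σ p : P, GenTangent 𝓘(ℝ, EP) p,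
    stdLift 𝓘(ℝ, EP) 𝓘(ℝ, EM) iM t u ∧ stdLift 𝓘(ℝ, EP) 𝓘(ℝ, EM') qM t v

/-- The reduced relation `R_{𝔠,S} = R_2 ∘ R ∘ R_1^⊤ : 𝕋M' ⇢ 𝔡_𝔠 × N'`. -/
def reducedRel (D : InvariantMetric 𝔡) (𝔠 : LieSubalgebra ℝ 𝔡)
    (R : BundleRel (fun m : M => GenTangent 𝓘(ℝ, EM) m) (fun _ : N => 𝔡))
    (iN : S → N) (qN : S → N') (iM : P → M) (qM : P → M') :
    BundleRel (fun m : M' => GenTangent 𝓘(ℝ, EM') m) (fun _ : N' => D.Reduced 𝔠) :=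
  fun u v => ∃ a b, reductionRel₁ (EP := EP) iM qM a u ∧ R a b ∧ reductionRel₂ D 𝔠 iN qN b v

/-- The relation `R_{μ,ω} : 𝕋M ⇢ 𝕋_γ N ≅ 𝔡 × N`, seen in `𝔡 × N` through the isomorphism given by
the splitting `s`. -/
noncomputable def splitFormRel (D : InvariantMetric 𝔡) (ρ : LieAction 𝓘(ℝ, EN) 𝔡 N)
    (s : ∀ x : N, TangentSpace 𝓘(ℝ, EN) x →ₗ[ℝ] 𝔡) (μ : M → N)
    (φ : ∀ m : M, TangentSpace 𝓘(ℝ, EM) m →ₗ[ℝ] TangentSpace 𝓘(ℝ, EM) m →ₗ[ℝ] ℝ) :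
    BundleRel (fun m : M => GenTangent 𝓘(ℝ, EM) m) (fun _ : N => 𝔡) :=
  fun u v => formRel 𝓘(ℝ, EM) 𝓘(ℝ, EN) μ φ u
    ⟨v.1, (actionCourant D ρ).splitMap s v.1 v.2⟩

/-- The action `ρ'` of `𝔡_𝔠` on `N'` is the one induced by the action of `𝔠` on `S`. -/
def IsReducedAction [IsManifold 𝓘(ℝ, EN') ∞ N'] (D : InvariantMetric 𝔡)
    (ρ : LieAction 𝓘(ℝ, EN) 𝔡 N) (𝔠 : LieSubalgebra ℝ 𝔡) (iN : S → N) (qN : S → N')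
    (ρ' : LieAction 𝓘(ℝ, EN') (D.Reduced 𝔠) N') : Prop :=
  ∀ (ξ : 𝔠) (x : S) (w : TangentSpace 𝓘(ℝ, ES) x),
    mfderiv 𝓘(ℝ, ES) 𝓘(ℝ, EN) iN x w = ρ.field (ξ : 𝔡) (iN x) →
    ρ'.field (D.toReduced 𝔠 ξ) (qN x) = mfderiv 𝓘(ℝ, ES) 𝓘(ℝ, EN') qN x w

/-- `θ ∈ Ω¹(S, 𝔠^⊥)` is a `𝔠^⊥`-invariant connection 1-form: `a ∘ θ` is a projection of `TS` onto
the tangent spaces of the `𝔠^⊥`-orbits, and `L_{ρ(ξ)} θ + [ξ, θ] = 0` for `ξ ∈ 𝔠^⊥`. -/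
structure IsConnectionForm [IsManifold 𝓘(ℝ, ES) ∞ S] (D : InvariantMetric 𝔡)
    (ρ : LieAction 𝓘(ℝ, EN) 𝔡 N) (𝔠 : LieSubalgebra ℝ 𝔡) (iN : S → N)
    (θ : ∀ x : S, TangentSpace 𝓘(ℝ, ES) x →ₗ[ℝ] 𝔡) : Prop where
  smooth : ∀ l : Module.Dual ℝ 𝔡, SmoothOneForm 𝓘(ℝ, ES) (fun x => l ∘ₗ θ x)
  mem : ∀ x w, θ x w ∈ D.perp 𝔠
  vertical : ∀ ξ x (w : TangentSpace 𝓘(ℝ, ES) x), actionGen ρ iN (D.perp 𝔠) ξ x w →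
    ρ.field (θ x w) (iN x) = ρ.field ξ (iN x)
  invariant : ∀ ξ (V X : ∀ x : S, TangentSpace 𝓘(ℝ, ES) x), SmoothField 𝓘(ℝ, ES) X →
    (∀ x, actionGen ρ iN (D.perp 𝔠) ξ x (V x)) → ∀ (x : S) (l : Module.Dual ℝ 𝔡),
    dirDeriv 𝓘(ℝ, ES) (fun y => l (θ y (X y))) x (V x) + l ⁅ξ, θ x (X x)⁆ =
      l (θ x (VectorField.mlieBracket 𝓘(ℝ, ES) V X x))

/-- The 2-form `⟨θ, ϑ_s⟩` on `S`, where `⟨ξ, ϑ_s⟩ = s^* ξ` for `ξ ∈ 𝔠^⊥`: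
`(X, Y) ↦ ⟨θ X, s Y⟩ - ⟨θ Y, s X⟩`. -/
noncomputable def connectionPairing (D : InvariantMetric 𝔡)
    (s : ∀ x : N, TangentSpace 𝓘(ℝ, EN) x →ₗ[ℝ] 𝔡) (iN : S → N)
    (θ : ∀ x : S, TangentSpace 𝓘(ℝ, ES) x →ₗ[ℝ] 𝔡) (x : S)
    (X Y : TangentSpace 𝓘(ℝ, ES) x) : ℝ :=
  D.form (θ x X) (s (iN x) (mfderiv 𝓘(ℝ, ES) 𝓘(ℝ, EN) iN x Y)) -
    D.form (θ x Y) (s (iN x) (mfderiv 𝓘(ℝ, ES) 𝓘(ℝ, EN) iN x X))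

/-- The 2-form `⟨θ, s ∘ a(θ)⟩` on `S`: `(X, Y) ↦ ⟨θ X, s a(θ Y)⟩ - ⟨θ Y, s a(θ X)⟩`. -/
noncomputable def connectionSquare (D : InvariantMetric 𝔡) (ρ : LieAction 𝓘(ℝ, EN) 𝔡 N)
    (s : ∀ x : N, TangentSpace 𝓘(ℝ, EN) x →ₗ[ℝ] 𝔡) (iN : S → N)
    (θ : ∀ x : S, TangentSpace 𝓘(ℝ, ES) x →ₗ[ℝ] 𝔡) (x : S)
    (X Y : TangentSpace 𝓘(ℝ, ES) x) : ℝ :=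
  D.form (θ x X) (s (iN x) (ρ.field (θ x Y) (iN x))) -
    D.form (θ x Y) (s (iN x) (ρ.field (θ x X) (iN x)))

/-- The 2-form `⟨θ, ϑ_s - ½ s ∘ a(θ)⟩` on `S`. -/
noncomputable def correctionForm (D : InvariantMetric 𝔡) (ρ : LieAction 𝓘(ℝ, EN) 𝔡 N)
    (s : ∀ x : N, TangentSpace 𝓘(ℝ, EN) x →ₗ[ℝ] 𝔡) (iN : S → N)
    (θ : ∀ x : S, TangentSpace 𝓘(ℝ, ES) x →ₗ[ℝ] 𝔡) (x : S)
    (X Y : TangentSpace 𝓘(ℝ, ES) x) : ℝ :=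
  connectionPairing D s iN θ x X Y - (1 / 2) * connectionSquare D ρ s iN θ x X Y

/-- The splitting `s' = s̃_θ : TN' → 𝔡_𝔠 × N'`. For a horizontal vector `w = X^h` on `S`, the
element `s w + a^*(ι_w ⟨θ, ϑ_s⟩)` lies in `𝔠`, and its class in `𝔠 / 𝔠^⊥` is the value of `s'` at
`(qN)_* w`; here `β` is any covector on `N` that restricts to the covector `ι_w ⟨θ, ϑ_s⟩` on `S`. -/
def IsReducedSplitting (D : InvariantMetric 𝔡) (ρ : LieAction 𝓘(ℝ, EN) 𝔡 N)
    (𝔠 : LieSubalgebra ℝ 𝔡) (s : ∀ x : N, TangentSpace 𝓘(ℝ, EN) x →ₗ[ℝ] 𝔡)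
    (iN : S → N) (qN : S → N') (θ : ∀ x : S, TangentSpace 𝓘(ℝ, ES) x →ₗ[ℝ] 𝔡)
    (s' : ∀ y : N', TangentSpace 𝓘(ℝ, EN') y →ₗ[ℝ] D.Reduced 𝔠) : Prop :=
  ∀ (x : S) (w : TangentSpace 𝓘(ℝ, ES) x), ρ.field (θ x w) (iN x) = 0 →
    ∀ (β : CotangentFibre 𝓘(ℝ, EN) (iN x)) (e : 𝔡),
      (∀ Y, β (mfderiv 𝓘(ℝ, ES) 𝓘(ℝ, EN) iN x Y) = connectionPairing D s iN θ x w Y) →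
      (actionCourant D ρ).IsCoanchor (iN x) β e →
      ∃ h : s (iN x) (mfderiv 𝓘(ℝ, ES) 𝓘(ℝ, EN) iN x w) + e ∈ 𝔠,
        s' (qN x) (mfderiv 𝓘(ℝ, ES) 𝓘(ℝ, EN') qN x w) = D.toReduced 𝔠 ⟨_, h⟩

end Reduction

/-!
# Reduction of exact morphisms of Manin pairs

The proof tests every identity of sections on smooth functions, smooth lifts and coordinates.

For `𝔡`-valued functions `f`, `g` along a map `ν : Q → N` that lift vector fields on `Q`, the *triple
product* `triple` is the number `⟨⟦f, g⟧, h⟩`, where the derivatives in the Courant bracket are taken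
along `Q`. The operator `K = s ∘ a` on `𝔡` satisfies `K + K^* = 1` (`form_split_add`). Hence the triple
product of arbitrary lifts is the pulled-back curvature of `s` plus derivatives of the 1-forms `⟨f, s⟩`
(`triple_expansion`). Applied along the graph of `μ`, this shows that the fibres `momentFibre` of
`R_{μ,φ}` form a Dirac structure exactly when `μ^* γ + dφ = 0`, the condition `CurvatureEq`
(`isExactDirac_momentFibre`, `curvatureEq_of_isDirac`). Applied along the identity, it shows that a
splitting identifies `𝔡 × N` with `𝕋_γ N` (`isIso_splitMap`).

Let `B = ⟨θ, ϑ_s - ½ s ∘ a(θ)⟩`. The pairing `τ(w, η) = ⟨s w, η⟩ + B(w, η_S)` of `w ∈ TS` with `η ∈ 𝔠`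
(`splitPairing`) vanishes if `η ∈ 𝔠^⊥` or if `w` is vertical, and it is invariant under `𝔠^⊥`. It
therefore descends to `N'` and defines the reduced splitting `s'` by `⟨s' (q_* w), [η]⟩ = τ(w, η)`
(`exists_reducedSplitting`). On horizontal vectors `s'` is given by the prescribed formula, and it is
isotropic by `K + K^* = 1`.

On `P = μ⁻¹(S)`, the 2-form `Ω = i_M^* φ - μ^* B` (`correctedForm`) vanishes on vertical vectors. A lift
`F : P → 𝔠` of a vector field is *adapted* if it represents the value of `s'` modulo `𝔠^⊥`. For adapted
lifts the integrability condition on `M` reads `⟨⟦F, G⟧, H⟩ + dΩ(X, Y, Z) = 0`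
(`triple_add_correctedForm`), and for projectable fields the triple product only depends on the
projections (`triple_adaptedLift_reduced`). With one vertical argument this gives the invariance of `Ω`,
so `Ω` descends to a 2-form `φ'` on `M'`; with general arguments it gives the integrability condition
for `s'`, `μ'` and `φ'` (`curvatureEq_reduced`), so `R_{μ',φ'}` is a Dirac structure.

What remains is linear algebra in the fibres. The reduced relation is `R_{μ',φ'}` by
`mem_momentFibre_reduced` and `exists_mem_momentFibre`. The conditions on the Lagrangian subbundles are
pulled back to `M` by `exists_sub_mem_momentFibre`, where cleanness of the intersection enters, and
`𝔥_𝔠` is Lagrangian because `(𝔥 ∩ 𝔠)^⊥ = 𝔥 + 𝔠^⊥` (`InvariantMetric.mem_reducedSub_iff`).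

Functions, maps and forms descend to a quotient by orbits because they are locally constant in the
directions of the fibres, which are connected by orbits (`IsOrbitQuotient.eq_of_vertical`), and because
smoothness can be tested after composition with a surjective submersion
(`contMDiff_of_comp_submersion`).
-/

set_option linter.unusedSectionVars false

/-! ### Smooth functions and their derivatives -/

section SmoothFunctions

variable {E : Type*} [NormedAddCommGroup E] [NormedSpace ℝ E]
  {B : Type*} [TopologicalSpace B] [ChartedSpace E B]
  {E' : Type*} [NormedAddCommGroup E'] [NormedSpace ℝ E']
  {B' : Type*} [TopologicalSpace B'] [ChartedSpace E' B']

theorem SmoothFun.mdifferentiableAt {f : B → ℝ} (hf : SmoothFun 𝓘(ℝ, E) f) (x : B) :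
    MDifferentiableAt 𝓘(ℝ, E) 𝓘(ℝ, ℝ) f x :=
  ContMDiff.mdifferentiableAt (I := 𝓘(ℝ, E)) (I' := 𝓘(ℝ, ℝ)) (n := ∞) hf (by simp)

theorem SmoothFun.const (c : ℝ) : SmoothFun 𝓘(ℝ, E) (fun _ : B => c) := contMDiff_const

theorem SmoothFun.add {f g : B → ℝ} (hf : SmoothFun 𝓘(ℝ, E) f) (hg : SmoothFun 𝓘(ℝ, E) g) :
    SmoothFun 𝓘(ℝ, E) (fun x => f x + g x) := ContMDiff.add hf hg

theorem SmoothFun.sub {f g : B → ℝ} (hf : SmoothFun 𝓘(ℝ, E) f) (hg : SmoothFun 𝓘(ℝ, E) g) :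
    SmoothFun 𝓘(ℝ, E) (fun x => f x - g x) := ContMDiff.sub hf hg

theorem SmoothFun.neg {f : B → ℝ} (hf : SmoothFun 𝓘(ℝ, E) f) :
    SmoothFun 𝓘(ℝ, E) (fun x => - f x) := ContMDiff.neg hf

theorem SmoothFun.mul {f g : B → ℝ} (hf : SmoothFun 𝓘(ℝ, E) f) (hg : SmoothFun 𝓘(ℝ, E) g) :
    SmoothFun 𝓘(ℝ, E) (fun x => f x * g x) := ContMDiff.mul hf hg

theorem SmoothFun.sum {ι : Type*} {t : Finset ι} {f : ι → B → ℝ}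
    (hf : ∀ i ∈ t, SmoothFun 𝓘(ℝ, E) (f i)) : SmoothFun 𝓘(ℝ, E) (fun x => ∑ i ∈ t, f i x) :=
  contMDiff_finsetSum hf

theorem SmoothFun.comp {g : B' → ℝ} (hg : SmoothFun 𝓘(ℝ, E') g) {f : B → B'}
    (hf : ContMDiff 𝓘(ℝ, E) 𝓘(ℝ, E') ∞ f) : SmoothFun 𝓘(ℝ, E) (fun x => g (f x)) :=
  ContMDiff.comp (I' := 𝓘(ℝ, E')) hg hf

theorem dirDeriv_const (c : ℝ) (x : B) (v : TangentSpace 𝓘(ℝ, E) x) :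
    dirDeriv 𝓘(ℝ, E) (fun _ => c) x v = 0 := by
  have := mfderiv_const (I := 𝓘(ℝ, E)) (I' := 𝓘(ℝ, ℝ)) (c := c) (x := x)
  exact congrArg (fun L : E →L[ℝ] ℝ => L v) this

theorem dirDeriv_add {f g : B → ℝ} (hf : SmoothFun 𝓘(ℝ, E) f) (hg : SmoothFun 𝓘(ℝ, E) g) (x : B)
    (v : TangentSpace 𝓘(ℝ, E) x) : dirDeriv 𝓘(ℝ, E) (fun y => f y + g y) x v =
      dirDeriv 𝓘(ℝ, E) f x v + dirDeriv 𝓘(ℝ, E) g x v := by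
  have := mfderiv_add (hf.mdifferentiableAt x) (hg.mdifferentiableAt x)
  exact congrArg (fun L : E →L[ℝ] ℝ => L v) this

theorem dirDeriv_neg {f : B → ℝ} (hf : SmoothFun 𝓘(ℝ, E) f) (x : B)
    (v : TangentSpace 𝓘(ℝ, E) x) : dirDeriv 𝓘(ℝ, E) (fun y => - f y) x v =
      - dirDeriv 𝓘(ℝ, E) f x v := by
  have := (hf.mdifferentiableAt x).hasMFDerivAt.neg.mfderiv
  exact congrArg (fun L : E →L[ℝ] ℝ => L v) this

theorem dirDeriv_sub {f g : B → ℝ} (hf : SmoothFun 𝓘(ℝ, E) f) (hg : SmoothFun 𝓘(ℝ, E) g) (x : B)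
    (v : TangentSpace 𝓘(ℝ, E) x) : dirDeriv 𝓘(ℝ, E) (fun y => f y - g y) x v =
      dirDeriv 𝓘(ℝ, E) f x v - dirDeriv 𝓘(ℝ, E) g x v := by
  simp only [sub_eq_add_neg, dirDeriv_add hf hg.neg, dirDeriv_neg hg]

theorem dirDeriv_mul {f g : B → ℝ} (hf : SmoothFun 𝓘(ℝ, E) f) (hg : SmoothFun 𝓘(ℝ, E) g) (x : B)
    (v : TangentSpace 𝓘(ℝ, E) x) : dirDeriv 𝓘(ℝ, E) (fun y => f y * g y) x v =
      f x * dirDeriv 𝓘(ℝ, E) g x v + g x * dirDeriv 𝓘(ℝ, E) f x v := by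
  have := ((hf.mdifferentiableAt x).hasMFDerivAt.mul (hg.mdifferentiableAt x).hasMFDerivAt).mfderiv
  exact congrArg (fun L : E →L[ℝ] ℝ => L v) this

theorem dirDeriv_const_mul (c : ℝ) {f : B → ℝ} (hf : SmoothFun 𝓘(ℝ, E) f) (x : B)
    (v : TangentSpace 𝓘(ℝ, E) x) : dirDeriv 𝓘(ℝ, E) (fun y => c * f y) x v =
      c * dirDeriv 𝓘(ℝ, E) f x v := by
  rw [dirDeriv_mul (SmoothFun.const c) hf, dirDeriv_const]; ring

theorem dirDeriv_sum {ι : Type*} (t : Finset ι) {f : ι → B → ℝ}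
    (hf : ∀ i, SmoothFun 𝓘(ℝ, E) (f i)) (x : B) (v : TangentSpace 𝓘(ℝ, E) x) :
    dirDeriv 𝓘(ℝ, E) (fun y => ∑ i ∈ t, f i y) x v = ∑ i ∈ t, dirDeriv 𝓘(ℝ, E) (f i) x v := by
  classical
  induction t using Finset.induction_on with
  | empty => simpa using dirDeriv_const 0 x v
  | insert a t ha ih =>
    simp only [Finset.sum_insert ha]
    rw [dirDeriv_add (hf a) (SmoothFun.sum fun i _ => hf i), ih]

theorem dirDeriv_congr {f g : B → ℝ} {x : B} (h : f =ᶠ[𝓝 x] g) (v : TangentSpace 𝓘(ℝ, E) x) :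
    dirDeriv 𝓘(ℝ, E) f x v = dirDeriv 𝓘(ℝ, E) g x v := by
  have := h.mfderiv_eq (I := 𝓘(ℝ, E)) (I' := 𝓘(ℝ, ℝ))
  exact congrArg (fun L : E →L[ℝ] ℝ => L v) this

theorem dirDeriv_comp {g : B' → ℝ} (hg : SmoothFun 𝓘(ℝ, E') g) {f : B → B'}
    (hf : ContMDiff 𝓘(ℝ, E) 𝓘(ℝ, E') ∞ f) (x : B) (v : TangentSpace 𝓘(ℝ, E) x) :
    dirDeriv 𝓘(ℝ, E) (fun y => g (f y)) x v =
      dirDeriv 𝓘(ℝ, E') g (f x) (mfderiv 𝓘(ℝ, E) 𝓘(ℝ, E') f x v) := by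
  have := mfderiv_comp x (hg.mdifferentiableAt (f x)) (hf.mdifferentiableAt (by simp) (x := x))
  exact congrArg (fun L : E →L[ℝ] ℝ => L v) this

theorem dirDeriv_map_add (f : B → ℝ) (x : B) (v w : TangentSpace 𝓘(ℝ, E) x) :
    dirDeriv 𝓘(ℝ, E) f x (v + w) = dirDeriv 𝓘(ℝ, E) f x v + dirDeriv 𝓘(ℝ, E) f x w :=
  map_add (mfderiv 𝓘(ℝ, E) 𝓘(ℝ, ℝ) f x) v w

theorem dirDeriv_map_smul (f : B → ℝ) (x : B) (c : ℝ) (v : TangentSpace 𝓘(ℝ, E) x) :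
    dirDeriv 𝓘(ℝ, E) f x (c • v) = c * dirDeriv 𝓘(ℝ, E) f x v :=
  map_smul (mfderiv 𝓘(ℝ, E) 𝓘(ℝ, ℝ) f x) c v

theorem dirDeriv_map_zero (f : B → ℝ) (x : B) :
    dirDeriv 𝓘(ℝ, E) f x (0 : TangentSpace 𝓘(ℝ, E) x) = 0 :=
  map_zero (mfderiv 𝓘(ℝ, E) 𝓘(ℝ, ℝ) f x)

theorem dirDeriv_map_sub (f : B → ℝ) (x : B) (v w : TangentSpace 𝓘(ℝ, E) x) :
    dirDeriv 𝓘(ℝ, E) f x (v - w) = dirDeriv 𝓘(ℝ, E) f x v - dirDeriv 𝓘(ℝ, E) f x w :=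
  map_sub (mfderiv 𝓘(ℝ, E) 𝓘(ℝ, ℝ) f x) v w

theorem dirDeriv_map_sum {ι : Type*} (t : Finset ι) (f : B → ℝ) (x : B)
    (v : ι → TangentSpace 𝓘(ℝ, E) x) :
    dirDeriv 𝓘(ℝ, E) f x (∑ i ∈ t, v i) = ∑ i ∈ t, dirDeriv 𝓘(ℝ, E) f x (v i) :=
  map_sum (mfderiv 𝓘(ℝ, E) 𝓘(ℝ, ℝ) f x) v t

/-- The derivative of a real function as a covector. -/
noncomputable def differential (f : B → ℝ) (x : B) : CotangentFibre 𝓘(ℝ, E) x where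
  toFun v := dirDeriv 𝓘(ℝ, E) f x v
  map_add' := dirDeriv_map_add f x
  map_smul' c v := by simpa using dirDeriv_map_smul f x c v

@[simp] theorem differential_apply (f : B → ℝ) (x : B) (v : TangentSpace 𝓘(ℝ, E) x) :
    differential (E := E) f x v = dirDeriv 𝓘(ℝ, E) f x v := rfl

end SmoothFunctions

/-! ### Vector fields as derivations -/

section Fields

variable {E : Type*} [NormedAddCommGroup E] [NormedSpace ℝ E]
  {B : Type*} [TopologicalSpace B] [ChartedSpace E B] [IsManifold 𝓘(ℝ, E) ∞ B]

theorem SmoothField.add {X Y : ∀ x : B, TangentSpace 𝓘(ℝ, E) x} (hX : SmoothField 𝓘(ℝ, E) X)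
    (hY : SmoothField 𝓘(ℝ, E) Y) : SmoothField 𝓘(ℝ, E) (fun x => X x + Y x) :=
  ContMDiff.add_section hX hY

theorem SmoothField.zero : SmoothField 𝓘(ℝ, E) (fun x : B => (0 : TangentSpace 𝓘(ℝ, E) x)) :=
  Bundle.contMDiff_zeroSection ℝ (TangentSpace 𝓘(ℝ, E) (M := B))

theorem SmoothField.smul {f : B → ℝ} (hf : SmoothFun 𝓘(ℝ, E) f)
    {X : ∀ x : B, TangentSpace 𝓘(ℝ, E) x} (hX : SmoothField 𝓘(ℝ, E) X) :
    SmoothField 𝓘(ℝ, E) (fun x => f x • X x) :=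
  ContMDiff.smul_section hf hX

theorem SmoothField.sum {ι : Type*} {t : Finset ι} {X : ι → ∀ x : B, TangentSpace 𝓘(ℝ, E) x}
    (hX : ∀ i ∈ t, SmoothField 𝓘(ℝ, E) (X i)) :
    SmoothField 𝓘(ℝ, E) (fun x => ∑ i ∈ t, X i x) :=
  ContMDiff.sum_section hX

theorem SmoothField.mdifferentiableAt {X : ∀ x : B, TangentSpace 𝓘(ℝ, E) x}
    (hX : SmoothField 𝓘(ℝ, E) X) (x : B) :
    MDifferentiableAt 𝓘(ℝ, E) 𝓘(ℝ, E).tangent (fun y => (⟨y, X y⟩ : TangentBundle 𝓘(ℝ, E) B)) x :=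
  ContMDiff.mdifferentiableAt (n := ∞) hX (by simp)

theorem SmoothFun.dirDeriv {f : B → ℝ} (hf : SmoothFun 𝓘(ℝ, E) f)
    {X : ∀ x : B, TangentSpace 𝓘(ℝ, E) x} (hX : SmoothField 𝓘(ℝ, E) X) :
    SmoothFun 𝓘(ℝ, E) (fun x => _root_.dirDeriv 𝓘(ℝ, E) f x (X x)) := by
  have h1 : ContMDiff 𝓘(ℝ, E).tangent 𝓘(ℝ, ℝ).tangent ∞ (tangentMap 𝓘(ℝ, E) 𝓘(ℝ, ℝ) f) :=
    ContMDiff.contMDiff_tangentMap (n := ∞) hf (by simp)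
  have h2 := h1.comp hX
  exact fun x => by
    have h3 := (Bundle.contMDiffAt_totalSpace.1 (h2 x)).2
    simp at h3
    exact h3

end Fields

section Bracket

variable {E : Type*} [NormedAddCommGroup E] [NormedSpace ℝ E] [CompleteSpace E]
  {B : Type*} [TopologicalSpace B] [ChartedSpace E B] [IsManifold 𝓘(ℝ, E) ∞ B]

/-- Derivatives at all points of the domain of a chart, computed in that one chart. -/
theorem dirDeriv_eq_fderiv_extChartAt {f : B → ℝ} (hf : SmoothFun 𝓘(ℝ, E) f) (x₀ : B) {y : B}
    (hy : y ∈ (extChartAt 𝓘(ℝ, E) x₀).source) (v : TangentSpace 𝓘(ℝ, E) y) :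
    dirDeriv 𝓘(ℝ, E) f y v = fderiv ℝ (f ∘ (extChartAt 𝓘(ℝ, E) x₀).symm)
      (extChartAt 𝓘(ℝ, E) x₀ y) (mfderiv 𝓘(ℝ, E) 𝓘(ℝ, E) (extChartAt 𝓘(ℝ, E) x₀) y v) := by
  have h1 : f =ᶠ[𝓝 y] (f ∘ (extChartAt 𝓘(ℝ, E) x₀).symm) ∘ extChartAt 𝓘(ℝ, E) x₀ := by
    filter_upwards [extChartAt_source_mem_nhds' hy] with z hz
    exact congrArg f ((extChartAt 𝓘(ℝ, E) x₀).left_inv hz).symm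
  have h2 : MDifferentiableAt 𝓘(ℝ, E) 𝓘(ℝ, E) (extChartAt 𝓘(ℝ, E) x₀) y :=
    mdifferentiableAt_extChartAt (by simpa using hy)
  have h3 : MDifferentiableAt 𝓘(ℝ, E) 𝓘(ℝ, ℝ) (f ∘ (extChartAt 𝓘(ℝ, E) x₀).symm)
      (extChartAt 𝓘(ℝ, E) x₀ y) := by
    have h4 : MDifferentiableAt 𝓘(ℝ, E) 𝓘(ℝ, E) (extChartAt 𝓘(ℝ, E) x₀).symm
        (extChartAt 𝓘(ℝ, E) x₀ y) := by
      have := contMDiffOn_extChartAt_symm (I := 𝓘(ℝ, E)) (n := ∞) x₀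
      exact ((this _ ((extChartAt 𝓘(ℝ, E) x₀).map_source hy)).contMDiffAt
        (extChartAt_target_mem_nhds' ((extChartAt 𝓘(ℝ, E) x₀).map_source hy))).mdifferentiableAt
          (by simp)
    exact (hf.mdifferentiableAt _).comp _ h4
  rw [dirDeriv_congr h1]
  have := mfderiv_comp y h3 h2
  rw [mfderiv_eq_fderiv] at this
  exact congrArg (fun L : E →L[ℝ] ℝ => L v) this

/-- `[X, Y] f = X (Y f) - Y (X f)`. This reduces all computations with brackets of vector fields to
derivatives of functions. -/
theorem dirDeriv_mlieBracket {f : B → ℝ} (hf : SmoothFun 𝓘(ℝ, E) f)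
    {X Y : ∀ x : B, TangentSpace 𝓘(ℝ, E) x} (hX : SmoothField 𝓘(ℝ, E) X)
    (hY : SmoothField 𝓘(ℝ, E) Y) (x : B) :
    dirDeriv 𝓘(ℝ, E) f x (VectorField.mlieBracket 𝓘(ℝ, E) X Y x) =
      dirDeriv 𝓘(ℝ, E) (fun y => dirDeriv 𝓘(ℝ, E) f y (Y y)) x (X x) -
      dirDeriv 𝓘(ℝ, E) (fun y => dirDeriv 𝓘(ℝ, E) f y (X y)) x (Y x) := by
  have : IsManifold 𝓘(ℝ, E) 2 B := IsManifold.of_le (n := ∞)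
    (WithTop.coe_le_coe.2 le_top : ((2 : ℕ∞) : WithTop ℕ∞) ≤ ((⊤ : ℕ∞) : WithTop ℕ∞))
  set φ := extChartAt 𝓘(ℝ, E) x with hφ
  -- the pullback of a field `V` to the chart domain differentiates `f ∘ φ.symm` as `V` does `f`
  let pull (V : ∀ x : B, TangentSpace 𝓘(ℝ, E) x) : E → E :=
    VectorField.mpullbackWithin 𝓘(ℝ, E) 𝓘(ℝ, E) φ.symm V (Set.range 𝓘(ℝ, E))
  have hpull : ∀ V : ∀ x : B, TangentSpace 𝓘(ℝ, E) x, ∀ z ∈ φ.target,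
      fderiv ℝ (f ∘ φ.symm) z (pull V z) = dirDeriv 𝓘(ℝ, E) f (φ.symm z) (V (φ.symm z)) := by
    intro V z hz
    rw [dirDeriv_eq_fderiv_extChartAt hf x (φ.map_target hz), ← hφ, φ.right_inv hz]
    congr 1
    have h1 := mfderivWithin_extChartAt_symm_comp_mfderiv_extChartAt (I := 𝓘(ℝ, E)) hz
    have h2 := isInvertible_mfderivWithin_extChartAt_symm (I := 𝓘(ℝ, E)) hz
    have h3 := h2.inverse_apply_self (mfderiv 𝓘(ℝ, E) 𝓘(ℝ, E) φ (φ.symm z) (V (φ.symm z)))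
    have h4 : mfderivWithin 𝓘(ℝ, E) 𝓘(ℝ, E) φ.symm (Set.range 𝓘(ℝ, E)) z
        (mfderiv 𝓘(ℝ, E) 𝓘(ℝ, E) φ (φ.symm z) (V (φ.symm z))) = V (φ.symm z) :=
      congrArg (fun L : E →L[ℝ] E => L (V (φ.symm z))) h1
    exact (congrArg _ h4).symm.trans h3
  have hdiff : ∀ V : ∀ x : B, TangentSpace 𝓘(ℝ, E) x, SmoothField 𝓘(ℝ, E) V →
      DifferentiableAt ℝ (pull V) (φ x) := by
    intro V hV
    have h1 := (hV.mdifferentiableAt x).mdifferentiableWithinAt (s := Set.univ)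
    have h2 := h1.differentiableWithinAt_mpullbackWithin_vectorField
    have h3 : φ.symm ⁻¹' Set.univ ∩ Set.range 𝓘(ℝ, E) = Set.univ := by simp
    rw [h3] at h2
    exact differentiableWithinAt_univ.1 h2
  have hd2 : ∀ V W : ∀ x : B, TangentSpace 𝓘(ℝ, E) x, SmoothField 𝓘(ℝ, E) V →
      fderiv ℝ (fun z => fderiv ℝ (f ∘ φ.symm) z (pull V z)) (φ x) (pull W (φ x)) =
      dirDeriv 𝓘(ℝ, E) (fun y => dirDeriv 𝓘(ℝ, E) f y (V y)) x (W x) := by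
    intro V W hV
    rw [dirDeriv_eq_fderiv_extChartAt (hf.dirDeriv hV) x (mem_extChartAt_source x), ← hφ]
    have h1 : (fun z => fderiv ℝ (f ∘ φ.symm) z (pull V z)) =ᶠ[𝓝 (φ x)]
        (fun y => dirDeriv 𝓘(ℝ, E) f y (V y)) ∘ φ.symm := by
      filter_upwards [extChartAt_target_mem_nhds (I := 𝓘(ℝ, E)) x] with z hz
      exact hpull V z hz
    rw [h1.fderiv_eq]
    congr 1
    have hz : φ x ∈ φ.target := mem_extChartAt_target x
    have h1 := mfderivWithin_extChartAt_symm_comp_mfderiv_extChartAt (I := 𝓘(ℝ, E)) hz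
    have h2 := isInvertible_mfderivWithin_extChartAt_symm (I := 𝓘(ℝ, E)) hz
    have hx : φ.symm (φ x) = x := extChartAt_to_inv x
    have h3 := h2.inverse_apply_self (mfderiv 𝓘(ℝ, E) 𝓘(ℝ, E) φ (φ.symm (φ x)) (W (φ.symm (φ x))))
    have h4 : mfderivWithin 𝓘(ℝ, E) 𝓘(ℝ, E) φ.symm (Set.range 𝓘(ℝ, E)) (φ x)
        (mfderiv 𝓘(ℝ, E) 𝓘(ℝ, E) φ (φ.symm (φ x)) (W (φ.symm (φ x)))) = W (φ.symm (φ x)) :=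
      congrArg (fun L : E →L[ℝ] E => L (W (φ.symm (φ x)))) h1
    refine ((congrArg _ h4).symm.trans h3).trans ?_
    rw [hx]
  have hbr : mfderiv 𝓘(ℝ, E) 𝓘(ℝ, E) φ x (VectorField.mlieBracket 𝓘(ℝ, E) X Y x) =
      (VectorField.lieBracket ℝ (pull X) (pull Y) (φ x) : E) := by
    have h1 : VectorField.mlieBracket 𝓘(ℝ, E) X Y x = (mfderiv 𝓘(ℝ, E) 𝓘(ℝ, E) φ x).inverse
        (VectorField.lieBracketWithin ℝ (pull X) (pull Y)
          (φ.symm ⁻¹' Set.univ ∩ Set.range 𝓘(ℝ, E)) (φ x) : E) :=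
      VectorField.mlieBracketWithin_apply
    have h2 : φ.symm ⁻¹' Set.univ ∩ Set.range 𝓘(ℝ, E) = Set.univ := by simp
    rw [h2, VectorField.lieBracketWithin_univ] at h1
    rw [h1]
    exact (isInvertible_mfderiv_extChartAt (I := 𝓘(ℝ, E))
      (mem_extChartAt_source x)).self_apply_inverse _
  have hf' : ContDiffAt ℝ ∞ (f ∘ φ.symm) (φ x) := by
    have h1 := (contMDiffOn_extChartAt_symm (I := 𝓘(ℝ, E)) (n := ∞) x _
      (mem_extChartAt_target x)).contMDiffAt (extChartAt_target_mem_nhds x)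
    exact (ContMDiffAt.comp _ (ContMDiff.contMDiffAt hf) h1).contDiffAt
  rw [dirDeriv_eq_fderiv_extChartAt hf x (mem_extChartAt_source x), ← hφ, hbr,
    VectorField.fderiv_apply_lieBracket hf' (by
      simpa using! (WithTop.coe_le_coe.2 le_top :
        ((2 : ℕ∞) : WithTop ℕ∞) ≤ ((⊤ : ℕ∞) : WithTop ℕ∞))) (hdiff Y hY) (hdiff X hX),
    hd2 Y X hY, hd2 X Y hX]

end Bracket

section Coordinates

variable {E : Type*} [NormedAddCommGroup E] [NormedSpace ℝ E] [FiniteDimensional ℝ E]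
  {B : Type*} [TopologicalSpace B] [ChartedSpace E B] [IsManifold 𝓘(ℝ, E) ∞ B] [T2Space B]

/-- Near each point there are coordinates that extend to global smooth functions, and whose
coordinate vector fields extend to global smooth fields. -/
theorem exists_coordinates (x₀ : B) : ∃ (n : ℕ) (g : Fin n → B → ℝ)
    (F : Fin n → ∀ x : B, TangentSpace 𝓘(ℝ, E) x),
    (∀ i, SmoothFun 𝓘(ℝ, E) (g i)) ∧ (∀ i, SmoothField 𝓘(ℝ, E) (F i)) ∧
    ∀ᶠ x in 𝓝 x₀, (∀ i j, dirDeriv 𝓘(ℝ, E) (g i) x (F j x) = if i = j then 1 else 0) ∧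
      ∀ v : TangentSpace 𝓘(ℝ, E) x, v = ∑ i, dirDeriv 𝓘(ℝ, E) (g i) x v • F i x := by
  have : IsManifold 𝓘(ℝ, E) 1 B := IsManifold.of_le (n := ∞)
    (WithTop.coe_le_coe.2 le_top : ((1 : ℕ∞) : WithTop ℕ∞) ≤ ((⊤ : ℕ∞) : WithTop ℕ∞))
  let χ : SmoothBumpFunction 𝓘(ℝ, E) x₀ := Classical.arbitrary _
  let b := Module.finBasis ℝ E
  let e := trivializationAt E (TangentSpace 𝓘(ℝ, E) (M := B)) x₀
  let φ := extChartAt 𝓘(ℝ, E) x₀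
  let g : Fin (Module.finrank ℝ E) → B → ℝ := fun i x => χ x • b.coord i (φ x)
  let F : Fin (Module.finrank ℝ E) → ∀ x : B, TangentSpace 𝓘(ℝ, E) x :=
    fun j => (fun x => χ x) • e.localFrame b j
  have hsrc : e.baseSet = (chartAt E x₀).source := rfl
  refine ⟨_, g, F, ?_, ?_, ?_⟩
  · intro i
    refine χ.contMDiff_smul (G := ℝ) ?_
    have h1 : ContMDiff 𝓘(ℝ, E) 𝓘(ℝ, ℝ) ∞ (b.coord i) :=
      (LinearMap.toContinuousLinearMap (b.coord i)).contMDiff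
    exact h1.comp_contMDiffOn (contMDiffOn_extChartAt (I := 𝓘(ℝ, E)))
  · intro j
    refine ContMDiffOn.smul_section_of_tsupport (u := (chartAt E x₀).source)
      χ.contMDiff.contMDiffOn (chartAt E x₀).open_source χ.tsupport_subset_chartAt_source ?_
    rw [← hsrc]
    exact e.contMDiffOn_localFrame_baseSet ∞ b j
  · have hone : ∀ᶠ x in 𝓝 x₀, χ =ᶠ[𝓝 x] 1 := eventually_eventually_nhds.2 χ.eventuallyEq_one
    filter_upwards [hone, chart_source_mem_nhds E x₀] with x hx hxs
    have hφ : MDifferentiableAt 𝓘(ℝ, E) 𝓘(ℝ, E) φ x := mdifferentiableAt_extChartAt hxs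
    have hg : ∀ i (v : TangentSpace 𝓘(ℝ, E) x), dirDeriv 𝓘(ℝ, E) (g i) x v =
        b.coord i (mfderiv 𝓘(ℝ, E) 𝓘(ℝ, E) φ x v) := by
      intro i v
      have h1 : g i =ᶠ[𝓝 x] (LinearMap.toContinuousLinearMap (b.coord i)) ∘ φ := by
        filter_upwards [hx] with y hy
        simp [g, hy]
      have h2 := mfderiv_comp x (I' := 𝓘(ℝ, E))
        ((LinearMap.toContinuousLinearMap (b.coord i)).contMDiff (n := 1)
          |>.mdifferentiableAt (by simp)) hφ
      rw [ContinuousLinearMap.mfderiv_eq] at h2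
      rw [dirDeriv_congr h1]
      exact congrArg (fun L : E →L[ℝ] ℝ => L v) h2
    have hF : ∀ j, mfderiv 𝓘(ℝ, E) 𝓘(ℝ, E) φ x (F j x) = b j := by
      intro j
      have h1 : F j x = e.symmL ℝ x (b j) := by
        have h2 : F j x = χ x • e.localFrame b j x := rfl
        rw [h2, hx.eq_of_nhds, e.localFrame_apply_of_mem_baseSet b (hsrc ▸ hxs)]
        simpa [Bundle.Trivialization.basisAt] using (e.symmL_apply (R := ℝ) (hsrc ▸ hxs) _).symm
      rw [h1, ← TangentBundle.continuousLinearMapAt_trivializationAt hxs]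
      exact e.continuousLinearMapAt_symmL (R := ℝ) (hsrc ▸ hxs) _
    refine ⟨fun i j => ?_, fun v => ?_⟩
    · rw [hg, hF]
      simp [Finsupp.single_apply, eq_comm]
    · have hinj := (isInvertible_mfderiv_extChartAt (I := 𝓘(ℝ, E)) (x := x₀) (y := x)
        (by simpa using hxs)).injective
      apply hinj
      have h3 : mfderiv 𝓘(ℝ, E) 𝓘(ℝ, E) φ x (∑ i, dirDeriv 𝓘(ℝ, E) (g i) x v • F i x) =
          ∑ i, dirDeriv 𝓘(ℝ, E) (g i) x v • (b i : E) := by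
        rw [map_sum]
        refine Finset.sum_congr rfl fun i _ => ?_
        rw [map_smul, hF]; rfl
      refine Eq.trans ?_ h3.symm
      simp only [hg]
      exact (b.sum_repr _).symm

end Coordinates

section Testing

variable {E : Type*} [NormedAddCommGroup E] [NormedSpace ℝ E] [FiniteDimensional ℝ E]
  {B : Type*} [TopologicalSpace B] [ChartedSpace E B] [IsManifold 𝓘(ℝ, E) ∞ B] [T2Space B]

omit [FiniteDimensional ℝ E] [IsManifold 𝓘(ℝ, E) ∞ B] [T2Space B] in
theorem smoothFun_of_eventuallyEq {f : B → ℝ}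
    (h : ∀ x, ∃ g, SmoothFun 𝓘(ℝ, E) g ∧ f =ᶠ[𝓝 x] g) : SmoothFun 𝓘(ℝ, E) f := fun x => by
  obtain ⟨g, hg, hfg⟩ := h x
  exact (ContMDiff.contMDiffAt hg).congr_of_eventuallyEq hfg

theorem eq_of_dirDeriv_eq {x : B} {v w : TangentSpace 𝓘(ℝ, E) x}
    (h : ∀ f : B → ℝ, SmoothFun 𝓘(ℝ, E) f → dirDeriv 𝓘(ℝ, E) f x v = dirDeriv 𝓘(ℝ, E) f x w) :
    v = w := by
  obtain ⟨n, g, F, hg, -, hx⟩ := exists_coordinates (E := E) x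
  rw [hx.self_of_nhds.2 v, hx.self_of_nhds.2 w]
  exact Finset.sum_congr rfl fun i _ => by rw [h _ (hg i)]

theorem exists_smoothFun_dirDeriv_eq {x : B} (β : CotangentFibre 𝓘(ℝ, E) x) :
    ∃ f : B → ℝ, SmoothFun 𝓘(ℝ, E) f ∧ ∀ v, dirDeriv 𝓘(ℝ, E) f x v = β v := by
  obtain ⟨n, g, F, hg, -, hx⟩ := exists_coordinates (E := E) x
  refine ⟨fun y => ∑ i, β (F i x) * g i y,
    SmoothFun.sum fun i _ => (SmoothFun.const _).mul (hg i), fun v => ?_⟩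
  rw [dirDeriv_sum _ fun i => (SmoothFun.const _).mul (hg i)]
  conv_rhs => rw [hx.self_of_nhds.2 v, map_sum]
  refine Finset.sum_congr rfl fun i _ => ?_
  rw [dirDeriv_const_mul _ (hg i), map_smul, smul_eq_mul, mul_comm]

theorem exists_smoothField_eq {x : B} (v : TangentSpace 𝓘(ℝ, E) x) :
    ∃ X : ∀ y : B, TangentSpace 𝓘(ℝ, E) y, SmoothField 𝓘(ℝ, E) X ∧ X x = v := by
  obtain ⟨n, g, F, hg, hF, hx⟩ := exists_coordinates (E := E) x
  exact ⟨fun y => ∑ i, dirDeriv 𝓘(ℝ, E) (g i) x v • F i y,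
    SmoothField.sum fun i _ => (hF i).smul (SmoothFun.const _), (hx.self_of_nhds.2 v).symm⟩

/-- A vector field is smooth if it takes smooth functions to smooth functions. -/
theorem smoothField_of_dirDeriv {X : ∀ x : B, TangentSpace 𝓘(ℝ, E) x}
    (h : ∀ f : B → ℝ, SmoothFun 𝓘(ℝ, E) f → SmoothFun 𝓘(ℝ, E) fun x => dirDeriv 𝓘(ℝ, E) f x (X x)) :
    SmoothField 𝓘(ℝ, E) X := by
  intro x
  obtain ⟨n, g, F, hg, hF, hx⟩ := exists_coordinates (E := E) x
  have h1 : SmoothField 𝓘(ℝ, E) (fun y => ∑ i, dirDeriv 𝓘(ℝ, E) (g i) y (X y) • F i y) :=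
    SmoothField.sum fun i _ => (hF i).smul (h _ (hg i))
  refine (h1 x).congr_of_eventuallyEq ?_
  filter_upwards [hx] with y hy
  rw [← hy.2 (X y)]

theorem exists_smoothFun_ne {x y : B} (h : x ≠ y) :
    ∃ f : B → ℝ, SmoothFun 𝓘(ℝ, E) f ∧ f x ≠ f y := by
  obtain ⟨χ, -, hχ⟩ := (SmoothBumpFunction.nhds_basis_support (I := 𝓘(ℝ, E))
    (isOpen_compl_singleton.mem_nhds h)).mem_iff.1 (isOpen_compl_singleton.mem_nhds h)
  refine ⟨χ, χ.contMDiff, ?_⟩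
  have h1 : χ y = 0 := by
    by_contra h2
    exact hχ h2 rfl
  rw [χ.eq_one, h1]
  exact one_ne_zero

end Testing

/-! ### Forms along maps -/

section Along

variable {E : Type*} [NormedAddCommGroup E] [NormedSpace ℝ E]
  {B : Type*} [TopologicalSpace B] [ChartedSpace E B]
  {E' : Type*} [NormedAddCommGroup E'] [NormedSpace ℝ E']
  {Q : Type*} [TopologicalSpace Q] [ChartedSpace E' Q]

variable (E E') in
/-- `V` is a smooth vector field along the map `f : Q → B`, as tested on the smooth functions
on `B`. -/
def SmoothAlong (f : Q → B) (V : ∀ q, TangentSpace 𝓘(ℝ, E) (f q)) : Prop :=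
  ∀ g : B → ℝ, SmoothFun 𝓘(ℝ, E) g → SmoothFun 𝓘(ℝ, E') (fun q => dirDeriv 𝓘(ℝ, E) g (f q) (V q))

theorem SmoothField.smoothAlong_map [IsManifold 𝓘(ℝ, E') ∞ Q]
    {X : ∀ q : Q, TangentSpace 𝓘(ℝ, E') q} (hX : SmoothField 𝓘(ℝ, E') X) {f : Q → B}
    (hf : ContMDiff 𝓘(ℝ, E') 𝓘(ℝ, E) ∞ f) :
    SmoothAlong E E' f (fun q => mfderiv 𝓘(ℝ, E') 𝓘(ℝ, E) f q (X q)) := fun g hg => by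
  have h := (hg.comp hf).dirDeriv hX
  simpa only [dirDeriv_comp hg hf] using h

theorem SmoothField.smoothAlong_comp [IsManifold 𝓘(ℝ, E) ∞ B]
    {Y : ∀ x : B, TangentSpace 𝓘(ℝ, E) x} (hY : SmoothField 𝓘(ℝ, E) Y) {f : Q → B}
    (hf : ContMDiff 𝓘(ℝ, E') 𝓘(ℝ, E) ∞ f) : SmoothAlong E E' f (fun q => Y (f q)) :=
  fun _ hg => (hg.dirDeriv hY).comp hf

theorem SmoothAlong.sub {f : Q → B} {V W : ∀ q, TangentSpace 𝓘(ℝ, E) (f q)}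
    (hV : SmoothAlong E E' f V) (hW : SmoothAlong E E' f W) :
    SmoothAlong E E' f (fun q => V q - W q) := fun g hg => by
  simpa only [dirDeriv_map_sub] using (hV g hg).sub (hW g hg)

theorem SmoothAlong.smul {f : Q → B} {c : Q → ℝ} (hc : SmoothFun 𝓘(ℝ, E') c)
    {V : ∀ q, TangentSpace 𝓘(ℝ, E) (f q)} (hV : SmoothAlong E E' f V) :
    SmoothAlong E E' f (fun q => c q • V q) := fun g hg => by
  simpa only [dirDeriv_map_smul] using hc.mul (hV g hg)

theorem SmoothAlong.sum {ι : Type*} {t : Finset ι} {f : Q → B}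
    {V : ι → ∀ q, TangentSpace 𝓘(ℝ, E) (f q)} (hV : ∀ i ∈ t, SmoothAlong E E' f (V i)) :
    SmoothAlong E E' f (fun q => ∑ i ∈ t, V i q) := fun g hg => by
  simpa only [dirDeriv_map_sum] using SmoothFun.sum fun i hi => hV i hi g hg

variable [FiniteDimensional ℝ E] [IsManifold 𝓘(ℝ, E) ∞ B] [T2Space B]

theorem SmoothOneForm.apply_along {α : ∀ x : B, CotangentFibre 𝓘(ℝ, E) x}
    (hα : SmoothOneForm 𝓘(ℝ, E) α) {f : Q → B} (hf : ContMDiff 𝓘(ℝ, E') 𝓘(ℝ, E) ∞ f)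
    {V : ∀ q, TangentSpace 𝓘(ℝ, E) (f q)} (hV : SmoothAlong E E' f V) :
    SmoothFun 𝓘(ℝ, E') (fun q => α (f q) (V q)) := by
  refine smoothFun_of_eventuallyEq fun q₀ => ?_
  obtain ⟨n, g, F, hg, hF, hx⟩ := exists_coordinates (E := E) (f q₀)
  refine ⟨fun q => ∑ i, dirDeriv 𝓘(ℝ, E) (g i) (f q) (V q) * α (f q) (F i (f q)),
    SmoothFun.sum fun i _ => (hV _ (hg i)).mul ((hα _ (hF i)).comp hf), ?_⟩
  filter_upwards [hf.continuous.continuousAt.eventually hx] with q hq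
  conv_lhs => rw [hq.2 (V q), map_sum]
  simp

theorem IsTwoForm.apply_along {φ : ∀ x : B, TangentSpace 𝓘(ℝ, E) x →ₗ[ℝ] TangentSpace 𝓘(ℝ, E) x →ₗ[ℝ] ℝ}
    (hφ : IsTwoForm 𝓘(ℝ, E) φ) {f : Q → B} (hf : ContMDiff 𝓘(ℝ, E') 𝓘(ℝ, E) ∞ f)
    {V W : ∀ q, TangentSpace 𝓘(ℝ, E) (f q)} (hV : SmoothAlong E E' f V)
    (hW : SmoothAlong E E' f W) : SmoothFun 𝓘(ℝ, E') (fun q => φ (f q) (V q) (W q)) := by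
  refine smoothFun_of_eventuallyEq fun q₀ => ?_
  obtain ⟨n, g, F, hg, hF, hx⟩ := exists_coordinates (E := E) (f q₀)
  refine ⟨fun q => ∑ i, dirDeriv 𝓘(ℝ, E) (g i) (f q) (V q) * φ (f q) (F i (f q)) (W q),
    SmoothFun.sum fun i _ => (hV _ (hg i)).mul
      (SmoothOneForm.apply_along (fun Y hY => hφ.smooth _ _ (hF i) hY) hf hW), ?_⟩
  filter_upwards [hf.continuous.continuousAt.eventually hx] with q hq
  conv_lhs => rw [hq.2 (V q), map_sum]
  simp

end Along

/-! ### Related vector fields -/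

section Related

variable {E : Type*} [NormedAddCommGroup E] [NormedSpace ℝ E] [FiniteDimensional ℝ E]
  {B : Type*} [TopologicalSpace B] [ChartedSpace E B] [IsManifold 𝓘(ℝ, E) ∞ B] [T2Space B]
  {E' : Type*} [NormedAddCommGroup E'] [NormedSpace ℝ E'] [FiniteDimensional ℝ E']
  {Q : Type*} [TopologicalSpace Q] [ChartedSpace E' Q] [IsManifold 𝓘(ℝ, E') ∞ Q]

/-- Brackets of related fields are related. -/
theorem mfderiv_mlieBracket_of_related {f : Q → B} (hf : ContMDiff 𝓘(ℝ, E') 𝓘(ℝ, E) ∞ f)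
    {X Y : ∀ q : Q, TangentSpace 𝓘(ℝ, E') q} {X' Y' : ∀ x : B, TangentSpace 𝓘(ℝ, E) x}
    (hX : SmoothField 𝓘(ℝ, E') X) (hY : SmoothField 𝓘(ℝ, E') Y)
    (hX' : SmoothField 𝓘(ℝ, E) X') (hY' : SmoothField 𝓘(ℝ, E) Y')
    (hXX' : ∀ q, mfderiv 𝓘(ℝ, E') 𝓘(ℝ, E) f q (X q) = X' (f q))
    (hYY' : ∀ q, mfderiv 𝓘(ℝ, E') 𝓘(ℝ, E) f q (Y q) = Y' (f q)) (q : Q) :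
    mfderiv 𝓘(ℝ, E') 𝓘(ℝ, E) f q (VectorField.mlieBracket 𝓘(ℝ, E') X Y q) =
      VectorField.mlieBracket 𝓘(ℝ, E) X' Y' (f q) := by
  refine eq_of_dirDeriv_eq fun g hg => ?_
  rw [← dirDeriv_comp hg hf, dirDeriv_mlieBracket (hg.comp hf) hX hY,
    dirDeriv_mlieBracket hg hX' hY']
  simp only [dirDeriv_comp hg hf, hXX', hYY']
  rw [dirDeriv_comp (hg.dirDeriv hY') hf, dirDeriv_comp (hg.dirDeriv hX') hf, hXX', hYY']

end Related

/-! ### Local inverses of matrices of functions -/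

section Matrices

variable {E : Type*} [NormedAddCommGroup E] [NormedSpace ℝ E]
  {B : Type*} [TopologicalSpace B] [ChartedSpace E B]

theorem SmoothFun.det {n : ℕ} {m : B → Matrix (Fin n) (Fin n) ℝ}
    (hm : ∀ i j, SmoothFun 𝓘(ℝ, E) (fun x => m x i j)) : SmoothFun 𝓘(ℝ, E) (fun x => (m x).det) := by
  simp only [Matrix.det_apply']
  exact SmoothFun.sum fun σ _ => (SmoothFun.const _).mul
    (contMDiff_finsetProd (I' := 𝓘(ℝ, E)) fun i _ => hm (σ i) i)

variable [FiniteDimensional ℝ E] [IsManifold 𝓘(ℝ, E) ∞ B] [T2Space B]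

/-- A smooth function has a globally defined smooth inverse near a point where it does not vanish:
`f / (f ^ 2 + 1 - χ)` for a bump function `χ` supported in the set where `f ≠ 0`. -/
theorem exists_smoothFun_inv {f : B → ℝ} (hf : SmoothFun 𝓘(ℝ, E) f) {x₀ : B} (h : f x₀ ≠ 0) :
    ∃ g, SmoothFun 𝓘(ℝ, E) g ∧ ∀ᶠ x in 𝓝 x₀, g x * f x = 1 := by
  have hU : {x | f x ≠ 0} ∈ 𝓝 x₀ := hf.continuous.continuousAt.eventually_ne h
  obtain ⟨χ, -, hχ⟩ := (SmoothBumpFunction.nhds_basis_support (I := 𝓘(ℝ, E)) hU).mem_iff.1 hU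
  have hpos : ∀ x, f x * f x + (1 - χ x) ≠ 0 := by
    intro x
    by_cases hx : χ x = 0
    · rw [hx]; nlinarith [mul_self_nonneg (f x)]
    · have h1 : f x ≠ 0 := hχ hx
      have := mul_self_pos.2 h1
      have := χ.le_one (x := x)
      linarith
  refine ⟨fun x => f x * (f x * f x + (1 - χ x))⁻¹, hf.mul
    (ContMDiff.inv₀ ((hf.mul hf).add ((SmoothFun.const 1).sub χ.contMDiff)) hpos), ?_⟩
  filter_upwards [hU, χ.eventuallyEq_one] with x hx hx1
  rw [hx1]
  simp only [Pi.one_apply, sub_self, add_zero]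
  field_simp

/-- The adjugate, divided by the determinant. -/
theorem exists_smooth_inverse_matrix {n : ℕ} {m : B → Matrix (Fin n) (Fin n) ℝ}
    (hm : ∀ i j, SmoothFun 𝓘(ℝ, E) (fun x => m x i j)) {x₀ : B} (h : (m x₀).det ≠ 0) :
    ∃ m' : B → Matrix (Fin n) (Fin n) ℝ, (∀ i j, SmoothFun 𝓘(ℝ, E) (fun x => m' x i j)) ∧
      ∀ᶠ x in 𝓝 x₀, m' x * m x = 1 ∧ m x * m' x = 1 := by
  obtain ⟨g, hg, hgf⟩ := exists_smoothFun_inv (SmoothFun.det hm) h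
  refine ⟨fun x => g x • (m x).adjugate, fun i j => ?_, ?_⟩
  · simp only [Matrix.smul_apply, smul_eq_mul, Matrix.adjugate_apply]
    refine hg.mul (SmoothFun.det fun k l => ?_)
    by_cases hk : k = j
    · subst hk
      simpa using SmoothFun.const _
    · simpa [Matrix.updateRow_ne hk] using hm k l
  · filter_upwards [hgf] with x hx
    constructor
    · rw [Matrix.smul_mul, Matrix.adjugate_mul, smul_smul, hx, one_smul]
    · rw [Matrix.mul_smul, Matrix.mul_adjugate, smul_smul, hx, one_smul]

end Matrices

/-! ### Immersions and submersions -/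

section Immersion

variable {E : Type*} [NormedAddCommGroup E] [NormedSpace ℝ E] [FiniteDimensional ℝ E]
  {B : Type*} [TopologicalSpace B] [ChartedSpace E B] [IsManifold 𝓘(ℝ, E) ∞ B] [T2Space B]
  {E' : Type*} [NormedAddCommGroup E'] [NormedSpace ℝ E'] [FiniteDimensional ℝ E']
  {Q : Type*} [TopologicalSpace Q] [ChartedSpace E' Q] [IsManifold 𝓘(ℝ, E') ∞ Q] [T2Space Q]

/-- A vector field on the source of an immersion is smooth if its image is smooth along the
immersion. -/
theorem smoothField_of_immersion {f : Q → B} (hf : ContMDiff 𝓘(ℝ, E') 𝓘(ℝ, E) ∞ f)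
    (hinj : ∀ q, Function.Injective (mfderiv 𝓘(ℝ, E') 𝓘(ℝ, E) f q))
    {X : ∀ q : Q, TangentSpace 𝓘(ℝ, E') q}
    (hX : SmoothAlong E E' f (fun q => mfderiv 𝓘(ℝ, E') 𝓘(ℝ, E) f q (X q))) :
    SmoothField 𝓘(ℝ, E') X := by
  intro x₀
  obtain ⟨k, h, W, hh, hW, hy⟩ := exists_coordinates (E := E') x₀
  -- functions on the target whose pullbacks have the same differentials at `x₀` as the coordinates
  obtain ⟨L, hL⟩ := LinearMap.exists_leftInverse_of_injective
    (mfderiv 𝓘(ℝ, E') 𝓘(ℝ, E) f x₀ : TangentSpace 𝓘(ℝ, E') x₀ →ₗ[ℝ] TangentSpace 𝓘(ℝ, E) (f x₀))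
    (LinearMap.ker_eq_bot.2 (hinj x₀))
  choose G hG hGL using fun i => exists_smoothFun_dirDeriv_eq
    ((differential (h i) x₀ : CotangentFibre 𝓘(ℝ, E') x₀) ∘ₗ L)
  let m : Q → Matrix (Fin k) (Fin k) ℝ :=
    fun x => Matrix.of fun i j => dirDeriv 𝓘(ℝ, E') (fun y => G i (f y)) x (W j x)
  have hm0 : m x₀ = 1 := by
    ext i j
    simp only [m, Matrix.of_apply, dirDeriv_comp (hG i) hf, hGL, LinearMap.comp_apply,
      differential_apply]
    have h1 : L (mfderiv 𝓘(ℝ, E') 𝓘(ℝ, E) f x₀ (W j x₀)) = W j x₀ := LinearMap.congr_fun hL _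
    rw [h1, hy.self_of_nhds.1, Matrix.one_apply]
  obtain ⟨m', hm', hinv⟩ := exists_smooth_inverse_matrix (m := m) (E := E') (x₀ := x₀)
    (fun i j => ((hG i).comp hf).dirDeriv (hW j)) (by rw [hm0]; simp)
  have hsm : SmoothField 𝓘(ℝ, E') (fun x => ∑ j, (∑ i, m' x j i *
      dirDeriv 𝓘(ℝ, E) (G i) (f x) (mfderiv 𝓘(ℝ, E') 𝓘(ℝ, E) f x (X x))) • W j x) :=
    SmoothField.sum fun j _ => (hW j).smul (SmoothFun.sum fun i _ => (hm' j i).mul (hX _ (hG i)))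
  refine (hsm x₀).congr_of_eventuallyEq ?_
  filter_upwards [hy, hinv] with x hx hinvx
  have h1 : ∀ i, dirDeriv 𝓘(ℝ, E) (G i) (f x) (mfderiv 𝓘(ℝ, E') 𝓘(ℝ, E) f x (X x)) =
      (m x).mulVec (fun j => dirDeriv 𝓘(ℝ, E') (h j) x (X x)) i := by
    intro i
    rw [← dirDeriv_comp (hG i) hf]
    conv_lhs => rw [hx.2 (X x), dirDeriv_map_sum]
    simp only [dirDeriv_map_smul, Matrix.mulVec, dotProduct, m, Matrix.of_apply]
    exact Finset.sum_congr rfl fun j _ => mul_comm _ _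
  congr 1
  conv_lhs => rw [hx.2 (X x)]
  refine Finset.sum_congr rfl fun j _ => ?_
  congr 1
  simp only [h1]
  have h2 := congrFun (Matrix.mulVec_mulVec (fun j => dirDeriv 𝓘(ℝ, E') (h j) x (X x))
    (m' x) (m x)) j
  rw [hinvx.1, Matrix.one_mulVec] at h2
  exact h2.symm

end Immersion

section Submersion

variable {E : Type*} [NormedAddCommGroup E] [NormedSpace ℝ E] [FiniteDimensional ℝ E]
  {B : Type*} [TopologicalSpace B] [ChartedSpace E B] [IsManifold 𝓘(ℝ, E) ∞ B] [T2Space B]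
  {E' : Type*} [NormedAddCommGroup E'] [NormedSpace ℝ E'] [FiniteDimensional ℝ E']
  {Q : Type*} [TopologicalSpace Q] [ChartedSpace E' Q] [IsManifold 𝓘(ℝ, E') ∞ Q] [T2Space Q]
  [SecondCountableTopology Q]

/-- Fields that exist locally and are characterized by convex conditions exist globally. -/
theorem exists_smoothField_of_local (t : ∀ q : Q, Set (TangentSpace 𝓘(ℝ, E') q))
    (ht : ∀ q, Convex ℝ (t q)) (h : ∀ q₀, ∃ X : ∀ q : Q, TangentSpace 𝓘(ℝ, E') q,
      SmoothField 𝓘(ℝ, E') X ∧ ∀ᶠ q in 𝓝 q₀, X q ∈ t q) :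
    ∃ X : ∀ q : Q, TangentSpace 𝓘(ℝ, E') q, SmoothField 𝓘(ℝ, E') X ∧ ∀ q, X q ∈ t q := by
  have : LocallyCompactSpace Q := Manifold.locallyCompact_of_finiteDimensional 𝓘(ℝ, E')
  obtain ⟨X, hX⟩ := exists_contMDiffSection_forall_mem_convex_of_local 𝓘(ℝ, E') (n := ⊤)
    (TangentSpace 𝓘(ℝ, E') (M := Q)) t ht fun q₀ => by
      obtain ⟨X, hX, hXt⟩ := h q₀
      exact ⟨_, hXt, X, hX.contMDiffOn, fun y hy => hy⟩
  exact ⟨X, X.contMDiff, hX⟩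

/-- Vector fields lift through submersions, with prescribed value at one point. -/
theorem exists_lift_field {f : Q → B} (hf : ContMDiff 𝓘(ℝ, E') 𝓘(ℝ, E) ∞ f)
    (hsurj : ∀ q, Function.Surjective (mfderiv 𝓘(ℝ, E') 𝓘(ℝ, E) f q))
    {Y : ∀ x : B, TangentSpace 𝓘(ℝ, E) x} (hY : SmoothField 𝓘(ℝ, E) Y) (p : Q)
    (w : TangentSpace 𝓘(ℝ, E') p) (hw : mfderiv 𝓘(ℝ, E') 𝓘(ℝ, E) f p w = Y (f p)) :
    ∃ X : ∀ q : Q, TangentSpace 𝓘(ℝ, E') q, SmoothField 𝓘(ℝ, E') X ∧ X p = w ∧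
      ∀ q, mfderiv 𝓘(ℝ, E') 𝓘(ℝ, E) f q (X q) = Y (f q) := by
  -- the local lift through a given vector
  have hloc : ∀ q₀ (u : TangentSpace 𝓘(ℝ, E') q₀), mfderiv 𝓘(ℝ, E') 𝓘(ℝ, E) f q₀ u = Y (f q₀) →
      ∃ X : ∀ q : Q, TangentSpace 𝓘(ℝ, E') q, SmoothField 𝓘(ℝ, E') X ∧ X q₀ = u ∧
        ∀ᶠ q in 𝓝 q₀, mfderiv 𝓘(ℝ, E') 𝓘(ℝ, E) f q (X q) = Y (f q) := by
    intro q₀ u hu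
    obtain ⟨n, g, F, hg, hF, hx⟩ := exists_coordinates (E := E) (f q₀)
    obtain ⟨U, hU, hUu⟩ := exists_smoothField_eq u
    choose v hv using fun j => hsurj q₀ (F j (f q₀))
    choose W hW hWv using fun j => exists_smoothField_eq (v j)
    let m : Q → Matrix (Fin n) (Fin n) ℝ :=
      fun x => Matrix.of fun i j => dirDeriv 𝓘(ℝ, E') (fun y => g i (f y)) x (W j x)
    have hm0 : m q₀ = 1 := by
      ext i j
      simp only [m, Matrix.of_apply, dirDeriv_comp (hg i) hf, hWv, hv]
      rw [hx.self_of_nhds.1, Matrix.one_apply]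
    obtain ⟨m', hm', hinv⟩ := exists_smooth_inverse_matrix (m := m) (E := E') (x₀ := q₀)
      (fun i j => ((hg i).comp hf).dirDeriv (hW j)) (by rw [hm0]; simp)
    let r : Q → Fin n → ℝ := fun x i => dirDeriv 𝓘(ℝ, E) (g i) (f x) (Y (f x)) -
      dirDeriv 𝓘(ℝ, E') (fun y => g i (f y)) x (U x)
    have hr : ∀ i, SmoothFun 𝓘(ℝ, E') (fun x => r x i) := fun i =>
      (((hg i).dirDeriv hY).comp hf).sub (((hg i).comp hf).dirDeriv hU)
    have hc : ∀ j, SmoothFun 𝓘(ℝ, E') (fun x => (m' x).mulVec (r x) j) := fun j => by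
      simpa only [Matrix.mulVec, dotProduct] using SmoothFun.sum fun i _ => (hm' j i).mul (hr i)
    refine ⟨fun x => U x + ∑ j, (m' x).mulVec (r x) j • W j x, hU.add (SmoothField.sum fun j _ =>
      (hW j).smul (hc j)), ?_, ?_⟩
    · have h0 : r q₀ = 0 := by
        funext i
        simp only [r, dirDeriv_comp (hg i) hf, hUu, hu, sub_self, Pi.zero_apply]
      simp only [h0, Matrix.mulVec_zero, Pi.zero_apply, zero_smul, Finset.sum_const_zero, add_zero,
        hUu]
    · filter_upwards [hf.continuous.continuousAt.eventually hx, hinv] with x hx hinvx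
      rw [hx.2 (mfderiv 𝓘(ℝ, E') 𝓘(ℝ, E) f x _), hx.2 (Y (f x))]
      refine Finset.sum_congr rfl fun i _ => ?_
      congr 1
      rw [← dirDeriv_comp (hg i) hf, dirDeriv_map_add, dirDeriv_map_sum]
      simp only [dirDeriv_map_smul]
      have h2 := congrFun (Matrix.mulVec_mulVec (r x) (m x) (m' x)) i
      rw [hinvx.2, Matrix.one_mulVec] at h2
      have h3 : ∑ j, (m' x).mulVec (r x) j * dirDeriv 𝓘(ℝ, E') (fun y => g i (f y)) x (W j x) =
          r x i := by
        rw [← h2]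
        simp only [Matrix.mulVec, dotProduct, m, Matrix.of_apply]
        exact Finset.sum_congr rfl fun j _ => mul_comm _ _
      rw [h3]
      simp only [r]; ring
  let t : ∀ q : Q, Set (TangentSpace 𝓘(ℝ, E') q) :=
    fun q => {u | mfderiv 𝓘(ℝ, E') 𝓘(ℝ, E) f q u = Y (f q) ∧ (q = p → HEq u w)}
  have htc : ∀ q, Convex ℝ (t q) := by
    intro q u₁ h₁ u₂ h₂ a b ha hb hab
    refine ⟨?_, fun hq => ?_⟩
    · rw [map_add, map_smul, map_smul, h₁.1, h₂.1, ← add_smul, hab, one_smul]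
    · subst hq
      have e₁ := eq_of_heq (h₁.2 rfl)
      have e₂ := eq_of_heq (h₂.2 rfl)
      rw [e₁, e₂, ← add_smul, hab, one_smul]
  obtain ⟨X, hX, hXt⟩ := exists_smoothField_of_local t htc fun q₀ => by
    by_cases hq : q₀ = p
    · subst hq
      obtain ⟨X, hX, hXw, hXf⟩ := hloc q₀ w hw
      refine ⟨X, hX, ?_⟩
      filter_upwards [hXf] with q hq
      exact ⟨hq, fun h => by subst h; exact heq_of_eq hXw⟩
    · obtain ⟨u, hu⟩ := hsurj q₀ (Y (f q₀))
      obtain ⟨X, hX, -, hXf⟩ := hloc q₀ u hu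
      refine ⟨X, hX, ?_⟩
      filter_upwards [hXf, isOpen_compl_singleton.mem_nhds hq] with q hq hqp
      exact ⟨hq, fun h => absurd h hqp⟩
  exact ⟨X, hX, eq_of_heq ((hXt p).2 rfl), fun q => (hXt q).1⟩

end Submersion

section LocalSection

variable {E : Type*} [NormedAddCommGroup E] [NormedSpace ℝ E] [FiniteDimensional ℝ E]
  {B : Type*} [TopologicalSpace B] [ChartedSpace E B] [IsManifold 𝓘(ℝ, E) ∞ B]
  {E' : Type*} [NormedAddCommGroup E'] [NormedSpace ℝ E'] [FiniteDimensional ℝ E']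
  {Q : Type*} [TopologicalSpace Q] [ChartedSpace E' Q] [IsManifold 𝓘(ℝ, E') ∞ Q]

omit [FiniteDimensional ℝ E'] in
/-- A submersion has smooth local sections: in charts, restrict to an affine subspace transversal to
the fibre and invert. -/
theorem exists_local_section {f : Q → B} (hf : ContMDiff 𝓘(ℝ, E') 𝓘(ℝ, E) ∞ f) (x : Q)
    (hsurj : Function.Surjective (mfderiv 𝓘(ℝ, E') 𝓘(ℝ, E) f x)) :
    ∃ σ : B → Q, ContMDiffAt 𝓘(ℝ, E) 𝓘(ℝ, E') ∞ σ (f x) ∧ σ (f x) = x ∧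
      ∀ᶠ y in 𝓝 (f x), f (σ y) = y := by
  have : IsManifold 𝓘(ℝ, E) 1 B := IsManifold.of_le (n := ∞)
    (WithTop.coe_le_coe.2 le_top : ((1 : ℕ∞) : WithTop ℕ∞) ≤ ((⊤ : ℕ∞) : WithTop ℕ∞))
  have : IsManifold 𝓘(ℝ, E') 1 Q := IsManifold.of_le (n := ∞)
    (WithTop.coe_le_coe.2 le_top : ((1 : ℕ∞) : WithTop ℕ∞) ≤ ((⊤ : ℕ∞) : WithTop ℕ∞))
  set φ := extChartAt 𝓘(ℝ, E') x with hφ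
  set ψ := extChartAt 𝓘(ℝ, E) (f x) with hψ
  have hφx : φ.symm (φ x) = x := extChartAt_to_inv x
  have hsymm : ContMDiffAt 𝓘(ℝ, E') 𝓘(ℝ, E') ∞ φ.symm (φ x) :=
    (contMDiffOn_extChartAt_symm (I := 𝓘(ℝ, E')) (n := ∞) x _
      (mem_extChartAt_target x)).contMDiffAt (extChartAt_target_mem_nhds x)
  have hψs : ContMDiffAt 𝓘(ℝ, E) 𝓘(ℝ, E) ∞ ψ (f x) := contMDiffAt_extChartAt
  have hF : ContMDiffAt 𝓘(ℝ, E') 𝓘(ℝ, E) ∞ (ψ ∘ f ∘ φ.symm) (φ x) := by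
    have h1 : ContMDiffAt 𝓘(ℝ, E') 𝓘(ℝ, E) ∞ (f ∘ φ.symm) (φ x) :=
      (hf.contMDiffAt).comp _ hsymm
    refine ContMDiffAt.comp _ ?_ h1
    simpa only [Function.comp_apply, hφx] using hψs
  have hFd : ContDiffAt ℝ ∞ (ψ ∘ f ∘ φ.symm) (φ x) := hF.contDiffAt
  set C := fderiv ℝ (ψ ∘ f ∘ φ.symm) (φ x) with hC
  have hCsurj : Function.Surjective C := by
    have h1 : (ψ ∘ f) =ᶠ[𝓝 x] (ψ ∘ f ∘ φ.symm) ∘ φ := by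
      filter_upwards [extChartAt_source_mem_nhds (I := 𝓘(ℝ, E')) x] with y hy
      exact congrArg (fun z => ψ (f z)) (φ.left_inv hy).symm
    have h2 := h1.mfderiv_eq (I := 𝓘(ℝ, E')) (I' := 𝓘(ℝ, E))
    rw [mfderiv_comp x (hF.mdifferentiableAt (by simp))
      (mdifferentiableAt_extChartAt (mem_chart_source E' x)),
      mfderiv_comp x (hψs.mdifferentiableAt (by simp)) (hf.mdifferentiableAt (by simp)),
      mfderiv_eq_fderiv] at h2
    intro u
    obtain ⟨v, hv⟩ := (isInvertible_mfderiv_extChartAt (I := 𝓘(ℝ, E))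
      (mem_extChartAt_source (f x))).surjective u
    obtain ⟨w, hw⟩ := hsurj v
    refine ⟨mfderiv 𝓘(ℝ, E') 𝓘(ℝ, E') φ x w, ?_⟩
    have h3 := congrArg (fun L : E' →L[ℝ] E => L w) h2
    refine Eq.trans h3.symm ?_
    rw [← hv, ← hw]; rfl
  obtain ⟨L₀, hL₀⟩ := LinearMap.exists_rightInverse_of_surjective (C : E' →ₗ[ℝ] E)
    (LinearMap.range_eq_top.2 hCsurj)
  let L : E →L[ℝ] E' := LinearMap.toContinuousLinearMap L₀
  have hCL : ∀ u, C (L u) = u := fun u => LinearMap.congr_fun hL₀ u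
  let G : E → E := fun z => (ψ ∘ f ∘ φ.symm) (φ x + L z)
  have haff : ContDiffAt ℝ ∞ (fun z : E => φ x + L z) 0 :=
    (contDiff_const.add L.contDiff).contDiffAt
  have hG : ContDiffAt ℝ ∞ G 0 := by
    refine ContDiffAt.comp (g := ψ ∘ f ∘ φ.symm) (0 : E) ?_ haff
    simpa using hFd
  have hG' : HasFDerivAt G ((ContinuousLinearEquiv.refl ℝ E : E ≃L[ℝ] E) : E →L[ℝ] E) 0 := by
    have h1 : HasFDerivAt (fun z : E => φ x + L z) L 0 := L.hasFDerivAt.const_add (φ x)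
    have h2 : HasFDerivAt (ψ ∘ f ∘ φ.symm) C (φ x + L 0) := by
      simpa using (hFd.differentiableAt (by simp)).hasFDerivAt
    have h3 := h2.comp (0 : E) h1
    convert! h3 using 1
    ext u
    simp [hCL]
  let Gi := hG.localInverse hG' (by simp)
  have hG0 : G 0 = ψ (f x) := by simp [G, hφx]
  have hGi0 : Gi (ψ (f x)) = 0 := by
    rw [← hG0]; exact hG.localInverse_apply_image hG' (by simp)
  have hGis : ContDiffAt ℝ ∞ Gi (ψ (f x)) := by
    rw [← hG0]; exact hG.to_localInverse hG' (by simp)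
  have hGiG : ∀ᶠ z in 𝓝 (ψ (f x)), G (Gi z) = z := by
    rw [← hG0]; exact (hG.hasStrictFDerivAt' hG' (by simp)).eventually_right_inverse
  have hσ : ContMDiffAt 𝓘(ℝ, E) 𝓘(ℝ, E') ∞ (fun y => φ.symm (φ x + L (Gi (ψ y)))) (f x) := by
    have h1 : ContMDiffAt 𝓘(ℝ, E) 𝓘(ℝ, E) ∞ (Gi ∘ ψ) (f x) := hGis.contMDiffAt.comp _ hψs
    have h2 : ContMDiffAt 𝓘(ℝ, E) 𝓘(ℝ, E') ∞ (fun y => φ x + L (Gi (ψ y))) (f x) := by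
      refine ContMDiffAt.comp (g := fun z : E => φ x + L z) (I' := 𝓘(ℝ, E)) _ ?_ h1
      exact (contDiff_const.add L.contDiff).contMDiff.contMDiffAt
    refine ContMDiffAt.comp (g := φ.symm) (I' := 𝓘(ℝ, E')) _ ?_ h2
    simpa [hGi0] using hsymm
  have hσx : φ.symm (φ x + L (Gi (ψ (f x)))) = x := by rw [hGi0]; simp [hφx]
  refine ⟨_, hσ, hσx, ?_⟩
  have hcont : ContinuousAt (fun y => f (φ.symm (φ x + L (Gi (ψ y))))) (f x) := by
    refine ContinuousAt.comp (g := f) ?_ hσ.continuousAt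
    exact hf.continuous.continuousAt
  have hmem : ∀ᶠ y in 𝓝 (f x), f (φ.symm (φ x + L (Gi (ψ y)))) ∈ ψ.source :=
    hcont.eventually_mem (by
      simp only [hσx]; exact extChartAt_source_mem_nhds (I := 𝓘(ℝ, E)) (f x))
  filter_upwards [hmem, extChartAt_source_mem_nhds (I := 𝓘(ℝ, E)) (f x),
    hψs.continuousAt.eventually hGiG] with y h1 h2 h3
  exact ψ.injOn h1 h2 h3

omit [FiniteDimensional ℝ E'] in
theorem contMDiff_of_comp_submersion {f : Q → B} (hf : ContMDiff 𝓘(ℝ, E') 𝓘(ℝ, E) ∞ f)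
    (hfs : Function.Surjective f)
    (hsurj : ∀ x, Function.Surjective (mfderiv 𝓘(ℝ, E') 𝓘(ℝ, E) f x))
    {F : Type*} [NormedAddCommGroup F] [NormedSpace ℝ F] {Y : Type*} [TopologicalSpace Y]
    [ChartedSpace F Y] {h : B → Y} (hh : ContMDiff 𝓘(ℝ, E') 𝓘(ℝ, F) ∞ (fun x => h (f x))) :
    ContMDiff 𝓘(ℝ, E) 𝓘(ℝ, F) ∞ h := by
  intro y
  obtain ⟨x, rfl⟩ := hfs y
  obtain ⟨σ, hσ, hσx, hσf⟩ := exists_local_section hf x (hsurj x)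
  have h1 : ContMDiffAt 𝓘(ℝ, E) 𝓘(ℝ, F) ∞ (fun y => h (f (σ y))) (f x) :=
    ContMDiffAt.comp (g := fun x => h (f x)) (I' := 𝓘(ℝ, E')) _ hh.contMDiffAt hσ
  refine h1.congr_of_eventuallyEq ?_
  filter_upwards [hσf] with y hy
  rw [hy]

end LocalSection

/-! ### Quotients by orbits -/

section OrbitQuotient

variable {E : Type*} [NormedAddCommGroup E] [NormedSpace ℝ E] [FiniteDimensional ℝ E]
  {B : Type*} [TopologicalSpace B] [ChartedSpace E B] [IsManifold 𝓘(ℝ, E) ∞ B]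
  {E' : Type*} [NormedAddCommGroup E'] [NormedSpace ℝ E'] [FiniteDimensional ℝ E']
  {Q : Type*} [TopologicalSpace Q] [ChartedSpace E' Q] [IsManifold 𝓘(ℝ, E') ∞ Q]
  {ι : Type*} {G : ι → ∀ x : Q, TangentSpace 𝓘(ℝ, E') x → Prop} {q : Q → B}

omit [FiniteDimensional ℝ E] [IsManifold 𝓘(ℝ, E) ∞ B] [FiniteDimensional ℝ E']
  [IsManifold 𝓘(ℝ, E') ∞ Q] in
/-- A function whose derivative vanishes on the vertical vectors is constant on the fibres, because
the fibres are connected by integral curves of the generators. -/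
theorem IsOrbitQuotient.eq_of_vertical (hq : IsOrbitQuotient 𝓘(ℝ, E') 𝓘(ℝ, E) G q) {f : Q → ℝ}
    (hf : SmoothFun 𝓘(ℝ, E') f)
    (hv : ∀ x w, mfderiv 𝓘(ℝ, E') 𝓘(ℝ, E) q x w = 0 → dirDeriv 𝓘(ℝ, E') f x w = 0) {x y : Q}
    (hxy : q x = q y) : f x = f y := by
  have key := (hq.fibre_iff x y).1 hxy
  clear hxy
  induction key with
  | refl => rfl
  | symm _ _ _ ih => exact ih.symm
  | trans _ _ _ _ _ ih₁ ih₂ => exact ih₁.trans ih₂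
  | rel x y h =>
    obtain ⟨ξ, c, rfl, rfl, hc⟩ := h
    have hd : ∀ t ∈ Set.Icc (0 : ℝ) 1,
        HasDerivWithinAt (fun t => f (c t)) 0 (Set.Icc 0 1) t := by
      intro t ht
      obtain ⟨w, hw, hcw⟩ := hc t ht
      have h1 := (hf.mdifferentiableAt (c t)).hasMFDerivAt.comp_hasMFDerivWithinAt t hcw
      have h2 : dirDeriv 𝓘(ℝ, E') f (c t) w = 0 := hv _ _ ((hq.ker_iff _ _).2 ⟨ξ, hw⟩)
      have h5 : (w : E') = (1 : ℝ) • w := (one_smul ℝ w).symm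
      obtain ⟨L, hL, hL1⟩ : ∃ L : ℝ →L[ℝ] ℝ,
          HasFDerivWithinAt (fun t => f (c t)) L (Set.Icc 0 1) t ∧ L 1 = 0 :=
        ⟨_, hasMFDerivWithinAt_iff_hasFDerivWithinAt.1 h1, Eq.trans
          (congrArg (fun u => mfderiv 𝓘(ℝ, E') 𝓘(ℝ, ℝ) f (c t) u) h5).symm h2⟩
      have h4 := hL.hasDerivWithinAt
      rwa [hL1] at h4
    have h0 := constant_of_has_deriv_right_zero (f := fun t => f (c t)) (a := 0) (b := 1)
      (fun t ht => (hd t ht).continuousWithinAt) (fun t ht => by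
        have h1 := (hd t ⟨ht.1, ht.2.le⟩)
        refine (h1.mono_of_mem_nhdsWithin ?_)
        exact Icc_mem_nhdsGE_of_mem ht)
    exact (h0 1 (by simp)).symm

/-- A map whose differential vanishes on the vertical vectors descends. -/
theorem IsOrbitQuotient.exists_map_descent (hq : IsOrbitQuotient 𝓘(ℝ, E') 𝓘(ℝ, E) G q)
    {F : Type*} [NormedAddCommGroup F] [NormedSpace ℝ F] [FiniteDimensional ℝ F] {Y : Type*}
    [TopologicalSpace Y] [ChartedSpace F Y] [IsManifold 𝓘(ℝ, F) ∞ Y] [T2Space Y] {f : Q → Y}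
    (hf : ContMDiff 𝓘(ℝ, E') 𝓘(ℝ, F) ∞ f)
    (hv : ∀ x w, mfderiv 𝓘(ℝ, E') 𝓘(ℝ, E) q x w = 0 → mfderiv 𝓘(ℝ, E') 𝓘(ℝ, F) f x w = 0) :
    ∃ g : B → Y, ContMDiff 𝓘(ℝ, E) 𝓘(ℝ, F) ∞ g ∧ ∀ x, g (q x) = f x := by
  have h1 : ∀ x, f (Function.surjInv hq.surjective (q x)) = f x := by
    intro x
    by_contra hne
    obtain ⟨g, hg, hgne⟩ := exists_smoothFun_ne (E := F) hne
    refine hgne (hq.eq_of_vertical (hg.comp hf) (fun x w hw => ?_)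
      (Function.surjInv_eq hq.surjective (q x)))
    rw [dirDeriv_comp hg hf, hv x w hw, dirDeriv_map_zero]
  refine ⟨fun y => f (Function.surjInv hq.surjective y), ?_, h1⟩
  refine contMDiff_of_comp_submersion hq.smooth hq.surjective hq.submersion ?_
  simp only [h1]
  exact hf

end OrbitQuotient

/-! ### Brackets, covectors and exterior derivatives -/

section FieldBrackets

variable {E : Type*} [NormedAddCommGroup E] [NormedSpace ℝ E] [FiniteDimensional ℝ E]
  {B : Type*} [TopologicalSpace B] [ChartedSpace E B] [IsManifold 𝓘(ℝ, E) ∞ B] [T2Space B]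

theorem mlieBracket_add_right' {X Y Z : ∀ x : B, TangentSpace 𝓘(ℝ, E) x}
    (hX : SmoothField 𝓘(ℝ, E) X) (hY : SmoothField 𝓘(ℝ, E) Y) (hZ : SmoothField 𝓘(ℝ, E) Z) (x : B) :
    VectorField.mlieBracket 𝓘(ℝ, E) X (fun y => Y y + Z y) x =
      VectorField.mlieBracket 𝓘(ℝ, E) X Y x + VectorField.mlieBracket 𝓘(ℝ, E) X Z x := by
  refine eq_of_dirDeriv_eq fun g hg => ?_
  rw [dirDeriv_map_add, dirDeriv_mlieBracket hg hX (hY.add hZ), dirDeriv_mlieBracket hg hX hY,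
    dirDeriv_mlieBracket hg hX hZ]
  simp only [dirDeriv_map_add]
  rw [dirDeriv_add (hg.dirDeriv hY) (hg.dirDeriv hZ)]
  ring

theorem mlieBracket_smul_right' {X Y : ∀ x : B, TangentSpace 𝓘(ℝ, E) x}
    (hX : SmoothField 𝓘(ℝ, E) X) (hY : SmoothField 𝓘(ℝ, E) Y) {f : B → ℝ}
    (hf : SmoothFun 𝓘(ℝ, E) f) (x : B) :
    VectorField.mlieBracket 𝓘(ℝ, E) X (fun y => f y • Y y) x =
      f x • VectorField.mlieBracket 𝓘(ℝ, E) X Y x + dirDeriv 𝓘(ℝ, E) f x (X x) • Y x := by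
  refine eq_of_dirDeriv_eq fun g hg => ?_
  rw [dirDeriv_map_add, dirDeriv_mlieBracket hg hX (hY.smul hf), dirDeriv_map_smul,
    dirDeriv_map_smul, dirDeriv_mlieBracket hg hX hY]
  simp only [dirDeriv_map_smul]
  rw [dirDeriv_mul hf (hg.dirDeriv hY)]
  ring

theorem mlieBracket_sum_smul_right {ι : Type*} (t : Finset ι) {X : ∀ x : B, TangentSpace 𝓘(ℝ, E) x}
    {Y : ι → ∀ x : B, TangentSpace 𝓘(ℝ, E) x} {f : ι → B → ℝ}
    (hX : SmoothField 𝓘(ℝ, E) X) (hY : ∀ i, SmoothField 𝓘(ℝ, E) (Y i))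
    (hf : ∀ i, SmoothFun 𝓘(ℝ, E) (f i)) (x : B) :
    VectorField.mlieBracket 𝓘(ℝ, E) X (fun y => ∑ i ∈ t, f i y • Y i y) x =
      ∑ i ∈ t, (f i x • VectorField.mlieBracket 𝓘(ℝ, E) X (Y i) x +
        dirDeriv 𝓘(ℝ, E) (f i) x (X x) • Y i x) := by
  refine eq_of_dirDeriv_eq fun g hg => ?_
  rw [dirDeriv_mlieBracket hg hX (SmoothField.sum fun i _ => (hY i).smul (hf i))]
  simp only [dirDeriv_map_sum, dirDeriv_map_add, dirDeriv_map_smul]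
  rw [dirDeriv_sum t fun i => (hf i).mul (hg.dirDeriv (hY i)), ← Finset.sum_sub_distrib]
  refine Finset.sum_congr rfl fun i _ => ?_
  rw [dirDeriv_mul (hf i) (hg.dirDeriv (hY i)), dirDeriv_mlieBracket hg hX (hY i)]
  ring

theorem mlieBracket_swap' (X Y : ∀ x : B, TangentSpace 𝓘(ℝ, E) x) (x : B) :
    VectorField.mlieBracket 𝓘(ℝ, E) X Y x = - VectorField.mlieBracket 𝓘(ℝ, E) Y X x := by
  rw [VectorField.mlieBracket_swap]; rfl

/-- A functional on vector fields that is linear over the smooth functions, with values at the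
point `x`, is given by a covector at `x`. -/
theorem exists_covector_of_tensorial (x : B) (Λ : (∀ x : B, TangentSpace 𝓘(ℝ, E) x) → ℝ)
    (hadd : ∀ Y Z, SmoothField 𝓘(ℝ, E) Y → SmoothField 𝓘(ℝ, E) Z →
      Λ (fun y => Y y + Z y) = Λ Y + Λ Z)
    (hsmul : ∀ f Y, SmoothFun 𝓘(ℝ, E) f → SmoothField 𝓘(ℝ, E) Y →
      Λ (fun y => f y • Y y) = f x * Λ Y) :
    ∃ β : CotangentFibre 𝓘(ℝ, E) x, ∀ Y, SmoothField 𝓘(ℝ, E) Y → Λ Y = β (Y x) := by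
  obtain ⟨n, g, F, hg, hF, hx⟩ := exists_coordinates (E := E) x
  refine ⟨∑ i, Λ (F i) • differential (g i) x, fun Y hY => ?_⟩
  obtain ⟨χ, -, hχ⟩ := (SmoothBumpFunction.nhds_basis_support (I := 𝓘(ℝ, E)) hx).mem_iff.1 hx
  have h0 : Λ (fun _ => 0) = 0 := by
    have := hsmul (fun _ => 0) _ (SmoothFun.const 0) hY
    simpa using this
  have hsum : ∀ (t : Finset (Fin n)) (f : Fin n → B → ℝ), (∀ i, SmoothFun 𝓘(ℝ, E) (f i)) →
      Λ (fun y => ∑ i ∈ t, f i y • F i y) = ∑ i ∈ t, f i x * Λ (F i) := by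
    intro t f hf
    induction t using Finset.induction_on with
    | empty => simpa using h0
    | insert a t ha ih =>
      simp only [Finset.sum_insert ha]
      rw [hadd _ _ ((hF a).smul (hf a)) (SmoothField.sum fun i _ => (hF i).smul (hf i)), ih,
        hsmul _ _ (hf a) (hF a)]
  -- cut off by a bump function, to pass from the local expansion to a global one
  have hχs : SmoothFun 𝓘(ℝ, E) χ := χ.contMDiff
  have h1 : (fun y => χ y • Y y) =
      fun y => ∑ i, (χ y * dirDeriv 𝓘(ℝ, E) (g i) y (Y y)) • F i y := by
    funext y
    by_cases hy : χ y = 0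
    · simp [hy]
    · have h2 := (hχ hy).2 (Y y)
      conv_lhs => rw [h2, Finset.smul_sum]
      simp only [smul_smul]
  have h3 := hsmul χ Y hχs hY
  rw [h1, hsum _ _ fun i => hχs.mul ((hg i).dirDeriv hY), χ.eq_one] at h3
  rw [one_mul] at h3
  rw [← h3]
  simp [LinearMap.sum_apply, mul_comm]

end FieldBrackets

section ExtDeriv

variable {E : Type*} [NormedAddCommGroup E] [NormedSpace ℝ E] [FiniteDimensional ℝ E]
  {B : Type*} [TopologicalSpace B] [ChartedSpace E B] [IsManifold 𝓘(ℝ, E) ∞ B] [T2Space B]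
  {E' : Type*} [NormedAddCommGroup E'] [NormedSpace ℝ E'] [FiniteDimensional ℝ E']
  {Q : Type*} [TopologicalSpace Q] [ChartedSpace E' Q] [IsManifold 𝓘(ℝ, E') ∞ Q] [T2Space Q]

/-- The value at `x` of the exterior derivative of the 2-form `φ` on the vector fields `X`, `Y`,
`Z`. -/
noncomputable def formDeriv (φ : ∀ x : B, TangentSpace 𝓘(ℝ, E) x →ₗ[ℝ] TangentSpace 𝓘(ℝ, E) x →ₗ[ℝ] ℝ)
    (X Y Z : ∀ x : B, TangentSpace 𝓘(ℝ, E) x) (x : B) : ℝ :=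
  dirDeriv 𝓘(ℝ, E) (fun y => φ y (Y y) (Z y)) x (X x)
    - dirDeriv 𝓘(ℝ, E) (fun y => φ y (X y) (Z y)) x (Y x)
    + dirDeriv 𝓘(ℝ, E) (fun y => φ y (X y) (Y y)) x (Z x)
    + φ x (Z x) (VectorField.mlieBracket 𝓘(ℝ, E) X Y x)
    - φ x (Y x) (VectorField.mlieBracket 𝓘(ℝ, E) X Z x)
    + φ x (X x) (VectorField.mlieBracket 𝓘(ℝ, E) Y Z x)

/-- The pullback of a 2-form. -/
noncomputable def pullbackForm (f : Q → B)
    (φ : ∀ x : B, TangentSpace 𝓘(ℝ, E) x →ₗ[ℝ] TangentSpace 𝓘(ℝ, E) x →ₗ[ℝ] ℝ) (q : Q) :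
    TangentSpace 𝓘(ℝ, E') q →ₗ[ℝ] TangentSpace 𝓘(ℝ, E') q →ₗ[ℝ] ℝ :=
  (φ (f q)).compl₁₂ (mfderiv 𝓘(ℝ, E') 𝓘(ℝ, E) f q : TangentSpace 𝓘(ℝ, E') q →ₗ[ℝ] _)
    (mfderiv 𝓘(ℝ, E') 𝓘(ℝ, E) f q : TangentSpace 𝓘(ℝ, E') q →ₗ[ℝ] _)

theorem pullbackForm_apply (f : Q → B)
    (φ : ∀ x : B, TangentSpace 𝓘(ℝ, E) x →ₗ[ℝ] TangentSpace 𝓘(ℝ, E) x →ₗ[ℝ] ℝ) (q : Q)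
    (v w : TangentSpace 𝓘(ℝ, E') q) : pullbackForm f φ q v w =
      φ (f q) (mfderiv 𝓘(ℝ, E') 𝓘(ℝ, E) f q v) (mfderiv 𝓘(ℝ, E') 𝓘(ℝ, E) f q w) := rfl

theorem IsTwoForm.swap {φ : ∀ x : B, TangentSpace 𝓘(ℝ, E) x →ₗ[ℝ] TangentSpace 𝓘(ℝ, E) x →ₗ[ℝ] ℝ}
    (hφ : IsTwoForm 𝓘(ℝ, E) φ) (x : B) (v w : TangentSpace 𝓘(ℝ, E) x) : φ x v w = - φ x w v := by
  have h := hφ.alt x (v + w)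
  simp only [map_add, LinearMap.add_apply, hφ.alt] at h
  linarith

theorem IsTwoForm.pullback {φ : ∀ x : B, TangentSpace 𝓘(ℝ, E) x →ₗ[ℝ] TangentSpace 𝓘(ℝ, E) x →ₗ[ℝ] ℝ}
    (hφ : IsTwoForm 𝓘(ℝ, E) φ) {f : Q → B} (hf : ContMDiff 𝓘(ℝ, E') 𝓘(ℝ, E) ∞ f) :
    IsTwoForm 𝓘(ℝ, E') (pullbackForm (E' := E') f φ) where
  alt _ _ := hφ.alt _ _
  smooth _ _ hX hY := hφ.apply_along hf (hX.smoothAlong_map hf) (hY.smoothAlong_map hf)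

theorem IsTwoForm.sub {φ ψ : ∀ x : B, TangentSpace 𝓘(ℝ, E) x →ₗ[ℝ] TangentSpace 𝓘(ℝ, E) x →ₗ[ℝ] ℝ}
    (hφ : IsTwoForm 𝓘(ℝ, E) φ) (hψ : IsTwoForm 𝓘(ℝ, E) ψ) :
    IsTwoForm 𝓘(ℝ, E) (fun x => φ x - ψ x) where
  alt x v := by simp [hφ.alt, hψ.alt]
  smooth X Y hX hY := (hφ.smooth X Y hX hY).sub (hψ.smooth X Y hX hY)

theorem formDeriv_sub {φ ψ : ∀ x : B, TangentSpace 𝓘(ℝ, E) x →ₗ[ℝ] TangentSpace 𝓘(ℝ, E) x →ₗ[ℝ] ℝ}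
    (hφ : IsTwoForm 𝓘(ℝ, E) φ) (hψ : IsTwoForm 𝓘(ℝ, E) ψ)
    {X Y Z : ∀ x : B, TangentSpace 𝓘(ℝ, E) x} (hX : SmoothField 𝓘(ℝ, E) X)
    (hY : SmoothField 𝓘(ℝ, E) Y) (hZ : SmoothField 𝓘(ℝ, E) Z) (x : B) :
    formDeriv (fun x => φ x - ψ x) X Y Z x = formDeriv φ X Y Z x - formDeriv ψ X Y Z x := by
  simp only [formDeriv, LinearMap.sub_apply]
  rw [dirDeriv_sub (hφ.smooth Y Z hY hZ) (hψ.smooth Y Z hY hZ),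
    dirDeriv_sub (hφ.smooth X Z hX hZ) (hψ.smooth X Z hX hZ),
    dirDeriv_sub (hφ.smooth X Y hX hY) (hψ.smooth X Y hX hY)]
  ring

/-- In local coordinates `g`, the exterior derivative of a pullback is the pullback of
`½ ∑ i j, d(h i j) ∧ d(g i) ∧ d(g j)`; the second derivatives of the coordinates cancel. -/
theorem formDeriv_pullback_coordinates
    {φ : ∀ x : B, TangentSpace 𝓘(ℝ, E) x →ₗ[ℝ] TangentSpace 𝓘(ℝ, E) x →ₗ[ℝ] ℝ}
    {f : Q → B} (hf : ContMDiff 𝓘(ℝ, E') 𝓘(ℝ, E) ∞ f)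
    {X Y Z : ∀ x : Q, TangentSpace 𝓘(ℝ, E') x} (hX : SmoothField 𝓘(ℝ, E') X)
    (hY : SmoothField 𝓘(ℝ, E') Y) (hZ : SmoothField 𝓘(ℝ, E') Z) (q : Q) {n : ℕ}
    {g : Fin n → B → ℝ} {h : Fin n → Fin n → B → ℝ} (hg : ∀ i, SmoothFun 𝓘(ℝ, E) (g i))
    (hh : ∀ i j, SmoothFun 𝓘(ℝ, E) (h i j)) (hanti : ∀ i j x, h i j x = - h j i x)
    (hx : ∀ᶠ x in 𝓝 (f q), ∀ v w, φ x v w = ∑ i, ∑ j,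
      h i j x * (dirDeriv 𝓘(ℝ, E) (g i) x v * dirDeriv 𝓘(ℝ, E) (g j) x w)) :
    formDeriv (pullbackForm f φ) X Y Z q = ∑ i, ∑ j,
      (dirDeriv 𝓘(ℝ, E) (h i j) (f q) (mfderiv 𝓘(ℝ, E') 𝓘(ℝ, E) f q (X q)) *
          (dirDeriv 𝓘(ℝ, E) (g i) (f q) (mfderiv 𝓘(ℝ, E') 𝓘(ℝ, E) f q (Y q)) *
            dirDeriv 𝓘(ℝ, E) (g j) (f q) (mfderiv 𝓘(ℝ, E') 𝓘(ℝ, E) f q (Z q))) -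
        dirDeriv 𝓘(ℝ, E) (h i j) (f q) (mfderiv 𝓘(ℝ, E') 𝓘(ℝ, E) f q (Y q)) *
          (dirDeriv 𝓘(ℝ, E) (g i) (f q) (mfderiv 𝓘(ℝ, E') 𝓘(ℝ, E) f q (X q)) *
            dirDeriv 𝓘(ℝ, E) (g j) (f q) (mfderiv 𝓘(ℝ, E') 𝓘(ℝ, E) f q (Z q))) +
        dirDeriv 𝓘(ℝ, E) (h i j) (f q) (mfderiv 𝓘(ℝ, E') 𝓘(ℝ, E) f q (Z q)) *
          (dirDeriv 𝓘(ℝ, E) (g i) (f q) (mfderiv 𝓘(ℝ, E') 𝓘(ℝ, E) f q (X q)) *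
            dirDeriv 𝓘(ℝ, E) (g j) (f q) (mfderiv 𝓘(ℝ, E') 𝓘(ℝ, E) f q (Y q)))) := by
  have hloc := hf.continuous.continuousAt.eventually hx
  simp only [← dirDeriv_comp (hg _) hf, ← dirDeriv_comp (hh _ _) hf]
  set G : Fin n → Q → ℝ := fun i q => g i (f q) with hGdef
  set K : Fin n → Fin n → Q → ℝ := fun i j q => h i j (f q) with hKdef
  have hG : ∀ i, SmoothFun 𝓘(ℝ, E') (G i) := fun i => (hg i).comp hf
  have hK : ∀ i j, SmoothFun 𝓘(ℝ, E') (K i j) := fun i j => (hh i j).comp hf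
  have hval : ∀ᶠ y in 𝓝 q, ∀ v w : TangentSpace 𝓘(ℝ, E') y, pullbackForm f φ y v w = ∑ i, ∑ j,
      K i j y * (dirDeriv 𝓘(ℝ, E') (G i) y v * dirDeriv 𝓘(ℝ, E') (G j) y w) := by
    filter_upwards [hloc] with y hy v w
    rw [pullbackForm_apply, hy]
    simp only [hGdef, hKdef, dirDeriv_comp (hg _) hf]
  have hder : ∀ {U V W : ∀ x : Q, TangentSpace 𝓘(ℝ, E') x}, SmoothField 𝓘(ℝ, E') U →
      SmoothField 𝓘(ℝ, E') V → SmoothField 𝓘(ℝ, E') W →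
      dirDeriv 𝓘(ℝ, E') (fun y => pullbackForm f φ y (U y) (V y)) q (W q) = ∑ i, ∑ j,
        (K i j q * (dirDeriv 𝓘(ℝ, E') (G i) q (U q) *
            dirDeriv 𝓘(ℝ, E') (fun y => dirDeriv 𝓘(ℝ, E') (G j) y (V y)) q (W q) +
          dirDeriv 𝓘(ℝ, E') (G j) q (V q) *
            dirDeriv 𝓘(ℝ, E') (fun y => dirDeriv 𝓘(ℝ, E') (G i) y (U y)) q (W q)) +
        dirDeriv 𝓘(ℝ, E') (G i) q (U q) * dirDeriv 𝓘(ℝ, E') (G j) q (V q) *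
          dirDeriv 𝓘(ℝ, E') (K i j) q (W q)) := by
    intro U V W hU hV hW
    have hloc' : (fun y => pullbackForm f φ y (U y) (V y)) =ᶠ[𝓝 q] fun y => ∑ i, ∑ j,
        K i j y * (dirDeriv 𝓘(ℝ, E') (G i) y (U y) * dirDeriv 𝓘(ℝ, E') (G j) y (V y)) := by
      filter_upwards [hval] with y hy using hy _ _
    rw [dirDeriv_congr hloc', dirDeriv_sum _ fun i => SmoothFun.sum fun j _ =>
      (hK i j).mul (((hG i).dirDeriv hU).mul ((hG j).dirDeriv hV))]
    refine Finset.sum_congr rfl fun i _ => ?_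
    rw [dirDeriv_sum _ fun j => (hK i j).mul (((hG i).dirDeriv hU).mul ((hG j).dirDeriv hV))]
    refine Finset.sum_congr rfl fun j _ => ?_
    rw [dirDeriv_mul (hK i j) (((hG i).dirDeriv hU).mul ((hG j).dirDeriv hV)),
      dirDeriv_mul ((hG i).dirDeriv hU) ((hG j).dirDeriv hV)]
  have hq := hval.self_of_nhds
  -- the terms with second derivatives, which cancel by antisymmetry of `K`
  have hswap : ∀ a b : Fin n → ℝ, ∑ i, ∑ j, K i j q * (a i * b j) =
      - ∑ i, ∑ j, K i j q * (b i * a j) := by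
    intro a b
    rw [Finset.sum_comm, ← Finset.sum_neg_distrib]
    refine Finset.sum_congr rfl fun i _ => ?_
    rw [← Finset.sum_neg_distrib]
    refine Finset.sum_congr rfl fun j _ => ?_
    have : K j i q = - K i j q := hanti _ _ _
    rw [this]; ring
  unfold formDeriv
  rw [hder hY hZ hX, hder hX hZ hY, hder hX hY hZ, hq, hq, hq]
  simp only [dirDeriv_mlieBracket (hG _) hX hY, dirDeriv_mlieBracket (hG _) hX hZ,
    dirDeriv_mlieBracket (hG _) hY hZ, mul_add, mul_sub, Finset.sum_add_distrib,
    Finset.sum_sub_distrib]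
  have e1 := hswap (fun i => dirDeriv 𝓘(ℝ, E') (G i) q (Z q)) (fun j =>
    dirDeriv 𝓘(ℝ, E') (fun y => dirDeriv 𝓘(ℝ, E') (G j) y (Y y)) q (X q))
  have e2 := hswap (fun i => dirDeriv 𝓘(ℝ, E') (G i) q (Z q)) (fun j =>
    dirDeriv 𝓘(ℝ, E') (fun y => dirDeriv 𝓘(ℝ, E') (G j) y (X y)) q (Y q))
  have e3 := hswap (fun i => dirDeriv 𝓘(ℝ, E') (G i) q (Y q)) (fun j =>
    dirDeriv 𝓘(ℝ, E') (fun y => dirDeriv 𝓘(ℝ, E') (G j) y (Z y)) q (X q))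
  have e4 := hswap (fun i => dirDeriv 𝓘(ℝ, E') (G i) q (Y q)) (fun j =>
    dirDeriv 𝓘(ℝ, E') (fun y => dirDeriv 𝓘(ℝ, E') (G j) y (X y)) q (Z q))
  have e5 := hswap (fun i => dirDeriv 𝓘(ℝ, E') (G i) q (X q)) (fun j =>
    dirDeriv 𝓘(ℝ, E') (fun y => dirDeriv 𝓘(ℝ, E') (G j) y (Z y)) q (Y q))
  have e6 := hswap (fun i => dirDeriv 𝓘(ℝ, E') (G i) q (X q)) (fun j =>
    dirDeriv 𝓘(ℝ, E') (fun y => dirDeriv 𝓘(ℝ, E') (G j) y (Y y)) q (Z q))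
  simp only [mul_comm] at e1 e2 e3 e4 e5 e6 ⊢
  linarith

/-- `f^* dφ = d f^* φ`. The fields only have to be related at the point `q`, because `dφ` is tensorial;
both sides are computed from one coordinate expression of `φ` near `f q`. -/
theorem formDeriv_pullback
    {φ : ∀ x : B, TangentSpace 𝓘(ℝ, E) x →ₗ[ℝ] TangentSpace 𝓘(ℝ, E) x →ₗ[ℝ] ℝ}
    (hφ : IsTwoForm 𝓘(ℝ, E) φ) {f : Q → B} (hf : ContMDiff 𝓘(ℝ, E') 𝓘(ℝ, E) ∞ f)
    {X Y Z : ∀ x : Q, TangentSpace 𝓘(ℝ, E') x} (hX : SmoothField 𝓘(ℝ, E') X)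
    (hY : SmoothField 𝓘(ℝ, E') Y) (hZ : SmoothField 𝓘(ℝ, E') Z)
    {X' Y' Z' : ∀ x : B, TangentSpace 𝓘(ℝ, E) x} (hX' : SmoothField 𝓘(ℝ, E) X')
    (hY' : SmoothField 𝓘(ℝ, E) Y') (hZ' : SmoothField 𝓘(ℝ, E) Z') {q : Q}
    (hXX' : mfderiv 𝓘(ℝ, E') 𝓘(ℝ, E) f q (X q) = X' (f q))
    (hYY' : mfderiv 𝓘(ℝ, E') 𝓘(ℝ, E) f q (Y q) = Y' (f q))
    (hZZ' : mfderiv 𝓘(ℝ, E') 𝓘(ℝ, E) f q (Z q) = Z' (f q)) :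
    formDeriv (pullbackForm f φ) X Y Z q = formDeriv φ X' Y' Z' (f q) := by
  obtain ⟨n, g, F, hg, hF, hx⟩ := exists_coordinates (E := E) (f q)
  have hx' : ∀ᶠ x in 𝓝 (f q), ∀ v w, φ x v w = ∑ i, ∑ j,
      φ x (F i x) (F j x) * (dirDeriv 𝓘(ℝ, E) (g i) x v * dirDeriv 𝓘(ℝ, E) (g j) x w) := by
    filter_upwards [hx] with x hx v w
    conv_lhs => rw [hx.2 v, hx.2 w]
    simp only [map_sum, LinearMap.sum_apply, map_smul, LinearMap.smul_apply, smul_eq_mul,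
      Finset.mul_sum]
    rw [Finset.sum_comm]
    refine Finset.sum_congr rfl fun i _ => Finset.sum_congr rfl fun j _ => ?_
    ring
  have hh : ∀ i j, SmoothFun 𝓘(ℝ, E) (fun x => φ x (F i x) (F j x)) := fun i j =>
    hφ.smooth _ _ (hF i) (hF j)
  have h1 := formDeriv_pullback_coordinates hf hX hY hZ q hg hh (fun i j x => hφ.swap x _ _) hx'
  have h2 := formDeriv_pullback_coordinates (E' := E) (Q := B) (f := id) (φ := φ) contMDiff_id
    hX' hY' hZ' (f q) hg hh (fun i j x => hφ.swap x _ _) hx'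
  have h3 : pullbackForm (E' := E) (id : B → B) φ = φ := by
    funext x
    ext v w
    rw [pullbackForm_apply, mfderiv_id]; rfl
  rw [h3] at h2
  rw [h1, h2]
  simp only [mfderiv_id, hXX', hYY', hZZ']
  rfl

end ExtDeriv

/-! ### Basic forms -/

section BasicForms

variable {E : Type*} [NormedAddCommGroup E] [NormedSpace ℝ E] [FiniteDimensional ℝ E]
  {B : Type*} [TopologicalSpace B] [ChartedSpace E B] [IsManifold 𝓘(ℝ, E) ∞ B] [T2Space B]
  {E' : Type*} [NormedAddCommGroup E'] [NormedSpace ℝ E'] [FiniteDimensional ℝ E']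
  {Q : Type*} [TopologicalSpace Q] [ChartedSpace E' Q] [IsManifold 𝓘(ℝ, E') ∞ Q] [T2Space Q]
  [SecondCountableTopology Q]
  {ι : Type*} {G : ι → ∀ x : Q, TangentSpace 𝓘(ℝ, E') x → Prop} {q : Q → B}

/-- Every tangent vector upstairs is the value of a smooth field that is a lift of a smooth field
downstairs. -/
theorem IsOrbitQuotient.exists_projectable (hq : IsOrbitQuotient 𝓘(ℝ, E') 𝓘(ℝ, E) G q) {x : Q}
    (w : TangentSpace 𝓘(ℝ, E') x) :
    ∃ (X : ∀ x : Q, TangentSpace 𝓘(ℝ, E') x) (Y : ∀ y : B, TangentSpace 𝓘(ℝ, E) y),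
      SmoothField 𝓘(ℝ, E') X ∧ SmoothField 𝓘(ℝ, E) Y ∧ X x = w ∧
      ∀ x, mfderiv 𝓘(ℝ, E') 𝓘(ℝ, E) q x (X x) = Y (q x) := by
  obtain ⟨Y, hY, hYw⟩ := exists_smoothField_eq (mfderiv 𝓘(ℝ, E') 𝓘(ℝ, E) q x w)
  obtain ⟨X, hX, hXw, hXY⟩ := exists_lift_field hq.smooth hq.submersion hY x w hYw.symm
  exact ⟨X, Y, hX, hY, hXw, hXY⟩

theorem IsOrbitQuotient.exists_lift (hq : IsOrbitQuotient 𝓘(ℝ, E') 𝓘(ℝ, E) G q)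
    {Y : ∀ y : B, TangentSpace 𝓘(ℝ, E) y} (hY : SmoothField 𝓘(ℝ, E) Y) :
    ∃ X : ∀ x : Q, TangentSpace 𝓘(ℝ, E') x, SmoothField 𝓘(ℝ, E') X ∧
      ∀ x, mfderiv 𝓘(ℝ, E') 𝓘(ℝ, E) q x (X x) = Y (q x) := by
  rcases isEmpty_or_nonempty Q with h | ⟨⟨x⟩⟩
  · exact ⟨fun x => (h.false x).elim, fun x => (h.false x).elim, fun x => (h.false x).elim⟩
  · obtain ⟨w, hw⟩ := hq.submersion x (Y (q x))
    obtain ⟨X, hX, -, hXY⟩ := exists_lift_field hq.smooth hq.submersion hY x w hw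
    exact ⟨X, hX, hXY⟩

/-- A 2-form that vanishes on vertical vectors and is invariant along them descends. Invariance is
tested on lifts of vector fields. -/
theorem IsOrbitQuotient.exists_twoForm_descent (hq : IsOrbitQuotient 𝓘(ℝ, E') 𝓘(ℝ, E) G q)
    {φ : ∀ x : Q, TangentSpace 𝓘(ℝ, E') x →ₗ[ℝ] TangentSpace 𝓘(ℝ, E') x →ₗ[ℝ] ℝ}
    (hφ : IsTwoForm 𝓘(ℝ, E') φ)
    (hv : ∀ x v w, mfderiv 𝓘(ℝ, E') 𝓘(ℝ, E) q x v = 0 → φ x v w = 0)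
    (hinv : ∀ (X Y : ∀ x : Q, TangentSpace 𝓘(ℝ, E') x) (X' Y' : ∀ y : B, TangentSpace 𝓘(ℝ, E) y),
      SmoothField 𝓘(ℝ, E') X → SmoothField 𝓘(ℝ, E') Y →
      SmoothField 𝓘(ℝ, E) X' → SmoothField 𝓘(ℝ, E) Y' →
      (∀ x, mfderiv 𝓘(ℝ, E') 𝓘(ℝ, E) q x (X x) = X' (q x)) →
      (∀ x, mfderiv 𝓘(ℝ, E') 𝓘(ℝ, E) q x (Y x) = Y' (q x)) →
      ∀ x v, mfderiv 𝓘(ℝ, E') 𝓘(ℝ, E) q x v = 0 →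
        dirDeriv 𝓘(ℝ, E') (fun y => φ y (X y) (Y y)) x v = 0) :
    ∃ φ' : ∀ y : B, TangentSpace 𝓘(ℝ, E) y →ₗ[ℝ] TangentSpace 𝓘(ℝ, E) y →ₗ[ℝ] ℝ,
      IsTwoForm 𝓘(ℝ, E) φ' ∧ ∀ x v w, φ' (q x) (mfderiv 𝓘(ℝ, E') 𝓘(ℝ, E) q x v)
        (mfderiv 𝓘(ℝ, E') 𝓘(ℝ, E) q x w) = φ x v w := by
  have hv' : ∀ x v w, mfderiv 𝓘(ℝ, E') 𝓘(ℝ, E) q x w = 0 → φ x v w = 0 := fun x v w h => by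
    rw [hφ.swap, hv x w v h, neg_zero]
  have hcongr : ∀ x v v' w w', mfderiv 𝓘(ℝ, E') 𝓘(ℝ, E) q x v = mfderiv 𝓘(ℝ, E') 𝓘(ℝ, E) q x v' →
      mfderiv 𝓘(ℝ, E') 𝓘(ℝ, E) q x w = mfderiv 𝓘(ℝ, E') 𝓘(ℝ, E) q x w' → φ x v w = φ x v' w' := by
    intro x v v' w w' h1 h2
    have h3 := hv x (v - v') w (by rw [map_sub, h1, sub_self])
    have h4 := hv' x v' (w - w') (by rw [map_sub, h2, sub_self])
    rw [map_sub, LinearMap.sub_apply] at h3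
    rw [map_sub] at h4
    linarith
  have hr : ∀ x, ∃ r : TangentSpace 𝓘(ℝ, E) (q x) →ₗ[ℝ] TangentSpace 𝓘(ℝ, E') x,
      ∀ u, mfderiv 𝓘(ℝ, E') 𝓘(ℝ, E) q x (r u) = u := fun x => by
    obtain ⟨r, hr⟩ := LinearMap.exists_rightInverse_of_surjective
      (mfderiv 𝓘(ℝ, E') 𝓘(ℝ, E) q x : TangentSpace 𝓘(ℝ, E') x →ₗ[ℝ] TangentSpace 𝓘(ℝ, E) (q x))
      (LinearMap.range_eq_top.2 (hq.submersion x))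
    exact ⟨r, fun u => LinearMap.congr_fun hr u⟩
  choose r hr using hr
  have hpt : ∀ y : B, ∃ ψ : TangentSpace 𝓘(ℝ, E) y →ₗ[ℝ] TangentSpace 𝓘(ℝ, E) y →ₗ[ℝ] ℝ,
      ∃ x, ∃ h : q x = y, ψ = h ▸ (φ x).compl₁₂ (r x) (r x) := fun y => by
    obtain ⟨x, hx⟩ := hq.surjective y
    exact ⟨_, x, hx, rfl⟩
  choose φ' hφ' using hpt
  have key : ∀ x v w, φ' (q x) (mfderiv 𝓘(ℝ, E') 𝓘(ℝ, E) q x v)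
        (mfderiv 𝓘(ℝ, E') 𝓘(ℝ, E) q x w) = φ x v w := by
    intro x v w
    obtain ⟨X, X', hX, hX', rfl, hXX'⟩ := hq.exists_projectable v
    obtain ⟨Y, Y', hY, hY', rfl, hYY'⟩ := hq.exists_projectable w
    obtain ⟨x₁, hx, h1⟩ := hφ' (q x)
    rw [hXX', hYY', hq.eq_of_vertical (hφ.smooth X Y hX hY)
      (hinv X Y X' Y' hX hY hX' hY' hXX' hYY') hx.symm, h1]
    have h2 : φ x₁ (X x₁) (Y x₁) = (φ x₁).compl₁₂ (r x₁) (r x₁) (X' (q x₁)) (Y' (q x₁)) :=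
      hcongr _ _ _ _ _ ((hXX' x₁).trans (hr _ _).symm) ((hYY' x₁).trans (hr _ _).symm)
    rw [h2]
    generalize hψ : (φ x₁).compl₁₂ (r x₁) (r x₁) = ψ
    clear hψ h1 h2
    generalize q x = y at hx
    subst hx
    rfl
  refine ⟨φ', ⟨fun y v => ?_, fun X' Y' hX' hY' => ?_⟩, key⟩
  · obtain ⟨x, rfl⟩ := hq.surjective y
    obtain ⟨u, rfl⟩ := hq.submersion x v
    rw [key, hφ.alt]
  · obtain ⟨X, hX, hXX'⟩ := hq.exists_lift hX'
    obtain ⟨Y, hY, hYY'⟩ := hq.exists_lift hY'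
    refine contMDiff_of_comp_submersion hq.smooth hq.surjective hq.submersion ?_
    simp only [← hXX', ← hYY', key]
    exact hφ.smooth X Y hX hY

/-- A 1-form that vanishes on vertical vectors and is invariant along the fibres is basic. -/
theorem IsOrbitQuotient.exists_oneForm_descent (hq : IsOrbitQuotient 𝓘(ℝ, E') 𝓘(ℝ, E) G q)
    {α : ∀ x : Q, CotangentFibre 𝓘(ℝ, E') x} (hα : SmoothOneForm 𝓘(ℝ, E') α)
    (hv : ∀ x w, mfderiv 𝓘(ℝ, E') 𝓘(ℝ, E) q x w = 0 → α x w = 0)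
    (hinv : ∀ (X : ∀ x : Q, TangentSpace 𝓘(ℝ, E') x) (X' : ∀ y : B, TangentSpace 𝓘(ℝ, E) y),
      SmoothField 𝓘(ℝ, E') X → SmoothField 𝓘(ℝ, E) X' →
      (∀ x, mfderiv 𝓘(ℝ, E') 𝓘(ℝ, E) q x (X x) = X' (q x)) →
      ∀ x v, mfderiv 𝓘(ℝ, E') 𝓘(ℝ, E) q x v = 0 →
        dirDeriv 𝓘(ℝ, E') (fun y => α y (X y)) x v = 0) :
    ∃ α' : ∀ y : B, CotangentFibre 𝓘(ℝ, E) y, SmoothOneForm 𝓘(ℝ, E) α' ∧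
      ∀ x w, α' (q x) (mfderiv 𝓘(ℝ, E') 𝓘(ℝ, E) q x w) = α x w := by
  have hcongr : ∀ x v v', mfderiv 𝓘(ℝ, E') 𝓘(ℝ, E) q x v = mfderiv 𝓘(ℝ, E') 𝓘(ℝ, E) q x v' →
      α x v = α x v' := by
    intro x v v' h1
    have h3 := hv x (v - v') (by rw [map_sub, h1, sub_self])
    rw [map_sub] at h3
    linarith
  have hpt : ∀ y : B, ∃ ψ : CotangentFibre 𝓘(ℝ, E) y, ∃ x, ∃ h : q x = y,
      ∃ ψ' : CotangentFibre 𝓘(ℝ, E) (q x), ψ = h ▸ ψ' ∧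
        ∀ w, ψ' (mfderiv 𝓘(ℝ, E') 𝓘(ℝ, E) q x w) = α x w := fun y => by
    obtain ⟨x, hx⟩ := hq.surjective y
    obtain ⟨r, hr⟩ := LinearMap.exists_rightInverse_of_surjective
      (mfderiv 𝓘(ℝ, E') 𝓘(ℝ, E) q x : TangentSpace 𝓘(ℝ, E') x →ₗ[ℝ] TangentSpace 𝓘(ℝ, E) (q x))
      (LinearMap.range_eq_top.2 (hq.submersion x))
    exact ⟨_, x, hx, α x ∘ₗ r, rfl, fun w => hcongr _ _ _ (LinearMap.congr_fun hr _)⟩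
  choose α' hα' using hpt
  have key : ∀ x w, α' (q x) (mfderiv 𝓘(ℝ, E') 𝓘(ℝ, E) q x w) = α x w := by
    intro x w
    obtain ⟨X, X', hX, hX', rfl, hXX'⟩ := hq.exists_projectable w
    obtain ⟨x₁, hx, ψ', h1, h2⟩ := hα' (q x)
    rw [hXX', hq.eq_of_vertical (hα X hX) (hinv X X' hX hX' hXX') hx.symm, h1, ← h2, hXX']
    clear h1 h2
    generalize q x = y at hx
    subst hx
    rfl
  refine ⟨α', fun X' hX' => ?_, key⟩
  obtain ⟨X, hX, hXX'⟩ := hq.exists_lift hX'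
  refine contMDiff_of_comp_submersion hq.smooth hq.surjective hq.submersion ?_
  simp only [← hXX', key]
  exact hα X hX

end BasicForms

/-! ### Vector-valued functions -/

section VectorValued

variable {E : Type*} [NormedAddCommGroup E] [NormedSpace ℝ E]
  {B : Type*} [TopologicalSpace B] [ChartedSpace E B]
  {E' : Type*} [NormedAddCommGroup E'] [NormedSpace ℝ E']
  {Q : Type*} [TopologicalSpace Q] [ChartedSpace E' Q]
  {V : Type*} [AddCommGroup V] [Module ℝ V]
  {W : Type*} [AddCommGroup W] [Module ℝ W]

variable (E) in
/-- The function `f` with values in a finite-dimensional vector space is smooth, as tested by the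
linear functionals. -/
def SmoothVec (f : B → V) : Prop := ∀ l : Module.Dual ℝ V, SmoothFun 𝓘(ℝ, E) (fun x => l (f x))

theorem SmoothVec.const (u : V) : SmoothVec E (fun _ : B => u) := fun _ => SmoothFun.const _

theorem SmoothVec.add {f g : B → V} (hf : SmoothVec E f) (hg : SmoothVec E g) :
    SmoothVec E (fun x => f x + g x) := fun l => by
  simpa only [map_add] using (hf l).add (hg l)

theorem SmoothVec.sub {f g : B → V} (hf : SmoothVec E f) (hg : SmoothVec E g) :
    SmoothVec E (fun x => f x - g x) := fun l => by
  simpa only [map_sub] using (hf l).sub (hg l)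

theorem SmoothVec.smul {c : B → ℝ} (hc : SmoothFun 𝓘(ℝ, E) c) {f : B → V} (hf : SmoothVec E f) :
    SmoothVec E (fun x => c x • f x) := fun l => by
  simpa only [map_smul, smul_eq_mul] using hc.mul (hf l)

theorem SmoothVec.sum {ι : Type*} {t : Finset ι} {f : ι → B → V}
    (hf : ∀ i ∈ t, SmoothVec E (f i)) : SmoothVec E (fun x => ∑ i ∈ t, f i x) := fun l => by
  simpa only [map_sum] using SmoothFun.sum fun i hi => hf i hi l

theorem SmoothVec.map {f : B → V} (hf : SmoothVec E f) (A : V →ₗ[ℝ] W) :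
    SmoothVec E (fun x => A (f x)) := fun l => hf (l ∘ₗ A)

theorem SmoothVec.comp {f : B → V} (hf : SmoothVec E f) {g : Q → B}
    (hg : ContMDiff 𝓘(ℝ, E') 𝓘(ℝ, E) ∞ g) : SmoothVec E' (fun x => f (g x)) :=
  fun l => (hf l).comp hg

variable [FiniteDimensional ℝ V] [FiniteDimensional ℝ W]

/-- The derivative of a vector-valued function along a tangent vector, computed by components. -/
noncomputable def vecDeriv (f : B → V) (x : B) (v : TangentSpace 𝓘(ℝ, E) x) : V :=
  ∑ i, dirDeriv 𝓘(ℝ, E) (fun y => (Module.finBasis ℝ V).coord i (f y)) x v • Module.finBasis ℝ V i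

theorem dual_eq_sum_coord (l : Module.Dual ℝ V) (u : V) :
    l u = ∑ i, l (Module.finBasis ℝ V i) * (Module.finBasis ℝ V).coord i u := by
  have h := congrArg l ((Module.finBasis ℝ V).sum_repr u).symm
  rw [map_sum] at h
  refine h.trans (Finset.sum_congr rfl fun i _ => ?_)
  rw [map_smul, smul_eq_mul, mul_comm]
  rfl

theorem dual_ext {u v : V} (h : ∀ l : Module.Dual ℝ V, l u = l v) : u = v :=
  (Module.forall_dual_apply_eq_zero_iff ℝ (u - v)).1 (fun l => by rw [map_sub, h l, sub_self]) |>
    sub_eq_zero.1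

/-- The product rule for the evaluation of a smooth family of functionals. -/
theorem dirDeriv_dual_apply {A : B → Module.Dual ℝ V} (hA : ∀ u, SmoothFun 𝓘(ℝ, E) (fun x => A x u))
    {f : B → V} (hf : SmoothVec E f) (x : B) (v : TangentSpace 𝓘(ℝ, E) x) :
    dirDeriv 𝓘(ℝ, E) (fun y => A y (f y)) x v =
      dirDeriv 𝓘(ℝ, E) (fun y => A y (f x)) x v + A x (vecDeriv f x v) := by
  have h : ∀ (y : B) (u : V), A y u =
      ∑ i, A y (Module.finBasis ℝ V i) * (Module.finBasis ℝ V).coord i u :=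
    fun y u => dual_eq_sum_coord (A y) u
  simp_rw [fun y => h y (f y), fun y => h y (f x)]
  rw [dirDeriv_sum _ fun i => (hA _).mul (hf _),
    dirDeriv_sum _ fun i => (hA _).mul (SmoothFun.const _), vecDeriv, map_sum,
    ← Finset.sum_add_distrib]
  refine Finset.sum_congr rfl fun i _ => ?_
  rw [dirDeriv_mul (hA _) (hf _), dirDeriv_mul (hA _) (SmoothFun.const _), dirDeriv_const,
    map_smul, smul_eq_mul]
  ring

theorem SmoothVec.dual_apply {A : B → Module.Dual ℝ V}
    (hA : ∀ u, SmoothFun 𝓘(ℝ, E) (fun x => A x u)) {f : B → V} (hf : SmoothVec E f) :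
    SmoothFun 𝓘(ℝ, E) (fun x => A x (f x)) := by
  simp_rw [dual_eq_sum_coord (A _) (f _)]
  exact SmoothFun.sum fun i _ => (hA _).mul (hf _)

theorem apply_vecDeriv {f : B → V} (hf : SmoothVec E f) (l : Module.Dual ℝ V) (x : B)
    (v : TangentSpace 𝓘(ℝ, E) x) :
    l (vecDeriv f x v) = dirDeriv 𝓘(ℝ, E) (fun y => l (f y)) x v := by
  rw [dirDeriv_dual_apply (A := fun _ => l) (fun u => SmoothFun.const _) hf, dirDeriv_const,
    zero_add]

theorem vecDeriv_map_add (f : B → V) (x : B) (v w : TangentSpace 𝓘(ℝ, E) x) :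
    vecDeriv f x (v + w) = vecDeriv f x v + vecDeriv f x w := by
  simp only [vecDeriv, dirDeriv_map_add, add_smul, Finset.sum_add_distrib]

theorem vecDeriv_map_smul (f : B → V) (x : B) (c : ℝ) (v : TangentSpace 𝓘(ℝ, E) x) :
    vecDeriv f x (c • v) = c • vecDeriv f x v := by
  simp only [vecDeriv, dirDeriv_map_smul, mul_smul, Finset.smul_sum]

theorem vecDeriv_map_zero (f : B → V) (x : B) :
    vecDeriv f x (0 : TangentSpace 𝓘(ℝ, E) x) = 0 := by
  simp [vecDeriv, dirDeriv_map_zero]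

theorem vecDeriv_const (u : V) (x : B) (v : TangentSpace 𝓘(ℝ, E) x) :
    vecDeriv (fun _ : B => u) x v = 0 := by
  simp [vecDeriv, dirDeriv_const]

theorem vecDeriv_add {f g : B → V} (hf : SmoothVec E f) (hg : SmoothVec E g) (x : B)
    (v : TangentSpace 𝓘(ℝ, E) x) :
    vecDeriv (fun y => f y + g y) x v = vecDeriv f x v + vecDeriv g x v := by
  refine dual_ext fun l => ?_
  rw [map_add, apply_vecDeriv (hf.add hg), apply_vecDeriv hf, apply_vecDeriv hg]
  simp only [map_add]
  exact dirDeriv_add (hf l) (hg l) x v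

theorem vecDeriv_smul {c : B → ℝ} (hc : SmoothFun 𝓘(ℝ, E) c) {f : B → V} (hf : SmoothVec E f)
    (x : B) (v : TangentSpace 𝓘(ℝ, E) x) :
    vecDeriv (fun y => c y • f y) x v = dirDeriv 𝓘(ℝ, E) c x v • f x + c x • vecDeriv f x v := by
  refine dual_ext fun l => ?_
  rw [map_add, apply_vecDeriv (hf.smul hc), map_smul, map_smul, apply_vecDeriv hf]
  simp only [map_smul, smul_eq_mul]
  rw [dirDeriv_mul hc (hf l)]
  ring

theorem vecDeriv_sum {ι : Type*} (t : Finset ι) {f : ι → B → V} (hf : ∀ i, SmoothVec E (f i))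
    (x : B) (v : TangentSpace 𝓘(ℝ, E) x) :
    vecDeriv (fun y => ∑ i ∈ t, f i y) x v = ∑ i ∈ t, vecDeriv (f i) x v := by
  refine dual_ext fun l => ?_
  rw [map_sum, apply_vecDeriv (SmoothVec.sum fun i _ => hf i)]
  simp only [map_sum, apply_vecDeriv (hf _)]
  exact dirDeriv_sum t (fun i => hf i l) x v

theorem vecDeriv_comp {f : B → V} (hf : SmoothVec E f) {g : Q → B}
    (hg : ContMDiff 𝓘(ℝ, E') 𝓘(ℝ, E) ∞ g) (x : Q) (v : TangentSpace 𝓘(ℝ, E') x) :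
    vecDeriv (fun y => f (g y)) x v = vecDeriv f (g x) (mfderiv 𝓘(ℝ, E') 𝓘(ℝ, E) g x v) := by
  simp only [vecDeriv, dirDeriv_comp (hf _) hg]

/-- The product rule for a smooth family of linear maps. -/
theorem vecDeriv_apply {A : B → V →ₗ[ℝ] W} (hA : ∀ u, SmoothVec E (fun x => A x u))
    {f : B → V} (hf : SmoothVec E f) (x : B) (v : TangentSpace 𝓘(ℝ, E) x) :
    vecDeriv (fun y => A y (f y)) x v =
      vecDeriv (fun y => A y (f x)) x v + A x (vecDeriv f x v) := by
  have h1 : ∀ l : Module.Dual ℝ W, ∀ u, SmoothFun 𝓘(ℝ, E) (fun x => (l ∘ₗ A x) u) :=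
    fun l u => hA u l
  have h2 : SmoothVec E (fun y => A y (f y)) := fun l => SmoothVec.dual_apply (h1 l) hf
  refine dual_ext fun l => ?_
  rw [map_add, apply_vecDeriv h2, apply_vecDeriv (hA _)]
  exact dirDeriv_dual_apply (h1 l) hf x v

theorem SmoothVec.linear_apply {A : B → V →ₗ[ℝ] W} (hA : ∀ u, SmoothVec E (fun x => A x u))
    {f : B → V} (hf : SmoothVec E f) : SmoothVec E (fun x => A x (f x)) :=
  fun l => SmoothVec.dual_apply (A := fun x => l ∘ₗ A x) (fun u => hA u l) hf

theorem SmoothVec.vecDeriv [IsManifold 𝓘(ℝ, E) ∞ B] {f : B → V} (hf : SmoothVec E f)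
    {X : ∀ x : B, TangentSpace 𝓘(ℝ, E) x} (hX : SmoothField 𝓘(ℝ, E) X) :
    SmoothVec E (fun x => _root_.vecDeriv f x (X x)) := fun l => by
  simp only [apply_vecDeriv hf]
  exact (hf l).dirDeriv hX

theorem SmoothVec.form {F : LinearMap.BilinForm ℝ V} {f g : B → V} (hf : SmoothVec E f)
    (hg : SmoothVec E g) : SmoothFun 𝓘(ℝ, E) (fun x => F (f x) (g x)) :=
  SmoothVec.dual_apply (A := fun x => F (f x)) (fun u => hf (F.flip u)) hg

theorem dirDeriv_form (F : LinearMap.BilinForm ℝ V) {f g : B → V} (hf : SmoothVec E f)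
    (hg : SmoothVec E g) (x : B) (v : TangentSpace 𝓘(ℝ, E) x) :
    dirDeriv 𝓘(ℝ, E) (fun y => F (f y) (g y)) x v =
      F (vecDeriv f x v) (g x) + F (f x) (vecDeriv g x v) := by
  rw [dirDeriv_dual_apply (A := fun x => F (f x)) (fun u => hf (F.flip u)) hg]
  congr 1
  exact (apply_vecDeriv hf (F.flip (g x)) x v).symm

end VectorValued

/-! ### Lifts of vector fields to an action Courant algebroid -/

section Lifts

variable {𝔡 : Type*} [LieRing 𝔡] [LieAlgebra ℝ 𝔡] [FiniteDimensional ℝ 𝔡]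
  (D : InvariantMetric 𝔡)
  {E : Type*} [NormedAddCommGroup E] [NormedSpace ℝ E] [FiniteDimensional ℝ E]
  {N : Type*} [TopologicalSpace N] [ChartedSpace E N] [IsManifold 𝓘(ℝ, E) ∞ N] [T2Space N]
  (ρ : LieAction 𝓘(ℝ, E) 𝔡 N)
  {E' : Type*} [NormedAddCommGroup E'] [NormedSpace ℝ E'] [FiniteDimensional ℝ E']
  {Q : Type*} [TopologicalSpace Q] [ChartedSpace E' Q] [IsManifold 𝓘(ℝ, E') ∞ Q] [T2Space Q]

/-- The anchor `𝔡 → T_x N` of the action Courant algebroid. -/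
noncomputable def LieAction.evalAt (x : N) : 𝔡 →ₗ[ℝ] TangentSpace 𝓘(ℝ, E) x :=
  (LinearMap.proj x).comp ρ.field

@[simp] theorem LieAction.evalAt_apply (x : N) (u : 𝔡) : ρ.evalAt x u = ρ.field u x := rfl

theorem LieAction.field_add (x : N) (u v : 𝔡) :
    ρ.field (u + v) x = ρ.field u x + ρ.field v x := map_add (ρ.evalAt x) u v

theorem LieAction.field_sub (x : N) (u v : 𝔡) :
    ρ.field (u - v) x = ρ.field u x - ρ.field v x := map_sub (ρ.evalAt x) u v

theorem LieAction.field_smul (x : N) (c : ℝ) (u : 𝔡) :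
    ρ.field (c • u) x = c • ρ.field u x := map_smul (ρ.evalAt x) c u

theorem LieAction.field_zero (x : N) : ρ.field (0 : 𝔡) x = 0 := map_zero (ρ.evalAt x)

/-- The triple product `⟨⟦f, g⟧, h⟩` for the pullback of the action Courant algebroid along a map
`ν : Q → N`: the `𝔡`-valued functions `f`, `g` on `Q` are lifts of the tangent vectors `x`, `y` at `q`
in the sense that `ρ(f) = ν_* x` and `ρ(g) = ν_* y`, and `h` is a lift of `z`. -/
noncomputable def triple (f g : Q → 𝔡) (q : Q) (x y : TangentSpace 𝓘(ℝ, E') q) (h : 𝔡)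
    (z : TangentSpace 𝓘(ℝ, E') q) : ℝ :=
  D.form ⁅f q, g q⁆ h + D.form (vecDeriv g q x) h - D.form (vecDeriv f q y) h +
    D.form (vecDeriv f q z) (g q)

variable {D} in
theorem triple_add (f g : Q → 𝔡) (q : Q) (x y : TangentSpace 𝓘(ℝ, E') q) (h h' : 𝔡)
    (z z' : TangentSpace 𝓘(ℝ, E') q) :
    triple D f g q x y (h + h') (z + z') = triple D f g q x y h z + triple D f g q x y h' z' := by
  simp only [triple, map_add, vecDeriv_map_add, LinearMap.add_apply]
  ring

theorem form_lie_swap (u v w : 𝔡) : D.form ⁅u, v⁆ w = - D.form ⁅v, u⁆ w := by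
  rw [← lie_skew, map_neg, LinearMap.neg_apply]

theorem form_lie_swap_right (u v w : 𝔡) : D.form ⁅u, v⁆ w = - D.form ⁅u, w⁆ v := by
  rw [form_lie_swap D u w v, D.inv w u v, D.symm w]
  ring

theorem triple_swap₁₂ {f g : Q → 𝔡} (hf : SmoothVec E' f) (hg : SmoothVec E' g) (q : Q)
    (x y z : TangentSpace 𝓘(ℝ, E') q) (h : 𝔡) :
    triple D f g q x y h z + triple D g f q y x h z =
      dirDeriv 𝓘(ℝ, E') (fun p => D.form (f p) (g p)) q z := by
  rw [dirDeriv_form D.form hf hg, triple, triple, form_lie_swap D (f q), D.symm (f q)]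
  ring

theorem triple_swap₂₃ {f g h : Q → 𝔡} (hg : SmoothVec E' g) (hh : SmoothVec E' h) (q : Q)
    (x y z : TangentSpace 𝓘(ℝ, E') q) :
    triple D f g q x y (h q) z + triple D f h q x z (g q) y =
      dirDeriv 𝓘(ℝ, E') (fun p => D.form (g p) (h p)) q x := by
  rw [dirDeriv_form D.form hg hh, triple, triple, form_lie_swap_right D (f q) (g q), D.symm (g q)]
  ring

/-- The function `f` on `Q` is a lift of the vector field `X` along `ν`. -/
def IsLift (ν : Q → N) (f : Q → 𝔡) (X : ∀ q : Q, TangentSpace 𝓘(ℝ, E') q) : Prop :=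
  ∀ q, mfderiv 𝓘(ℝ, E') 𝓘(ℝ, E) ν q (X q) = ρ.field (f q) (ν q)

variable {ρ}

/-- The bracket of lifts is a lift of the bracket. -/
theorem anchor_bracket_of_lift {ν : Q → N} (hν : ContMDiff 𝓘(ℝ, E') 𝓘(ℝ, E) ∞ ν) {f g : Q → 𝔡}
    (hf : SmoothVec E' f) (hg : SmoothVec E' g) {X Y : ∀ q : Q, TangentSpace 𝓘(ℝ, E') q}
    (hX : SmoothField 𝓘(ℝ, E') X) (hY : SmoothField 𝓘(ℝ, E') Y) (hfX : IsLift ρ ν f X)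
    (hgY : IsLift ρ ν g Y) (q : Q) :
    ρ.field (⁅f q, g q⁆ + vecDeriv g q (X q) - vecDeriv f q (Y q)) (ν q) =
      mfderiv 𝓘(ℝ, E') 𝓘(ℝ, E) ν q (VectorField.mlieBracket 𝓘(ℝ, E') X Y q) := by
  refine eq_of_dirDeriv_eq fun k hk => ?_
  have hA : ∀ u, SmoothFun 𝓘(ℝ, E')
      (fun y => (differential k (ν y) ∘ₗ ρ.evalAt (ν y) : Module.Dual ℝ 𝔡) u) :=
    fun u => (hk.dirDeriv (ρ.smooth u)).comp hν
  have hder : ∀ {f g : Q → 𝔡} {X Y : ∀ q : Q, TangentSpace 𝓘(ℝ, E') q}, SmoothVec E' f →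
      SmoothVec E' g → IsLift ρ ν f X → IsLift ρ ν g Y →
      dirDeriv 𝓘(ℝ, E') (fun y => dirDeriv 𝓘(ℝ, E') (fun p => k (ν p)) y (Y y)) q (X q) =
        dirDeriv 𝓘(ℝ, E) (fun n => dirDeriv 𝓘(ℝ, E) k n (ρ.field (g q) n)) (ν q)
          (ρ.field (f q) (ν q)) +
        dirDeriv 𝓘(ℝ, E) k (ν q) (ρ.field (vecDeriv g q (X q)) (ν q)) := by
    intro f g X Y hf hg hfX hgY
    have h1 : ∀ y, dirDeriv 𝓘(ℝ, E') (fun p => k (ν p)) y (Y y) =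
        (differential k (ν y) ∘ₗ ρ.evalAt (ν y) : Module.Dual ℝ 𝔡) (g y) := fun y => by
      rw [dirDeriv_comp hk hν, hgY]; rfl
    simp only [h1]
    rw [dirDeriv_dual_apply hA hg, ← hfX, ← dirDeriv_comp (hk.dirDeriv (ρ.smooth (g q))) hν]
    rfl
  rw [← dirDeriv_comp hk hν, dirDeriv_mlieBracket (hk.comp hν) hX hY, hder hf hg hfX hgY,
    hder hg hf hgY hfX, ρ.field_sub, ρ.field_add, dirDeriv_map_sub, dirDeriv_map_add, ρ.map_lie,
    dirDeriv_mlieBracket hk (ρ.smooth _) (ρ.smooth _)]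
  ring

section Splitting

variable {D} {s : ∀ x : N, TangentSpace 𝓘(ℝ, E) x →ₗ[ℝ] 𝔡}

theorem CourantData.IsIsotropicSplitting.field_apply
    (hs : (actionCourant D ρ).IsIsotropicSplitting s) (x : N) (v : TangentSpace 𝓘(ℝ, E) x) :
    ρ.field (s x v) x = v := hs.splits x v

theorem CourantData.IsIsotropicSplitting.form_apply
    (hs : (actionCourant D ρ).IsIsotropicSplitting s) (x : N) (v w : TangentSpace 𝓘(ℝ, E) x) :
    D.form (s x v) (s x w) = 0 := hs.isotropic x v w

/-- An element of the kernel of the anchor is `a^* α`, where `α` is its pairing with the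
splitting. -/
theorem form_of_field_eq_zero (hexact : (actionCourant D ρ).IsExact)
    (hs : (actionCourant D ρ).IsIsotropicSplitting s) {x : N} {κ : 𝔡} (hκ : ρ.field κ x = 0)
    (u : 𝔡) : D.form κ u = D.form κ (s x (ρ.field u x)) := by
  have h1 : ρ.field (u - s x (ρ.field u x)) x = 0 := by
    rw [ρ.field_sub, hs.field_apply, sub_self]
  obtain ⟨β, hβ⟩ := hexact.ker_le_range x _ h1
  have h2 : D.form (u - s x (ρ.field u x)) κ = β (ρ.field κ x) := hβ κ
  rw [hκ, map_zero, D.symm, map_sub] at h2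
  linarith

/-- `K + K^* = 1` for the projection `K = s ∘ a`. -/
theorem form_split_add (hexact : (actionCourant D ρ).IsExact)
    (hs : (actionCourant D ρ).IsIsotropicSplitting s) (x : N) (u v : 𝔡) :
    D.form (s x (ρ.field u x)) v + D.form u (s x (ρ.field v x)) = D.form u v := by
  have h1 : ρ.field (u - s x (ρ.field u x)) x = 0 := by
    rw [ρ.field_sub, hs.field_apply, sub_self]
  have h2 := form_of_field_eq_zero hexact hs h1 v
  rw [map_sub, LinearMap.sub_apply, LinearMap.sub_apply, hs.form_apply] at h2
  linarith

variable (D ρ s) in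
/-- The projection `K = s ∘ a` of `𝔡` at `x`. -/
noncomputable def splitProj (x : N) : 𝔡 →ₗ[ℝ] 𝔡 := s x ∘ₗ ρ.evalAt x

theorem splitProj_apply (x : N) (u : 𝔡) : splitProj ρ s x u = s x (ρ.field u x) := rfl

theorem smoothVec_splitProj (hs : (actionCourant D ρ).IsIsotropicSplitting s) (u : 𝔡) :
    SmoothVec E (fun x => splitProj ρ s x u) := hs.smooth _ (ρ.smooth u)

theorem CourantData.IsIsotropicSplitting.smoothOneForm
    (hs : (actionCourant D ρ).IsIsotropicSplitting s) (l : Module.Dual ℝ 𝔡) :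
    SmoothOneForm 𝓘(ℝ, E) (fun x => l ∘ₗ s x) := fun X hX => hs.smooth X hX l

theorem CourantData.IsIsotropicSplitting.smoothVec_along
    (hs : (actionCourant D ρ).IsIsotropicSplitting s) {ν : Q → N}
    (hν : ContMDiff 𝓘(ℝ, E') 𝓘(ℝ, E) ∞ ν) {V : ∀ q, TangentSpace 𝓘(ℝ, E) (ν q)}
    (hV : SmoothAlong E E' ν V) : SmoothVec E' (fun q => s (ν q) (V q)) :=
  fun l => (hs.smoothOneForm l).apply_along hν hV

variable (D ρ s) in
/-- The value of the curvature of the splitting `s` on tangent vectors. -/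
noncomputable def curvTensor (x : N) (u v w : TangentSpace 𝓘(ℝ, E) x) : ℝ :=
  D.form ⁅s x u, s x v⁆ (s x w)
    + D.form (vecDeriv (fun y => splitProj ρ s y (s x v)) x u) (s x w)
    - D.form (vecDeriv (fun y => splitProj ρ s y (s x u)) x v) (s x w)
    + D.form (vecDeriv (fun y => splitProj ρ s y (s x u)) x w) (s x v)

/-- The pairing of a derivative of `s` with `s` is tensorial, because `s` is isotropic. -/
theorem form_vecDeriv_split (hs : (actionCourant D ρ).IsIsotropicSplitting s) {ν : Q → N}
    (hν : ContMDiff 𝓘(ℝ, E') 𝓘(ℝ, E) ∞ ν) {V : ∀ q, TangentSpace 𝓘(ℝ, E) (ν q)}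
    (hV : SmoothAlong E E' ν V) (q : Q) (x : TangentSpace 𝓘(ℝ, E') q)
    (w : TangentSpace 𝓘(ℝ, E) (ν q)) :
    D.form (vecDeriv (fun p => s (ν p) (V p)) q x) (s (ν q) w) =
      D.form (vecDeriv (fun y => splitProj ρ s y (s (ν q) (V q))) (ν q)
        (mfderiv 𝓘(ℝ, E') 𝓘(ℝ, E) ν q x)) (s (ν q) w) := by
  have h1 : ∀ p, s (ν p) (V p) = splitProj ρ s (ν p) (s (ν p) (V p)) := fun p => by
    rw [splitProj_apply, hs.field_apply]
  have h2 : (fun p => s (ν p) (V p)) = fun p => splitProj ρ s (ν p) (s (ν p) (V p)) := funext h1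
  conv_lhs => rw [h2]
  rw [vecDeriv_apply (A := fun p => splitProj ρ s (ν p))
    (fun u => (smoothVec_splitProj hs u).comp hν) (hs.smoothVec_along hν hV),
    vecDeriv_comp (smoothVec_splitProj hs _) hν, map_add, LinearMap.add_apply,
    splitProj_apply, hs.form_apply, add_zero]

/-- The triple product of the lifts given by the splitting is the pulled-back curvature. -/
theorem triple_split (hs : (actionCourant D ρ).IsIsotropicSplitting s) {ν : Q → N}
    (hν : ContMDiff 𝓘(ℝ, E') 𝓘(ℝ, E) ∞ ν) {X Y : ∀ q : Q, TangentSpace 𝓘(ℝ, E') q}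
    (hX : SmoothField 𝓘(ℝ, E') X) (hY : SmoothField 𝓘(ℝ, E') Y) (q : Q)
    (z : TangentSpace 𝓘(ℝ, E') q) :
    triple D (fun p => s (ν p) (mfderiv 𝓘(ℝ, E') 𝓘(ℝ, E) ν p (X p)))
      (fun p => s (ν p) (mfderiv 𝓘(ℝ, E') 𝓘(ℝ, E) ν p (Y p))) q (X q) (Y q)
      (s (ν q) (mfderiv 𝓘(ℝ, E') 𝓘(ℝ, E) ν q z)) z =
    curvTensor D ρ s (ν q) (mfderiv 𝓘(ℝ, E') 𝓘(ℝ, E) ν q (X q))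
      (mfderiv 𝓘(ℝ, E') 𝓘(ℝ, E) ν q (Y q)) (mfderiv 𝓘(ℝ, E') 𝓘(ℝ, E) ν q z) := by
  have hX' := hX.smoothAlong_map (E := E) hν
  have hY' := hY.smoothAlong_map (E := E) hν
  rw [triple, curvTensor, form_vecDeriv_split hs hν hX', form_vecDeriv_split hs hν hY',
    form_vecDeriv_split hs hν hX']

section Expansion

variable (hexact : (actionCourant D ρ).IsExact) (hs : (actionCourant D ρ).IsIsotropicSplitting s)
  {ν : Q → N} (hν : ContMDiff 𝓘(ℝ, E') 𝓘(ℝ, E) ∞ ν)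

include hs hν in
theorem smoothVec_split_map {X : ∀ q : Q, TangentSpace 𝓘(ℝ, E') q} (hX : SmoothField 𝓘(ℝ, E') X) :
    SmoothVec E' (fun q => s (ν q) (mfderiv 𝓘(ℝ, E') 𝓘(ℝ, E) ν q (X q))) :=
  hs.smoothVec_along hν (hX.smoothAlong_map hν)

include hs in
theorem isLift_split (X : ∀ q : Q, TangentSpace 𝓘(ℝ, E') q) :
    IsLift ρ ν (fun q => s (ν q) (mfderiv 𝓘(ℝ, E') 𝓘(ℝ, E) ν q (X q))) X :=
  fun _ => (hs.field_apply _ _).symm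

include hexact hs hν in
/-- Only the component of the last argument along the splitting matters for the part of the triple
product that is not determined by the bracket of vector fields. -/
theorem triple_eq_triple_split_right {f g : Q → 𝔡} {X Y : ∀ q : Q, TangentSpace 𝓘(ℝ, E') q}
    (hf : SmoothVec E' f) (hg : SmoothVec E' g)
    (hX : SmoothField 𝓘(ℝ, E') X) (hY : SmoothField 𝓘(ℝ, E') Y) (hfX : IsLift ρ ν f X)
    (hgY : IsLift ρ ν g Y) (q : Q) {h : 𝔡} {z : TangentSpace 𝓘(ℝ, E') q}
    (hz : mfderiv 𝓘(ℝ, E') 𝓘(ℝ, E) ν q z = ρ.field h (ν q)) :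
    triple D f g q (X q) (Y q) h z =
      triple D f g q (X q) (Y q) (s (ν q) (mfderiv 𝓘(ℝ, E') 𝓘(ℝ, E) ν q z)) z +
      D.form h (s (ν q) (mfderiv 𝓘(ℝ, E') 𝓘(ℝ, E) ν q
        (VectorField.mlieBracket 𝓘(ℝ, E') X Y q))) := by
  set H := s (ν q) (mfderiv 𝓘(ℝ, E') 𝓘(ℝ, E) ν q z) with hH
  have h1 : ρ.field (h - H) (ν q) = 0 := by
    rw [ρ.field_sub, hH, hs.field_apply, hz, sub_self]
  have h2 := triple_add (D := D) f g q (X q) (Y q) H (h - H) z 0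
  rw [add_sub_cancel, add_zero] at h2
  have h3 := form_of_field_eq_zero hexact hs h1
    (⁅f q, g q⁆ + vecDeriv g q (X q) - vecDeriv f q (Y q))
  have h4 : ∀ v, D.form (h - H) (s (ν q) v) = D.form h (s (ν q) v) := fun v => by
    rw [map_sub, LinearMap.sub_apply, hH, hs.form_apply, sub_zero]
  rw [anchor_bracket_of_lift hν hf hg hX hY hfX hgY, h4, D.symm (h - H)] at h3
  rw [h2, ← h3, triple, triple, vecDeriv_map_zero]
  simp only [map_sub, map_add, map_zero, LinearMap.zero_apply, LinearMap.sub_apply,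
    LinearMap.add_apply]
  ring

variable {f g : Q → 𝔡} {X Y Z : ∀ q : Q, TangentSpace 𝓘(ℝ, E') q}
  (hf : SmoothVec E' f) (hg : SmoothVec E' g)
  (hX : SmoothField 𝓘(ℝ, E') X) (hY : SmoothField 𝓘(ℝ, E') Y) (hZ : SmoothField 𝓘(ℝ, E') Z)
  (hfX : IsLift ρ ν f X) (hgY : IsLift ρ ν g Y)

include hexact hs hν hf hg hX hY hZ hfX hgY in
/-- The second argument of a triple product may be replaced by the lift given by the splitting, at
the cost of derivatives of the 1-form `⟨g, s⟩`. -/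
theorem triple_split_right (q : Q) :
    triple D f g q (X q) (Y q) (s (ν q) (mfderiv 𝓘(ℝ, E') 𝓘(ℝ, E) ν q (Z q))) (Z q) =
      triple D f (fun p => s (ν p) (mfderiv 𝓘(ℝ, E') 𝓘(ℝ, E) ν p (Y p))) q (X q) (Y q)
        (s (ν q) (mfderiv 𝓘(ℝ, E') 𝓘(ℝ, E) ν q (Z q))) (Z q) +
      dirDeriv 𝓘(ℝ, E') (fun p => D.form (g p)
        (s (ν p) (mfderiv 𝓘(ℝ, E') 𝓘(ℝ, E) ν p (Z p)))) q (X q) -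
      D.form (g q) (s (ν q) (mfderiv 𝓘(ℝ, E') 𝓘(ℝ, E) ν q
        (VectorField.mlieBracket 𝓘(ℝ, E') X Z q))) := by
  have hG := smoothVec_split_map hs hν hY
  have hH := smoothVec_split_map hs hν hZ
  have h1 := triple_swap₂₃ D (f := f) hg hH q (X q) (Y q) (Z q)
  have h2 := triple_swap₂₃ D (f := f) hH hG q (X q) (Z q) (Y q)
  have h3 := triple_eq_triple_split_right hexact hs hν hf hH hX hZ hfX (isLift_split hs Z) q
    (hgY q)
  simp only [hs.form_apply] at h2
  rw [dirDeriv_const] at h2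
  linarith

include hexact hs hν hf hg hX hY hZ hfX hgY in
/-- The triple product of arbitrary lifts, in terms of that of the lifts given by the splitting and
of the 1-forms `⟨f, s⟩`, `⟨g, s⟩` and `⟨h, s⟩`. -/
theorem triple_expansion (q : Q) {h : 𝔡}
    (hhZ : mfderiv 𝓘(ℝ, E') 𝓘(ℝ, E) ν q (Z q) = ρ.field h (ν q)) :
    triple D f g q (X q) (Y q) h (Z q) =
      curvTensor D ρ s (ν q) (mfderiv 𝓘(ℝ, E') 𝓘(ℝ, E) ν q (X q))
        (mfderiv 𝓘(ℝ, E') 𝓘(ℝ, E) ν q (Y q)) (mfderiv 𝓘(ℝ, E') 𝓘(ℝ, E) ν q (Z q)) +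
      (D.form h (s (ν q) (mfderiv 𝓘(ℝ, E') 𝓘(ℝ, E) ν q
          (VectorField.mlieBracket 𝓘(ℝ, E') X Y q)))
        + dirDeriv 𝓘(ℝ, E') (fun p => D.form (g p)
            (s (ν p) (mfderiv 𝓘(ℝ, E') 𝓘(ℝ, E) ν p (Z p)))) q (X q)
        - D.form (g q) (s (ν q) (mfderiv 𝓘(ℝ, E') 𝓘(ℝ, E) ν q
            (VectorField.mlieBracket 𝓘(ℝ, E') X Z q)))
        + dirDeriv 𝓘(ℝ, E') (fun p => D.form (f p)
            (s (ν p) (mfderiv 𝓘(ℝ, E') 𝓘(ℝ, E) ν p (Y p)))) q (Z q)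
        - dirDeriv 𝓘(ℝ, E') (fun p => D.form (f p)
            (s (ν p) (mfderiv 𝓘(ℝ, E') 𝓘(ℝ, E) ν p (Z p)))) q (Y q)
        + D.form (f q) (s (ν q) (mfderiv 𝓘(ℝ, E') 𝓘(ℝ, E) ν q
            (VectorField.mlieBracket 𝓘(ℝ, E') Y Z q)))) := by
  have hF := smoothVec_split_map hs hν hX
  have hG := smoothVec_split_map hs hν hY
  have h1 := triple_eq_triple_split_right hexact hs hν hf hg hX hY hfX hgY q hhZ
  have h2 := triple_split_right hexact hs hν hf hg hX hY hZ hfX hgY q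
  have h3 := triple_swap₁₂ D hf hG q (X q) (Y q) (Z q)
    (s (ν q) (mfderiv 𝓘(ℝ, E') 𝓘(ℝ, E) ν q (Z q)))
  have h4 := triple_split_right hexact hs hν hG hf hY hX hZ (isLift_split hs Y) hfX q
  have h5 := triple_swap₁₂ D hF hG q (X q) (Y q) (Z q)
    (s (ν q) (mfderiv 𝓘(ℝ, E') 𝓘(ℝ, E) ν q (Z q)))
  have h6 := triple_split hs hν hX hY q (Z q)
  simp only [hs.form_apply] at h5
  rw [dirDeriv_const] at h5
  linarith

end Expansion

end Splitting

end Lifts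

/-! ### Existence of Courant brackets -/

theorem InvariantMetric.exists_form_eq {𝔡 : Type*} [LieRing 𝔡] [LieAlgebra ℝ 𝔡]
    [FiniteDimensional ℝ 𝔡] (D : InvariantMetric 𝔡) (l : Module.Dual ℝ 𝔡) :
    ∃ u, ∀ v, D.form u v = l v := by
  have hinj : Function.Injective (D.form : 𝔡 →ₗ[ℝ] Module.Dual ℝ 𝔡) := by
    rw [← LinearMap.ker_eq_bot, LinearMap.ker_eq_bot']
    exact fun u hu => D.nondeg u fun v => LinearMap.congr_fun hu v
  obtain ⟨u, hu⟩ := (LinearMap.injective_iff_surjective_of_finrank_eq_finrank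
    (Subspace.dual_finrank_eq (K := ℝ) (V := 𝔡)).symm).1 hinj l
  exact ⟨u, fun v => LinearMap.congr_fun hu v⟩

section ActionBracket

variable {𝔡 : Type*} [LieRing 𝔡] [LieAlgebra ℝ 𝔡] [FiniteDimensional ℝ 𝔡]
  {D : InvariantMetric 𝔡}
  {E : Type*} [NormedAddCommGroup E] [NormedSpace ℝ E] [FiniteDimensional ℝ E]
  {N : Type*} [TopologicalSpace N] [ChartedSpace E N] [IsManifold 𝓘(ℝ, E) ∞ N] [T2Space N]
  {ρ : LieAction 𝓘(ℝ, E) 𝔡 N}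

theorem actionCourant_bracket_iff {f g h : N → 𝔡} (hf : SmoothVec E f) (hg : SmoothVec E g) :
    (actionCourant D ρ).bracket f g h ↔ ∀ x η, D.form (h x) η =
      triple D f g x (ρ.field (f x) x) (ρ.field (g x) x) η (ρ.field η x) := by
  have h1 : ∀ (f : N → 𝔡), SmoothVec E f → ∀ (η : 𝔡) (x : N) (v : TangentSpace 𝓘(ℝ, E) x),
      dirDeriv 𝓘(ℝ, E) (fun y => D.form (f y) η) x v = D.form (vecDeriv f x v) η :=
    fun f hf η x v => (apply_vecDeriv hf (D.form.flip η) x v).symm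
  refine forall_congr' fun x => forall_congr' fun η => ?_
  rw [h1 g hg, h1 f hf, h1 f hf]
  rfl

/-- The bracket of smooth sections of `𝔡 × N` exists: its pairing with `η` is the triple product, which
is linear in `η`. -/
theorem actionCourant_bracket_exists {f g : N → 𝔡} (hf : SmoothVec E f) (hg : SmoothVec E g) :
    ∃ h, (actionCourant D ρ).bracket f g h := by
  have h1 : ∀ x, ∃ u, ∀ η, D.form u η =
      triple D f g x (ρ.field (f x) x) (ρ.field (g x) x) η (ρ.field η x) := fun x => by
    let l : Module.Dual ℝ 𝔡 :=
      { toFun := fun η => triple D f g x (ρ.field (f x) x) (ρ.field (g x) x) η (ρ.field η x)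
        map_add' := fun a b => by rw [ρ.field_add, triple_add]
        map_smul' := fun c a => by
          rw [ρ.field_smul]
          simp only [triple, vecDeriv_map_smul, map_smul, LinearMap.smul_apply,
            smul_eq_mul, RingHom.id_apply]
          ring }
    exact D.exists_form_eq l
  choose h hh using h1
  exact ⟨h, (actionCourant_bracket_iff hf hg).2 hh⟩

end ActionBracket

section TangentBracket

variable {E : Type*} [NormedAddCommGroup E] [NormedSpace ℝ E] [FiniteDimensional ℝ E]
  {M : Type*} [TopologicalSpace M] [ChartedSpace E M] [IsManifold 𝓘(ℝ, E) ∞ M] [T2Space M]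

/-- The section `b` of `TM ⊕ T^*M` is smooth. -/
abbrev SmoothGen (b : ∀ m : M, GenTangent 𝓘(ℝ, E) m) : Prop :=
  SmoothField 𝓘(ℝ, E) (fun x => (b x).1) ∧ SmoothOneForm 𝓘(ℝ, E) (fun x => (b x).2)

/-- The pairing of `⟦b, b'⟧` with `Z + l` at `m`, for the untwisted bracket. -/
noncomputable def genTriple (b b' : ∀ m : M, GenTangent 𝓘(ℝ, E) m) (m : M)
    (l : CotangentFibre 𝓘(ℝ, E) m) (Z : ∀ m : M, TangentSpace 𝓘(ℝ, E) m) : ℝ :=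
  l (VectorField.mlieBracket 𝓘(ℝ, E) (fun y => (b y).1) (fun y => (b' y).1) m)
    + (dirDeriv 𝓘(ℝ, E) (fun y => (b' y).2 (Z y)) m (b m).1
      - (b' m).2 (VectorField.mlieBracket 𝓘(ℝ, E) (fun y => (b y).1) Z m)
      - (dirDeriv 𝓘(ℝ, E) (fun y => (b y).2 (Z y)) m (b' m).1
        - dirDeriv 𝓘(ℝ, E) (fun y => (b y).2 ((b' y).1)) m (Z m)
        - (b m).2 (VectorField.mlieBracket 𝓘(ℝ, E) (fun y => (b' y).1) Z m)))

/-- The metric of `TM ⊕ T^*M`. -/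
noncomputable def genPairing {m : M} (e e' : GenTangent 𝓘(ℝ, E) m) : ℝ := e.2 e'.1 + e'.2 e.1

theorem SmoothGen.pairing {b b' : ∀ m : M, GenTangent 𝓘(ℝ, E) m} (hb : SmoothGen b)
    (hb' : SmoothGen b') : SmoothFun 𝓘(ℝ, E) (fun m => genPairing (b m) (b' m)) :=
  (hb.2 _ hb'.1).add (hb'.2 _ hb.1)

theorem SmoothGen.smul {f : M → ℝ} (hf : SmoothFun 𝓘(ℝ, E) f)
    {b : ∀ m : M, GenTangent 𝓘(ℝ, E) m} (hb : SmoothGen b) : SmoothGen (fun m => f m • b m) :=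
  ⟨hb.1.smul hf, fun X hX => hf.mul (hb.2 X hX)⟩

theorem gen_sum_fst {ι : Type*} (t : Finset ι) {m : M} (b : ι → GenTangent 𝓘(ℝ, E) m) :
    (∑ j ∈ t, b j).1 = ∑ j ∈ t, (b j).1 := Prod.fst_sum

theorem gen_sum_snd {ι : Type*} (t : Finset ι) {m : M} (b : ι → GenTangent 𝓘(ℝ, E) m)
    (v : TangentSpace 𝓘(ℝ, E) m) :
    (∑ j ∈ t, b j).2 v = ∑ j ∈ t, (b j).2 v := by
  rw [Prod.snd_sum, LinearMap.sum_apply]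

theorem SmoothGen.sum {ι : Type*} {t : Finset ι} {b : ι → ∀ m : M, GenTangent 𝓘(ℝ, E) m}
    (hb : ∀ j, SmoothGen (b j)) : SmoothGen (fun m => ∑ j ∈ t, b j m) := by
  refine ⟨?_, fun X hX => ?_⟩
  · simp only [gen_sum_fst]
    exact SmoothField.sum fun j _ => (hb j).1
  · simp only [gen_sum_snd]
    exact SmoothFun.sum fun j _ => (hb j).2 X hX

theorem genPairing_sum_smul {ι : Type*} (t : Finset ι) {m : M} (f : ι → ℝ)
    (b : ι → GenTangent 𝓘(ℝ, E) m) (e : GenTangent 𝓘(ℝ, E) m) :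
    genPairing (∑ j ∈ t, f j • b j) e = ∑ j ∈ t, f j * genPairing (b j) e := by
  simp only [genPairing, gen_sum_fst, gen_sum_snd, Prod.smul_fst, Prod.smul_snd, map_sum, map_smul,
    LinearMap.smul_apply, smul_eq_mul, ← Finset.sum_add_distrib, mul_add]

theorem genPairing_symm {m : M} (e e' : GenTangent 𝓘(ℝ, E) m) :
    genPairing e e' = genPairing e' e := add_comm _ _

theorem genTriple_swap {b b' : ∀ m : M, GenTangent 𝓘(ℝ, E) m} (hb : SmoothGen b)
    (hb' : SmoothGen b') (m : M) (l : CotangentFibre 𝓘(ℝ, E) m)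
    (Z : ∀ m : M, TangentSpace 𝓘(ℝ, E) m) :
    genTriple b b' m l Z + genTriple b' b m l Z =
      dirDeriv 𝓘(ℝ, E) (fun y => genPairing (b y) (b' y)) m (Z m) := by
  simp only [genPairing]
  rw [dirDeriv_add (hb.2 _ hb'.1) (hb'.2 _ hb.1), genTriple, genTriple,
    mlieBracket_swap' (fun y => (b y).1) (fun y => (b' y).1), map_neg]
  ring

/-- The Leibniz rule in the second argument. -/
theorem genTriple_sum_right {ι : Type*} (t : Finset ι) {b : ∀ m : M, GenTangent 𝓘(ℝ, E) m}
    (hb : SmoothGen b) {g : ι → M → ℝ} (hg : ∀ k, SmoothFun 𝓘(ℝ, E) (g k))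
    {b' : ι → ∀ m : M, GenTangent 𝓘(ℝ, E) m} (hb' : ∀ k, SmoothGen (b' k)) (m : M)
    (l : CotangentFibre 𝓘(ℝ, E) m) {Z : ∀ m : M, TangentSpace 𝓘(ℝ, E) m}
    (hZ : SmoothField 𝓘(ℝ, E) Z) :
    genTriple b (fun m => ∑ k ∈ t, g k m • b' k m) m l Z = ∑ k ∈ t,
      (g k m * genTriple b (b' k) m l Z +
        dirDeriv 𝓘(ℝ, E) (g k) m (b m).1 * genPairing (b' k m) (Z m, l)) := by
  have hfst : (fun y => (∑ k ∈ t, g k y • b' k y).1) = fun y => ∑ k ∈ t, g k y • (b' k y).1 := by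
    funext y; rw [gen_sum_fst]; rfl
  have hsnd : ∀ (V : ∀ m : M, TangentSpace 𝓘(ℝ, E) m) (y : M),
      (∑ k ∈ t, g k y • b' k y).2 (V y) = ∑ k ∈ t, g k y * (b' k y).2 (V y) := fun V y => by
    rw [gen_sum_snd]; rfl
  have e1 := mlieBracket_sum_smul_right t hb.1 (fun k => (hb' k).1) hg m
  have e2 : dirDeriv 𝓘(ℝ, E) (fun y => (∑ k ∈ t, g k y • b' k y).2 (Z y)) m (b m).1 =
      ∑ k ∈ t, (g k m * dirDeriv 𝓘(ℝ, E) (fun y => (b' k y).2 (Z y)) m (b m).1 +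
        (b' k m).2 (Z m) * dirDeriv 𝓘(ℝ, E) (g k) m (b m).1) := by
    simp only [hsnd]
    rw [dirDeriv_sum t fun k => (hg k).mul ((hb' k).2 Z hZ)]
    exact Finset.sum_congr rfl fun k _ => dirDeriv_mul (hg k) ((hb' k).2 Z hZ) _ _
  have e3 : dirDeriv 𝓘(ℝ, E) (fun y => (b y).2 (∑ k ∈ t, g k y • (b' k y).1)) m (Z m) =
      ∑ k ∈ t, (g k m * dirDeriv 𝓘(ℝ, E) (fun y => (b y).2 (b' k y).1) m (Z m) +
        (b m).2 (b' k m).1 * dirDeriv 𝓘(ℝ, E) (g k) m (Z m)) := by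
    simp only [map_sum, map_smul, smul_eq_mul]
    rw [dirDeriv_sum t fun k => (hg k).mul (hb.2 _ (hb' k).1)]
    exact Finset.sum_congr rfl fun k _ => dirDeriv_mul (hg k) (hb.2 _ (hb' k).1) _ _
  have e4 : VectorField.mlieBracket 𝓘(ℝ, E) (fun y => ∑ k ∈ t, g k y • (b' k y).1) Z m =
      ∑ k ∈ t, (g k m • VectorField.mlieBracket 𝓘(ℝ, E) (fun y => (b' k y).1) Z m -
        dirDeriv 𝓘(ℝ, E) (g k) m (Z m) • (b' k m).1) := by
    rw [mlieBracket_swap', mlieBracket_sum_smul_right t hZ (fun k => (hb' k).1) hg m,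
      ← Finset.sum_neg_distrib]
    refine Finset.sum_congr rfl fun k _ => ?_
    rw [mlieBracket_swap' (fun y => (b' k y).1) Z, smul_neg]
    abel
  have e5 : ∀ y, (∑ k ∈ t, g k y • b' k y).1 = ∑ k ∈ t, g k y • (b' k y).1 :=
    fun y => congrFun hfst y
  have e6 : ∀ v : TangentSpace 𝓘(ℝ, E) m,
      (∑ k ∈ t, g k m • b' k m).2 v = ∑ k ∈ t, g k m * (b' k m).2 v := fun v => by
    rw [gen_sum_snd]; rfl
  rw [genTriple, hfst, e1, e2]
  simp only [e5, e6]
  rw [e3, e4]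
  simp only [map_sum, dirDeriv_map_sum, dirDeriv_map_smul, map_add, map_sub, map_smul, smul_eq_mul,
    ← Finset.sum_add_distrib, ← Finset.sum_sub_distrib]
  refine Finset.sum_congr rfl fun k _ => ?_
  rw [genTriple, genPairing]
  ring

/-- The Leibniz rule in the first argument; it follows from the one in the second argument by
`genTriple_swap`. -/
theorem genTriple_sum_left {ι : Type*} (t : Finset ι) {b' : ∀ m : M, GenTangent 𝓘(ℝ, E) m}
    (hb' : SmoothGen b') {f : ι → M → ℝ} (hf : ∀ k, SmoothFun 𝓘(ℝ, E) (f k))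
    {b : ι → ∀ m : M, GenTangent 𝓘(ℝ, E) m} (hb : ∀ k, SmoothGen (b k)) (m : M)
    (l : CotangentFibre 𝓘(ℝ, E) m) {Z : ∀ m : M, TangentSpace 𝓘(ℝ, E) m}
    (hZ : SmoothField 𝓘(ℝ, E) Z) :
    genTriple (fun m => ∑ j ∈ t, f j m • b j m) b' m l Z = ∑ j ∈ t,
      (f j m * genTriple (b j) b' m l Z -
        dirDeriv 𝓘(ℝ, E) (f j) m (b' m).1 * genPairing (b j m) (Z m, l) +
        dirDeriv 𝓘(ℝ, E) (f j) m (Z m) * genPairing (b j m) (b' m)) := by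
  have h1 := genTriple_swap (SmoothGen.sum (t := t) fun j => (hb j).smul (hf j)) hb' m l Z
  rw [genTriple_sum_right t hb' hf hb m l hZ] at h1
  simp only [genPairing_sum_smul] at h1
  rw [dirDeriv_sum t fun j => (hf j).mul ((hb j).pairing hb')] at h1
  rw [eq_sub_of_add_eq h1, ← Finset.sum_sub_distrib]
  refine Finset.sum_congr rfl fun j _ => ?_
  rw [dirDeriv_mul (hf j) ((hb j).pairing hb'), ← genTriple_swap (hb j) hb' m l Z]
  ring

/-- The bracket of smooth sections of `𝕋M` exists, because the expression that defines its covector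
part is tensorial in `Z`. -/
theorem tangentCourant_bracket_exists {b b' : ∀ m : M, GenTangent 𝓘(ℝ, E) m} (hb : SmoothGen b)
    (hb' : SmoothGen b') : ∃ d, (tangentCourant 𝓘(ℝ, E) (B := M) 0).bracket b b' d := by
  have h1 : ∀ m, ∃ β : CotangentFibre 𝓘(ℝ, E) m, ∀ Z, SmoothField 𝓘(ℝ, E) Z →
      genTriple b b' m 0 Z = β (Z m) := fun m => by
    refine exists_covector_of_tensorial m _ (fun Y Z hY hZ => ?_) (fun f Z hf hZ => ?_)
    · simp only [genTriple, LinearMap.zero_apply, map_add, dirDeriv_map_add,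
        mlieBracket_add_right' hb.1 hY hZ, mlieBracket_add_right' hb'.1 hY hZ,
        dirDeriv_add (hb.2 _ hY) (hb.2 _ hZ), dirDeriv_add (hb'.2 _ hY) (hb'.2 _ hZ)]
      ring
    · simp only [genTriple, LinearMap.zero_apply, map_add, map_smul, smul_eq_mul,
        dirDeriv_map_smul, mlieBracket_smul_right' hb.1 hZ hf, mlieBracket_smul_right' hb'.1 hZ hf,
        dirDeriv_mul hf (hb.2 _ hZ), dirDeriv_mul hf (hb'.2 _ hZ)]
      ring
  choose β hβ using h1
  refine ⟨fun m => (VectorField.mlieBracket 𝓘(ℝ, E) (fun y => (b y).1) (fun y => (b' y).1) m, β m),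
    fun m => ⟨rfl, fun Z hZ => ?_⟩⟩
  refine (hβ m Z hZ).symm.trans ?_
  simp only [genTriple, LinearMap.zero_apply, zero_add, Pi.zero_apply, add_zero]

theorem genPairing_bracket {b b' d : ∀ m : M, GenTangent 𝓘(ℝ, E) m}
    (h : (tangentCourant 𝓘(ℝ, E) (B := M) 0).bracket b b' d) (m : M)
    (l : CotangentFibre 𝓘(ℝ, E) m) {Z : ∀ m : M, TangentSpace 𝓘(ℝ, E) m}
    (hZ : SmoothField 𝓘(ℝ, E) Z) : genPairing (d m) (Z m, l) = genTriple b b' m l Z := by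
  obtain ⟨h1, h2⟩ := h m
  rw [genPairing, h1, h2 Z hZ, genTriple]
  simp only [LinearMap.zero_apply, Pi.zero_apply, add_zero]
  ring

end TangentBracket

/-! ### The Courant bracket along a graph -/

section Graph

variable {E : Type*} [NormedAddCommGroup E] [NormedSpace ℝ E]
  {N : Type*} [TopologicalSpace N] [ChartedSpace E N]
  {E' : Type*} [NormedAddCommGroup E'] [NormedSpace ℝ E']
  {M : Type*} [TopologicalSpace M] [ChartedSpace E' M]
  {μ : M → N} (hμ : ContMDiff 𝓘(ℝ, E') 𝓘(ℝ, E) ∞ μ)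

include hμ

theorem contMDiff_graphMap :
    ContMDiff 𝓘(ℝ, E') (𝓘(ℝ, E).prod 𝓘(ℝ, E')) ∞ (graphMap μ) := hμ.prodMk contMDiff_id

theorem mfderiv_graphMap (m : M) (v : TangentSpace 𝓘(ℝ, E') m) :
    mfderiv 𝓘(ℝ, E') (𝓘(ℝ, E).prod 𝓘(ℝ, E')) (graphMap μ) m v =
      ((mfderiv 𝓘(ℝ, E') 𝓘(ℝ, E) μ m v, v) : TangentSpace 𝓘(ℝ, E) (μ m) × TangentSpace 𝓘(ℝ, E') m) := by
  have h := mfderiv_prodMk (I := 𝓘(ℝ, E')) (hμ.mdifferentiableAt (by simp) (x := m))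
    (mdifferentiableAt_id (I := 𝓘(ℝ, E')) (x := m))
  have h2 := congrArg (fun L : E' →L[ℝ] E × E' => L v) h
  rw [mfderiv_id] at h2
  exact h2

theorem SmoothFun.comp_graphMap {f : N × M → ℝ} (hf : SmoothFun (𝓘(ℝ, E).prod 𝓘(ℝ, E')) f) :
    SmoothFun 𝓘(ℝ, E') (fun m => f (μ m, m)) :=
  ContMDiff.comp (I' := 𝓘(ℝ, E).prod 𝓘(ℝ, E')) (f := graphMap μ) hf (contMDiff_graphMap hμ)

theorem dirDeriv_comp_graphMap {f : N × M → ℝ} (hf : SmoothFun (𝓘(ℝ, E).prod 𝓘(ℝ, E')) f) (m : M)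
    (v : TangentSpace 𝓘(ℝ, E') m) :
    dirDeriv 𝓘(ℝ, E') (fun m => f (μ m, m)) m v =
      dirDeriv (𝓘(ℝ, E).prod 𝓘(ℝ, E')) f (graphMap μ m)
        ((mfderiv 𝓘(ℝ, E') 𝓘(ℝ, E) μ m v, v) :
          TangentSpace 𝓘(ℝ, E) (μ m) × TangentSpace 𝓘(ℝ, E') m) := by
  have h := mfderiv_comp m (g := f)
    (ContMDiff.mdifferentiableAt (n := ∞) hf (by simp) (x := graphMap μ m))
    ((contMDiff_graphMap hμ).mdifferentiableAt (by simp) (x := m))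
  have h2 := congrArg (fun L : E' →L[ℝ] ℝ => L v) h
  rw [← mfderiv_graphMap hμ]
  exact h2

end Graph

section GraphBracket

variable {𝔡 : Type*} [LieRing 𝔡] [LieAlgebra ℝ 𝔡] [FiniteDimensional ℝ 𝔡]
  {D : InvariantMetric 𝔡}
  {E : Type*} [NormedAddCommGroup E] [NormedSpace ℝ E] [FiniteDimensional ℝ E]
  {N : Type*} [TopologicalSpace N] [ChartedSpace E N] [IsManifold 𝓘(ℝ, E) ∞ N] [T2Space N]
  {ρ : LieAction 𝓘(ℝ, E) 𝔡 N}
  {E' : Type*} [NormedAddCommGroup E'] [NormedSpace ℝ E'] [FiniteDimensional ℝ E']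
  {M : Type*} [TopologicalSpace M] [ChartedSpace E' M] [IsManifold 𝓘(ℝ, E') ∞ M] [T2Space M]
  {μ : M → N} (hμ : ContMDiff 𝓘(ℝ, E') 𝓘(ℝ, E) ∞ μ)

theorem LieAction.field_sum_smul {ι : Type*} [Fintype ι] (f : ι → ℝ) (a : ι → 𝔡) (x : N) :
    ρ.field (∑ j, f j • a j) x = ∑ j, f j • ρ.field (a j) x := by
  rw [← ρ.evalAt_apply, map_sum]
  exact Finset.sum_congr rfl fun j _ => by rw [map_smul, ρ.evalAt_apply]

theorem vecDeriv_map_sum_smul {ι : Type*} [Fintype ι] (b : N → 𝔡) (x : N) (f : ι → ℝ)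
    (w : ι → TangentSpace 𝓘(ℝ, E) x) :
    vecDeriv b x (∑ j, f j • w j) = ∑ j, f j • vecDeriv b x (w j) := by
  let L : TangentSpace 𝓘(ℝ, E) x →ₗ[ℝ] 𝔡 :=
    { toFun := vecDeriv b x, map_add' := vecDeriv_map_add b x
      map_smul' := vecDeriv_map_smul b x }
  have h1 := map_sum L (fun j => f j • w j) Finset.univ
  simp only [map_smul] at h1
  exact h1

include hμ

theorem vecDeriv_sum_smul_comp {ι : Type*} [Fintype ι] {f : ι → M → ℝ} {a : ι → N → 𝔡}
    (hf : ∀ j, SmoothFun 𝓘(ℝ, E') (f j)) (ha : ∀ j, SmoothVec E (a j)) (m : M)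
    (v : TangentSpace 𝓘(ℝ, E') m) :
    vecDeriv (fun m => ∑ j, f j m • a j (μ m)) m v =
      ∑ j, (dirDeriv 𝓘(ℝ, E') (f j) m v • a j (μ m) +
        f j m • vecDeriv (a j) (μ m) (mfderiv 𝓘(ℝ, E') 𝓘(ℝ, E) μ m v)) := by
  rw [vecDeriv_sum _ fun j => ((ha j).comp hμ).smul (hf j)]
  refine Finset.sum_congr rfl fun j _ => ?_
  rw [vecDeriv_smul (hf j) ((ha j).comp hμ), vecDeriv_comp (ha j) hμ]

/-- The expansion of the triple product for linear combinations of pulled back sections. -/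
theorem triple_sum {ι κ : Type*} [Fintype ι] [Fintype κ] {f : ι → M → ℝ} {a : ι → N → 𝔡}
    {g : κ → M → ℝ} {a' : κ → N → 𝔡}
    (hf : ∀ j, SmoothFun 𝓘(ℝ, E') (f j)) (hg : ∀ k, SmoothFun 𝓘(ℝ, E') (g k))
    (ha : ∀ j, SmoothVec E (a j)) (ha' : ∀ k, SmoothVec E (a' k))
    {c : ι → κ → N → 𝔡} (hc : ∀ j k, (actionCourant D ρ).bracket (a j) (a' k) (c j k))
    (m : M) {x y z : TangentSpace 𝓘(ℝ, E') m} {h : 𝔡}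
    (hx : mfderiv 𝓘(ℝ, E') 𝓘(ℝ, E) μ m x = ρ.field (∑ j, f j m • a j (μ m)) (μ m))
    (hy : mfderiv 𝓘(ℝ, E') 𝓘(ℝ, E) μ m y = ρ.field (∑ k, g k m • a' k (μ m)) (μ m))
    (hz : mfderiv 𝓘(ℝ, E') 𝓘(ℝ, E) μ m z = ρ.field h (μ m)) :
    triple D (fun m => ∑ j, f j m • a j (μ m)) (fun m => ∑ k, g k m • a' k (μ m)) m x y h z =
      ∑ j, ∑ k, f j m * g k m * D.form (c j k (μ m)) h +
        ∑ k, dirDeriv 𝓘(ℝ, E') (g k) m x * D.form (a' k (μ m)) h -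
        ∑ j, dirDeriv 𝓘(ℝ, E') (f j) m y * D.form (a j (μ m)) h +
        ∑ j, ∑ k, dirDeriv 𝓘(ℝ, E') (f j) m z * g k m * D.form (a j (μ m)) (a' k (μ m)) := by
  have hcc : ∀ j k, D.form (c j k (μ m)) h = D.form ⁅a j (μ m), a' k (μ m)⁆ h +
      D.form (vecDeriv (a' k) (μ m) (ρ.field (a j (μ m)) (μ m))) h -
      D.form (vecDeriv (a j) (μ m) (ρ.field (a' k (μ m)) (μ m))) h +
      D.form (vecDeriv (a j) (μ m) (ρ.field h (μ m))) (a' k (μ m)) := fun j k =>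
    (actionCourant_bracket_iff (ha j) (ha' k)).1 (hc j k) (μ m) h
  have e1 : D.form ⁅∑ j, f j m • a j (μ m), ∑ k, g k m • a' k (μ m)⁆ h =
      ∑ j, ∑ k, f j m * g k m * D.form ⁅a j (μ m), a' k (μ m)⁆ h := by
    simp only [sum_lie, lie_sum, smul_lie, lie_smul, map_sum, map_smul, LinearMap.sum_apply,
      LinearMap.smul_apply, smul_eq_mul, Finset.mul_sum]
    rw [Finset.sum_comm]
    exact Finset.sum_congr rfl fun j _ => Finset.sum_congr rfl fun k _ => by ring
  have e2 : D.form (vecDeriv (fun m => ∑ k, g k m • a' k (μ m)) m x) h =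
      ∑ k, dirDeriv 𝓘(ℝ, E') (g k) m x * D.form (a' k (μ m)) h + ∑ j, ∑ k, f j m * g k m *
        D.form (vecDeriv (a' k) (μ m) (ρ.field (a j (μ m)) (μ m))) h := by
    rw [vecDeriv_sum_smul_comp hμ hg ha', hx, ρ.field_sum_smul, Finset.sum_comm,
      ← Finset.sum_add_distrib]
    simp only [vecDeriv_map_sum_smul, map_sum, map_add, map_smul, LinearMap.sum_apply,
      LinearMap.add_apply, LinearMap.smul_apply, smul_eq_mul, Finset.mul_sum]
    refine Finset.sum_congr rfl fun k _ => ?_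
    congr 1
    exact Finset.sum_congr rfl fun j _ => by ring
  have e3 : D.form (vecDeriv (fun m => ∑ j, f j m • a j (μ m)) m y) h =
      ∑ j, dirDeriv 𝓘(ℝ, E') (f j) m y * D.form (a j (μ m)) h + ∑ j, ∑ k, f j m * g k m *
        D.form (vecDeriv (a j) (μ m) (ρ.field (a' k (μ m)) (μ m))) h := by
    rw [vecDeriv_sum_smul_comp hμ hf ha, hy, ρ.field_sum_smul, ← Finset.sum_add_distrib]
    simp only [vecDeriv_map_sum_smul, map_sum, map_add, map_smul, LinearMap.sum_apply,
      LinearMap.add_apply, LinearMap.smul_apply, smul_eq_mul, Finset.mul_sum, mul_assoc]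
  have e4 : D.form (vecDeriv (fun m => ∑ j, f j m • a j (μ m)) m z) (∑ k, g k m • a' k (μ m)) =
      ∑ j, ∑ k, dirDeriv 𝓘(ℝ, E') (f j) m z * g k m * D.form (a j (μ m)) (a' k (μ m)) +
      ∑ j, ∑ k, f j m * g k m *
        D.form (vecDeriv (a j) (μ m) (ρ.field h (μ m))) (a' k (μ m)) := by
    rw [vecDeriv_sum_smul_comp hμ hf ha, hz]
    simp only [map_sum, map_add, map_smul, LinearMap.sum_apply, LinearMap.add_apply,
      LinearMap.smul_apply, smul_eq_mul, ← Finset.sum_add_distrib,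
      Finset.mul_sum]
    rw [Finset.sum_comm]
    exact Finset.sum_congr rfl fun j _ => Finset.sum_congr rfl fun k _ => by ring
  rw [triple, e1, e2, e3, e4]
  simp only [hcc, mul_add, mul_sub, Finset.sum_add_distrib, Finset.sum_sub_distrib]
  ring

/-- The corresponding expansion for `TM ⊕ T^*M`. -/
theorem genTriple_sum {ι κ : Type*} [Fintype ι] [Fintype κ] {f : ι → M → ℝ} {g : κ → M → ℝ}
    {b : ι → ∀ m : M, GenTangent 𝓘(ℝ, E') m} {b' : κ → ∀ m : M, GenTangent 𝓘(ℝ, E') m}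
    (hf : ∀ j, SmoothFun 𝓘(ℝ, E') (f j)) (hg : ∀ k, SmoothFun 𝓘(ℝ, E') (g k))
    (hb : ∀ j, SmoothGen (b j)) (hb' : ∀ k, SmoothGen (b' k)) (m : M)
    (l : CotangentFibre 𝓘(ℝ, E') m) {Z : ∀ m : M, TangentSpace 𝓘(ℝ, E') m}
    (hZ : SmoothField 𝓘(ℝ, E') Z) :
    genTriple (fun m => ∑ j, f j m • b j m) (fun m => ∑ k, g k m • b' k m) m l Z =
      ∑ j, ∑ k, f j m * g k m * genTriple (b j) (b' k) m l Z +
        ∑ k, dirDeriv 𝓘(ℝ, E') (g k) m (∑ j, f j m • b j m).1 * genPairing (b' k m) (Z m, l) -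
        ∑ j, dirDeriv 𝓘(ℝ, E') (f j) m (∑ k, g k m • b' k m).1 * genPairing (b j m) (Z m, l) +
        ∑ j, ∑ k, dirDeriv 𝓘(ℝ, E') (f j) m (Z m) * g k m * genPairing (b j m) (b' k m) := by
  rw [genTriple_sum_left _ (SmoothGen.sum fun k => (hb' k).smul (hg k)) hf hb m l hZ]
  have e1 : ∀ j, genTriple (b j) (fun m => ∑ k, g k m • b' k m) m l Z = _ := fun j =>
    genTriple_sum_right _ (hb j) hg hb' m l hZ
  have e2 : ∀ j, genPairing (b j m) (∑ k, g k m • b' k m) =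
      ∑ k, g k m * genPairing (b j m) (b' k m) := fun j => by
    rw [genPairing_symm, genPairing_sum_smul]
    exact Finset.sum_congr rfl fun k _ => by rw [genPairing_symm]
  have e3 : ∀ k, dirDeriv 𝓘(ℝ, E') (g k) m (∑ j, f j m • b j m).1 =
      ∑ j, f j m * dirDeriv 𝓘(ℝ, E') (g k) m (b j m).1 := fun k => by
    rw [gen_sum_fst, dirDeriv_map_sum]
    exact Finset.sum_congr rfl fun j _ => dirDeriv_map_smul _ _ _ _
  simp only [e1, e2, e3, Finset.mul_sum, Finset.sum_mul, Finset.sum_add_distrib,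
    Finset.sum_sub_distrib, mul_add, mul_assoc]
  rw [Finset.sum_comm (f := fun (k : κ) (j : ι) => f j m *
    (dirDeriv 𝓘(ℝ, E') (g k) m (b j m).1 * genPairing (b' k m) (Z m, l)))]

omit hμ in
/-- The derivative along the anchor of a finite sum of products of functions and sections. -/
theorem dirDeriv_prodAnchor_eval (σ : CourantData.SectionSum (actionCourant D ρ)
    (tangentCourant 𝓘(ℝ, E') (B := M) 0)) (F : N × M → ℝ) (p : N × M) :
    dirDeriv (𝓘(ℝ, E).prod 𝓘(ℝ, E')) F p
      (CourantData.prodAnchor (actionCourant D ρ) (tangentCourant 𝓘(ℝ, E') (B := M) 0) p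
        (σ.eval p)) =
    ∑ j, σ.f j p * dirDeriv (𝓘(ℝ, E).prod 𝓘(ℝ, E')) F p
      (CourantData.prodAnchor (actionCourant D ρ) (tangentCourant 𝓘(ℝ, E') (B := M) 0) p
        (σ.a j p.1, σ.b j p.2)) := by
  let L : TangentSpace (𝓘(ℝ, E).prod 𝓘(ℝ, E')) p →ₗ[ℝ] ℝ :=
    { toFun := fun v => dirDeriv (𝓘(ℝ, E).prod 𝓘(ℝ, E')) F p v
      map_add' := map_add (mfderiv (𝓘(ℝ, E).prod 𝓘(ℝ, E')) 𝓘(ℝ, ℝ) F p)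
      map_smul' := map_smul (mfderiv (𝓘(ℝ, E).prod 𝓘(ℝ, E')) 𝓘(ℝ, ℝ) F p) }
  have h1 := map_sum (L ∘ₗ CourantData.prodAnchor (actionCourant D ρ)
    (tangentCourant 𝓘(ℝ, E') (B := M) 0) p) (fun j => σ.f j p • (σ.a j p.1, σ.b j p.2))
    Finset.univ
  simp only [map_smul, smul_eq_mul] at h1
  exact h1

/-- The Courant bracket of sections of `(𝔡 × N) × \overline{𝕋M}` that project to the tangent
bundle of the graph of `μ`: along the graph, it is the difference of the triple products of the two
factors. -/
theorem prodConj_bracket_graph {z z' σ₃ : ∀ p : N × M, 𝔡 × GenTangent 𝓘(ℝ, E') p.2}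
    (h : ((actionCourant D ρ).prodConj (tangentCourant 𝓘(ℝ, E') (B := M) 0)).bracket z z' σ₃)
    (hz : ∀ m, mfderiv 𝓘(ℝ, E') 𝓘(ℝ, E) μ m (z (μ m, m)).2.1 = ρ.field (z (μ m, m)).1 (μ m))
    (hz' : ∀ m, mfderiv 𝓘(ℝ, E') 𝓘(ℝ, E) μ m (z' (μ m, m)).2.1 = ρ.field (z' (μ m, m)).1 (μ m))
    (m : M) {Z : ∀ m : M, TangentSpace 𝓘(ℝ, E') m} (hZ : SmoothField 𝓘(ℝ, E') Z) {η : 𝔡}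
    (l : CotangentFibre 𝓘(ℝ, E') m)
    (hη : mfderiv 𝓘(ℝ, E') 𝓘(ℝ, E) μ m (Z m) = ρ.field η (μ m)) :
    D.form (σ₃ (μ m, m)).1 η - genPairing (σ₃ (μ m, m)).2 (Z m, l) =
      triple D (fun m => (z (μ m, m)).1) (fun m => (z' (μ m, m)).1) m (z (μ m, m)).2.1
        (z' (μ m, m)).2.1 η (Z m) -
      genTriple (fun m => (z (μ m, m)).2) (fun m => (z' (μ m, m)).2) m l Z := by
  obtain ⟨σ, σ', rfl, rfl, c, d, hc, hd, hw⟩ := h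
  have hfst : ∀ (σ : CourantData.SectionSum (actionCourant D ρ)
      (tangentCourant 𝓘(ℝ, E') (B := M) 0)) (m : M),
      (σ.eval (μ m, m)).1 = ∑ j, σ.f j (μ m, m) • σ.a j (μ m) := fun σ m => Prod.fst_sum
  have hsnd : ∀ (σ : CourantData.SectionSum (actionCourant D ρ)
      (tangentCourant 𝓘(ℝ, E') (B := M) 0)) (m : M),
      (σ.eval (μ m, m)).2 = ∑ j, σ.f j (μ m, m) • σ.b j m := fun σ m => Prod.snd_sum
  have hf : ∀ (σ : CourantData.SectionSum (actionCourant D ρ)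
      (tangentCourant 𝓘(ℝ, E') (B := M) 0)) j, SmoothFun 𝓘(ℝ, E') (fun m => σ.f j (μ m, m)) :=
    fun σ j => (σ.smooth_f j).comp_graphMap hμ
  have h1 := triple_sum hμ (hf σ) (hf σ') σ.smooth_a σ'.smooth_a hc m
    (by rw [← hfst]; exact hz m) (by rw [← hfst]; exact hz' m) hη
  have h2 := genTriple_sum hμ (hf σ) (hf σ') σ.smooth_b σ'.smooth_b m l hZ
  have h3 : ∀ j k, genTriple (σ.b j) (σ'.b k) m l Z = genPairing (d j k m) (Z m, l) :=
    fun j k => (genPairing_bracket (hd j k) m l hZ).symm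
  have hder : ∀ (σ σ' : CourantData.SectionSum (actionCourant D ρ)
      (tangentCourant 𝓘(ℝ, E') (B := M) 0)),
      (∀ m, mfderiv 𝓘(ℝ, E') 𝓘(ℝ, E) μ m (σ.eval (μ m, m)).2.1 =
        ρ.field (σ.eval (μ m, m)).1 (μ m)) → ∀ k,
      ∑ j, σ.f j (μ m, m) * dirDeriv (𝓘(ℝ, E).prod 𝓘(ℝ, E')) (σ'.f k) (μ m, m)
        (CourantData.prodAnchor (actionCourant D ρ) (tangentCourant 𝓘(ℝ, E') (B := M) 0) (μ m, m)
          (σ.a j (μ m), σ.b j m)) =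
      dirDeriv 𝓘(ℝ, E') (fun m => σ'.f k (μ m, m)) m (σ.eval (μ m, m)).2.1 := by
    intro σ σ' hz k
    rw [dirDeriv_comp_graphMap hμ (σ'.smooth_f k), hz m]
    exact (dirDeriv_prodAnchor_eval σ (σ'.f k) (μ m, m)).symm
  have hder' : ∀ j, dirDeriv 𝓘(ℝ, E') (fun m => σ.f j (μ m, m)) m (Z m) =
      dirDeriv (𝓘(ℝ, E).prod 𝓘(ℝ, E')) (σ.f j) (μ m, m)
        (CourantData.prodAnchor (actionCourant D ρ) (tangentCourant 𝓘(ℝ, E') (B := M) 0) (μ m, m)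
          (η, (Z m, l))) := fun j => by
    rw [dirDeriv_comp_graphMap hμ (σ.smooth_f j), hη]
    rfl
  have h4 : D.form (σ₃ (μ m, m)).1 η - genPairing (σ₃ (μ m, m)).2 (Z m, l) = ∑ j, ∑ k,
      (σ.f j (μ m, m) * σ'.f k (μ m, m) *
          (D.form (c j k (μ m)) η - genPairing (d j k m) (Z m, l)) +
        σ.f j (μ m, m) * dirDeriv (𝓘(ℝ, E).prod 𝓘(ℝ, E')) (σ'.f k) (μ m, m)
          (CourantData.prodAnchor (actionCourant D ρ) (tangentCourant 𝓘(ℝ, E') (B := M) 0) (μ m, m)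
            (σ.a j (μ m), σ.b j m)) *
          (D.form (σ'.a k (μ m)) η - genPairing (σ'.b k m) (Z m, l)) -
        σ'.f k (μ m, m) * dirDeriv (𝓘(ℝ, E).prod 𝓘(ℝ, E')) (σ.f j) (μ m, m)
          (CourantData.prodAnchor (actionCourant D ρ) (tangentCourant 𝓘(ℝ, E') (B := M) 0) (μ m, m)
            (σ'.a k (μ m), σ'.b k m)) *
          (D.form (σ.a j (μ m)) η - genPairing (σ.b j m) (Z m, l)) +
        σ'.f k (μ m, m) *
          (D.form (σ.a j (μ m)) (σ'.a k (μ m)) - genPairing (σ.b j m) (σ'.b k m)) *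
          dirDeriv (𝓘(ℝ, E).prod 𝓘(ℝ, E')) (σ.f j) (μ m, m)
            (CourantData.prodAnchor (actionCourant D ρ) (tangentCourant 𝓘(ℝ, E') (B := M) 0)
              (μ m, m) (η, (Z m, l)))) := hw (μ m, m) (η, (Z m, l))
  rw [h4]
  simp only [← hfst, ← hsnd] at h1 h2
  rw [h1, h2]
  simp only [← hder σ σ' hz, ← hder σ' σ hz', hder', h3]
  simp only [Finset.sum_mul]
  rw [Finset.sum_comm (f := fun (k : Fin σ'.n) (j : Fin σ.n) => σ.f j (μ m, m) *
    dirDeriv (𝓘(ℝ, E).prod 𝓘(ℝ, E')) (σ'.f k) (μ m, m)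
        (CourantData.prodAnchor (actionCourant D ρ) (tangentCourant 𝓘(ℝ, E') (B := M) 0) (μ m, m)
          (σ.a j (μ m), σ.b j m)) * D.form (σ'.a k (μ m)) η),
    Finset.sum_comm (f := fun (k : Fin σ'.n) (j : Fin σ.n) => σ.f j (μ m, m) *
    dirDeriv (𝓘(ℝ, E).prod 𝓘(ℝ, E')) (σ'.f k) (μ m, m)
        (CourantData.prodAnchor (actionCourant D ρ) (tangentCourant 𝓘(ℝ, E') (B := M) 0) (μ m, m)
          (σ.a j (μ m), σ.b j m)) * genPairing (σ'.b k m) (Z m, l))]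
  simp only [← Finset.sum_add_distrib, ← Finset.sum_sub_distrib]
  refine Finset.sum_congr rfl fun j _ => Finset.sum_congr rfl fun k _ => ?_
  ring

end GraphBracket

/-! ### The Dirac structure of a map and a 2-form -/

section FormRel

variable {E : Type*} [NormedAddCommGroup E] [NormedSpace ℝ E]
  {N : Type*} [TopologicalSpace N] [ChartedSpace E N]
  {E' : Type*} [NormedAddCommGroup E'] [NormedSpace ℝ E']
  {M : Type*} [TopologicalSpace M] [ChartedSpace E' M]
  {μ : M → N} {φ : ∀ m : M, TangentSpace 𝓘(ℝ, E') m →ₗ[ℝ] TangentSpace 𝓘(ℝ, E') m →ₗ[ℝ] ℝ}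

theorem formRel_iff (m : M) (e : GenTangent 𝓘(ℝ, E') m) (e' : GenTangent 𝓘(ℝ, E) (μ m)) :
    formRel 𝓘(ℝ, E') 𝓘(ℝ, E) μ φ ⟨m, e⟩ ⟨μ m, e'⟩ ↔
      mfderiv 𝓘(ℝ, E') 𝓘(ℝ, E) μ m e.1 = e'.1 ∧
      ∀ v, e.2 v = e'.2 (mfderiv 𝓘(ℝ, E') 𝓘(ℝ, E) μ m v) - φ m e.1 v := by
  constructor
  · rintro ⟨x, X, α, h1, h2⟩
    obtain ⟨rfl, h1⟩ := Sigma.mk.inj_iff.1 h1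
    obtain ⟨-, h2⟩ := Sigma.mk.inj_iff.1 h2
    rw [eq_of_heq h1, eq_of_heq h2]
    refine ⟨rfl, fun v => ?_⟩
    simp only [LinearMap.add_apply, LinearMap.neg_apply, LinearMap.comp_apply]
    exact neg_add_eq_sub _ _
  · rintro ⟨h1, h2⟩
    refine ⟨m, e.1, e'.2, ?_, ?_⟩
    · refine Sigma.ext rfl (heq_of_eq (Prod.ext rfl (LinearMap.ext fun v => ?_)))
      refine (h2 v).trans ?_
      simp only [LinearMap.add_apply, LinearMap.neg_apply, LinearMap.comp_apply]
      exact (neg_add_eq_sub _ _).symm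
    · exact Sigma.ext rfl (heq_of_eq (Prod.ext h1.symm rfl))

theorem formRel_support {u : Σ m : M, GenTangent 𝓘(ℝ, E') m} {v : Σ x : N, GenTangent 𝓘(ℝ, E) x}
    (h : formRel 𝓘(ℝ, E') 𝓘(ℝ, E) μ φ u v) : v.1 = μ u.1 := by
  obtain ⟨x, X, α, rfl, rfl⟩ := h
  rfl

end FormRel

section MomentFibre

variable {𝔡 : Type*} [LieRing 𝔡] [LieAlgebra ℝ 𝔡] [FiniteDimensional ℝ 𝔡]
  (D : InvariantMetric 𝔡)
  {E : Type*} [NormedAddCommGroup E] [NormedSpace ℝ E] [FiniteDimensional ℝ E]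
  {N : Type*} [TopologicalSpace N] [ChartedSpace E N] [IsManifold 𝓘(ℝ, E) ∞ N] [T2Space N]
  (ρ : LieAction 𝓘(ℝ, E) 𝔡 N) (s : ∀ x : N, TangentSpace 𝓘(ℝ, E) x →ₗ[ℝ] 𝔡)
  {E' : Type*} [NormedAddCommGroup E'] [NormedSpace ℝ E'] [FiniteDimensional ℝ E']
  {M : Type*} [TopologicalSpace M] [ChartedSpace E' M] [IsManifold 𝓘(ℝ, E') ∞ M] [T2Space M]
  (μ : M → N) (φ : ∀ m : M, TangentSpace 𝓘(ℝ, E') m →ₗ[ℝ] TangentSpace 𝓘(ℝ, E') m →ₗ[ℝ] ℝ)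

/-- The fibre at `(μ m, m)` of the relation `R_{μ,φ}`, in terms of `𝔡`: the elements `(h, X + β)` with
`ρ(h) = μ_* X` and `β = ⟨h, s ∘ μ_*⟩ - ι_X φ`. -/
def momentFibre (m : M) : Set (𝔡 × GenTangent 𝓘(ℝ, E') m) :=
  {e | mfderiv 𝓘(ℝ, E') 𝓘(ℝ, E) μ m e.2.1 = ρ.field e.1 (μ m) ∧
    ∀ v, e.2.2 v = D.form e.1 (s (μ m) (mfderiv 𝓘(ℝ, E') 𝓘(ℝ, E) μ m v)) - φ m e.2.1 v}

theorem splitFormRel_iff (m : M) (e : GenTangent 𝓘(ℝ, E') m) (h : 𝔡) :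
    splitFormRel D ρ s μ φ ⟨m, e⟩ ⟨μ m, h⟩ ↔ (h, e) ∈ momentFibre D ρ s μ φ m :=
  formRel_iff m e ((actionCourant D ρ).splitMap s (μ m) h)

theorem graphFibre_splitFormRel :
    graphFibre μ (splitFormRel D ρ s μ φ) = momentFibre D ρ s μ φ :=
  funext fun m => Set.ext fun e => splitFormRel_iff D ρ s μ φ m e.2 e.1

variable {D ρ s μ φ}

/-- A `𝔡`-valued function on `M` and a section of `TM ⊕ T^*M` as a section over `N × M`. -/
noncomputable def sectionOfAlong {F : M → 𝔡} (hF : SmoothVec E' F)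
    {b : ∀ m : M, GenTangent 𝓘(ℝ, E') m} (hb : SmoothGen b) :
    CourantData.SectionSum (actionCourant D ρ) (tangentCourant 𝓘(ℝ, E') (B := M) 0) where
  n := Module.finrank ℝ 𝔡 + 1
  f := Fin.cons (α := fun _ => N × M → ℝ) (fun _ => 1)
    fun i p => (Module.finBasis ℝ 𝔡).coord i (F p.2)
  a := Fin.cons (α := fun _ => N → 𝔡) (fun _ => 0) fun i _ => Module.finBasis ℝ 𝔡 i
  b := Fin.cons (α := fun _ => ∀ m : M, GenTangent 𝓘(ℝ, E') m) b fun _ _ => 0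
  smooth_f := by
    refine Fin.cases contMDiff_const fun i => ?_
    have h : SmoothFun (𝓘(ℝ, E).prod 𝓘(ℝ, E'))
        (fun p : N × M => (Module.finBasis ℝ 𝔡).coord i (F p.2)) :=
      ContMDiff.comp (I' := 𝓘(ℝ, E')) (g := fun m => (Module.finBasis ℝ 𝔡).coord i (F m))
        (hF _) contMDiff_snd
    exact h
  smooth_a := by
    refine Fin.cases ?_ fun i => ?_
    · exact SmoothVec.const (E := E) (0 : 𝔡)
    · exact SmoothVec.const (E := E) _
  smooth_b := by
    refine Fin.cases hb fun i => ⟨SmoothField.zero, fun X hX => ?_⟩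
    exact SmoothFun.const 0

theorem sectionOfAlong_eval {F : M → 𝔡} (hF : SmoothVec E' F)
    {b : ∀ m : M, GenTangent 𝓘(ℝ, E') m} (hb : SmoothGen b) (p : N × M) :
    (sectionOfAlong (D := D) (ρ := ρ) hF hb).eval p = (F p.2, b p.2) := by
  have h := Fin.sum_univ_succ fun j : Fin (Module.finrank ℝ 𝔡 + 1) =>
    (sectionOfAlong (D := D) (ρ := ρ) hF hb).f j p •
      (((sectionOfAlong (D := D) (ρ := ρ) hF hb).a j p.1,
        (sectionOfAlong (D := D) (ρ := ρ) hF hb).b j p.2) : 𝔡 × GenTangent 𝓘(ℝ, E') p.2)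
  refine Eq.trans h ?_
  have h1 : ∀ i : Fin (Module.finrank ℝ 𝔡),
      (sectionOfAlong (D := D) (ρ := ρ) hF hb).f i.succ p •
      (((sectionOfAlong (D := D) (ρ := ρ) hF hb).a i.succ p.1,
        (sectionOfAlong (D := D) (ρ := ρ) hF hb).b i.succ p.2) : 𝔡 × GenTangent 𝓘(ℝ, E') p.2) =
      ((Module.finBasis ℝ 𝔡).repr (F p.2) i • Module.finBasis ℝ 𝔡 i, 0) := fun i =>
    Prod.ext rfl (smul_zero _)
  rw [Finset.sum_congr rfl fun i _ => h1 i]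
  refine Prod.ext ?_ ?_
  · rw [Prod.fst_add, Prod.fst_sum]
    refine Eq.trans ?_ ((Module.finBasis ℝ 𝔡).sum_repr (F p.2))
    refine Eq.trans (congrArg (· + _) (smul_zero (1 : ℝ))) (zero_add _)
  · rw [Prod.snd_add, Prod.snd_sum, Finset.sum_const_zero, add_zero]
    exact one_smul ℝ (b p.2)

variable (hexact : (actionCourant D ρ).IsExact) (hs : (actionCourant D ρ).IsIsotropicSplitting s)
  (hμ : ContMDiff 𝓘(ℝ, E') 𝓘(ℝ, E) ∞ μ) (hφ : IsTwoForm 𝓘(ℝ, E') φ)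

include hs in
theorem split_mem_momentFibre (m : M) (x : TangentSpace 𝓘(ℝ, E') m) :
    ((s (μ m) (mfderiv 𝓘(ℝ, E') 𝓘(ℝ, E) μ m x), (x, -φ m x)) :
      𝔡 × GenTangent 𝓘(ℝ, E') m) ∈ momentFibre D ρ s μ φ m := by
  refine ⟨(hs.field_apply _ _).symm, fun v => ?_⟩
  rw [hs.form_apply, zero_sub, LinearMap.neg_apply]

include hs hμ hφ in
/-- Every element of the fibre is the value of a smooth section of the Dirac structure. -/
theorem exists_section_momentFibre {m : M} {e : 𝔡 × GenTangent 𝓘(ℝ, E') m}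
    (he : e ∈ momentFibre D ρ s μ φ m) :
    ∃ (F : M → 𝔡) (b : ∀ m : M, GenTangent 𝓘(ℝ, E') m), SmoothVec E' F ∧ SmoothGen b ∧
      (∀ m, (F m, b m) ∈ momentFibre D ρ s μ φ m) ∧ (F m, b m) = e := by
  obtain ⟨X, hX, hXm⟩ := exists_smoothField_eq e.2.1
  set κ := e.1 - s (μ m) (mfderiv 𝓘(ℝ, E') 𝓘(ℝ, E) μ m e.2.1) with hκ
  let F : M → 𝔡 := fun m => s (μ m) (mfderiv 𝓘(ℝ, E') 𝓘(ℝ, E) μ m (X m)) +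
    (κ - splitProj ρ s (μ m) κ)
  have hF : SmoothVec E' F := (smoothVec_split_map hs hμ hX).add
    ((SmoothVec.const κ).sub ((smoothVec_splitProj hs κ).comp hμ))
  let b : ∀ m : M, GenTangent 𝓘(ℝ, E') m := fun m => (X m,
    D.form (F m) ∘ₗ s (μ m) ∘ₗ
      (mfderiv 𝓘(ℝ, E') 𝓘(ℝ, E) μ m : TangentSpace 𝓘(ℝ, E') m →ₗ[ℝ] TangentSpace 𝓘(ℝ, E) (μ m)) -
      φ m (X m))
  have hb : SmoothGen b := ⟨hX, fun Y hY =>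
    (SmoothVec.form (F := D.form) hF (smoothVec_split_map hs hμ hY)).sub (hφ.smooth X Y hX hY)⟩
  have hFb : ∀ m, (F m, b m) ∈ momentFibre D ρ s μ φ m := fun m => by
    refine ⟨?_, fun v => rfl⟩
    change _ = ρ.field (_ + (κ - s (μ m) (ρ.field κ (μ m)))) (μ m)
    rw [ρ.field_add, ρ.field_sub, hs.field_apply, hs.field_apply, sub_self, add_zero]
  have hFm : F m = e.1 := by
    have h1 : ρ.field κ (μ m) = 0 := by
      rw [hκ, ρ.field_sub, hs.field_apply, he.1, sub_self]
    change s (μ m) (mfderiv 𝓘(ℝ, E') 𝓘(ℝ, E) μ m (X m)) + (κ - s (μ m) (ρ.field κ (μ m))) = _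
    rw [h1, hXm, map_zero, sub_zero, hκ]
    abel
  refine ⟨F, b, hF, hb, hFb, Prod.ext hFm (Prod.ext hXm (LinearMap.ext fun v => ?_))⟩
  rw [he.2 v, ← hFm]
  refine ((hFb m).2 v).trans ?_
  change _ - φ m (X m) v = _
  rw [hXm]

include hexact hs hμ hφ in
/-- The pairing of the bracket of two sections of the Dirac structure with a third one is the sum of
the pullback of the curvature and the exterior derivative of the 2-form. -/
theorem triple_sub_genTriple {F G : M → 𝔡} {b b' : ∀ m : M, GenTangent 𝓘(ℝ, E') m}
    (hF : SmoothVec E' F) (hG : SmoothVec E' G) (hb : SmoothGen b) (hb' : SmoothGen b')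
    (hFb : ∀ m, (F m, b m) ∈ momentFibre D ρ s μ φ m)
    (hGb' : ∀ m, (G m, b' m) ∈ momentFibre D ρ s μ φ m) (m : M)
    {Z : ∀ m : M, TangentSpace 𝓘(ℝ, E') m} (hZ : SmoothField 𝓘(ℝ, E') Z) {η : 𝔡}
    {l : CotangentFibre 𝓘(ℝ, E') m} (he : (η, (Z m, l)) ∈ momentFibre D ρ s μ φ m) :
    triple D F G m (b m).1 (b' m).1 η (Z m) - genTriple b b' m l Z =
      curvTensor D ρ s (μ m) (mfderiv 𝓘(ℝ, E') 𝓘(ℝ, E) μ m (b m).1)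
        (mfderiv 𝓘(ℝ, E') 𝓘(ℝ, E) μ m (b' m).1) (mfderiv 𝓘(ℝ, E') 𝓘(ℝ, E) μ m (Z m)) +
      formDeriv φ (fun m => (b m).1) (fun m => (b' m).1) Z m := by
  have h1 := triple_expansion hexact hs hμ hF hG hb.1 hb'.1 hZ (fun m => (hFb m).1)
    (fun m => (hGb' m).1) m he.1
  have hα : ∀ {F : M → 𝔡} {b : ∀ m : M, GenTangent 𝓘(ℝ, E') m},
      (∀ m, (F m, b m) ∈ momentFibre D ρ s μ φ m) → ∀ m v,
      D.form (F m) (s (μ m) (mfderiv 𝓘(ℝ, E') 𝓘(ℝ, E) μ m v)) = (b m).2 v + φ m (b m).1 v :=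
    fun h m v => by
      have := (h m).2 v
      simp only at this
      rw [this]; ring
  have hαl : ∀ v, D.form η (s (μ m) (mfderiv 𝓘(ℝ, E') 𝓘(ℝ, E) μ m v)) = l v + φ m (Z m) v :=
    fun v => by
      have := he.2 v
      simp only at this
      rw [this]; ring
  simp only [hα hFb, hα hGb', hαl] at h1
  rw [dirDeriv_add (hb'.2 _ hZ) (hφ.smooth _ _ hb'.1 hZ),
    dirDeriv_add (hb.2 _ hb'.1) (hφ.smooth _ _ hb.1 hb'.1),
    dirDeriv_add (hb.2 _ hZ) (hφ.smooth _ _ hb.1 hZ)] at h1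
  rw [h1, genTriple, formDeriv]
  ring

variable (D ρ s μ φ) in
/-- The integrability condition `μ^* γ + dφ = 0` for `R_{μ,φ}` (up to the order of the arguments
of `γ`), where `γ` is the curvature of the splitting `s`. -/
def CurvatureEq : Prop := ∀ X Y Z : ∀ m : M, TangentSpace 𝓘(ℝ, E') m, SmoothField 𝓘(ℝ, E') X →
  SmoothField 𝓘(ℝ, E') Y → SmoothField 𝓘(ℝ, E') Z → ∀ m,
  curvTensor D ρ s (μ m) (mfderiv 𝓘(ℝ, E') 𝓘(ℝ, E) μ m (X m))
    (mfderiv 𝓘(ℝ, E') 𝓘(ℝ, E) μ m (Y m)) (mfderiv 𝓘(ℝ, E') 𝓘(ℝ, E) μ m (Z m)) +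
  formDeriv φ X Y Z m = 0

include hs hφ in
theorem momentFibre_isotropic {m : M} {e e' : 𝔡 × GenTangent 𝓘(ℝ, E') m}
    (hexact : (actionCourant D ρ).IsExact)
    (he : e ∈ momentFibre D ρ s μ φ m) (he' : e' ∈ momentFibre D ρ s μ φ m) :
    D.form e.1 e'.1 - genPairing e.2 e'.2 = 0 := by
  rw [genPairing, he.2, he'.2, he.1, he'.1, hφ.swap m e'.2.1, ← form_split_add hexact hs (μ m) e.1,
    D.symm e'.1]
  ring

include hexact hs hφ in
/-- The fibres of `R_{μ,φ}` are Lagrangian. -/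
theorem mem_momentFibre_iff {m : M} {e : 𝔡 × GenTangent 𝓘(ℝ, E') m} :
    e ∈ momentFibre D ρ s μ φ m ↔ ∀ e' ∈ momentFibre D ρ s μ φ m,
      D.form e.1 e'.1 - genPairing e.2 e'.2 = 0 := by
  refine ⟨fun he e' he' => momentFibre_isotropic hs hφ hexact he he', fun h => ⟨?_, fun v => ?_⟩⟩
  · -- pairing with the elements of the kernel of the anchor
    rw [← sub_eq_zero]
    refine (Module.forall_dual_apply_eq_zero_iff ℝ _).1 fun β => ?_
    obtain ⟨κ, hκ⟩ := D.exists_form_eq (β ∘ₗ ρ.evalAt (μ m))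
    have hκ0 : ρ.field κ (μ m) = 0 := hexact.range_le_ker (μ m) β κ hκ
    have h1 := h (κ, (0, D.form κ ∘ₗ s (μ m) ∘ₗ
      (mfderiv 𝓘(ℝ, E') 𝓘(ℝ, E) μ m :
        TangentSpace 𝓘(ℝ, E') m →ₗ[ℝ] TangentSpace 𝓘(ℝ, E) (μ m)))) ⟨?_, fun v => ?_⟩
    · have h2 : D.form κ (s (μ m) (mfderiv 𝓘(ℝ, E') 𝓘(ℝ, E) μ m e.2.1)) =
          β (mfderiv 𝓘(ℝ, E') 𝓘(ℝ, E) μ m e.2.1) := by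
        rw [hκ, LinearMap.comp_apply, ρ.evalAt_apply, hs.field_apply]
      have h3 : D.form e.1 κ - (e.2.2 0 +
        D.form κ (s (μ m) (mfderiv 𝓘(ℝ, E') 𝓘(ℝ, E) μ m e.2.1))) = 0 := h1
      rw [h2, map_zero, D.symm, hκ] at h3
      rw [map_sub]
      simp only [LinearMap.comp_apply, ρ.evalAt_apply] at h3
      linarith
    · rw [map_zero, hκ0]
    · simp
  · have h1 := h _ (split_mem_momentFibre hs m v)
    simp only [genPairing, LinearMap.neg_apply] at h1
    rw [hφ.swap m v] at h1
    linarith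

theorem prodConj_isCoanchor_iff (m : M) (β : CotangentFibre (𝓘(ℝ, E).prod 𝓘(ℝ, E')) (graphMap μ m))
    (e : 𝔡 × GenTangent 𝓘(ℝ, E') m) :
    ((actionCourant D ρ).prodConj (tangentCourant 𝓘(ℝ, E') (B := M) 0)).IsCoanchor (graphMap μ m)
      β e ↔ ∀ e' : 𝔡 × GenTangent 𝓘(ℝ, E') m, D.form e.1 e'.1 - genPairing e.2 e'.2 =
        β ((ρ.field e'.1 (μ m), e'.2.1) :
          TangentSpace 𝓘(ℝ, E) (μ m) × TangentSpace 𝓘(ℝ, E') m) := Iff.rfl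

end MomentFibre

section MomentDirac

variable {𝔡 : Type*} [LieRing 𝔡] [LieAlgebra ℝ 𝔡] [FiniteDimensional ℝ 𝔡]
  {D : InvariantMetric 𝔡}
  {E : Type*} [NormedAddCommGroup E] [NormedSpace ℝ E] [FiniteDimensional ℝ E]
  {N : Type*} [TopologicalSpace N] [ChartedSpace E N] [IsManifold 𝓘(ℝ, E) ∞ N] [T2Space N]
  {ρ : LieAction 𝓘(ℝ, E) 𝔡 N} {s : ∀ x : N, TangentSpace 𝓘(ℝ, E) x →ₗ[ℝ] 𝔡}
  {E' : Type*} [NormedAddCommGroup E'] [NormedSpace ℝ E'] [FiniteDimensional ℝ E']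
  {M : Type*} [TopologicalSpace M] [ChartedSpace E' M] [IsManifold 𝓘(ℝ, E') ∞ M] [T2Space M]
  {μ : M → N} {φ : ∀ m : M, TangentSpace 𝓘(ℝ, E') m →ₗ[ℝ] TangentSpace 𝓘(ℝ, E') m →ₗ[ℝ] ℝ}
  (hexact : (actionCourant D ρ).IsExact) (hs : (actionCourant D ρ).IsIsotropicSplitting s)
  (hμ : ContMDiff 𝓘(ℝ, E') 𝓘(ℝ, E) ∞ μ) (hφ : IsTwoForm 𝓘(ℝ, E') φ)

include hexact in
/-- The elements `a^* β` of the product project to zero. -/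
theorem anchor_eq_zero_of_isCoanchor {m : M}
    {β : CotangentFibre (𝓘(ℝ, E).prod 𝓘(ℝ, E')) (graphMap μ m)} {e : 𝔡 × GenTangent 𝓘(ℝ, E') m}
    (he : ((actionCourant D ρ).prodConj (tangentCourant 𝓘(ℝ, E') (B := M) 0)).IsCoanchor
      (graphMap μ m) β e) : ρ.field e.1 (μ m) = 0 ∧ e.2.1 = 0 := by
  replace he := (prodConj_isCoanchor_iff m β e).1 he
  let i₁ : TangentSpace 𝓘(ℝ, E) (μ m) →ₗ[ℝ] TangentSpace (𝓘(ℝ, E).prod 𝓘(ℝ, E')) (graphMap μ m) :=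
    LinearMap.inl ℝ (TangentSpace 𝓘(ℝ, E) (μ m)) (TangentSpace 𝓘(ℝ, E') m)
  constructor
  · refine hexact.range_le_ker (μ m) (β ∘ₗ i₁) e.1 fun h => ?_
    have h1 := he (h, (0, 0))
    simp only [genPairing, map_zero, LinearMap.zero_apply, add_zero, sub_zero] at h1
    exact h1
  · refine (Module.forall_dual_apply_eq_zero_iff ℝ _).1 fun l => ?_
    have h1 := he (0, (0, l))
    simp only [genPairing, map_zero, zero_add, zero_sub, ρ.field_zero] at h1
    have h2 : β ((0, 0) : TangentSpace 𝓘(ℝ, E) (μ m) × TangentSpace 𝓘(ℝ, E') m) = 0 := map_zero β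
    rw [h2] at h1
    linarith

include hexact hs hμ in
/-- The image under `a^*` of the annihilator of the tangent space of the graph lies in `R_{μ,φ}`. -/
theorem mem_momentFibre_of_isCoanchor {m : M}
    {β : CotangentFibre (𝓘(ℝ, E).prod 𝓘(ℝ, E')) (graphMap μ m)} {e : 𝔡 × GenTangent 𝓘(ℝ, E') m}
    (hβ : ∀ v, β (mfderiv 𝓘(ℝ, E') (𝓘(ℝ, E).prod 𝓘(ℝ, E')) (graphMap μ) m v) = 0)
    (he : ((actionCourant D ρ).prodConj (tangentCourant 𝓘(ℝ, E') (B := M) 0)).IsCoanchor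
      (graphMap μ m) β e) : e ∈ momentFibre D ρ s μ φ m := by
  obtain ⟨h1, h2⟩ := anchor_eq_zero_of_isCoanchor hexact he
  replace he := (prodConj_isCoanchor_iff m β e).1 he
  refine ⟨by rw [h1, h2, map_zero], fun v => ?_⟩
  have h3 := he (s (μ m) (mfderiv 𝓘(ℝ, E') 𝓘(ℝ, E) μ m v), (v, 0))
  rw [hs.field_apply] at h3
  have h4 := hβ v
  rw [mfderiv_graphMap hμ] at h4
  simp only [genPairing, LinearMap.zero_apply, add_zero] at h3
  rw [h2, map_zero, LinearMap.zero_apply, sub_zero]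
  have h5 := h3.trans h4
  linarith

include hexact hs hμ in
/-- The kernel of the anchor on `R_{μ,φ}` consists of images of covectors that annihilate the tangent
space of the graph. -/
theorem exists_isCoanchor_of_mem_momentFibre {m : M} {e : 𝔡 × GenTangent 𝓘(ℝ, E') m}
    (he : e ∈ momentFibre D ρ s μ φ m) (h1 : ρ.field e.1 (μ m) = 0) (h2 : e.2.1 = 0) :
    ∃ β : CotangentFibre (𝓘(ℝ, E).prod 𝓘(ℝ, E')) (graphMap μ m),
      (∀ v, β (mfderiv 𝓘(ℝ, E') (𝓘(ℝ, E).prod 𝓘(ℝ, E')) (graphMap μ) m v) = 0) ∧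
      ((actionCourant D ρ).prodConj (tangentCourant 𝓘(ℝ, E') (B := M) 0)).IsCoanchor
        (graphMap μ m) β e := by
  let π₁ : TangentSpace (𝓘(ℝ, E).prod 𝓘(ℝ, E')) (graphMap μ m) →ₗ[ℝ]
      TangentSpace 𝓘(ℝ, E) (μ m) :=
    LinearMap.fst ℝ (TangentSpace 𝓘(ℝ, E) (μ m)) (TangentSpace 𝓘(ℝ, E') m)
  let π₂ : TangentSpace (𝓘(ℝ, E).prod 𝓘(ℝ, E')) (graphMap μ m) →ₗ[ℝ]
      TangentSpace 𝓘(ℝ, E') m :=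
    LinearMap.snd ℝ (TangentSpace 𝓘(ℝ, E) (μ m)) (TangentSpace 𝓘(ℝ, E') m)
  have h3 : ∀ v, e.2.2 v = D.form e.1 (s (μ m) (mfderiv 𝓘(ℝ, E') 𝓘(ℝ, E) μ m v)) := fun v => by
    rw [he.2 v, h2, map_zero, LinearMap.zero_apply, sub_zero]
  refine ⟨D.form e.1 ∘ₗ s (μ m) ∘ₗ π₁ - e.2.2 ∘ₗ π₂, fun v => ?_,
    (prodConj_isCoanchor_iff m _ e).2 fun e' => ?_⟩
  · rw [mfderiv_graphMap hμ]
    exact sub_eq_zero.2 (h3 v).symm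
  · rw [genPairing, h2, map_zero, add_zero, form_of_field_eq_zero hexact hs h1]
    rfl

include hexact hs hμ hφ in
/-- `R_{μ,φ}` is an exact Dirac structure if the integrability condition holds. -/
theorem isExactDirac_momentFibre (hC : CurvatureEq D ρ s μ φ) :
    ((actionCourant D ρ).prodConj (tangentCourant 𝓘(ℝ, E') (B := M) 0)).IsExactDirac 𝓘(ℝ, E')
      (graphMap μ) (momentFibre D ρ s μ φ) where
  lagrangian m e := mem_momentFibre_iff hexact hs hφ
  subbundle m e he := by
    obtain ⟨F, b, hF, hb, hFb, hm⟩ := exists_section_momentFibre hs hμ hφ he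
    refine ⟨(sectionOfAlong hF hb).eval, ⟨_, rfl⟩, ?_, Filter.Eventually.of_forall fun m' => ?_⟩
    · rw [sectionOfAlong_eval]; exact hm
    · rw [sectionOfAlong_eval]; exact hFb m'
  involutive σ₁ σ₂ σ₃ h₁ h₂ h hσ₁ hσ₂ m := by
    obtain ⟨τ₁, rfl⟩ := h₁
    obtain ⟨τ₂, rfl⟩ := h₂
    have hsm : ∀ τ : CourantData.SectionSum (actionCourant D ρ)
        (tangentCourant 𝓘(ℝ, E') (B := M) 0), SmoothVec E' (fun m => (τ.eval (μ m, m)).1) ∧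
        SmoothGen (fun m => (τ.eval (μ m, m)).2) := fun τ => by
      have h1 : ∀ m, (τ.eval (μ m, m)).1 = ∑ j, τ.f j (μ m, m) • τ.a j (μ m) :=
        fun m => Prod.fst_sum
      have h2 : ∀ m, (τ.eval (μ m, m)).2 = ∑ j, τ.f j (μ m, m) • τ.b j m :=
        fun m => Prod.snd_sum
      simp only [h1, h2]
      exact ⟨SmoothVec.sum fun j _ => SmoothVec.smul ((τ.smooth_f j).comp_graphMap hμ)
        (SmoothVec.comp (τ.smooth_a j) hμ),
        SmoothGen.sum fun j => SmoothGen.smul ((τ.smooth_f j).comp_graphMap hμ) (τ.smooth_b j)⟩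
    refine (mem_momentFibre_iff hexact hs hφ).2 fun e he => ?_
    obtain ⟨Z, hZ, hZm⟩ := exists_smoothField_eq e.2.1
    have he' : (e.1, (Z m, e.2.2)) ∈ momentFibre D ρ s μ φ m := by rw [hZm]; exact he
    have h3 := prodConj_bracket_graph hμ h (fun m => (hσ₁ m).1) (fun m => (hσ₂ m).1) m hZ e.2.2
      he'.1
    rw [triple_sub_genTriple hexact hs hμ hφ (hsm τ₁).1 (hsm τ₂).1 (hsm τ₁).2 (hsm τ₂).2 hσ₁ hσ₂ m
      hZ he', hC _ _ _ (hsm τ₁).2.1 (hsm τ₂).2.1 hZ m, hZm] at h3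
    exact h3
  coanchor_mem m β e hβ he := mem_momentFibre_of_isCoanchor hexact hs hμ hβ he
  injective m β hβ he := by
    replace he : ∀ e' : 𝔡 × GenTangent 𝓘(ℝ, E') m, D.form 0 e'.1 - genPairing 0 e'.2 =
        β ((ρ.field e'.1 (μ m), e'.2.1) :
          TangentSpace 𝓘(ℝ, E) (μ m) × TangentSpace 𝓘(ℝ, E') m) :=
      (prodConj_isCoanchor_iff m β 0).1 he
    refine LinearMap.ext fun v => ?_
    have h1 := he (s (μ m) (show TangentSpace 𝓘(ℝ, E) (μ m) × TangentSpace 𝓘(ℝ, E') m from v).1,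
      ((show TangentSpace 𝓘(ℝ, E) (μ m) × TangentSpace 𝓘(ℝ, E') m from v).2, 0))
    rw [hs.field_apply] at h1
    refine Eq.trans h1.symm ?_
    simp [genPairing]
  ker_iff m e he := by
    refine ⟨fun h => exists_isCoanchor_of_mem_momentFibre hexact hs hμ he (congrArg Prod.fst h)
      (congrArg Prod.snd h), ?_⟩
    rintro ⟨β, -, hβ⟩
    obtain ⟨h1, h2⟩ := anchor_eq_zero_of_isCoanchor hexact hβ
    exact Prod.ext h1 h2
  range_eq m := by
    refine Set.Subset.antisymm ?_ ?_
    · rintro _ ⟨e, he, rfl⟩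
      exact ⟨e.2.1, (mfderiv_graphMap hμ m _).trans (Prod.ext he.1 rfl)⟩
    · rintro _ ⟨v, rfl⟩
      have h1 : ((ρ.field (s (μ m) (mfderiv 𝓘(ℝ, E') 𝓘(ℝ, E) μ m v)) (μ m), v) :
          TangentSpace 𝓘(ℝ, E) (μ m) × TangentSpace 𝓘(ℝ, E') m) =
          (mfderiv 𝓘(ℝ, E') 𝓘(ℝ, E) μ m v, v) := Prod.ext (hs.field_apply _ _) rfl
      exact ⟨_, split_mem_momentFibre hs m v, h1.trans (mfderiv_graphMap hμ m v).symm⟩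

/-- The metric of `(𝔡 × N) × \overline{𝕋M}` is non-degenerate. -/
theorem exists_prodPairing_eq (m : M) (l : Module.Dual ℝ (𝔡 × GenTangent 𝓘(ℝ, E') m)) :
    ∃ w : 𝔡 × GenTangent 𝓘(ℝ, E') m, ∀ e, D.form w.1 e.1 - genPairing w.2 e.2 = l e := by
  have : FiniteDimensional ℝ (TangentSpace 𝓘(ℝ, E') m) := inferInstanceAs (FiniteDimensional ℝ E')
  obtain ⟨u, hu⟩ := D.exists_form_eq (l ∘ₗ LinearMap.inl ℝ _ _)
  obtain ⟨v, hv⟩ := (Module.evalEquiv ℝ (TangentSpace 𝓘(ℝ, E') m)).surjective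
    (l ∘ₗ LinearMap.inr ℝ _ _ ∘ₗ LinearMap.inr ℝ _ _)
  refine ⟨(u, (-v, -(l ∘ₗ LinearMap.inr ℝ _ _ ∘ₗ LinearMap.inl ℝ _ _))), fun e => ?_⟩
  have h1 : e.2.2 v = l (0, (0, e.2.2)) := LinearMap.congr_fun hv e.2.2
  have h2 : D.form u e.1 = l (e.1, 0) := hu e.1
  have h3 : e = (e.1, 0) + ((0, (0, e.2.2)) + (0, (e.2.1, 0))) := by
    refine Prod.ext ?_ (Prod.ext ?_ ?_) <;> simp
  have h4 := congrArg l h3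
  rw [map_add, map_add] at h4
  rw [h4, genPairing, ← h1, ← h2]
  simp
  ring

include hexact hs hμ hφ in
/-- Conversely, the integrability condition holds if `R_{μ,φ}` is a Dirac structure. -/
theorem curvatureEq_of_isDirac
    (h : ((actionCourant D ρ).prodConj (tangentCourant 𝓘(ℝ, E') (B := M) 0)).IsDirac
      (graphMap μ) (momentFibre D ρ s μ φ)) : CurvatureEq D ρ s μ φ := by
  intro X Y Z hX hY hZ m
  have hsec : ∀ {X : ∀ m : M, TangentSpace 𝓘(ℝ, E') m}, SmoothField 𝓘(ℝ, E') X →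
      SmoothGen (fun m => ((X m, -φ m (X m)) : GenTangent 𝓘(ℝ, E') m)) := fun {X} hX =>
    ⟨hX, fun Y hY => (hφ.smooth X Y hX hY).neg⟩
  have hF := smoothVec_split_map hs hμ hX
  have hG := smoothVec_split_map hs hμ hY
  let σ := sectionOfAlong (D := D) (ρ := ρ) hF (hsec hX)
  let σ' := sectionOfAlong (D := D) (ρ := ρ) hG (hsec hY)
  choose c hc using fun j k =>
    actionCourant_bracket_exists (D := D) (ρ := ρ) (σ.smooth_a j) (σ'.smooth_a k)
  choose d hd using fun j k => tangentCourant_bracket_exists (σ.smooth_b j) (σ'.smooth_b k)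
  let L : ∀ (F : N × M → ℝ) (p : N × M), Module.Dual ℝ (𝔡 × GenTangent 𝓘(ℝ, E') p.2) :=
    fun F p =>
    { toFun := fun e => dirDeriv (𝓘(ℝ, E).prod 𝓘(ℝ, E')) F p
        (CourantData.prodAnchor (actionCourant D ρ) (tangentCourant 𝓘(ℝ, E') (B := M) 0) p e)
      map_add' := fun e e' => by
        rw [map_add]; exact map_add (mfderiv (𝓘(ℝ, E).prod 𝓘(ℝ, E')) 𝓘(ℝ, ℝ) F p) _ _
      map_smul' := fun r e => by
        rw [map_smul]; exact map_smul (mfderiv (𝓘(ℝ, E).prod 𝓘(ℝ, E')) 𝓘(ℝ, ℝ) F p) _ _ }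
  let P : ∀ p : N × M, 𝔡 × GenTangent 𝓘(ℝ, E') p.2 → Module.Dual ℝ (𝔡 × GenTangent 𝓘(ℝ, E') p.2) :=
    fun p => CourantData.prodPairing (actionCourant D ρ) (tangentCourant 𝓘(ℝ, E') (B := M) 0) p
  choose w hw using fun p : N × M => exists_prodPairing_eq (D := D) p.2 (∑ j, ∑ k,
    ((σ.f j p * σ'.f k p) • P p (c j k p.1, d j k p.2)
      + (σ.f j p * L (σ'.f k) p (σ.a j p.1, σ.b j p.2)) • P p (σ'.a k p.1, σ'.b k p.2)
      - (σ'.f k p * L (σ.f j) p (σ'.a k p.1, σ'.b k p.2)) • P p (σ.a j p.1, σ.b j p.2)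
      + (σ'.f k p * P p (σ.a j p.1, σ.b j p.2) (σ'.a k p.1, σ'.b k p.2)) • L (σ.f j) p))
  have hbr : ((actionCourant D ρ).prodConj (tangentCourant 𝓘(ℝ, E') (B := M) 0)).bracket
      σ.eval σ'.eval w := by
    refine ⟨σ, σ', rfl, rfl, c, d, hc, hd, fun p e => (hw p e).trans ?_⟩
    simp only [LinearMap.sum_apply, LinearMap.add_apply, LinearMap.sub_apply,
      LinearMap.smul_apply, smul_eq_mul]
    rfl
  have hσ : ∀ m, σ.eval (graphMap μ m) = _ := fun m => sectionOfAlong_eval hF (hsec hX) _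
  have hσ' : ∀ m, σ'.eval (graphMap μ m) = _ := fun m => sectionOfAlong_eval hG (hsec hY) _
  have h1 := h.involutive _ _ w ⟨σ, rfl⟩ ⟨σ', rfl⟩ hbr
    (fun m => by rw [hσ]; exact split_mem_momentFibre hs m (X m))
    (fun m => by rw [hσ']; exact split_mem_momentFibre hs m (Y m)) m
  have he := split_mem_momentFibre (D := D) (ρ := ρ) (μ := μ) (φ := φ) hs m (Z m)
  have h2 := (mem_momentFibre_iff hexact hs hφ).1 h1 _ he
  have h3 := triple_sub_genTriple hexact hs hμ hφ hF hG (hsec hX) (hsec hY)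
    (fun m => split_mem_momentFibre hs m (X m)) (fun m => split_mem_momentFibre hs m (Y m)) m hZ he
  have hz : ∀ m, (σ.eval (μ m, m)) = _ := hσ
  have hz' : ∀ m, (σ'.eval (μ m, m)) = _ := hσ'
  have h4 := prodConj_bracket_graph hμ hbr
    (fun m => by rw [hz]; exact (split_mem_momentFibre (φ := φ) hs m (X m)).1)
    (fun m => by rw [hz']; exact (split_mem_momentFibre (φ := φ) hs m (Y m)).1) m hZ
    (-φ m (Z m)) he.1
  simp only [hz, hz'] at h4
  exact h3.symm.trans (h4.symm.trans h2)

end MomentDirac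

/-! ### The curvature of an isotropic splitting -/

section Curvature

variable {𝔡 : Type*} [LieRing 𝔡] [LieAlgebra ℝ 𝔡] [FiniteDimensional ℝ 𝔡]
  {D : InvariantMetric 𝔡}
  {E : Type*} [NormedAddCommGroup E] [NormedSpace ℝ E] [FiniteDimensional ℝ E]
  {N : Type*} [TopologicalSpace N] [ChartedSpace E N] [IsManifold 𝓘(ℝ, E) ∞ N] [T2Space N]
  {ρ : LieAction 𝓘(ℝ, E) 𝔡 N} {s : ∀ x : N, TangentSpace 𝓘(ℝ, E) x →ₗ[ℝ] 𝔡}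
  (hexact : (actionCourant D ρ).IsExact) (hs : (actionCourant D ρ).IsIsotropicSplitting s)

omit [FiniteDimensional ℝ E] [T2Space N] in
theorem SmoothVec.lie {f g : N → 𝔡} (hf : SmoothVec E f) (hg : SmoothVec E g) :
    SmoothVec E (fun x => ⁅f x, g x⁆) := fun l =>
  SmoothVec.form (F := LinearMap.compr₂ (LieModule.toEnd ℝ 𝔡 𝔡 : 𝔡 →ₗ[ℝ] 𝔡 →ₗ[ℝ] 𝔡) l) hf hg

theorem SmoothVec.smoothField {f : N → 𝔡} (hf : SmoothVec E f) :
    SmoothField 𝓘(ℝ, E) (fun x => ρ.field (f x) x) := by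
  have h : ∀ x, ρ.field (f x) x =
      ∑ i, (Module.finBasis ℝ 𝔡).coord i (f x) • ρ.field (Module.finBasis ℝ 𝔡 i) x := fun x => by
    conv_lhs => rw [← (Module.finBasis ℝ 𝔡).sum_repr (f x), ρ.field_sum_smul]
    rfl
  simp only [h]
  exact SmoothField.sum fun i _ => (ρ.smooth _).smul (hf _)

include hs

/-- The derivative of the projection `K = s ∘ a`. -/
noncomputable def splitProjDeriv (x : N) : TangentSpace 𝓘(ℝ, E) x →ₗ[ℝ] 𝔡 →ₗ[ℝ] 𝔡 :=
  LinearMap.mk₂ ℝ (fun u v => vecDeriv (fun y => splitProj ρ s y v) x u)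
    (fun u u' v => vecDeriv_map_add _ x u u') (fun c u v => vecDeriv_map_smul _ x c u)
    (fun u v v' => by
      simp only [map_add]
      exact vecDeriv_add (smoothVec_splitProj hs v) (smoothVec_splitProj hs v') x u)
    (fun c u v => by
      simp only [map_smul]
      have h := vecDeriv_smul (SmoothFun.const c) (smoothVec_splitProj hs v) x u
      rw [dirDeriv_const, zero_smul, zero_add] at h
      exact h)

theorem curvTensor_eq (x : N) (u v w : TangentSpace 𝓘(ℝ, E) x) :
    curvTensor D ρ s x u v w = D.form ⁅s x u, s x v⁆ (s x w)
      + D.form (splitProjDeriv hs x u (s x v)) (s x w)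
      - D.form (splitProjDeriv hs x v (s x u)) (s x w)
      + D.form (splitProjDeriv hs x w (s x u)) (s x v) := rfl

theorem form_splitProjDeriv_swap (x : N) (u v w : TangentSpace 𝓘(ℝ, E) x) :
    D.form (splitProjDeriv hs x u (s x v)) (s x w) =
      -D.form (splitProjDeriv hs x u (s x w)) (s x v) := by
  have h := dirDeriv_form D.form (smoothVec_splitProj hs (s x v))
    (smoothVec_splitProj hs (s x w)) x u
  have h1 : ∀ y, D.form (splitProj ρ s y (s x v)) (splitProj ρ s y (s x w)) = 0 :=
    fun y => hs.form_apply _ _ _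
  simp only [h1] at h
  rw [dirDeriv_const, splitProj_apply, splitProj_apply, hs.field_apply, hs.field_apply,
    D.symm (s x v)] at h
  exact eq_neg_of_add_eq_zero_left h.symm

theorem curvTensor_self₁₂ (x : N) (u w : TangentSpace 𝓘(ℝ, E) x) :
    curvTensor D ρ s x u u w = 0 := by
  have h := form_splitProjDeriv_swap hs x w u u
  rw [curvTensor_eq hs, lie_self, map_zero, LinearMap.zero_apply]
  linarith

theorem curvTensor_self₂₃ (x : N) (u v : TangentSpace 𝓘(ℝ, E) x) :
    curvTensor D ρ s x u v v = 0 := by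
  have h := form_splitProjDeriv_swap hs x u v v
  have h1 := form_lie_swap_right D (s x u) (s x v) (s x v)
  rw [curvTensor_eq hs]
  linarith

theorem curvTensor_cycle (x : N) (u v w : TangentSpace 𝓘(ℝ, E) x) :
    curvTensor D ρ s x w u v = curvTensor D ρ s x u v w := by
  have h1 := form_splitProjDeriv_swap hs x v w u
  have h2 := form_splitProjDeriv_swap hs x u v w
  have h3 := D.inv (s x w) (s x u) (s x v)
  rw [D.symm (s x w)] at h3
  rw [curvTensor_eq hs, curvTensor_eq hs]
  linarith

/-- The curvature of the splitting as a 3-form. -/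
noncomputable def curvForm (x : N) : TangentSpace 𝓘(ℝ, E) x →ₗ[ℝ] TangentSpace 𝓘(ℝ, E) x →ₗ[ℝ]
    TangentSpace 𝓘(ℝ, E) x →ₗ[ℝ] ℝ :=
  LinearMap.mk₂ ℝ (fun w v =>
    { toFun := fun u => curvTensor D ρ s x u v w
      map_add' := fun u u' => by
        simp only [curvTensor_eq hs, map_add, add_lie, LinearMap.add_apply]; ring
      map_smul' := fun c u => by
        simp only [curvTensor_eq hs, map_smul, smul_lie, LinearMap.smul_apply, smul_eq_mul,
          RingHom.id_apply]; ring })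
    (fun w w' v => LinearMap.ext fun u => by
      change curvTensor D ρ s x u v (w + w') = curvTensor D ρ s x u v w + curvTensor D ρ s x u v w'
      simp only [curvTensor_eq hs, map_add, LinearMap.add_apply]; ring)
    (fun c w v => LinearMap.ext fun u => by
      change curvTensor D ρ s x u v (c • w) = c • curvTensor D ρ s x u v w
      simp only [curvTensor_eq hs, map_smul, LinearMap.smul_apply, smul_eq_mul]; ring)
    (fun w v v' => LinearMap.ext fun u => by
      change curvTensor D ρ s x u (v + v') w = curvTensor D ρ s x u v w + curvTensor D ρ s x u v' w
      simp only [curvTensor_eq hs, map_add, lie_add, LinearMap.add_apply]; ring)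
    (fun c w v => LinearMap.ext fun u => by
      change curvTensor D ρ s x u (c • v) w = c • curvTensor D ρ s x u v w
      simp only [curvTensor_eq hs, map_smul, lie_smul, LinearMap.smul_apply, smul_eq_mul]; ring)

theorem curvForm_apply (x : N) (u v w : TangentSpace 𝓘(ℝ, E) x) :
    curvForm hs x w v u = curvTensor D ρ s x u v w := rfl

/-- The triple product of lifts of fields on `N` itself given by the splitting. -/
theorem triple_split_self {X Y : ∀ x : N, TangentSpace 𝓘(ℝ, E) x} (hX : SmoothField 𝓘(ℝ, E) X)
    (hY : SmoothField 𝓘(ℝ, E) Y) (x : N) (z : TangentSpace 𝓘(ℝ, E) x) :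
    triple D (fun y => s y (X y)) (fun y => s y (Y y)) x (X x) (Y x) (s x z) z =
      curvTensor D ρ s x (X x) (Y x) z := by
  have h := triple_split hs (contMDiff_id : ContMDiff 𝓘(ℝ, E) 𝓘(ℝ, E) ∞ (id : N → N)) hX hY x z
  simp only [mfderiv_id] at h
  exact h

theorem smoothFun_curvTensor {X Y Z : ∀ x : N, TangentSpace 𝓘(ℝ, E) x}
    (hX : SmoothField 𝓘(ℝ, E) X) (hY : SmoothField 𝓘(ℝ, E) Y) (hZ : SmoothField 𝓘(ℝ, E) Z) :
    SmoothFun 𝓘(ℝ, E) (fun x => curvTensor D ρ s x (X x) (Y x) (Z x)) := by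
  simp only [← triple_split_self hs hX hY, triple]
  have hF : SmoothVec E (fun x => s x (X x)) := hs.smooth X hX
  have hG : SmoothVec E (fun x => s x (Y x)) := hs.smooth Y hY
  have hH : SmoothVec E (fun x => s x (Z x)) := hs.smooth Z hZ
  exact ((((hF.lie hG).form hH).add ((hG.vecDeriv hX).form hH)).sub
    ((hF.vecDeriv hY).form hH)).add ((hF.vecDeriv hZ).form hG)

theorem isCurvature_curvForm : (actionCourant D ρ).IsCurvature s (curvForm hs) where
  form :=
    { alt₁₂ := fun x v w => curvTensor_self₂₃ hs x w v
      alt₂₃ := fun x v w => curvTensor_self₁₂ hs x w v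
      smooth := fun _ _ _ hX hY hZ => smoothFun_curvTensor hs hZ hY hX }
  eq X Y Z hX hY hZ σ hσ x := by
    have h := (actionCourant_bracket_iff (hs.smooth X hX) (hs.smooth Y hY)).1 hσ x (s x (Z x))
    rw [hs.field_apply, hs.field_apply, hs.field_apply, triple_split_self hs hX hY] at h
    exact h.symm

omit hs in
theorem CourantData.IsCurvature.unique
    {γ γ' : ∀ x : N, TangentSpace 𝓘(ℝ, E) x →ₗ[ℝ] TangentSpace 𝓘(ℝ, E) x →ₗ[ℝ]
      TangentSpace 𝓘(ℝ, E) x →ₗ[ℝ] ℝ} (hs : (actionCourant D ρ).IsIsotropicSplitting s)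
    (h : (actionCourant D ρ).IsCurvature s γ) (h' : (actionCourant D ρ).IsCurvature s γ') :
    γ = γ' := by
  refine funext fun x => LinearMap.ext fun w => LinearMap.ext fun v => LinearMap.ext fun u => ?_
  obtain ⟨X, hX, rfl⟩ := exists_smoothField_eq u
  obtain ⟨Y, hY, rfl⟩ := exists_smoothField_eq v
  obtain ⟨Z, hZ, rfl⟩ := exists_smoothField_eq w
  obtain ⟨σ, hσ⟩ := actionCourant_bracket_exists (D := D) (ρ := ρ) (hs.smooth X hX)
    (hs.smooth Y hY)
  rw [h.eq X Y Z hX hY hZ σ hσ, h'.eq X Y Z hX hY hZ σ hσ]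

include hexact

theorem eq_zero_of_split {x : N} {u : 𝔡} (h1 : ρ.field u x = 0)
    (h2 : ∀ v, D.form u (s x v) = 0) : u = 0 :=
  D.nondeg u fun v => by rw [form_of_field_eq_zero hexact hs h1, h2]

theorem splitMap_bijective (x : N) : Function.Bijective ((actionCourant D ρ).splitMap s x) := by
  constructor
  · refine (injective_iff_map_eq_zero _).2 fun u hu => ?_
    exact eq_zero_of_split hexact hs (congrArg Prod.fst hu)
      fun v => LinearMap.congr_fun (congrArg Prod.snd hu) v
  · rintro ⟨v, β⟩
    obtain ⟨κ, hκ⟩ := D.exists_form_eq (β ∘ₗ ρ.evalAt x)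
    have hκ0 : ρ.field κ x = 0 := hexact.range_le_ker x β κ hκ
    refine ⟨s x v + κ, Prod.ext ?_ (LinearMap.ext fun w => ?_)⟩
    · change ρ.field (s x v + κ) x = v
      rw [ρ.field_add, hs.field_apply, hκ0, add_zero]
    · change D.form (s x v + κ) (s x w) = β w
      rw [map_add, LinearMap.add_apply, hs.form_apply, hκ, zero_add, LinearMap.comp_apply,
        ρ.evalAt_apply, hs.field_apply]

theorem smoothVec_iff_smoothGen_splitMap {f : N → 𝔡} : SmoothVec E f ↔
    SmoothGen (fun x => (actionCourant D ρ).splitMap s x (f x)) := by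
  refine ⟨fun hf => ⟨hf.smoothField, fun X hX => SmoothVec.form (F := D.form) hf (hs.smooth X hX)⟩,
    fun ⟨h1, h2⟩ l => ?_⟩
  obtain ⟨u, hu⟩ := D.exists_form_eq l
  have h3 : ∀ x, l (f x) = D.form (s x (ρ.field (f x) x)) u +
      D.form (f x) (s x (ρ.field u x)) := fun x => by
    rw [form_split_add hexact hs, ← hu, D.symm]
  simp only [h3]
  have h4 : SmoothVec E (fun x => s x (ρ.field (f x) x)) := hs.smooth _ h1
  exact (h4.map (D.form.flip u) LinearMap.id).add (h2 _ (ρ.smooth u))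

/-- The map `a ⊕ s^*` intertwines the brackets of `𝔡 × N` and `𝕋_γ N`, by the expansion of the triple
product along the identity map. -/
theorem bracket_iff_bracket_splitMap {f g h : N → 𝔡} (hf : SmoothVec E f) (hg : SmoothVec E g) :
    (actionCourant D ρ).bracket f g h ↔ (tangentCourant 𝓘(ℝ, E) (curvForm hs)).bracket
      (fun x => (actionCourant D ρ).splitMap s x (f x))
      (fun x => (actionCourant D ρ).splitMap s x (g x))
      (fun x => (actionCourant D ρ).splitMap s x (h x)) := by
  have hX : SmoothField 𝓘(ℝ, E) (fun x => ρ.field (f x) x) := hf.smoothField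
  have hY : SmoothField 𝓘(ℝ, E) (fun x => ρ.field (g x) x) := hg.smoothField
  have hfX : IsLift ρ (id : N → N) f (fun x => ρ.field (f x) x) := fun x => by
    rw [mfderiv_id]; rfl
  have hgY : IsLift ρ (id : N → N) g (fun x => ρ.field (g x) x) := fun x => by
    rw [mfderiv_id]; rfl
  have hexp : ∀ {Z : ∀ x : N, TangentSpace 𝓘(ℝ, E) x}, SmoothField 𝓘(ℝ, E) Z → ∀ x η,
      Z x = ρ.field η x → triple D f g x (ρ.field (f x) x) (ρ.field (g x) x) η (Z x) = _ :=
    fun {Z} hZ x η hη => triple_expansion hexact hs contMDiff_id hf hg hX hY hZ hfX hgY x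
      (by rw [mfderiv_id]; exact hη)
  simp only [mfderiv_id] at hexp
  have hbr : ∀ {Z : ∀ x : N, TangentSpace 𝓘(ℝ, E) x}, SmoothField 𝓘(ℝ, E) Z → ∀ x η,
      Z x = ρ.field η x → triple D f g x (ρ.field (f x) x) (ρ.field (g x) x) η (Z x) =
      D.form η (s x (VectorField.mlieBracket 𝓘(ℝ, E) (fun x => ρ.field (f x) x)
        (fun x => ρ.field (g x) x) x)) +
      ((dirDeriv 𝓘(ℝ, E) (fun y => D.form (g y) (s y (Z y))) x (ρ.field (f x) x)
          - D.form (g x) (s x (VectorField.mlieBracket 𝓘(ℝ, E) (fun x => ρ.field (f x) x) Z x)))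
        - (dirDeriv 𝓘(ℝ, E) (fun y => D.form (f y) (s y (Z y))) x (ρ.field (g x) x)
          - dirDeriv 𝓘(ℝ, E) (fun y => D.form (f y) (s y (ρ.field (g y) y))) x (Z x)
          - D.form (f x) (s x (VectorField.mlieBracket 𝓘(ℝ, E) (fun x => ρ.field (g x) x) Z x)))
        + curvForm hs x (ρ.field (g x) x) (ρ.field (f x) x) (Z x)) := by
    intro Z hZ x η hη
    rw [curvForm_apply, curvTensor_cycle hs]
    refine (hexp hZ x η hη).trans ?_
    simp only [id, ContinuousLinearMap.id_apply]
    ring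
  rw [actionCourant_bracket_iff hf hg]
  constructor
  · intro h1 x
    have h2 : ρ.field (h x) x = VectorField.mlieBracket 𝓘(ℝ, E) (fun x => ρ.field (f x) x)
        (fun x => ρ.field (g x) x) x := by
      have h3 := anchor_bracket_of_lift contMDiff_id hf hg hX hY hfX hgY x
      rw [mfderiv_id] at h3
      let β : CotangentFibre 𝓘(ℝ, E) x :=
        { toFun := fun v => D.form (vecDeriv f x v) (g x)
          map_add' := fun v w => by rw [vecDeriv_map_add, map_add, LinearMap.add_apply]
          map_smul' := fun c v => by
            rw [vecDeriv_map_smul, map_smul, LinearMap.smul_apply, RingHom.id_apply] }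
      have h4 : ρ.field (h x - (⁅f x, g x⁆ + vecDeriv g x (ρ.field (f x) x) -
          vecDeriv f x (ρ.field (g x) x))) x = 0 := by
        refine hexact.range_le_ker x β _ fun η => ?_
        change D.form _ η = D.form (vecDeriv f x (ρ.field η x)) (g x)
        rw [map_sub, LinearMap.sub_apply, h1, triple]
        simp only [map_sub, map_add, LinearMap.sub_apply, LinearMap.add_apply]
        ring
      rw [ρ.field_sub, sub_eq_zero] at h4
      exact h4.trans h3
    refine ⟨h2, fun Z hZ => ?_⟩
    have h5 := h1 x (s x (Z x))
    rw [hs.field_apply, hbr hZ x _ (hs.field_apply _ _).symm, hs.form_apply, zero_add] at h5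
    exact h5
  · intro h1 x η
    obtain ⟨h2, h3⟩ := h1 x
    obtain ⟨Z, hZ, hZx⟩ := exists_smoothField_eq (ρ.field η x)
    have h4 : ρ.field (h x) x = VectorField.mlieBracket 𝓘(ℝ, E) (fun x => ρ.field (f x) x)
        (fun x => ρ.field (g x) x) x := h2
    have h5 : D.form (h x) (s x (Z x)) = _ := h3 Z hZ
    rw [← hZx, hbr hZ x η hZx, ← form_split_add hexact hs x, ← hZx, h5, h4, D.symm η]
    rfl

/-- An isotropic splitting identifies the action Courant algebroid with the twisted standard one. -/
theorem isIso_splitMap : (actionCourant D ρ).IsIso (tangentCourant 𝓘(ℝ, E) (curvForm hs))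
    ((actionCourant D ρ).splitMap s) where
  bijective := splitMap_bijective hexact hs
  smooth _ := smoothVec_iff_smoothGen_splitMap hexact hs
  pairing x e e' := by
    change D.form e (s x (ρ.field e' x)) + D.form e' (s x (ρ.field e x)) = D.form e e'
    rw [← form_split_add hexact hs x e e', D.symm e', add_comm]
  anchor _ _ := rfl
  bracket _ _ _ hf hg := bracket_iff_bracket_splitMap hexact hs hf hg

end Curvature

/-! ### Transport along isomorphisms of Courant algebroids -/

namespace CourantData

section Transport

variable {E H : Type*} [NormedAddCommGroup E] [NormedSpace ℝ E] [TopologicalSpace H]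
  {I : ModelWithCorners ℝ E H} {B : Type*} [TopologicalSpace B] [ChartedSpace H B]
  {V : B → Type*} [∀ x, AddCommGroup (V x)] [∀ x, Module ℝ (V x)]
  {V' : B → Type*} [∀ x, AddCommGroup (V' x)] [∀ x, Module ℝ (V' x)]
  {C : CourantData I V} {C' : CourantData I V'} {Φ : ∀ x, V x →ₗ[ℝ] V' x}

/-- The inverse of an isomorphism of Courant algebroids. -/
noncomputable def IsIso.inv (h : C.IsIso C' Φ) (x : B) : V' x →ₗ[ℝ] V x :=
  (LinearEquiv.ofBijective (Φ x) (h.bijective x)).symm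

theorem IsIso.apply_inv (h : C.IsIso C' Φ) (x : B) (e : V' x) : Φ x (h.inv x e) = e :=
  (LinearEquiv.ofBijective (Φ x) (h.bijective x)).apply_symm_apply e

theorem IsIso.inv_apply (h : C.IsIso C' Φ) (x : B) (e : V x) : h.inv x (Φ x e) = e :=
  (LinearEquiv.ofBijective (Φ x) (h.bijective x)).symm_apply_apply e

theorem IsIso.symm (h : C.IsIso C' Φ) : C'.IsIso C h.inv where
  bijective x := (LinearEquiv.ofBijective (Φ x) (h.bijective x)).symm.bijective
  smooth σ := by
    rw [h.smooth]
    simp only [h.apply_inv]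
  pairing x e e' := by rw [← h.pairing, h.apply_inv, h.apply_inv]
  anchor x e := by rw [← h.anchor, h.apply_inv]
  bracket σ₁ σ₂ σ₃ h₁ h₂ := by
    rw [h.bracket _ _ _ ((h.smooth _).2 (by simpa only [h.apply_inv] using h₁))
      ((h.smooth _).2 (by simpa only [h.apply_inv] using h₂))]
    simp only [h.apply_inv]

theorem IsIso.isCoanchor_iff (h : C.IsIso C' Φ) {x : B} {β : CotangentFibre I x} {e : V x} :
    C'.IsCoanchor x β (Φ x e) ↔ C.IsCoanchor x β e := by
  constructor
  · intro h1 e'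
    rw [← h.pairing, h1, h.anchor]
  · intro h1 e'
    obtain ⟨e', rfl⟩ := (h.bijective x).2 e'
    rw [h.pairing, h1, h.anchor]

theorem IsIso.isDirac (h : C.IsIso C' Φ) {S : Type*} [TopologicalSpace S] {i : S → B}
    {L : ∀ s, Set (V (i s))} (hL : C.IsDirac i L) : C'.IsDirac i (fun s => Φ (i s) '' L s) where
  lagrangian s e := by
    obtain ⟨e, rfl⟩ := (h.bijective (i s)).2 e
    rw [(h.bijective (i s)).1.mem_set_image, hL.lagrangian, Set.forall_mem_image]
    simp only [h.pairing]
  subbundle := by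
    rintro s _ ⟨e, he, rfl⟩
    obtain ⟨σ, h1, h2, h3⟩ := hL.subbundle s e he
    exact ⟨fun x => Φ x (σ x), (h.smooth σ).1 h1, congrArg (Φ (i s)) h2,
      h3.mono fun s' hs' => ⟨_, hs', rfl⟩⟩
  involutive σ₁ σ₂ σ₃ h₁ h₂ h₃ hσ₁ hσ₂ s := by
    have hmem : ∀ (σ : ∀ x, V' x), (∀ s, σ (i s) ∈ Φ (i s) '' L s) → ∀ s,
        h.inv (i s) (σ (i s)) ∈ L s := fun σ hσ s => by
      obtain ⟨e, he, he'⟩ := hσ s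
      rwa [← he', h.inv_apply]
    exact ⟨_, hL.involutive _ _ _ ((h.symm.smooth σ₁).1 h₁) ((h.symm.smooth σ₂).1 h₂)
      ((h.symm.bracket σ₁ σ₂ σ₃ h₁ h₂).1 h₃) (hmem σ₁ hσ₁) (hmem σ₂ hσ₂) s, h.apply_inv _ _⟩

theorem IsIso.isExactDirac (h : C.IsIso C' Φ) {E' H' : Type*} [NormedAddCommGroup E']
    [NormedSpace ℝ E'] [TopologicalSpace H'] {J : ModelWithCorners ℝ E' H'} {S : Type*}
    [TopologicalSpace S] [ChartedSpace H' S] {i : S → B}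
    {L : ∀ s, Set (V (i s))} (hL : C.IsExactDirac J i L) :
    C'.IsExactDirac J i (fun s => Φ (i s) '' L s) where
  toIsDirac := h.isDirac hL.toIsDirac
  coanchor_mem s β e hβ he := by
    obtain ⟨e, rfl⟩ := (h.bijective (i s)).2 e
    exact ⟨e, hL.coanchor_mem s β e hβ (h.isCoanchor_iff.1 he), rfl⟩
  injective s β hβ he := hL.injective s β hβ (h.isCoanchor_iff.1 (by rwa [map_zero]))
  ker_iff := by
    rintro s _ ⟨e, he, rfl⟩
    rw [h.anchor, hL.ker_iff s e he]
    simp only [h.isCoanchor_iff]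
  range_eq s := by
    rw [← hL.range_eq, Set.image_image]
    simp only [h.anchor]

end Transport

section TransportProduct

variable {E₁ H₁ E₂ H₂ : Type*}
  [NormedAddCommGroup E₁] [NormedSpace ℝ E₁] [TopologicalSpace H₁]
  [NormedAddCommGroup E₂] [NormedSpace ℝ E₂] [TopologicalSpace H₂]
  {I₁ : ModelWithCorners ℝ E₁ H₁} {I₂ : ModelWithCorners ℝ E₂ H₂}
  {M₁ M₂ : Type*} [TopologicalSpace M₁] [ChartedSpace H₁ M₁]
  [TopologicalSpace M₂] [ChartedSpace H₂ M₂]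
  {V₁ : M₁ → Type*} [∀ x, AddCommGroup (V₁ x)] [∀ x, Module ℝ (V₁ x)]
  {V₂ : M₂ → Type*} [∀ x, AddCommGroup (V₂ x)] [∀ x, Module ℝ (V₂ x)]
  {V₂' : M₂ → Type*} [∀ x, AddCommGroup (V₂' x)] [∀ x, Module ℝ (V₂' x)]
  {C₂ : CourantData I₂ V₂} {C₂' : CourantData I₂ V₂'} {C₁ : CourantData I₁ V₁}
  {Φ : ∀ x, V₂ x →ₗ[ℝ] V₂' x}

/-- The map of products induced by a bundle map between the first factors. -/
def prodMapFst (V₁ : M₁ → Type*) [∀ x, AddCommGroup (V₁ x)] [∀ x, Module ℝ (V₁ x)]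
    (Φ : ∀ x, V₂ x →ₗ[ℝ] V₂' x) (p : M₂ × M₁) : (V₂ p.1 × V₁ p.2) →ₗ[ℝ] (V₂' p.1 × V₁ p.2) :=
  (Φ p.1).prodMap LinearMap.id

/-- The image of a `SectionSum` under an isomorphism of the first factors. -/
def SectionSum.map (h : C₂.IsIso C₂' Φ) (σ : SectionSum C₂ C₁) : SectionSum C₂' C₁ where
  n := σ.n
  f := σ.f
  a j x := Φ x (σ.a j x)
  b := σ.b
  smooth_f := σ.smooth_f
  smooth_a j := (h.smooth _).1 (σ.smooth_a j)
  smooth_b := σ.smooth_b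

theorem SectionSum.map_eval (h : C₂.IsIso C₂' Φ) (σ : SectionSum C₂ C₁) (p : M₂ × M₁) :
    (σ.map h).eval p = prodMapFst V₁ Φ p (σ.eval p) := by
  have h1 := map_sum (prodMapFst V₁ Φ p) (fun j => σ.f j p • (σ.a j p.1, σ.b j p.2)) Finset.univ
  simp only [map_smul] at h1
  exact h1.symm

theorem IsIso.prodPairing_map (h : C₂.IsIso C₂' Φ) (p : M₂ × M₁) (e e' : V₂ p.1 × V₁ p.2) :
    prodPairing C₂' C₁ p (prodMapFst V₁ Φ p e) (prodMapFst V₁ Φ p e') =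
      prodPairing C₂ C₁ p e e' :=
  congrArg (· - C₁.pairing p.2 e.2 e'.2) (h.pairing p.1 e.1 e'.1)

theorem IsIso.prodAnchor_map (h : C₂.IsIso C₂' Φ) (p : M₂ × M₁) (e : V₂ p.1 × V₁ p.2) :
    prodAnchor C₂' C₁ p (prodMapFst V₁ Φ p e) = prodAnchor C₂ C₁ p e :=
  Prod.ext (h.anchor p.1 e.1) rfl

theorem IsIso.prodMapFst_bijective (h : C₂.IsIso C₂' Φ) (p : M₂ × M₁) :
    Function.Bijective (prodMapFst V₁ Φ p) :=
  Function.Bijective.prodMap (h.bijective p.1) Function.bijective_id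

theorem IsIso.prodMapFst_inv (h : C₂.IsIso C₂' Φ) (p : M₂ × M₁) (e : V₂ p.1 × V₁ p.2) :
    prodMapFst V₁ h.inv p (prodMapFst V₁ Φ p e) = e := Prod.ext (h.inv_apply _ _) rfl

theorem IsIso.prodConj_smooth (h : C₂.IsIso C₂' Φ) {z : ∀ p : M₂ × M₁, V₂ p.1 × V₁ p.2}
    (hz : (C₂.prodConj C₁).smooth z) :
    (C₂'.prodConj C₁).smooth (fun p => prodMapFst V₁ Φ p (z p)) := by
  obtain ⟨σ, rfl⟩ := hz
  exact ⟨σ.map h, funext fun p => (σ.map_eval h p).symm⟩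

theorem IsIso.prodConj_bracket (h : C₂.IsIso C₂' Φ) {z z' w : ∀ p : M₂ × M₁, V₂ p.1 × V₁ p.2}
    (hz : (C₂.prodConj C₁).bracket z z' w) :
    (C₂'.prodConj C₁).bracket (fun p => prodMapFst V₁ Φ p (z p))
      (fun p => prodMapFst V₁ Φ p (z' p)) (fun p => prodMapFst V₁ Φ p (w p)) := by
  obtain ⟨σ, σ', rfl, rfl, c, d, hc, hd, hw⟩ := hz
  refine ⟨σ.map h, σ'.map h, funext fun p => (σ.map_eval h p).symm,
    funext fun p => (σ'.map_eval h p).symm, fun j k x => Φ x (c j k x), d,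
    fun j k => (h.bracket _ _ _ (σ.smooth_a j) (σ'.smooth_a k)).1 (hc j k), hd, fun p e => ?_⟩
  obtain ⟨e, rfl⟩ := (h.prodMapFst_bijective (V₁ := V₁) p).2 e
  rw [h.prodPairing_map, hw p e]
  have hp : ∀ (u : V₂ p.1) (v : V₁ p.2), ((Φ p.1 u, v) : V₂' p.1 × V₁ p.2) =
    prodMapFst V₁ Φ p (u, v) := fun _ _ => rfl
  refine Finset.sum_congr rfl fun j _ => Finset.sum_congr rfl fun k _ => ?_
  simp only [SectionSum.map, hp, h.prodPairing_map, h.prodAnchor_map]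

theorem IsIso.prodConj (h : C₂.IsIso C₂' Φ) (C₁ : CourantData I₁ V₁) :
    (C₂.prodConj C₁).IsIso (C₂'.prodConj C₁) (prodMapFst V₁ Φ) where
  bijective := h.prodMapFst_bijective
  smooth z := ⟨h.prodConj_smooth, fun hz => by
    have h1 := h.symm.prodConj_smooth hz
    simpa only [h.prodMapFst_inv] using h1⟩
  pairing := h.prodPairing_map
  anchor := h.prodAnchor_map
  bracket z z' w _ _ := ⟨h.prodConj_bracket, fun hz => by
    have h1 := h.symm.prodConj_bracket hz
    simpa only [h.prodMapFst_inv] using h1⟩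

end TransportProduct

end CourantData

/-! ### Exact morphisms of Manin pairs from maps and 2-forms -/

theorem isDirac_tangentDirac {E : Type*} [NormedAddCommGroup E] [NormedSpace ℝ E]
    [FiniteDimensional ℝ E] {M : Type*} [TopologicalSpace M] [ChartedSpace E M]
    [IsManifold 𝓘(ℝ, E) ∞ M] [T2Space M] :
    (tangentCourant 𝓘(ℝ, E) (B := M) 0).IsDirac id (tangentDirac 𝓘(ℝ, E)) where
  lagrangian m e := by
    refine ⟨fun he e' he' => ?_, fun h => LinearMap.ext fun v => ?_⟩
    · change e.2 e'.1 + e'.2 e.1 = 0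
      rw [show e.2 = 0 from he, show e'.2 = 0 from he']
      exact add_zero 0
    · have h1 : e.2 v + (0 : CotangentFibre 𝓘(ℝ, E) m) e.1 = 0 := h (v, 0) rfl
      simpa using h1
  subbundle m e he := by
    obtain ⟨X, hX, hXm⟩ := exists_smoothField_eq e.1
    exact ⟨fun x => (X x, 0), ⟨hX, fun Y _ => SmoothFun.const 0⟩, Prod.ext hXm (Eq.symm he),
      Filter.Eventually.of_forall fun _ => rfl⟩
  involutive σ₁ σ₂ σ₃ _ _ h h₁ h₂ m := by
    refine LinearMap.ext fun v => ?_
    obtain ⟨Z, hZ, rfl⟩ := exists_smoothField_eq v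
    refine ((h m).2 Z hZ).trans ?_
    have h1' : ∀ m, (σ₁ m).2 = 0 := h₁
    have h2' : ∀ m, (σ₂ m).2 = 0 := h₂
    simp only [h1', h2', LinearMap.zero_apply, Pi.zero_apply, dirDeriv_const]
    simp

section

variable {𝔡 : Type*} [LieRing 𝔡] [LieAlgebra ℝ 𝔡] [FiniteDimensional ℝ 𝔡]
  {D : InvariantMetric 𝔡}
  {E : Type*} [NormedAddCommGroup E] [NormedSpace ℝ E] [FiniteDimensional ℝ E]
  {N : Type*} [TopologicalSpace N] [ChartedSpace E N] [IsManifold 𝓘(ℝ, E) ∞ N] [T2Space N]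
  {ρ : LieAction 𝓘(ℝ, E) 𝔡 N} {s : ∀ x : N, TangentSpace 𝓘(ℝ, E) x →ₗ[ℝ] 𝔡}

/-- A Lagrangian subalgebra is a Dirac structure in the action Courant algebroid. -/
theorem isDirac_lagrangian {L : Set 𝔡} (hL : ∀ e, e ∈ L ↔ ∀ e' ∈ L, D.form e e' = 0)
    (hlie : ∀ a ∈ L, ∀ b ∈ L, ⁅a, b⁆ ∈ L) : (actionCourant D ρ).IsDirac id (fun _ => L) where
  lagrangian _ := hL
  subbundle x e he := ⟨fun _ => e, SmoothVec.const e, rfl, Filter.Eventually.of_forall fun _ => he⟩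
  involutive f g h hf hg hh hfL hgL x := by
    replace hfL : ∀ x, f x ∈ L := hfL
    replace hgL : ∀ x, g x ∈ L := hgL
    refine (hL _).2 fun η hη => ?_
    have h1 : ∀ {f : N → 𝔡}, SmoothVec E f → (∀ x, f x ∈ L) → ∀ η ∈ L, ∀ x v,
        D.form (vecDeriv f x v) η = 0 := fun {f} hf hfL η hη x v => by
      have h2 := apply_vecDeriv hf (D.form.flip η) x v
      have h3 : ∀ y, D.form.flip η (f y) = 0 := fun y => (hL _).1 (hfL y) η hη
      simp only [h3] at h2
      rw [dirDeriv_const] at h2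
      exact h2
    refine ((actionCourant_bracket_iff hf hg).1 hh x η).trans ?_
    rw [triple, h1 hg hgL η hη, h1 hf hfL η hη, h1 hf hfL _ (hgL x),
      (hL _).1 (hlie _ (hfL x) _ (hgL x)) η hη]
    simp

variable {E' : Type*} [NormedAddCommGroup E'] [NormedSpace ℝ E'] [FiniteDimensional ℝ E']
  {M : Type*} [TopologicalSpace M] [ChartedSpace E' M] [IsManifold 𝓘(ℝ, E') ∞ M] [T2Space M]
  {μ : M → N} {φ : ∀ m : M, TangentSpace 𝓘(ℝ, E') m →ₗ[ℝ] TangentSpace 𝓘(ℝ, E') m →ₗ[ℝ] ℝ}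

/-- The integrability condition makes `R_{μ,φ}` an exact morphism of Manin pairs. The hypotheses `hm1`
and `hm2` express the conditions on the Lagrangian subbundles in `𝔡 × N`, before the isomorphism with
`𝕋_γ N` is applied. -/
theorem isExactManinMorphism_formRel (hexact : (actionCourant D ρ).IsExact)
    (hs : (actionCourant D ρ).IsIsotropicSplitting s)
    (hμ : ContMDiff 𝓘(ℝ, E') 𝓘(ℝ, E) ∞ μ) (hφ : IsTwoForm 𝓘(ℝ, E') φ)
    (hC : CurvatureEq D ρ s μ φ) {L : Set 𝔡}
    (hL : (actionCourant D ρ).IsDirac id (fun _ => L))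
    (hm1 : ∀ m u X, ((u, (X, 0)) : 𝔡 × GenTangent 𝓘(ℝ, E') m) ∈ momentFibre D ρ s μ φ m → u ∈ L)
    (hm2 : ∀ m X, ((0, (X, 0)) : 𝔡 × GenTangent 𝓘(ℝ, E') m) ∈ momentFibre D ρ s μ φ m → X = 0) :
    IsExactManinMorphism (tangentCourant 𝓘(ℝ, E') (B := M) 0) (tangentDirac 𝓘(ℝ, E'))
      (tangentCourant 𝓘(ℝ, E) (curvForm hs)) (fun y => (actionCourant D ρ).splitMap s y '' L)
      μ (formRel 𝓘(ℝ, E') 𝓘(ℝ, E) μ φ) := by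
  have hiso := isIso_splitMap hexact hs
  have hm : ∀ m (e : GenTangent 𝓘(ℝ, E') m) u, e ∈ tangentDirac 𝓘(ℝ, E') m →
      formRel 𝓘(ℝ, E') 𝓘(ℝ, E) μ φ ⟨m, e⟩ ⟨μ m, (actionCourant D ρ).splitMap s (μ m) u⟩ →
      ((u, (e.1, 0)) : 𝔡 × GenTangent 𝓘(ℝ, E') m) ∈ momentFibre D ρ s μ φ m := by
    rintro m ⟨X, β⟩ u rfl h
    exact (splitFormRel_iff D ρ s μ φ m _ u).1 h
  refine ⟨isDirac_tangentDirac, hiso.isDirac hL, hμ, fun u v h => formRel_support h, ?_, ?_, ?_⟩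
  · have h1 := (hiso.prodConj (tangentCourant 𝓘(ℝ, E') (B := M) 0)).isExactDirac
      (isExactDirac_momentFibre hexact hs hμ hφ hC)
    refine (congrArg (CourantData.IsExactDirac _ 𝓘(ℝ, E') (graphMap μ)) (funext fun m => ?_)).mpr h1
    refine Set.ext fun e => ⟨fun he => ?_, ?_⟩
    · obtain ⟨u, hu⟩ := (hiso.bijective (μ m)).2 e.1
      refine ⟨(u, e.2), (splitFormRel_iff D ρ s μ φ m e.2 u).1 ?_, Prod.ext hu rfl⟩
      have h2 : formRel 𝓘(ℝ, E') 𝓘(ℝ, E) μ φ ⟨m, e.2⟩ ⟨μ m, e.1⟩ := he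
      rw [← hu] at h2
      exact h2
    · rintro ⟨⟨u, e⟩, he, rfl⟩
      exact (splitFormRel_iff D ρ s μ φ m e u).2 he
  · intro m e he e' h
    obtain ⟨u, rfl⟩ := (hiso.bijective (μ m)).2 e'
    exact ⟨u, hm1 m u e.1 (hm m e u he h), rfl⟩
  · intro m e he h
    have h1 := hm m e 0 he (by rw [map_zero]; exact h)
    exact Prod.ext (hm2 m e.1 h1) he

end

/-! ### Orthogonal complements -/

section Perp

variable {𝔡 : Type*} [LieRing 𝔡] [LieAlgebra ℝ 𝔡] [FiniteDimensional ℝ 𝔡]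
  (D : InvariantMetric 𝔡)

/-- `W^⊥⊥ ⊆ W`. -/
theorem InvariantMetric.mem_of_forall_form_eq_zero {W : Submodule ℝ 𝔡} {u : 𝔡}
    (h : ∀ ζ, (∀ y ∈ W, D.form ζ y = 0) → D.form ζ u = 0) : u ∈ W := by
  by_contra hu
  obtain ⟨l, hl, hW⟩ := Submodule.exists_le_ker_of_notMem hu
  obtain ⟨ζ, hζ⟩ := D.exists_form_eq l
  exact hl ((hζ u).symm.trans (h ζ fun y hy => (hζ y).trans (hW hy)))

theorem InvariantMetric.mem_of_forall_perp {𝔠 : LieSubalgebra ℝ 𝔡} {u : 𝔡}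
    (h : ∀ ζ ∈ D.perp 𝔠, D.form u ζ = 0) : u ∈ 𝔠 :=
  D.mem_of_forall_form_eq_zero (W := 𝔠.toSubmodule) fun ζ hζ =>
    (D.symm ζ u).trans (h ζ fun y hy => (D.symm y ζ).trans (hζ y hy))

variable {D} {𝔠 : LieSubalgebra ℝ 𝔡}

theorem InvariantMetric.form_of_mem_perp {ζ η : 𝔡} (hζ : ζ ∈ D.perp 𝔠) (hη : η ∈ 𝔠) :
    D.form ζ η = 0 := (D.symm ζ η).trans (hζ η hη)

theorem InvariantMetric.lie_mem_perp {ζ η : 𝔡} (hζ : ζ ∈ D.perp 𝔠) (hη : η ∈ 𝔠) :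
    ⁅ζ, η⁆ ∈ D.perp 𝔠 := fun y hy => by
  rw [D.symm, D.inv]
  exact InvariantMetric.form_of_mem_perp hζ (𝔠.lie_mem hη hy)

instance : FiniteDimensional ℝ (D.Reduced 𝔠) :=
  inferInstanceAs (FiniteDimensional ℝ (𝔠.toSubmodule ⧸ (D.perpIdeal 𝔠).toSubmodule))

theorem InvariantMetric.toReduced_surjective : Function.Surjective (D.toReduced 𝔠) :=
  Submodule.mkQ_surjective _

theorem InvariantMetric.toReduced_eq_zero {η : 𝔠} : D.toReduced 𝔠 η = 0 ↔ (η : 𝔡) ∈ D.perp 𝔠 :=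
  Submodule.Quotient.mk_eq_zero _

theorem InvariantMetric.toReduced_add (η ξ : 𝔠) :
    D.toReduced 𝔠 (η + ξ) = D.toReduced 𝔠 η + D.toReduced 𝔠 ξ := rfl

theorem InvariantMetric.toReduced_sub (η ξ : 𝔠) :
    D.toReduced 𝔠 (η - ξ) = D.toReduced 𝔠 η - D.toReduced 𝔠 ξ := rfl

theorem InvariantMetric.reduced_form (η ξ : 𝔠) :
    (D.reduced 𝔠).form (D.toReduced 𝔠 η) (D.toReduced 𝔠 ξ) = D.form η ξ := rfl

theorem InvariantMetric.reduced_ext {u v : D.Reduced 𝔠}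
    (h : ∀ η : 𝔠, (D.reduced 𝔠).form u (D.toReduced 𝔠 η) =
      (D.reduced 𝔠).form v (D.toReduced 𝔠 η)) : u = v := by
  refine sub_eq_zero.1 ((D.reduced 𝔠).nondeg _ fun w => ?_)
  obtain ⟨η, rfl⟩ := D.toReduced_surjective w
  rw [map_sub, LinearMap.sub_apply, h, sub_self]

end Perp

/-! ### The action on the quotient -/

section ReducedAction

variable {𝔡 : Type*} [LieRing 𝔡] [LieAlgebra ℝ 𝔡] [FiniteDimensional ℝ 𝔡]
  {EN : Type*} [NormedAddCommGroup EN] [NormedSpace ℝ EN] [FiniteDimensional ℝ EN]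
  {N : Type*} [TopologicalSpace N] [ChartedSpace EN N] [IsManifold 𝓘(ℝ, EN) ∞ N] [T2Space N]
  {ES : Type*} [NormedAddCommGroup ES] [NormedSpace ℝ ES] [FiniteDimensional ℝ ES]
  {S : Type*} [TopologicalSpace S] [ChartedSpace ES S] [IsManifold 𝓘(ℝ, ES) ∞ S] [T2Space S]
  [SecondCountableTopology S]
  {EN' : Type*} [NormedAddCommGroup EN'] [NormedSpace ℝ EN'] [FiniteDimensional ℝ EN']
  {N' : Type*} [TopologicalSpace N'] [ChartedSpace EN' N'] [IsManifold 𝓘(ℝ, EN') ∞ N'] [T2Space N']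

/-- `S` is a submanifold of `N` on which `𝔠` acts transitively and `qN : S → N'` is the quotient by
the orbits of `𝔠^⊥`. -/
structure IsTransitiveQuotient (D : InvariantMetric 𝔡) (ρ : LieAction 𝓘(ℝ, EN) 𝔡 N)
    (𝔠 : LieSubalgebra ℝ 𝔡) (iN : S → N) (qN : S → N') : Prop where
  coisotropic : D.perp 𝔠 ≤ 𝔠.toSubmodule
  smooth_iN : ContMDiff 𝓘(ℝ, ES) 𝓘(ℝ, EN) ∞ iN
  immersion_iN : ∀ x, Function.Injective (mfderiv 𝓘(ℝ, ES) 𝓘(ℝ, EN) iN x)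
  invariant : ∀ ξ ∈ 𝔠, ∀ x, ∃ w, actionGen (ES := ES) ρ iN 𝔠.toSubmodule ξ x w
  transitive : ∀ x w, ∃ ξ, actionGen (ES := ES) ρ iN 𝔠.toSubmodule ξ x w
  quotient : IsOrbitQuotient 𝓘(ℝ, ES) 𝓘(ℝ, EN') (actionGen ρ iN (D.perp 𝔠)) qN

namespace IsTransitiveQuotient

variable {D : InvariantMetric 𝔡} {ρ : LieAction 𝓘(ℝ, EN) 𝔡 N} {𝔠 : LieSubalgebra ℝ 𝔡}
  {iN : S → N} {qN : S → N'}
  (hT : IsTransitiveQuotient (ES := ES) (EN' := EN') D ρ 𝔠 iN qN)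

/-- The action of `𝔠` on `S`. -/
noncomputable def fieldS (η : 𝔠) (x : S) : TangentSpace 𝓘(ℝ, ES) x :=
  Classical.choose (hT.invariant η η.2 x)

theorem map_fieldS (η : 𝔠) (x : S) :
    mfderiv 𝓘(ℝ, ES) 𝓘(ℝ, EN) iN x (hT.fieldS η x) = ρ.field (η : 𝔡) (iN x) :=
  (Classical.choose_spec (hT.invariant η η.2 x)).2

theorem eq_fieldS {η : 𝔠} {x : S} {w : TangentSpace 𝓘(ℝ, ES) x}
    (h : mfderiv 𝓘(ℝ, ES) 𝓘(ℝ, EN) iN x w = ρ.field (η : 𝔡) (iN x)) : w = hT.fieldS η x :=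
  hT.immersion_iN x (h.trans (hT.map_fieldS η x).symm)

theorem fieldS_add (η ξ : 𝔠) (x : S) :
    hT.fieldS (η + ξ) x = hT.fieldS η x + hT.fieldS ξ x :=
  (hT.eq_fieldS (by
    rw [map_add, hT.map_fieldS, hT.map_fieldS]
    exact (ρ.field_add _ _ _).symm)).symm

theorem fieldS_sub (η ξ : 𝔠) (x : S) :
    hT.fieldS (η - ξ) x = hT.fieldS η x - hT.fieldS ξ x :=
  (hT.eq_fieldS (by
    rw [map_sub, hT.map_fieldS, hT.map_fieldS]
    exact (ρ.field_sub _ _ _).symm)).symm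

theorem fieldS_smul (c : ℝ) (η : 𝔠) (x : S) :
    hT.fieldS (c • η) x = c • hT.fieldS η x :=
  (hT.eq_fieldS (by
    rw [map_smul, hT.map_fieldS]
    exact (ρ.field_smul _ _ _).symm)).symm

/-- The evaluation `𝔠 → T_x S`. -/
noncomputable def evalS (x : S) : 𝔠 →ₗ[ℝ] TangentSpace 𝓘(ℝ, ES) x where
  toFun η := hT.fieldS η x
  map_add' η ξ := hT.fieldS_add η ξ x
  map_smul' c η := hT.fieldS_smul c η x

theorem fieldS_eq_zero {η : 𝔠} {x : S} (h : ρ.field (η : 𝔡) (iN x) = 0) : hT.fieldS η x = 0 :=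
  (hT.eq_fieldS (by rw [map_zero, h])).symm

theorem smooth_fieldS (η : 𝔠) : SmoothField 𝓘(ℝ, ES) (hT.fieldS η) := by
  refine smoothField_of_immersion hT.smooth_iN hT.immersion_iN ?_
  simp only [hT.map_fieldS]
  exact (ρ.smooth _).smoothAlong_comp hT.smooth_iN

theorem exists_fieldS_eq (x : S) (w : TangentSpace 𝓘(ℝ, ES) x) : ∃ η, w = hT.fieldS η x := by
  obtain ⟨ξ, hξ, h⟩ := hT.transitive x w
  exact ⟨⟨ξ, hξ⟩, hT.eq_fieldS h⟩

theorem exists_perp_of_vertical {x : S} {w : TangentSpace 𝓘(ℝ, ES) x}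
    (h : mfderiv 𝓘(ℝ, ES) 𝓘(ℝ, EN') qN x w = 0) :
    ∃ ζ : 𝔠, (ζ : 𝔡) ∈ D.perp 𝔠 ∧ w = hT.fieldS ζ x := by
  obtain ⟨ξ, hξ, h1⟩ := (hT.quotient.ker_iff x w).1 h
  exact ⟨⟨ξ, hT.coisotropic hξ⟩, hξ, hT.eq_fieldS h1⟩

theorem map_fieldS_of_mem_perp {ζ : 𝔠} (hζ : (ζ : 𝔡) ∈ D.perp 𝔠) (x : S) :
    mfderiv 𝓘(ℝ, ES) 𝓘(ℝ, EN') qN x (hT.fieldS ζ x) = 0 :=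
  (hT.quotient.ker_iff x _).2 ⟨ζ, hζ, hT.map_fieldS ζ x⟩

theorem fieldS_lie (η ξ : 𝔠) (x : S) :
    hT.fieldS ⁅η, ξ⁆ x = VectorField.mlieBracket 𝓘(ℝ, ES) (hT.fieldS η) (hT.fieldS ξ) x := by
  refine (hT.eq_fieldS ?_).symm
  rw [mfderiv_mlieBracket_of_related hT.smooth_iN (hT.smooth_fieldS η) (hT.smooth_fieldS ξ)
    (ρ.smooth _) (ρ.smooth _) (hT.map_fieldS η) (hT.map_fieldS ξ)]
  exact (ρ.map_lie _ _ _).symm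

/-- The projection to `N'` of the vector field of `η` only depends on the point of `N'`. -/
theorem dirDeriv_fieldS_eq (η : 𝔠) {g : N' → ℝ} (hg : SmoothFun 𝓘(ℝ, EN') g) {x y : S}
    (h : qN x = qN y) :
    dirDeriv 𝓘(ℝ, ES) (fun z => g (qN z)) x (hT.fieldS η x) =
      dirDeriv 𝓘(ℝ, ES) (fun z => g (qN z)) y (hT.fieldS η y) := by
  have hgq : SmoothFun 𝓘(ℝ, ES) (fun z => g (qN z)) := hg.comp hT.quotient.smooth
  refine hT.quotient.eq_of_vertical (hgq.dirDeriv (hT.smooth_fieldS η)) (fun z w hw => ?_) h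
  obtain ⟨ζ, hζ, rfl⟩ := hT.exists_perp_of_vertical hw
  have h0 : ∀ {ζ : 𝔠}, (ζ : 𝔡) ∈ D.perp 𝔠 → ∀ z,
      dirDeriv 𝓘(ℝ, ES) (fun z => g (qN z)) z (hT.fieldS ζ z) = 0 := fun {ζ} hζ z => by
    rw [dirDeriv_comp hg hT.quotient.smooth, hT.map_fieldS_of_mem_perp hζ, dirDeriv_map_zero]
  have h1 := dirDeriv_mlieBracket hgq (hT.smooth_fieldS ζ) (hT.smooth_fieldS η) z
  have h2 : ((⁅ζ, η⁆ : 𝔠) : 𝔡) ∈ D.perp 𝔠 := InvariantMetric.lie_mem_perp hζ η.2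
  rw [← hT.fieldS_lie, h0 h2] at h1
  simp only [h0 hζ] at h1
  rw [dirDeriv_const] at h1
  linarith

include hT in
/-- The action of `𝔠` on `S` induces an action of `𝔠 / 𝔠^⊥` on the quotient. -/
theorem exists_reducedAction :
    ∃ ρ' : LieAction 𝓘(ℝ, EN') (D.Reduced 𝔠) N', IsReducedAction (ES := ES) D ρ 𝔠 iN qN ρ' := by
  have h1 : ∀ y : N', ∃ L : 𝔠 →ₗ[ℝ] TangentSpace 𝓘(ℝ, EN') y, ∀ x, qN x = y → ∀ η,
      ∀ g : N' → ℝ, SmoothFun 𝓘(ℝ, EN') g → dirDeriv 𝓘(ℝ, EN') g y (L η) =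
        dirDeriv 𝓘(ℝ, ES) (fun z => g (qN z)) x (hT.fieldS η x) := by
    intro y
    obtain ⟨x₀, rfl⟩ := hT.quotient.surjective y
    refine ⟨(mfderiv 𝓘(ℝ, ES) 𝓘(ℝ, EN') qN x₀ :
      TangentSpace 𝓘(ℝ, ES) x₀ →ₗ[ℝ] TangentSpace 𝓘(ℝ, EN') (qN x₀)) ∘ₗ hT.evalS x₀,
      fun x hx η g hg => ?_⟩
    rw [hT.dirDeriv_fieldS_eq η hg hx, dirDeriv_comp hg hT.quotient.smooth]
    rfl
  choose L hL using h1
  have hLq : ∀ x η, L (qN x) η = mfderiv 𝓘(ℝ, ES) 𝓘(ℝ, EN') qN x (hT.fieldS η x) :=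
    fun x η => eq_of_dirDeriv_eq fun g hg => by
      rw [hL _ x rfl η g hg, dirDeriv_comp hg hT.quotient.smooth]
  have hker : ∀ y, (D.perpIdeal 𝔠).toSubmodule ≤ LinearMap.ker (L y) := fun y ζ hζ => by
    obtain ⟨x, rfl⟩ := hT.quotient.surjective y
    exact LinearMap.mem_ker.2 ((hLq x ζ).trans (hT.map_fieldS_of_mem_perp hζ x))
  let F : D.Reduced 𝔠 →ₗ[ℝ] (∀ y : N', TangentSpace 𝓘(ℝ, EN') y) :=
    LinearMap.pi fun y => (D.perpIdeal 𝔠).toSubmodule.liftQ (L y) (hker y)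
  have hF : ∀ (η : 𝔠) x, F (D.toReduced 𝔠 η) (qN x) =
      mfderiv 𝓘(ℝ, ES) 𝓘(ℝ, EN') qN x (hT.fieldS η x) := fun η x => hLq x η
  have hFs : ∀ ξ, SmoothField 𝓘(ℝ, EN') (F ξ) := fun ξ => by
    obtain ⟨η, rfl⟩ := D.toReduced_surjective ξ
    refine smoothField_of_dirDeriv fun g hg => ?_
    refine contMDiff_of_comp_submersion hT.quotient.smooth hT.quotient.surjective
      hT.quotient.submersion ?_
    simp only [hF, ← dirDeriv_comp hg hT.quotient.smooth]
    exact (hg.comp hT.quotient.smooth).dirDeriv (hT.smooth_fieldS η)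
  refine ⟨⟨F, hFs, fun ξ ξ' y => ?_⟩, fun ξ x w hw => ?_⟩
  · obtain ⟨η, rfl⟩ := D.toReduced_surjective ξ
    obtain ⟨η', rfl⟩ := D.toReduced_surjective ξ'
    obtain ⟨x, rfl⟩ := hT.quotient.surjective y
    rw [← mfderiv_mlieBracket_of_related hT.quotient.smooth (hT.smooth_fieldS η)
      (hT.smooth_fieldS η') (hFs _) (hFs _) (fun x => (hF η x).symm) (fun x => (hF η' x).symm),
      ← hT.fieldS_lie]
    exact hF ⁅η, η'⁆ x
  · rw [hT.eq_fieldS hw]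
    exact hF ξ x

variable {ρ' : LieAction 𝓘(ℝ, EN') (D.Reduced 𝔠) N'}
  (hρ' : IsReducedAction (ES := ES) D ρ 𝔠 iN qN ρ')

include hρ' in
theorem field_toReduced (η : 𝔠) (x : S) : ρ'.field (D.toReduced 𝔠 η) (qN x) =
    mfderiv 𝓘(ℝ, ES) 𝓘(ℝ, EN') qN x (hT.fieldS η x) := hρ' η x _ (hT.map_fieldS η x)

include hT hρ' in
theorem reducedAction_unique {ρ'' : LieAction 𝓘(ℝ, EN') (D.Reduced 𝔠) N'}
    (hρ'' : IsReducedAction (ES := ES) D ρ 𝔠 iN qN ρ'') : ρ'' = ρ' := by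
  have h : ρ''.field = ρ'.field := by
    refine LinearMap.ext fun ξ => funext fun y => ?_
    obtain ⟨η, rfl⟩ := D.toReduced_surjective ξ
    obtain ⟨x, rfl⟩ := hT.quotient.surjective y
    rw [hT.field_toReduced hρ', hT.field_toReduced hρ'']
  cases ρ''
  cases ρ'
  congr

include hT in
/-- A covector on `S` extends to `N`, since `S` is immersed. -/
theorem exists_extension (x : S) (β : CotangentFibre 𝓘(ℝ, ES) x) :
    ∃ β' : CotangentFibre 𝓘(ℝ, EN) (iN x),
      ∀ w, β' (mfderiv 𝓘(ℝ, ES) 𝓘(ℝ, EN) iN x w) = β w := by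
  obtain ⟨r, hr⟩ := LinearMap.exists_leftInverse_of_injective
    (mfderiv 𝓘(ℝ, ES) 𝓘(ℝ, EN) iN x : TangentSpace 𝓘(ℝ, ES) x →ₗ[ℝ] TangentSpace 𝓘(ℝ, EN) (iN x))
    (LinearMap.ker_eq_bot.2 (hT.immersion_iN x))
  exact ⟨β ∘ₗ r, fun w => congrArg β (LinearMap.congr_fun hr w)⟩

variable (hexact : (actionCourant D ρ).IsExact)

include hT hexact in
/-- The element `a^* β'` of `𝔡`, where `β'` is a covector on `N` that restricts to `q^* β` on `S`, lies
in `𝔠` and represents `a'^* β`. -/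
theorem exists_coanchor (x : S) (β : CotangentFibre 𝓘(ℝ, EN') (qN x)) :
    ∃ ξ : 𝔠, ρ.field (ξ : 𝔡) (iN x) = 0 ∧ ∀ (u : 𝔡) (w : TangentSpace 𝓘(ℝ, ES) x),
      mfderiv 𝓘(ℝ, ES) 𝓘(ℝ, EN) iN x w = ρ.field u (iN x) →
      D.form ξ u = β (mfderiv 𝓘(ℝ, ES) 𝓘(ℝ, EN') qN x w) := by
  obtain ⟨β', hβ'⟩ := hT.exists_extension x (β ∘ₗ (mfderiv 𝓘(ℝ, ES) 𝓘(ℝ, EN') qN x :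
    TangentSpace 𝓘(ℝ, ES) x →ₗ[ℝ] TangentSpace 𝓘(ℝ, EN') (qN x)))
  obtain ⟨ξ, hξ⟩ := D.exists_form_eq (β' ∘ₗ ρ.evalAt (iN x))
  have h1 : ∀ (u : 𝔡) (w : TangentSpace 𝓘(ℝ, ES) x),
      mfderiv 𝓘(ℝ, ES) 𝓘(ℝ, EN) iN x w = ρ.field u (iN x) →
      D.form ξ u = β (mfderiv 𝓘(ℝ, ES) 𝓘(ℝ, EN') qN x w) := fun u w h => by
    rw [hξ, LinearMap.comp_apply, ρ.evalAt_apply, ← h, hβ']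
    rfl
  refine ⟨⟨ξ, D.mem_of_forall_perp fun ζ hζ => ?_⟩, hexact.range_le_ker (iN x) β' ξ hξ, h1⟩
  rw [h1 ζ _ (hT.map_fieldS ⟨ζ, hT.coisotropic hζ⟩ x), hT.map_fieldS_of_mem_perp hζ, map_zero]

include hT hρ' hexact in
/-- Exactness passes to `𝔡_𝔠 × N'`. An element of the kernel of the reduced anchor has a representative
in the kernel of the anchor on `N`, which is the image of a covector on `N`; that covector descends. -/
theorem isExact_reduced : (actionCourant (D.reduced 𝔠) ρ').IsExact := by
  have hsurj : ∀ y, Function.Surjective ((actionCourant (D.reduced 𝔠) ρ').anchor y) := by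
    intro y v
    obtain ⟨x, rfl⟩ := hT.quotient.surjective y
    obtain ⟨w, rfl⟩ := hT.quotient.submersion x v
    obtain ⟨η, rfl⟩ := hT.exists_fieldS_eq x w
    exact ⟨D.toReduced 𝔠 η, hT.field_toReduced hρ' η x⟩
  refine ⟨fun y β h => LinearMap.ext fun v => ?_, fun y β e h => ?_, fun y e h => ?_, hsurj⟩
  · obtain ⟨e, rfl⟩ := hsurj y v
    rw [← h e, map_zero, LinearMap.zero_apply, LinearMap.zero_apply]
  · obtain ⟨x, rfl⟩ := hT.quotient.surjective y
    obtain ⟨ξ, hξ0, hξ⟩ := hT.exists_coanchor hexact x β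
    have h1 : e = D.toReduced 𝔠 ξ := InvariantMetric.reduced_ext fun η => by
      rw [InvariantMetric.reduced_form, hξ η _ (hT.map_fieldS η x), ← hT.field_toReduced hρ']
      exact h (D.toReduced 𝔠 η)
    rw [h1]
    refine (hT.field_toReduced hρ' ξ x).trans ?_
    rw [hT.fieldS_eq_zero hξ0, map_zero]
  · obtain ⟨x, rfl⟩ := hT.quotient.surjective y
    obtain ⟨η, rfl⟩ := D.toReduced_surjective e
    obtain ⟨ζ, hζ, hηζ⟩ := hT.exists_perp_of_vertical ((hT.field_toReduced hρ' η x).symm.trans h)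
    have h1 : ρ.field ((η - ζ : 𝔠) : 𝔡) (iN x) = 0 := by
      rw [← hT.map_fieldS, hT.fieldS_sub, hηζ, sub_self, map_zero]
    obtain ⟨β', hβ'⟩ := hexact.ker_le_range (iN x) _ h1
    replace hβ' : ∀ u, D.form ((η - ζ : 𝔠) : 𝔡) u = β' (ρ.field u (iN x)) := hβ'
    obtain ⟨r, hr⟩ := LinearMap.exists_rightInverse_of_surjective
      (mfderiv 𝓘(ℝ, ES) 𝓘(ℝ, EN') qN x : TangentSpace 𝓘(ℝ, ES) x →ₗ[ℝ] TangentSpace 𝓘(ℝ, EN') (qN x))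
      (LinearMap.range_eq_top.2 (hT.quotient.submersion x))
    have hr' : ∀ u, mfderiv 𝓘(ℝ, ES) 𝓘(ℝ, EN') qN x (r u) = u := fun u => LinearMap.congr_fun hr u
    refine ⟨β' ∘ₗ (mfderiv 𝓘(ℝ, ES) 𝓘(ℝ, EN) iN x :
      TangentSpace 𝓘(ℝ, ES) x →ₗ[ℝ] TangentSpace 𝓘(ℝ, EN) (iN x)) ∘ₗ r, fun e' => ?_⟩
    obtain ⟨ξ, rfl⟩ := D.toReduced_surjective e'
    have h2 : mfderiv 𝓘(ℝ, ES) 𝓘(ℝ, EN') qN x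
        (hT.fieldS ξ x - r (mfderiv 𝓘(ℝ, ES) 𝓘(ℝ, EN') qN x (hT.fieldS ξ x))) = 0 := by
      rw [map_sub, hr', sub_self]
    obtain ⟨ζ', hζ', h3⟩ := hT.exists_perp_of_vertical h2
    have h4 : β' (mfderiv 𝓘(ℝ, ES) 𝓘(ℝ, EN) iN x (hT.fieldS ζ' x)) = 0 := by
      rw [hT.map_fieldS, ← hβ', D.symm]
      exact InvariantMetric.form_of_mem_perp hζ' (η - ζ).2
    rw [← h3, map_sub, map_sub, hT.map_fieldS, ← hβ', sub_eq_zero] at h4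
    have h5 : D.form ((η - ζ : 𝔠) : 𝔡) ξ = D.form η ξ := by
      change D.form ((η : 𝔡) - ζ) ξ = _
      rw [map_sub, LinearMap.sub_apply, InvariantMetric.form_of_mem_perp hζ ξ.2, sub_zero]
    refine h5.symm.trans (h4.trans ?_)
    change _ = β' (mfderiv 𝓘(ℝ, ES) 𝓘(ℝ, EN) iN x (r (ρ'.field (D.toReduced 𝔠 ξ) (qN x))))
    rw [hT.field_toReduced hρ']

end IsTransitiveQuotient

end ReducedAction

/-! ### The correction 2-form and invariance -/

section Correction

variable {𝔡 : Type*} [LieRing 𝔡] [LieAlgebra ℝ 𝔡] [FiniteDimensional ℝ 𝔡]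
  {EN : Type*} [NormedAddCommGroup EN] [NormedSpace ℝ EN] [FiniteDimensional ℝ EN]
  {N : Type*} [TopologicalSpace N] [ChartedSpace EN N] [IsManifold 𝓘(ℝ, EN) ∞ N] [T2Space N]
  {ES : Type*} [NormedAddCommGroup ES] [NormedSpace ℝ ES] [FiniteDimensional ℝ ES]
  {S : Type*} [TopologicalSpace S] [ChartedSpace ES S] [IsManifold 𝓘(ℝ, ES) ∞ S] [T2Space S]
  [SecondCountableTopology S]
  {EN' : Type*} [NormedAddCommGroup EN'] [NormedSpace ℝ EN'] [FiniteDimensional ℝ EN']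
  {N' : Type*} [TopologicalSpace N'] [ChartedSpace EN' N'] [IsManifold 𝓘(ℝ, EN') ∞ N'] [T2Space N']
  {D : InvariantMetric 𝔡} {ρ : LieAction 𝓘(ℝ, EN) 𝔡 N} {𝔠 : LieSubalgebra ℝ 𝔡}
  {iN : S → N} {qN : S → N'} {s : ∀ x : N, TangentSpace 𝓘(ℝ, EN) x →ₗ[ℝ] 𝔡}
  {θ : ∀ x : S, TangentSpace 𝓘(ℝ, ES) x →ₗ[ℝ] 𝔡}

/-- The restriction of the splitting to `TS`. -/
noncomputable def splitAlong (s : ∀ x : N, TangentSpace 𝓘(ℝ, EN) x →ₗ[ℝ] 𝔡) (iN : S → N) (x : S) :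
    TangentSpace 𝓘(ℝ, ES) x →ₗ[ℝ] 𝔡 :=
  s (iN x) ∘ₗ (mfderiv 𝓘(ℝ, ES) 𝓘(ℝ, EN) iN x :
    TangentSpace 𝓘(ℝ, ES) x →ₗ[ℝ] TangentSpace 𝓘(ℝ, EN) (iN x))

/-- The correction 2-form, as a bilinear form. -/
noncomputable def corrForm (D : InvariantMetric 𝔡) (ρ : LieAction 𝓘(ℝ, EN) 𝔡 N)
    (s : ∀ x : N, TangentSpace 𝓘(ℝ, EN) x →ₗ[ℝ] 𝔡) (iN : S → N)
    (θ : ∀ x : S, TangentSpace 𝓘(ℝ, ES) x →ₗ[ℝ] 𝔡) (x : S) :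
    TangentSpace 𝓘(ℝ, ES) x →ₗ[ℝ] TangentSpace 𝓘(ℝ, ES) x →ₗ[ℝ] ℝ :=
  D.form.compl₁₂ (θ x) (splitAlong s iN x) - (D.form.compl₁₂ (θ x) (splitAlong s iN x)).flip -
    (1 / 2 : ℝ) • (D.form.compl₁₂ (θ x) (splitProj ρ s (iN x) ∘ₗ θ x) -
      (D.form.compl₁₂ (θ x) (splitProj ρ s (iN x) ∘ₗ θ x)).flip)

theorem corrForm_eq (x : S) (X Y : TangentSpace 𝓘(ℝ, ES) x) : corrForm D ρ s iN θ x X Y =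
    (D.form (θ x X) (splitAlong s iN x Y) - D.form (θ x Y) (splitAlong s iN x X)) - 1 / 2 *
      (D.form (θ x X) ((splitProj ρ s (iN x) ∘ₗ θ x) Y) -
        D.form (θ x Y) ((splitProj ρ s (iN x) ∘ₗ θ x) X)) := rfl

theorem corrForm_self (x : S) (X : TangentSpace 𝓘(ℝ, ES) x) :
    corrForm D ρ s iN θ x X X = 0 := by
  simp only [corrForm_eq, sub_self, mul_zero]

/-- The family of linear maps `A x : T_x S → 𝔡` is smooth and equivariant with respect to `ζ ∈ 𝔡`, which
acts on `S` by the vector field `V`. -/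
structure IsEquivariantAlong (ζ : 𝔡) (V : ∀ x : S, TangentSpace 𝓘(ℝ, ES) x)
    (A : ∀ x : S, TangentSpace 𝓘(ℝ, ES) x →ₗ[ℝ] 𝔡) : Prop where
  smooth : ∀ X : ∀ x : S, TangentSpace 𝓘(ℝ, ES) x, SmoothField 𝓘(ℝ, ES) X →
    SmoothVec ES (fun x => A x (X x))
  lie : ∀ X : ∀ x : S, TangentSpace 𝓘(ℝ, ES) x, SmoothField 𝓘(ℝ, ES) X → ∀ x,
    vecDeriv (fun y => A y (X y)) x (V x) + ⁅ζ, A x (X x)⁆ =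
      A x (VectorField.mlieBracket 𝓘(ℝ, ES) V X x)

theorem IsEquivariantAlong.dirDeriv_form {ζ : 𝔡} {V : ∀ x : S, TangentSpace 𝓘(ℝ, ES) x}
    {A A' : ∀ x : S, TangentSpace 𝓘(ℝ, ES) x →ₗ[ℝ] 𝔡} (hA : IsEquivariantAlong ζ V A)
    (hA' : IsEquivariantAlong ζ V A') {X Y : ∀ x : S, TangentSpace 𝓘(ℝ, ES) x}
    (hX : SmoothField 𝓘(ℝ, ES) X) (hY : SmoothField 𝓘(ℝ, ES) Y) (x : S) :
    dirDeriv 𝓘(ℝ, ES) (fun y => D.form (A y (X y)) (A' y (Y y))) x (V x) =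
      D.form (A x (VectorField.mlieBracket 𝓘(ℝ, ES) V X x)) (A' x (Y x)) +
        D.form (A x (X x)) (A' x (VectorField.mlieBracket 𝓘(ℝ, ES) V Y x)) := by
  rw [_root_.dirDeriv_form D.form (hA.smooth X hX) (hA'.smooth Y hY), ← hA.lie X hX,
    ← hA'.lie Y hY, map_add, map_add, LinearMap.add_apply, ← D.inv,
    form_lie_swap D (A x (X x)) ζ]
  ring

section

variable (hs : (actionCourant D ρ).IsIsotropicSplitting s) (hs_inv : IsInvariantSplitting ρ s)

include hs hs_inv

theorem vecDeriv_splitProj_field (ζ u : 𝔡) (y : N) :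
    vecDeriv (fun z => splitProj ρ s z u) y (ρ.field ζ y) + ⁅ζ, splitProj ρ s y u⁆ =
      splitProj ρ s y ⁅ζ, u⁆ := by
  refine dual_ext fun l => ?_
  rw [map_add, apply_vecDeriv (smoothVec_splitProj hs u)]
  refine (hs_inv ζ (ρ.field u) (ρ.smooth u) y l).trans ?_
  rw [splitProj_apply, ρ.map_lie]

variable (hiN : ContMDiff 𝓘(ℝ, ES) 𝓘(ℝ, EN) ∞ iN) {ζ : 𝔡} {V : ∀ x : S, TangentSpace 𝓘(ℝ, ES) x}
  (hζ : ∀ x, mfderiv 𝓘(ℝ, ES) 𝓘(ℝ, EN) iN x (V x) = ρ.field ζ (iN x))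

include hiN hζ

theorem vecDeriv_splitProj_comp {f : S → 𝔡} (hf : SmoothVec ES f) (x : S) :
    vecDeriv (fun y => splitProj ρ s (iN y) (f y)) x (V x) + ⁅ζ, splitProj ρ s (iN x) (f x)⁆ =
      splitProj ρ s (iN x) (vecDeriv f x (V x) + ⁅ζ, f x⁆) := by
  rw [vecDeriv_apply (A := fun y => splitProj ρ s (iN y))
    (fun u => (smoothVec_splitProj hs u).comp hiN) hf, vecDeriv_comp (smoothVec_splitProj hs _) hiN,
    hζ, map_add, ← vecDeriv_splitProj_field hs hs_inv]
  abel

theorem IsEquivariantAlong.splitProj_comp {A : ∀ x : S, TangentSpace 𝓘(ℝ, ES) x →ₗ[ℝ] 𝔡}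
    (hA : IsEquivariantAlong ζ V A) :
    IsEquivariantAlong ζ V (fun x => splitProj ρ s (iN x) ∘ₗ A x) where
  smooth X hX := SmoothVec.linear_apply (A := fun y => splitProj ρ s (iN y))
    (fun u => (smoothVec_splitProj hs u).comp hiN) (hA.smooth X hX)
  lie X hX x := by
    rw [LinearMap.comp_apply, LinearMap.comp_apply, ← hA.lie X hX,
      ← vecDeriv_splitProj_comp hs hs_inv hiN hζ (hA.smooth X hX)]
    rfl

theorem isEquivariantAlong_splitAlong (hV : SmoothField 𝓘(ℝ, ES) V) :
    IsEquivariantAlong ζ V (splitAlong s iN) where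
  smooth X hX := smoothVec_split_map hs hiN hX
  lie X hX x := by
    have h1 : SmoothVec ES (fun y => splitAlong s iN y (X y)) := smoothVec_split_map hs hiN hX
    have h2 : ∀ y, splitProj ρ s (iN y) (splitAlong s iN y (X y)) = splitAlong s iN y (X y) :=
      fun y => congrArg (s (iN y)) (hs.field_apply _ _)
    have h3 := vecDeriv_splitProj_comp hs hs_inv hiN hζ h1 x
    simp only [h2] at h3
    have h4 := anchor_bracket_of_lift hiN (SmoothVec.const (E := ES) ζ) h1 hV hX hζ
      (fun y => (hs.field_apply _ _).symm) x
    rw [vecDeriv_const, sub_zero, add_comm] at h4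
    rw [h3, splitProj_apply, h4]
    rfl

end

namespace IsConnectionForm

variable (hθ : IsConnectionForm D ρ 𝔠 iN θ)

include hθ in
theorem smoothVec {X : ∀ x : S, TangentSpace 𝓘(ℝ, ES) x} (hX : SmoothField 𝓘(ℝ, ES) X) :
    SmoothVec ES (fun x => θ x (X x)) := fun l => hθ.smooth l X hX

include hθ in
theorem isEquivariantAlong {ζ : 𝔡} (hζ : ζ ∈ D.perp 𝔠) {V : ∀ x : S, TangentSpace 𝓘(ℝ, ES) x}
    (hV : ∀ x, mfderiv 𝓘(ℝ, ES) 𝓘(ℝ, EN) iN x (V x) = ρ.field ζ (iN x)) :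
    IsEquivariantAlong ζ V θ where
  smooth _ hX := hθ.smoothVec hX
  lie X hX x := dual_ext fun l => by
    rw [map_add, apply_vecDeriv (hθ.smoothVec hX)]
    exact hθ.invariant ζ V X hX (fun x => ⟨hζ, hV x⟩) x l

end IsConnectionForm

section

variable (hs : (actionCourant D ρ).IsIsotropicSplitting s) (hs_inv : IsInvariantSplitting ρ s)
  (hθ : IsConnectionForm D ρ 𝔠 iN θ) (hiN : ContMDiff 𝓘(ℝ, ES) 𝓘(ℝ, EN) ∞ iN)

include hs hθ hiN

theorem isTwoForm_corrForm : IsTwoForm 𝓘(ℝ, ES) (corrForm D ρ s iN θ) where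
  alt := corrForm_self
  smooth X Y hX hY := by
    have h1 : ∀ {X : ∀ x : S, TangentSpace 𝓘(ℝ, ES) x}, SmoothField 𝓘(ℝ, ES) X →
        SmoothVec ES (fun x => splitAlong s iN x (X x)) :=
      fun {X} hX => smoothVec_split_map hs hiN hX
    have h2 : ∀ {X : ∀ x : S, TangentSpace 𝓘(ℝ, ES) x}, SmoothField 𝓘(ℝ, ES) X →
        SmoothVec ES (fun x => (splitProj ρ s (iN x) ∘ₗ θ x) (X x)) := fun {X} hX =>
      SmoothVec.linear_apply (A := fun y => splitProj ρ s (iN y))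
        (fun u => (smoothVec_splitProj hs u).comp hiN) (hθ.smoothVec hX)
    simp only [corrForm_eq]
    exact (((hθ.smoothVec hX).form (h1 hY)).sub ((hθ.smoothVec hY).form (h1 hX))).sub
      ((SmoothFun.const (1 / 2)).mul
        (((hθ.smoothVec hX).form (h2 hY)).sub ((hθ.smoothVec hY).form (h2 hX))))

include hs_inv

/-- The correction 2-form is invariant under `𝔠^⊥`. -/
theorem dirDeriv_corrForm {ζ : 𝔡} (hζ : ζ ∈ D.perp 𝔠) {V : ∀ x : S, TangentSpace 𝓘(ℝ, ES) x}
    (hV : SmoothField 𝓘(ℝ, ES) V)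
    (hVζ : ∀ x, mfderiv 𝓘(ℝ, ES) 𝓘(ℝ, EN) iN x (V x) = ρ.field ζ (iN x))
    {X Y : ∀ x : S, TangentSpace 𝓘(ℝ, ES) x}
    (hX : SmoothField 𝓘(ℝ, ES) X) (hY : SmoothField 𝓘(ℝ, ES) Y) (x : S) :
    dirDeriv 𝓘(ℝ, ES) (fun y => corrForm D ρ s iN θ y (X y) (Y y)) x (V x) =
      corrForm D ρ s iN θ x (VectorField.mlieBracket 𝓘(ℝ, ES) V X x) (Y x) +
        corrForm D ρ s iN θ x (X x) (VectorField.mlieBracket 𝓘(ℝ, ES) V Y x) := by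
  have e1 := hθ.isEquivariantAlong hζ hVζ
  have e2 := isEquivariantAlong_splitAlong hs hs_inv hiN hVζ hV
  have e3 := e1.splitProj_comp hs hs_inv hiN hVζ
  have f1 := fun {X} (hX : SmoothField 𝓘(ℝ, ES) X) {Y} (hY : SmoothField 𝓘(ℝ, ES) Y) =>
    (e1.smooth X hX).form (F := D.form) (e2.smooth Y hY)
  have f2 := fun {X} (hX : SmoothField 𝓘(ℝ, ES) X) {Y} (hY : SmoothField 𝓘(ℝ, ES) Y) =>
    (e1.smooth X hX).form (F := D.form) (e3.smooth Y hY)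
  simp only [corrForm_eq]
  rw [dirDeriv_sub ((f1 hX hY).sub (f1 hY hX)) ((SmoothFun.const _).mul ((f2 hX hY).sub (f2 hY hX))),
    dirDeriv_sub (f1 hX hY) (f1 hY hX),
    dirDeriv_mul (SmoothFun.const _) ((f2 hX hY).sub (f2 hY hX)), dirDeriv_const,
    dirDeriv_sub (f2 hX hY) (f2 hY hX), e1.dirDeriv_form e2 hX hY, e1.dirDeriv_form e2 hY hX,
    e1.dirDeriv_form e3 hX hY, e1.dirDeriv_form e3 hY hX]
  ring

end

end Correction

/-! ### The reduced splitting -/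

namespace IsTransitiveQuotient

variable {𝔡 : Type*} [LieRing 𝔡] [LieAlgebra ℝ 𝔡] [FiniteDimensional ℝ 𝔡]
  {EN : Type*} [NormedAddCommGroup EN] [NormedSpace ℝ EN] [FiniteDimensional ℝ EN]
  {N : Type*} [TopologicalSpace N] [ChartedSpace EN N] [IsManifold 𝓘(ℝ, EN) ∞ N] [T2Space N]
  {ES : Type*} [NormedAddCommGroup ES] [NormedSpace ℝ ES] [FiniteDimensional ℝ ES]
  {S : Type*} [TopologicalSpace S] [ChartedSpace ES S] [IsManifold 𝓘(ℝ, ES) ∞ S] [T2Space S]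
  [SecondCountableTopology S]
  {EN' : Type*} [NormedAddCommGroup EN'] [NormedSpace ℝ EN'] [FiniteDimensional ℝ EN']
  {N' : Type*} [TopologicalSpace N'] [ChartedSpace EN' N'] [IsManifold 𝓘(ℝ, EN') ∞ N'] [T2Space N']
  {D : InvariantMetric 𝔡} {ρ : LieAction 𝓘(ℝ, EN) 𝔡 N} {𝔠 : LieSubalgebra ℝ 𝔡}
  {iN : S → N} {qN : S → N'} {s : ∀ x : N, TangentSpace 𝓘(ℝ, EN) x →ₗ[ℝ] 𝔡}
  {θ : ∀ x : S, TangentSpace 𝓘(ℝ, ES) x →ₗ[ℝ] 𝔡}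
  (hT : IsTransitiveQuotient (ES := ES) (EN' := EN') D ρ 𝔠 iN qN)
  (hexact : (actionCourant D ρ).IsExact) (hs : (actionCourant D ρ).IsIsotropicSplitting s)
  (hs_inv : IsInvariantSplitting ρ s) (hθ : IsConnectionForm D ρ 𝔠 iN θ)

/-- The pairing `τ(w, η) = ⟨s(w), η⟩ + B(w, η_S)` of `TS` with `𝔠`, where `B` is the correction 2-form. It
descends to a pairing of `TN'` with `𝔠 / 𝔠^⊥`, which defines the reduced splitting. -/
noncomputable def splitPairing (s : ∀ x : N, TangentSpace 𝓘(ℝ, EN) x →ₗ[ℝ] 𝔡)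
    (θ : ∀ x : S, TangentSpace 𝓘(ℝ, ES) x →ₗ[ℝ] 𝔡) (x : S) :
    TangentSpace 𝓘(ℝ, ES) x →ₗ[ℝ] 𝔠 →ₗ[ℝ] ℝ :=
  D.form.compl₁₂ (splitAlong s iN x) 𝔠.toSubmodule.subtype +
    (corrForm D ρ s iN θ x).compl₂ (hT.evalS x)

theorem splitPairing_apply (x : S) (w : TangentSpace 𝓘(ℝ, ES) x) (η : 𝔠) :
    hT.splitPairing s θ x w η = D.form (splitAlong s iN x w) η +
      corrForm D ρ s iN θ x w (hT.fieldS η x) := rfl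

theorem splitAlong_fieldS (η : 𝔠) (x : S) :
    splitAlong s iN x (hT.fieldS η x) = splitProj ρ s (iN x) η :=
  congrArg (s (iN x)) (hT.map_fieldS η x)

include hθ in
theorem splitProj_connection {ζ : 𝔠} (hζ : (ζ : 𝔡) ∈ D.perp 𝔠) (x : S) :
    splitProj ρ s (iN x) (θ x (hT.fieldS ζ x)) = splitProj ρ s (iN x) ζ :=
  congrArg (s (iN x)) (hθ.vertical ζ x _ ⟨hζ, hT.map_fieldS ζ x⟩)

include hT hexact hs hθ in
theorem corrForm_eq' (x : S) (X Y : TangentSpace 𝓘(ℝ, ES) x) : corrForm D ρ s iN θ x X Y =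
    D.form (θ x X) (splitAlong s iN x Y) - D.form (θ x Y) (splitAlong s iN x X) -
      D.form (θ x X) (splitProj ρ s (iN x) (θ x Y)) := by
  have h1 := form_split_add hexact hs (iN x) (θ x X) (θ x Y)
  rw [InvariantMetric.form_of_mem_perp (hθ.mem x X) (hT.coisotropic (hθ.mem x Y)),
    D.symm (s _ _)] at h1
  rw [corrForm_eq]
  simp only [LinearMap.comp_apply, splitProj_apply]
  linarith

include hexact hs hθ

theorem splitPairing_of_mem_perp {ζ : 𝔠} (hζ : (ζ : 𝔡) ∈ D.perp 𝔠) (x : S)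
    (w : TangentSpace 𝓘(ℝ, ES) x) : hT.splitPairing s θ x w ζ = 0 := by
  obtain ⟨η, rfl⟩ := hT.exists_fieldS_eq x w
  have h1 := hT.splitProj_connection (s := s) hθ hζ x
  -- the difference of `ζ` and `θ(ζ_S)` is in the kernel of the anchor
  have h2 : ρ.field ((ζ : 𝔡) - θ x (hT.fieldS ζ x)) (iN x) = 0 := by
    rw [ρ.field_sub, hθ.vertical ζ x _ ⟨hζ, hT.map_fieldS ζ x⟩, sub_self]
  have h3 := form_of_field_eq_zero hexact hs h2 η
  rw [map_sub, LinearMap.sub_apply, LinearMap.sub_apply,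
    InvariantMetric.form_of_mem_perp hζ η.2,
    InvariantMetric.form_of_mem_perp (hθ.mem x _) η.2] at h3
  rw [splitPairing_apply, hT.corrForm_eq' hexact hs hθ, hT.splitAlong_fieldS, hT.splitAlong_fieldS,
    h1, D.symm (splitProj ρ s (iN x) η)]
  simp only [splitProj_apply] at *
  linarith

theorem splitPairing_of_vertical {x : S} {w : TangentSpace 𝓘(ℝ, ES) x}
    (hw : mfderiv 𝓘(ℝ, ES) 𝓘(ℝ, EN') qN x w = 0) (η : 𝔠) : hT.splitPairing s θ x w η = 0 := by
  obtain ⟨ζ, hζ, rfl⟩ := hT.exists_perp_of_vertical hw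
  have h1 := hT.splitProj_connection (s := s) hθ hζ x
  have h2 := form_split_add hexact hs (iN x) (θ x (hT.fieldS ζ x)) (θ x (hT.fieldS η x))
  have h3 := form_split_add hexact hs (iN x) (θ x (hT.fieldS ζ x)) η
  rw [InvariantMetric.form_of_mem_perp (hθ.mem x _) (hT.coisotropic (hθ.mem x _))] at h2
  rw [InvariantMetric.form_of_mem_perp (hθ.mem x _) η.2] at h3
  rw [splitPairing_apply, hT.corrForm_eq' hexact hs hθ, hT.splitAlong_fieldS, hT.splitAlong_fieldS,
    ← h1, D.symm (θ x (hT.fieldS η x))]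
  simp only [splitProj_apply] at *
  linarith

theorem smoothFun_splitPairing {X : ∀ x : S, TangentSpace 𝓘(ℝ, ES) x}
    (hX : SmoothField 𝓘(ℝ, ES) X) (η : 𝔠) :
    SmoothFun 𝓘(ℝ, ES) (fun x => hT.splitPairing s θ x (X x) η) := by
  have h : SmoothVec ES (fun x => splitAlong s iN x (X x)) :=
    smoothVec_split_map hs hT.smooth_iN hX
  exact (h.form (F := D.form) (SmoothVec.const (η : 𝔡))).add
    ((isTwoForm_corrForm hs hθ hT.smooth_iN).smooth _ _ hX (hT.smooth_fieldS η))

include hs_inv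

/-- The pairing is invariant under `𝔠^⊥`. -/
theorem dirDeriv_splitPairing {ζ : 𝔠} (hζ : (ζ : 𝔡) ∈ D.perp 𝔠)
    {X : ∀ x : S, TangentSpace 𝓘(ℝ, ES) x} (hX : SmoothField 𝓘(ℝ, ES) X) (η : 𝔠) (x : S) :
    dirDeriv 𝓘(ℝ, ES) (fun y => hT.splitPairing s θ y (X y) η) x (hT.fieldS ζ x) =
      hT.splitPairing s θ x (VectorField.mlieBracket 𝓘(ℝ, ES) (hT.fieldS ζ) X x) η := by
  have h0 := hT.splitPairing_of_mem_perp hexact hs hθ (ζ := ⁅ζ, η⁆)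
    (InvariantMetric.lie_mem_perp hζ η.2) x (X x)
  have h1 : SmoothVec ES (fun x => splitAlong s iN x (X x)) :=
    smoothVec_split_map hs hT.smooth_iN hX
  have h2 := (isEquivariantAlong_splitAlong hs hs_inv hT.smooth_iN (hT.map_fieldS ζ)
    (hT.smooth_fieldS ζ)).lie X hX x
  have h3 := dirDeriv_corrForm hs hs_inv hθ hT.smooth_iN hζ (hT.smooth_fieldS ζ) (hT.map_fieldS ζ)
    hX (hT.smooth_fieldS η) x
  have h4 := _root_.dirDeriv_form D.form h1 (SmoothVec.const (E := ES) (η : 𝔡)) x (hT.fieldS ζ x)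
  rw [vecDeriv_const, map_zero, add_zero] at h4
  have h5 := form_lie_swap D (ζ : 𝔡) (splitAlong s iN x (X x)) η
  rw [D.inv (splitAlong s iN x (X x))] at h5
  simp only [splitPairing_apply] at h0 ⊢
  rw [dirDeriv_add (h1.form (F := D.form) (SmoothVec.const (η : 𝔡)))
    ((isTwoForm_corrForm hs hθ hT.smooth_iN).smooth _ _ hX (hT.smooth_fieldS η)), h3, h4, ← h2,
    map_add, LinearMap.add_apply, ← hT.fieldS_lie]
  have h6 : ((⁅ζ, η⁆ : 𝔠) : 𝔡) = ⁅(ζ : 𝔡), (η : 𝔡)⁆ := rfl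
  rw [h6] at h0
  linarith

/-- The pairing descends to the quotient. -/
theorem exists_splitPairing_descent (η : 𝔠) :
    ∃ α : ∀ y : N', CotangentFibre 𝓘(ℝ, EN') y, SmoothOneForm 𝓘(ℝ, EN') α ∧
      ∀ x w, α (qN x) (mfderiv 𝓘(ℝ, ES) 𝓘(ℝ, EN') qN x w) = hT.splitPairing s θ x w η := by
  refine hT.quotient.exists_oneForm_descent
    (α := fun x => (hT.splitPairing s θ x).flip η)
    (fun X hX => hT.smoothFun_splitPairing hexact hs hθ hX η)
    (fun x w hw => hT.splitPairing_of_vertical hexact hs hθ hw η) ?_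
  intro X X' hX hX' hXX' x v hv
  obtain ⟨ζ, hζ, rfl⟩ := hT.exists_perp_of_vertical hv
  refine (hT.dirDeriv_splitPairing hexact hs hs_inv hθ hζ hX η x).trans ?_
  refine hT.splitPairing_of_vertical hexact hs hθ ?_ η
  rw [mfderiv_mlieBracket_of_related hT.quotient.smooth (hT.smooth_fieldS ζ) hX SmoothField.zero hX'
    (hT.map_fieldS_of_mem_perp hζ) hXX']
  have h1 := VectorField.mlieBracket_zero_left (I := 𝓘(ℝ, EN')) (W := X')
  exact congrFun h1 (qN x)

/-- The reduced splitting `s'`, defined by `⟨s' (q_* w), [η]⟩ = τ(w, η)`. -/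
theorem exists_reducedSplitting :
    ∃ s' : ∀ y : N', TangentSpace 𝓘(ℝ, EN') y →ₗ[ℝ] D.Reduced 𝔠,
      (∀ X' : ∀ y : N', TangentSpace 𝓘(ℝ, EN') y, SmoothField 𝓘(ℝ, EN') X' →
        SmoothVec EN' (fun y => s' y (X' y))) ∧
      ∀ x w (η : 𝔠), (D.reduced 𝔠).form
        (s' (qN x) (mfderiv 𝓘(ℝ, ES) 𝓘(ℝ, EN') qN x w)) (D.toReduced 𝔠 η) =
          hT.splitPairing s θ x w η := by
  choose α hα hαq using hT.exists_splitPairing_descent hexact hs hs_inv hθ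
  have h1 : ∀ y (v : TangentSpace 𝓘(ℝ, EN') y), ∃ u : D.Reduced 𝔠, ∀ η : 𝔠,
      (D.reduced 𝔠).form u (D.toReduced 𝔠 η) = α η y v := fun y v => by
    obtain ⟨x, rfl⟩ := hT.quotient.surjective y
    obtain ⟨w, rfl⟩ := hT.quotient.submersion x v
    obtain ⟨u, hu⟩ := (D.reduced 𝔠).exists_form_eq ((D.perpIdeal 𝔠).toSubmodule.liftQ
      (hT.splitPairing s θ x w) fun ζ hζ =>
        LinearMap.mem_ker.2 (hT.splitPairing_of_mem_perp hexact hs hθ hζ x w))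
    exact ⟨u, fun η => (hu _).trans (hαq η x w).symm⟩
  choose u hu using h1
  refine ⟨fun y => ⟨⟨u y, fun v w => InvariantMetric.reduced_ext fun η => ?_⟩,
    fun c v => InvariantMetric.reduced_ext fun η => ?_⟩, fun X' hX' l => ?_, fun x w η => ?_⟩
  · rw [map_add, LinearMap.add_apply, hu, hu, hu, map_add]
  · simp only [RingHom.id_apply]
    rw [map_smul, LinearMap.smul_apply, hu, hu, map_smul]
  · obtain ⟨ξ, hξ⟩ := (D.reduced 𝔠).exists_form_eq l
    obtain ⟨η, rfl⟩ := D.toReduced_surjective ξ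
    have h2 : ∀ y, l (u y (X' y)) = α η y (X' y) := fun y => by
      rw [← hξ, (D.reduced 𝔠).symm, hu]
    exact (hα η X' hX').congr h2
  · exact (hu _ _ η).trans (hαq η x w)

omit hs_inv

variable {ρ' : LieAction 𝓘(ℝ, EN') (D.Reduced 𝔠) N'}
  (hρ' : IsReducedAction (ES := ES) D ρ 𝔠 iN qN ρ')
  {s' : ∀ y : N', TangentSpace 𝓘(ℝ, EN') y →ₗ[ℝ] D.Reduced 𝔠}
  (hs' : ∀ x w (η : 𝔠), (D.reduced 𝔠).form
    (s' (qN x) (mfderiv 𝓘(ℝ, ES) 𝓘(ℝ, EN') qN x w)) (D.toReduced 𝔠 η) =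
      hT.splitPairing s θ x w η)

include hρ' hs'

/-- Isotropy holds because a representative `σ ∈ 𝔠` of `s' (q_* w)` can be chosen with `σ_S = w`; then
`⟨σ, σ⟩ = τ(w, σ) = ⟨K σ, σ⟩`, which is `½ ⟨σ, σ⟩` by `K + K^* = 1`. -/
theorem isIsotropicSplitting_reduced
    (hsm : ∀ X' : ∀ y : N', TangentSpace 𝓘(ℝ, EN') y, SmoothField 𝓘(ℝ, EN') X' →
      SmoothVec EN' (fun y => s' y (X' y))) :
    (actionCourant (D.reduced 𝔠) ρ').IsIsotropicSplitting s' := by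
  have hsplit : ∀ y v, ρ'.field (s' y v) y = v := by
    intro y v
    obtain ⟨x, rfl⟩ := hT.quotient.surjective y
    obtain ⟨w, rfl⟩ := hT.quotient.submersion x v
    rw [← sub_eq_zero]
    refine (Module.forall_dual_apply_eq_zero_iff ℝ _).1 fun β => ?_
    obtain ⟨ξ, hξ0, hξ⟩ := hT.exists_coanchor hexact x β
    obtain ⟨σ, hσ⟩ := D.toReduced_surjective
      (s' (qN x) (mfderiv 𝓘(ℝ, ES) 𝓘(ℝ, EN') qN x w))
    have h1 := hs' x w ξ
    have h2 : D.form ξ (splitAlong s iN x w) = _ := hξ _ w (hs.field_apply _ _).symm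
    rw [← hσ, InvariantMetric.reduced_form, D.symm, hξ σ _ (hT.map_fieldS σ x),
      splitPairing_apply, hT.fieldS_eq_zero hξ0, map_zero, add_zero, D.symm, h2] at h1
    rw [← hσ, hT.field_toReduced hρ', map_sub, h1, sub_self]
  have hself : ∀ y v, (D.reduced 𝔠).form (s' y v) (s' y v) = 0 := by
    intro y v
    obtain ⟨x, rfl⟩ := hT.quotient.surjective y
    obtain ⟨σ₀, hσ₀⟩ := D.toReduced_surjective (s' (qN x) v)
    obtain ⟨w, rfl⟩ := hT.quotient.submersion x v
    -- a representative `σ` of the value of `s'` with `σ_S = w`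
    obtain ⟨ζ, hζ, hζw⟩ := hT.exists_perp_of_vertical
      (x := x) (w := w - hT.fieldS σ₀ x) (by
        rw [map_sub, ← hT.field_toReduced hρ' σ₀, hσ₀, hsplit, sub_self])
    have hσw : hT.fieldS (σ₀ + ζ) x = w := by
      rw [hT.fieldS_add, ← hζw]; abel
    have hσ : D.toReduced 𝔠 (σ₀ + ζ) = s' (qN x) (mfderiv 𝓘(ℝ, ES) 𝓘(ℝ, EN') qN x w) := by
      rw [InvariantMetric.toReduced_add, InvariantMetric.toReduced_eq_zero.2 hζ, add_zero, hσ₀]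
    have h1 := hs' x w (σ₀ + ζ)
    rw [← hσ, InvariantMetric.reduced_form, splitPairing_apply, hσw, corrForm_self, add_zero,
      ← hσw, hT.splitAlong_fieldS, splitProj_apply] at h1
    have h2 := form_split_add hexact hs (iN x) ((σ₀ + ζ : 𝔠) : 𝔡) ((σ₀ + ζ : 𝔠) : 𝔡)
    rw [D.symm _ (s _ _)] at h2
    rw [← hσ, InvariantMetric.reduced_form]
    linarith
  refine ⟨hsm, hsplit, fun y v w => ?_⟩
  have h1 := hself y (v + w)
  rw [map_add, map_add, map_add, LinearMap.add_apply, LinearMap.add_apply, hself, hself,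
    (D.reduced 𝔠).symm (s' y w)] at h1
  change (D.reduced 𝔠).form (s' y v) (s' y w) = 0
  linarith

omit hρ' in
/-- On horizontal vectors the pairing `τ` is the pairing with `s(X) + a^*(ι_X ⟨θ, ϑ_s⟩)`. -/
theorem isReducedSplitting : IsReducedSplitting D ρ 𝔠 s iN qN θ s' := by
  intro x w hw β e hβ he
  have h1 : ∀ η : 𝔠, D.form (splitAlong s iN x w + e) η = hT.splitPairing s θ x w η := by
    intro η
    have h2 : D.form e (η : 𝔡) = β (ρ.field η (iN x)) := he η
    have h3 := form_split_add hexact hs (iN x) (θ x w) (θ x (hT.fieldS η x))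
    rw [hw, map_zero, map_zero, LinearMap.zero_apply, zero_add,
      InvariantMetric.form_of_mem_perp (hθ.mem x _) (hT.coisotropic (hθ.mem x _))] at h3
    rw [map_add, LinearMap.add_apply, h2, ← hT.map_fieldS, hβ, splitPairing_apply,
      hT.corrForm_eq' hexact hs hθ, splitProj_apply, h3, sub_zero]
    rfl
  have h2 : splitAlong s iN x w + e ∈ 𝔠 := D.mem_of_forall_perp fun ζ hζ =>
    (h1 ⟨ζ, hT.coisotropic hζ⟩).trans (hT.splitPairing_of_mem_perp hexact hs hθ hζ x w)
  refine ⟨h2, InvariantMetric.reduced_ext fun η => ?_⟩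
  rw [hs', InvariantMetric.reduced_form, ← h1]
  rfl

omit hρ' hs' hs in
include hT in
/-- A splitting is determined by its values on horizontal vectors. -/
theorem reducedSplitting_unique {s₁ s₂ : ∀ y : N', TangentSpace 𝓘(ℝ, EN') y →ₗ[ℝ] D.Reduced 𝔠}
    (h₁ : IsReducedSplitting D ρ 𝔠 s iN qN θ s₁) (h₂ : IsReducedSplitting D ρ 𝔠 s iN qN θ s₂) :
    s₁ = s₂ := by
  refine funext fun y => LinearMap.ext fun v => ?_
  obtain ⟨x, rfl⟩ := hT.quotient.surjective y
  obtain ⟨w, rfl⟩ := hT.quotient.submersion x v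
  let ζ : 𝔠 := ⟨θ x w, hT.coisotropic (hθ.mem x w)⟩
  have h3 : mfderiv 𝓘(ℝ, ES) 𝓘(ℝ, EN') qN x (w - hT.fieldS ζ x) =
      mfderiv 𝓘(ℝ, ES) 𝓘(ℝ, EN') qN x w := by
    rw [map_sub, hT.map_fieldS_of_mem_perp (hθ.mem x w), sub_zero]
  have h4 : ρ.field (θ x (w - hT.fieldS ζ x)) (iN x) = 0 := by
    rw [map_sub, ρ.field_sub, hθ.vertical ζ x _ ⟨hθ.mem x w, hT.map_fieldS ζ x⟩]
    exact sub_self _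
  obtain ⟨β, hβ⟩ := hT.exists_extension x
    (D.form (θ x (w - hT.fieldS ζ x)) ∘ₗ splitAlong s iN x -
      D.form.flip (splitAlong s iN x (w - hT.fieldS ζ x)) ∘ₗ θ x)
  obtain ⟨e, he⟩ := D.exists_form_eq (β ∘ₗ ρ.evalAt (iN x))
  obtain ⟨_, h5⟩ := h₁ x _ h4 β e hβ he
  obtain ⟨_, h6⟩ := h₂ x _ h4 β e hβ he
  rw [← h3, h5, h6]

end IsTransitiveQuotient

/-! ### Adapted lifts -/

section Composite

variable {𝔡 : Type*} [LieRing 𝔡] [LieAlgebra ℝ 𝔡] [FiniteDimensional ℝ 𝔡]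
  {D : InvariantMetric 𝔡}
  {E : Type*} [NormedAddCommGroup E] [NormedSpace ℝ E] [FiniteDimensional ℝ E]
  {N : Type*} [TopologicalSpace N] [ChartedSpace E N] [IsManifold 𝓘(ℝ, E) ∞ N] [T2Space N]
  {ρ : LieAction 𝓘(ℝ, E) 𝔡 N} {s : ∀ x : N, TangentSpace 𝓘(ℝ, E) x →ₗ[ℝ] 𝔡}
  {F : Type*} [NormedAddCommGroup F] [NormedSpace ℝ F] [FiniteDimensional ℝ F]
  {A : Type*} [TopologicalSpace A] [ChartedSpace F A] [IsManifold 𝓘(ℝ, F) ∞ A]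
  {F' : Type*} [NormedAddCommGroup F'] [NormedSpace ℝ F'] [FiniteDimensional ℝ F']
  {P : Type*} [TopologicalSpace P] [ChartedSpace F' P] [IsManifold 𝓘(ℝ, F') ∞ P]
  {g : A → N} {f : P → A} {ν : P → N} (hg : ContMDiff 𝓘(ℝ, F) 𝓘(ℝ, E) ∞ g)
  (hf : ContMDiff 𝓘(ℝ, F') 𝓘(ℝ, F) ∞ f) (hν : ∀ p, ν p = g (f p))

include hg hf in
theorem mfderiv_comp_apply' (p : P) (w : TangentSpace 𝓘(ℝ, F') p) :
    mfderiv 𝓘(ℝ, F') 𝓘(ℝ, E) (fun p => g (f p)) p w =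
      mfderiv 𝓘(ℝ, F) 𝓘(ℝ, E) g (f p) (mfderiv 𝓘(ℝ, F') 𝓘(ℝ, F) f p w) := by
  have h := mfderiv_comp p (hg.mdifferentiableAt (by simp) (x := f p))
    (hf.mdifferentiableAt (by simp) (x := p))
  exact congrArg (fun L : F' →L[ℝ] E => L w) h

include hg hf hν

/-- Here and below the factorization of `ν` is a hypothesis, because `P → N` is used with its two
factorizations `μ ∘ i_M` and `i_N ∘ μ_P`, which are not definitionally equal. -/
theorem split_mfderiv_comp (p : P) (w : TangentSpace 𝓘(ℝ, F') p) :
    s (ν p) (mfderiv 𝓘(ℝ, F') 𝓘(ℝ, E) ν p w) =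
      s (g (f p)) (mfderiv 𝓘(ℝ, F) 𝓘(ℝ, E) g (f p) (mfderiv 𝓘(ℝ, F') 𝓘(ℝ, F) f p w)) := by
  obtain rfl : ν = fun p => g (f p) := funext hν
  rw [mfderiv_comp_apply' hg hf]

theorem mfderiv_comp_eq_field_iff (p : P) (w : TangentSpace 𝓘(ℝ, F') p) (u : 𝔡) :
    mfderiv 𝓘(ℝ, F') 𝓘(ℝ, E) ν p w = ρ.field u (ν p) ↔
      mfderiv 𝓘(ℝ, F) 𝓘(ℝ, E) g (f p) (mfderiv 𝓘(ℝ, F') 𝓘(ℝ, F) f p w) =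
        ρ.field u (g (f p)) := by
  obtain rfl : ν = fun p => g (f p) := funext hν
  rw [mfderiv_comp_apply' hg hf]

theorem curvTensor_mfderiv_comp (p : P) (u v w : TangentSpace 𝓘(ℝ, F') p) :
    curvTensor D ρ s (ν p) (mfderiv 𝓘(ℝ, F') 𝓘(ℝ, E) ν p u) (mfderiv 𝓘(ℝ, F') 𝓘(ℝ, E) ν p v)
      (mfderiv 𝓘(ℝ, F') 𝓘(ℝ, E) ν p w) =
    curvTensor D ρ s (g (f p))
      (mfderiv 𝓘(ℝ, F) 𝓘(ℝ, E) g (f p) (mfderiv 𝓘(ℝ, F') 𝓘(ℝ, F) f p u))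
      (mfderiv 𝓘(ℝ, F) 𝓘(ℝ, E) g (f p) (mfderiv 𝓘(ℝ, F') 𝓘(ℝ, F) f p v))
      (mfderiv 𝓘(ℝ, F) 𝓘(ℝ, E) g (f p) (mfderiv 𝓘(ℝ, F') 𝓘(ℝ, F) f p w)) := by
  obtain rfl : ν = fun p => g (f p) := funext hν
  simp only [mfderiv_comp_apply' hg hf]

end Composite

namespace IsTransitiveQuotient

variable {𝔡 : Type*} [LieRing 𝔡] [LieAlgebra ℝ 𝔡] [FiniteDimensional ℝ 𝔡]
  {EN : Type*} [NormedAddCommGroup EN] [NormedSpace ℝ EN] [FiniteDimensional ℝ EN]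
  {N : Type*} [TopologicalSpace N] [ChartedSpace EN N] [IsManifold 𝓘(ℝ, EN) ∞ N] [T2Space N]
  {ES : Type*} [NormedAddCommGroup ES] [NormedSpace ℝ ES] [FiniteDimensional ℝ ES]
  {S : Type*} [TopologicalSpace S] [ChartedSpace ES S] [IsManifold 𝓘(ℝ, ES) ∞ S] [T2Space S]
  [SecondCountableTopology S]
  {EN' : Type*} [NormedAddCommGroup EN'] [NormedSpace ℝ EN'] [FiniteDimensional ℝ EN']
  {N' : Type*} [TopologicalSpace N'] [ChartedSpace EN' N'] [IsManifold 𝓘(ℝ, EN') ∞ N'] [T2Space N']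
  {D : InvariantMetric 𝔡} {ρ : LieAction 𝓘(ℝ, EN) 𝔡 N} {𝔠 : LieSubalgebra ℝ 𝔡}
  {iN : S → N} {qN : S → N'} {s : ∀ x : N, TangentSpace 𝓘(ℝ, EN) x →ₗ[ℝ] 𝔡}
  {θ : ∀ x : S, TangentSpace 𝓘(ℝ, ES) x →ₗ[ℝ] 𝔡}
  {EP : Type*} [NormedAddCommGroup EP] [NormedSpace ℝ EP] [FiniteDimensional ℝ EP]
  {P : Type*} [TopologicalSpace P] [ChartedSpace EP P] [IsManifold 𝓘(ℝ, EP) ∞ P] [T2Space P]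
  (hT : IsTransitiveQuotient (ES := ES) (EN' := EN') D ρ 𝔠 iN qN)
  (hexact : (actionCourant D ρ).IsExact) (hs : (actionCourant D ρ).IsIsotropicSplitting s)
  (hθ : IsConnectionForm D ρ 𝔠 iN θ)
  {μP : P → S} (hμP : ContMDiff 𝓘(ℝ, EP) 𝓘(ℝ, ES) ∞ μP)

/-- `F : P → 𝔠` is a lift of the vector field `X` on `P` along `P → N` whose class modulo `𝔠^⊥` is the
value of the reduced splitting. -/
structure IsAdaptedLift (s : ∀ x : N, TangentSpace 𝓘(ℝ, EN) x →ₗ[ℝ] 𝔡)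
    (θ : ∀ x : S, TangentSpace 𝓘(ℝ, ES) x →ₗ[ℝ] 𝔡) (μP : P → S)
    (X : ∀ p : P, TangentSpace 𝓘(ℝ, EP) p) (F : P → 𝔡) : Prop where
  smooth : SmoothVec EP F
  mem : ∀ p, F p ∈ 𝔠
  lift : ∀ p, mfderiv 𝓘(ℝ, ES) 𝓘(ℝ, EN) iN (μP p) (mfderiv 𝓘(ℝ, EP) 𝓘(ℝ, ES) μP p (X p)) =
    ρ.field (F p) (iN (μP p))
  pairing : ∀ p (η : 𝔠), D.form (F p) η =
    hT.splitPairing s θ (μP p) (mfderiv 𝓘(ℝ, EP) 𝓘(ℝ, ES) μP p (X p)) η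

variable {hT}

include hexact hs in
/-- The 1-form `⟨F, s⟩` of an adapted lift of `X` is the contraction of the correction form with `X`. -/
theorem IsAdaptedLift.form_splitAlong {X : ∀ p : P, TangentSpace 𝓘(ℝ, EP) p} {F : P → 𝔡}
    (hF : hT.IsAdaptedLift s θ μP X F) (p : P) (w : TangentSpace 𝓘(ℝ, ES) (μP p)) :
    D.form (F p) (splitAlong s iN (μP p) w) = corrForm D ρ s iN θ (μP p)
      (mfderiv 𝓘(ℝ, EP) 𝓘(ℝ, ES) μP p (X p)) w := by
  obtain ⟨η, rfl⟩ := hT.exists_fieldS_eq _ w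
  have h1 := form_split_add hexact hs (iN (μP p)) (F p) (η : 𝔡)
  have h2 := hF.pairing p η
  have h3 : splitAlong s iN (μP p) (mfderiv 𝓘(ℝ, EP) 𝓘(ℝ, ES) μP p (X p)) =
      s (iN (μP p)) (ρ.field (F p) (iN (μP p))) := congrArg (s (iN (μP p))) (hF.lift p)
  rw [splitPairing_apply, h3] at h2
  rw [hT.splitAlong_fieldS, splitProj_apply]
  linarith

include hexact hs hμP hθ in
/-- The triple product of adapted lifts. -/
theorem triple_adaptedLift {X Y Z : ∀ p : P, TangentSpace 𝓘(ℝ, EP) p} {F G H : P → 𝔡}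
    (hX : SmoothField 𝓘(ℝ, EP) X) (hY : SmoothField 𝓘(ℝ, EP) Y) (hZ : SmoothField 𝓘(ℝ, EP) Z)
    (hF : hT.IsAdaptedLift s θ μP X F) (hG : hT.IsAdaptedLift s θ μP Y G)
    (hH : hT.IsAdaptedLift s θ μP Z H) (p : P) :
    triple D F G p (X p) (Y p) (H p) (Z p) =
      curvTensor D ρ s (iN (μP p)) (mfderiv 𝓘(ℝ, EP) 𝓘(ℝ, EN) (fun p => iN (μP p)) p (X p))
        (mfderiv 𝓘(ℝ, EP) 𝓘(ℝ, EN) (fun p => iN (μP p)) p (Y p))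
        (mfderiv 𝓘(ℝ, EP) 𝓘(ℝ, EN) (fun p => iN (μP p)) p (Z p)) +
      formDeriv (pullbackForm μP (corrForm D ρ s iN θ)) X Y Z p := by
  have hν : ContMDiff 𝓘(ℝ, EP) 𝓘(ℝ, EN) ∞ (fun p => iN (μP p)) := hT.smooth_iN.comp hμP
  have hlift : ∀ {X : ∀ p : P, TangentSpace 𝓘(ℝ, EP) p} {F : P → 𝔡},
      hT.IsAdaptedLift s θ μP X F → IsLift ρ (fun p => iN (μP p)) F X := fun hF p =>
    (mfderiv_comp_eq_field_iff hT.smooth_iN hμP (fun _ => rfl) p _ _).2 (hF.lift p)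
  have hα : ∀ {X : ∀ p : P, TangentSpace 𝓘(ℝ, EP) p} {F : P → 𝔡},
      hT.IsAdaptedLift s θ μP X F → ∀ p w, D.form (F p) (s (iN (μP p))
        (mfderiv 𝓘(ℝ, EP) 𝓘(ℝ, EN) (fun p => iN (μP p)) p w)) =
        pullbackForm μP (corrForm D ρ s iN θ) p (X p) w := fun hF p w => by
    rw [mfderiv_comp_apply' hT.smooth_iN hμP]
    exact hF.form_splitAlong hexact hs p _
  have h1 := triple_expansion hexact hs hν hF.smooth hG.smooth hX hY hZ (hlift hF) (hlift hG) p
    (hlift hH p)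
  simp only [hα hF, hα hG, hα hH] at h1
  rw [h1, formDeriv]
  ring

variable {ρ' : LieAction 𝓘(ℝ, EN') (D.Reduced 𝔠) N'}
  (hρ' : IsReducedAction (ES := ES) D ρ 𝔠 iN qN ρ')
  {s' : ∀ y : N', TangentSpace 𝓘(ℝ, EN') y →ₗ[ℝ] D.Reduced 𝔠}
  (hs'i : (actionCourant (D.reduced 𝔠) ρ').IsIsotropicSplitting s')
  (hs' : ∀ x w (η : 𝔠), (D.reduced 𝔠).form
    (s' (qN x) (mfderiv 𝓘(ℝ, ES) 𝓘(ℝ, EN') qN x w)) (D.toReduced 𝔠 η) =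
      hT.splitPairing s θ x w η)

include hθ hμP hρ' hs'i hs' in
/-- A representative in `𝔠` of the value of `s'` lifts `X` up to a vertical vector, which the connection
`θ` lifts to `𝔠^⊥`. -/
theorem exists_adaptedLift {X : ∀ p : P, TangentSpace 𝓘(ℝ, EP) p} (hX : SmoothField 𝓘(ℝ, EP) X) :
    ∃ F, hT.IsAdaptedLift s θ μP X F := by
  obtain ⟨l, hl⟩ := LinearMap.exists_rightInverse_of_surjective
    ((D.perpIdeal 𝔠).toSubmodule.mkQ : 𝔠 →ₗ[ℝ] D.Reduced 𝔠)
    (LinearMap.range_eq_top.2 (Submodule.mkQ_surjective _))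
  replace hl : ∀ v, D.toReduced 𝔠 (l v) = v := fun v => LinearMap.congr_fun hl v
  have hqμ : ContMDiff 𝓘(ℝ, EP) 𝓘(ℝ, EN') ∞ (fun p => qN (μP p)) := hT.quotient.smooth.comp hμP
  let u : P → 𝔠 := fun p => l (s' (qN (μP p))
    (mfderiv 𝓘(ℝ, EP) 𝓘(ℝ, EN') (fun p => qN (μP p)) p (X p)))
  have hu : SmoothVec EP u := (smoothVec_split_map hs'i hqμ hX).map l
  have hu' : SmoothVec EP (fun p => (u p : 𝔡)) := hu.map 𝔠.toSubmodule.subtype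
  have hur : ∀ p, D.toReduced 𝔠 (u p) = s' (qN (μP p)) (mfderiv 𝓘(ℝ, ES) 𝓘(ℝ, EN') qN (μP p)
      (mfderiv 𝓘(ℝ, EP) 𝓘(ℝ, ES) μP p (X p))) := fun p => by
    rw [hl, mfderiv_comp_apply' hT.quotient.smooth hμP]
  let V : ∀ p, TangentSpace 𝓘(ℝ, ES) (μP p) := fun p =>
    mfderiv 𝓘(ℝ, EP) 𝓘(ℝ, ES) μP p (X p) - hT.fieldS (u p) (μP p)
  have hVs : SmoothAlong ES EP μP V := by
    have h1 : ∀ p, hT.fieldS (u p) (μP p) = ∑ i, (Module.finBasis ℝ 𝔠).coord i (u p) •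
        hT.fieldS (Module.finBasis ℝ 𝔠 i) (μP p) := fun p => by
      have h2 := congrArg (hT.evalS (μP p)) ((Module.finBasis ℝ 𝔠).sum_repr (u p))
      rw [map_sum] at h2
      simp only [map_smul] at h2
      exact h2.symm
    refine (hX.smoothAlong_map hμP).sub ?_
    simp only [h1]
    exact SmoothAlong.sum fun i _ => SmoothAlong.smul (hu _)
      ((hT.smooth_fieldS _).smoothAlong_comp hμP)
  have hVv : ∀ p, mfderiv 𝓘(ℝ, ES) 𝓘(ℝ, EN') qN (μP p) (V p) = 0 := fun p => by
    rw [map_sub, ← hT.field_toReduced hρ', hur, hs'i.field_apply, sub_self]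
  refine ⟨fun p => u p + θ (μP p) (V p), hu'.add fun k => (hθ.smooth k).apply_along hμP hVs,
    fun p => 𝔠.add_mem (u p).2 (hT.coisotropic (hθ.mem _ _)), fun p => ?_, fun p η => ?_⟩
  · obtain ⟨ζ, hζ, hζV⟩ := hT.exists_perp_of_vertical (hVv p)
    rw [ρ.field_add, hζV, hθ.vertical ζ (μP p) _ ⟨hζ, hT.map_fieldS ζ _⟩, ← hT.map_fieldS,
      ← hT.map_fieldS, ← map_add, ← hζV]
    congr 1
    exact (add_sub_cancel _ _).symm
  · rw [map_add, LinearMap.add_apply, InvariantMetric.form_of_mem_perp (hθ.mem _ _) η.2, add_zero,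
      ← InvariantMetric.reduced_form, hur, hs']

end IsTransitiveQuotient

/-! ### The reduced 2-form -/

section ReducedForm

variable {𝔡 : Type*} [LieRing 𝔡] [LieAlgebra ℝ 𝔡] [FiniteDimensional ℝ 𝔡]
  {EN : Type*} [NormedAddCommGroup EN] [NormedSpace ℝ EN] [FiniteDimensional ℝ EN]
  {N : Type*} [TopologicalSpace N] [ChartedSpace EN N] [IsManifold 𝓘(ℝ, EN) ∞ N] [T2Space N]
  {EM : Type*} [NormedAddCommGroup EM] [NormedSpace ℝ EM] [FiniteDimensional ℝ EM]
  {M : Type*} [TopologicalSpace M] [ChartedSpace EM M] [IsManifold 𝓘(ℝ, EM) ∞ M] [T2Space M]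
  {ES : Type*} [NormedAddCommGroup ES] [NormedSpace ℝ ES] [FiniteDimensional ℝ ES]
  {S : Type*} [TopologicalSpace S] [ChartedSpace ES S] [IsManifold 𝓘(ℝ, ES) ∞ S] [T2Space S]
  [SecondCountableTopology S]
  {EP : Type*} [NormedAddCommGroup EP] [NormedSpace ℝ EP] [FiniteDimensional ℝ EP]
  {P : Type*} [TopologicalSpace P] [ChartedSpace EP P] [IsManifold 𝓘(ℝ, EP) ∞ P] [T2Space P]
  [SecondCountableTopology P]
  {EN' : Type*} [NormedAddCommGroup EN'] [NormedSpace ℝ EN'] [FiniteDimensional ℝ EN']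
  {N' : Type*} [TopologicalSpace N'] [ChartedSpace EN' N'] [IsManifold 𝓘(ℝ, EN') ∞ N'] [T2Space N']
  {EM' : Type*} [NormedAddCommGroup EM'] [NormedSpace ℝ EM'] [FiniteDimensional ℝ EM']
  {M' : Type*} [TopologicalSpace M'] [ChartedSpace EM' M'] [IsManifold 𝓘(ℝ, EM') ∞ M'] [T2Space M']
  {D : InvariantMetric 𝔡} {ρ : LieAction 𝓘(ℝ, EN) 𝔡 N} {𝔥 𝔠 : LieSubalgebra ℝ 𝔡}
  {s : ∀ x : N, TangentSpace 𝓘(ℝ, EN) x →ₗ[ℝ] 𝔡} {μ : M → N}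
  {φ : ∀ m : M, TangentSpace 𝓘(ℝ, EM) m →ₗ[ℝ] TangentSpace 𝓘(ℝ, EM) m →ₗ[ℝ] ℝ}
  {iN : S → N} {qN : S → N'} {iM : P → M} {μP : P → S} {qM : P → M'}
  {θ : ∀ x : S, TangentSpace 𝓘(ℝ, ES) x →ₗ[ℝ] 𝔡}

namespace IsTransitiveReductiveData

variable (hred : IsTransitiveReductiveData (ES := ES) (EP := EP) (EN' := EN') (EM' := EM')
    D ρ 𝔥 𝔠 μ (splitFormRel D ρ s μ φ) iN qN iM μP qM)

include hred in
theorem isTransitiveQuotient : IsTransitiveQuotient (ES := ES) (EN' := EN') D ρ 𝔠 iN qN where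
  coisotropic := hred.coisotropic
  smooth_iN := hred.smooth_iN
  immersion_iN := hred.immersion_iN
  invariant := hred.invariant
  transitive := hred.transitive
  quotient := hred.quotient_N

include hred in
/-- The square formed by `P`, `M`, `S` and `N` commutes. -/
theorem apply_eq (p : P) : iN (μP p) = μ (iM p) := (hred.range_iff _ _).1 ⟨p, rfl, rfl⟩

variable (hμ : ContMDiff 𝓘(ℝ, EM) 𝓘(ℝ, EN) ∞ μ)

include hred hμ in
theorem split_map_eq (p : P) (w : TangentSpace 𝓘(ℝ, EP) p) :
    s (μ (iM p)) (mfderiv 𝓘(ℝ, EM) 𝓘(ℝ, EN) μ (iM p) (mfderiv 𝓘(ℝ, EP) 𝓘(ℝ, EM) iM p w)) =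
      splitAlong s iN (μP p) (mfderiv 𝓘(ℝ, EP) 𝓘(ℝ, ES) μP p w) :=
  (split_mfderiv_comp hμ hred.smooth_iM hred.apply_eq p w).symm.trans
    (split_mfderiv_comp hred.smooth_iN hred.smooth_μP (fun _ => rfl) p w)

include hred hμ in
theorem map_eq_field_iff (p : P) (w : TangentSpace 𝓘(ℝ, EP) p) (u : 𝔡) :
    mfderiv 𝓘(ℝ, EM) 𝓘(ℝ, EN) μ (iM p) (mfderiv 𝓘(ℝ, EP) 𝓘(ℝ, EM) iM p w) =
      ρ.field u (μ (iM p)) ↔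
    mfderiv 𝓘(ℝ, ES) 𝓘(ℝ, EN) iN (μP p) (mfderiv 𝓘(ℝ, EP) 𝓘(ℝ, ES) μP p w) =
      ρ.field u (iN (μP p)) :=
  (mfderiv_comp_eq_field_iff hμ hred.smooth_iM hred.apply_eq p w u).symm.trans
    (mfderiv_comp_eq_field_iff hred.smooth_iN hred.smooth_μP (fun _ => rfl) p w u)

include hred in
/-- The vertical vectors of `q_M` are those related by `R_{μ,φ}` to elements of `𝔥 ∩ 𝔠^⊥`. -/
theorem vertical_iff (p : P) (w : TangentSpace 𝓘(ℝ, EP) p) :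
    mfderiv 𝓘(ℝ, EP) 𝓘(ℝ, EM') qM p w = 0 ↔ ∃ ζ ∈ 𝔥, ζ ∈ D.perp 𝔠 ∧
      ((ζ, (mfderiv 𝓘(ℝ, EP) 𝓘(ℝ, EM) iM p w, 0)) : 𝔡 × GenTangent 𝓘(ℝ, EM) (iM p)) ∈
        momentFibre D ρ s μ φ (iM p) := by
  rw [hred.quotient_M.ker_iff]
  constructor
  · rintro ⟨ζ, ⟨h1, h2⟩, h3⟩
    exact ⟨ζ, h1, h2, (splitFormRel_iff D ρ s μ φ _ _ _).1 h3⟩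
  · rintro ⟨ζ, h1, h2, h3⟩
    exact ⟨ζ, ⟨h1, h2⟩, (splitFormRel_iff D ρ s μ φ _ _ _).2 h3⟩

include hμ in
/-- A vertical vector of `q_M` projects to a generating field of some `ζ ∈ 𝔠^⊥`, and its contraction with
`i_M^* φ` is `⟨ζ, s⟩`. -/
theorem exists_of_vertical {p : P} {w : TangentSpace 𝓘(ℝ, EP) p}
    (hw : mfderiv 𝓘(ℝ, EP) 𝓘(ℝ, EM') qM p w = 0) : ∃ ζ : 𝔠, (ζ : 𝔡) ∈ D.perp 𝔠 ∧
      mfderiv 𝓘(ℝ, EP) 𝓘(ℝ, ES) μP p w = hred.isTransitiveQuotient.fieldS ζ (μP p) ∧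
      ∀ v : TangentSpace 𝓘(ℝ, EP) p, φ (iM p) (mfderiv 𝓘(ℝ, EP) 𝓘(ℝ, EM) iM p w)
        (mfderiv 𝓘(ℝ, EP) 𝓘(ℝ, EM) iM p v) =
          D.form ζ (splitAlong s iN (μP p) (mfderiv 𝓘(ℝ, EP) 𝓘(ℝ, ES) μP p v)) := by
  obtain ⟨ζ, -, h2, h3, h4⟩ := (hred.vertical_iff p w).1 hw
  refine ⟨⟨ζ, hred.coisotropic h2⟩, h2,
    hred.isTransitiveQuotient.eq_fieldS ((hred.map_eq_field_iff hμ p w ζ).1 h3), fun v => ?_⟩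
  have h5 : (0 : ℝ) = _ := h4 (mfderiv 𝓘(ℝ, EP) 𝓘(ℝ, EM) iM p v)
  rw [← hred.split_map_eq hμ]
  exact (sub_eq_zero.1 h5.symm).symm

include hred hμ in
/-- The map `μ'` of the quotients. -/
theorem exists_reducedMap : ∃ μ' : M' → N', ContMDiff 𝓘(ℝ, EM') 𝓘(ℝ, EN') ∞ μ' ∧
    ∀ p, μ' (qM p) = qN (μP p) := by
  refine hred.quotient_M.exists_map_descent (hred.quotient_N.smooth.comp hred.smooth_μP)
    fun p w hw => ?_
  obtain ⟨ζ, hζ, h1, -⟩ := hred.exists_of_vertical hμ hw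
  refine (mfderiv_comp_apply' hred.quotient_N.smooth hred.smooth_μP p w).trans ?_
  rw [h1, hred.isTransitiveQuotient.map_fieldS_of_mem_perp hζ]

end IsTransitiveReductiveData

/-- The 2-form `i_M^* φ - μ^* ⟨θ, ϑ_s - ½ s ∘ a(θ)⟩` on `P`. -/
noncomputable def correctedForm (D : InvariantMetric 𝔡) (ρ : LieAction 𝓘(ℝ, EN) 𝔡 N)
    (s : ∀ x : N, TangentSpace 𝓘(ℝ, EN) x →ₗ[ℝ] 𝔡)
    (φ : ∀ m : M, TangentSpace 𝓘(ℝ, EM) m →ₗ[ℝ] TangentSpace 𝓘(ℝ, EM) m →ₗ[ℝ] ℝ)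
    (iN : S → N) (iM : P → M) (μP : P → S) (θ : ∀ x : S, TangentSpace 𝓘(ℝ, ES) x →ₗ[ℝ] 𝔡) (p : P) :
    TangentSpace 𝓘(ℝ, EP) p →ₗ[ℝ] TangentSpace 𝓘(ℝ, EP) p →ₗ[ℝ] ℝ :=
  pullbackForm iM φ p - pullbackForm μP (corrForm D ρ s iN θ) p

namespace IsTransitiveReductiveData

variable (hred : IsTransitiveReductiveData (ES := ES) (EP := EP) (EN' := EN') (EM' := EM')
    D ρ 𝔥 𝔠 μ (splitFormRel D ρ s μ φ) iN qN iM μP qM)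
  (hμ : ContMDiff 𝓘(ℝ, EM) 𝓘(ℝ, EN) ∞ μ)
  (hexact : (actionCourant D ρ).IsExact) (hs : (actionCourant D ρ).IsIsotropicSplitting s)
  (hθ : IsConnectionForm D ρ 𝔠 iN θ) (hφ : IsTwoForm 𝓘(ℝ, EM) φ)

include hred hs hθ hφ in
theorem isTwoForm_correctedForm :
    IsTwoForm 𝓘(ℝ, EP) (correctedForm (EP := EP) D ρ s φ iN iM μP θ) :=
  (hφ.pullback hred.smooth_iM).sub
    ((isTwoForm_corrForm hs hθ hred.smooth_iN).pullback hred.smooth_μP)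

include hred hμ hexact hs hθ in
theorem correctedForm_of_vertical {p : P} {v : TangentSpace 𝓘(ℝ, EP) p}
    (hv : mfderiv 𝓘(ℝ, EP) 𝓘(ℝ, EM') qM p v = 0) (w : TangentSpace 𝓘(ℝ, EP) p) :
    correctedForm D ρ s φ iN iM μP θ p v w = 0 := by
  obtain ⟨ζ, hζ, h1, h2⟩ := hred.exists_of_vertical hμ hv
  have h3 := hred.isTransitiveQuotient.splitPairing_of_mem_perp hexact hs hθ hζ (μP p)
    (mfderiv 𝓘(ℝ, EP) 𝓘(ℝ, ES) μP p w)
  rw [hred.isTransitiveQuotient.splitPairing_apply, ← h1,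
    (isTwoForm_corrForm hs hθ hred.smooth_iN).swap, D.symm, ← h2] at h3
  exact (sub_eq_add_neg _ _).trans h3

include hexact hs hθ hφ in
/-- The integrability condition on `M`, in terms of adapted lifts on `P`. -/
theorem triple_add_correctedForm (hC : CurvatureEq D ρ s μ φ)
    {X Y Z : ∀ p : P, TangentSpace 𝓘(ℝ, EP) p} {F G H : P → 𝔡}
    (hX : SmoothField 𝓘(ℝ, EP) X) (hY : SmoothField 𝓘(ℝ, EP) Y) (hZ : SmoothField 𝓘(ℝ, EP) Z)
    (hF : hred.isTransitiveQuotient.IsAdaptedLift s θ μP X F)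
    (hG : hred.isTransitiveQuotient.IsAdaptedLift s θ μP Y G)
    (hH : hred.isTransitiveQuotient.IsAdaptedLift s θ μP Z H) (hμ : ContMDiff 𝓘(ℝ, EM) 𝓘(ℝ, EN) ∞ μ)
    (p : P) :
    triple D F G p (X p) (Y p) (H p) (Z p) +
      formDeriv (correctedForm D ρ s φ iN iM μP θ) X Y Z p = 0 := by
  have h1 := hred.isTransitiveQuotient.triple_adaptedLift hexact hs hθ hred.smooth_μP hX hY hZ
    hF hG hH p
  have h2 := curvTensor_mfderiv_comp (D := D) (ρ := ρ) (s := s) hμ hred.smooth_iM hred.apply_eq p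
    (X p) (Y p) (Z p)
  obtain ⟨X', hX', hXp⟩ := exists_smoothField_eq (mfderiv 𝓘(ℝ, EP) 𝓘(ℝ, EM) iM p (X p))
  obtain ⟨Y', hY', hYp⟩ := exists_smoothField_eq (mfderiv 𝓘(ℝ, EP) 𝓘(ℝ, EM) iM p (Y p))
  obtain ⟨Z', hZ', hZp⟩ := exists_smoothField_eq (mfderiv 𝓘(ℝ, EP) 𝓘(ℝ, EM) iM p (Z p))
  have h3 := hC X' Y' Z' hX' hY' hZ' (iM p)
  have h4 := formDeriv_pullback hφ hred.smooth_iM hX hY hZ hX' hY' hZ' hXp.symm hYp.symm hZp.symm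
  have h5 := formDeriv_sub (hφ.pullback hred.smooth_iM)
    ((isTwoForm_corrForm hs hθ hred.smooth_iN).pullback hred.smooth_μP) hX hY hZ p
  rw [hXp, hYp, hZp, ← h2, ← h4] at h3
  have h6 : formDeriv (correctedForm D ρ s φ iN iM μP θ) X Y Z p = _ := h5
  rw [h1, h6]
  linarith

section Related

variable {ρ' : LieAction 𝓘(ℝ, EN') (D.Reduced 𝔠) N'}
  (hρ' : IsReducedAction (ES := ES) D ρ 𝔠 iN qN ρ')
  {s' : ∀ y : N', TangentSpace 𝓘(ℝ, EN') y →ₗ[ℝ] D.Reduced 𝔠}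
  (hs'i : (actionCourant (D.reduced 𝔠) ρ').IsIsotropicSplitting s')
  (hs' : ∀ x w (η : 𝔠), (D.reduced 𝔠).form
    (s' (qN x) (mfderiv 𝓘(ℝ, ES) 𝓘(ℝ, EN') qN x w)) (D.toReduced 𝔠 η) =
      hred.isTransitiveQuotient.splitPairing s θ x w η)
  {μ' : M' → N'} (hμ' : ContMDiff 𝓘(ℝ, EM') 𝓘(ℝ, EN') ∞ μ') (hμq : ∀ p, μ' (qM p) = qN (μP p))

include hs' hμ' hμq in
/-- The class modulo `𝔠^⊥` of an adapted lift. -/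
theorem toReduced_adaptedLift {X : ∀ p : P, TangentSpace 𝓘(ℝ, EP) p} {F : P → 𝔡}
    (hF : hred.isTransitiveQuotient.IsAdaptedLift s θ μP X F)
    {X' : ∀ m : M', TangentSpace 𝓘(ℝ, EM') m}
    (hXX' : ∀ p, mfderiv 𝓘(ℝ, EP) 𝓘(ℝ, EM') qM p (X p) = X' (qM p)) (p : P) :
    D.toReduced 𝔠 ⟨F p, hF.mem p⟩ =
      s' (μ' (qM p)) (mfderiv 𝓘(ℝ, EM') 𝓘(ℝ, EN') μ' (qM p) (X' (qM p))) := by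
  have h1 := split_mfderiv_comp (s := s') hμ' hred.quotient_M.smooth (fun p => (hμq p).symm) p (X p)
  have h2 := split_mfderiv_comp (s := s') hred.quotient_N.smooth hred.smooth_μP (fun _ => rfl) p
    (X p)
  rw [← hXX', ← h1, h2]
  refine InvariantMetric.reduced_ext fun η => ?_
  rw [hs', InvariantMetric.reduced_form]
  exact hF.pairing p η

include hs' hμ' hμq hs'i in
/-- Derivatives of adapted lifts of projectable fields, paired with `𝔠`, are derivatives on `M'`. -/
theorem form_vecDeriv_adaptedLift {X : ∀ p : P, TangentSpace 𝓘(ℝ, EP) p} {F : P → 𝔡}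
    (hF : hred.isTransitiveQuotient.IsAdaptedLift s θ μP X F)
    {X' : ∀ m : M', TangentSpace 𝓘(ℝ, EM') m} (hX' : SmoothField 𝓘(ℝ, EM') X')
    (hXX' : ∀ p, mfderiv 𝓘(ℝ, EP) 𝓘(ℝ, EM') qM p (X p) = X' (qM p)) (p : P)
    (x : TangentSpace 𝓘(ℝ, EP) p) (η : 𝔠) :
    D.form (vecDeriv F p x) η = (D.reduced 𝔠).form
      (vecDeriv (fun m => s' (μ' m) (mfderiv 𝓘(ℝ, EM') 𝓘(ℝ, EN') μ' m (X' m))) (qM p)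
        (mfderiv 𝓘(ℝ, EP) 𝓘(ℝ, EM') qM p x)) (D.toReduced 𝔠 η) := by
  have hf := smoothVec_split_map hs'i hμ' hX'
  have h1 : ∀ p, D.form (F p) η = (D.reduced 𝔠).form
      (s' (μ' (qM p)) (mfderiv 𝓘(ℝ, EM') 𝓘(ℝ, EN') μ' (qM p) (X' (qM p)))) (D.toReduced 𝔠 η) :=
    fun p => by
      rw [← hred.toReduced_adaptedLift hs' hμ' hμq hF hXX', InvariantMetric.reduced_form]
  have h2 : D.form (vecDeriv F p x) η = dirDeriv 𝓘(ℝ, EP) (fun p => D.form (F p) η) p x :=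
    apply_vecDeriv hF.smooth (D.form.flip (η : 𝔡)) p x
  rw [h2, ← vecDeriv_comp hf hred.quotient_M.smooth]
  refine Eq.trans ?_ (apply_vecDeriv (hf.comp hred.quotient_M.smooth)
    ((D.reduced 𝔠).form.flip (D.toReduced 𝔠 η)) p x).symm
  exact congrArg (fun g => dirDeriv 𝓘(ℝ, EP) g p x) (funext h1)

include hs' hμ' hμq hs'i in
/-- The triple product of adapted lifts is the triple product on `M'`. -/
theorem triple_adaptedLift_reduced {X Y Z : ∀ p : P, TangentSpace 𝓘(ℝ, EP) p} {F G H : P → 𝔡}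
    (hF : hred.isTransitiveQuotient.IsAdaptedLift s θ μP X F)
    (hG : hred.isTransitiveQuotient.IsAdaptedLift s θ μP Y G)
    (hH : hred.isTransitiveQuotient.IsAdaptedLift s θ μP Z H)
    {X' Y' Z' : ∀ m : M', TangentSpace 𝓘(ℝ, EM') m} (hX' : SmoothField 𝓘(ℝ, EM') X')
    (hY' : SmoothField 𝓘(ℝ, EM') Y')
    (hXX' : ∀ p, mfderiv 𝓘(ℝ, EP) 𝓘(ℝ, EM') qM p (X p) = X' (qM p))
    (hYY' : ∀ p, mfderiv 𝓘(ℝ, EP) 𝓘(ℝ, EM') qM p (Y p) = Y' (qM p))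
    (hZZ' : ∀ p, mfderiv 𝓘(ℝ, EP) 𝓘(ℝ, EM') qM p (Z p) = Z' (qM p)) (p : P) :
    triple D F G p (X p) (Y p) (H p) (Z p) = triple (D.reduced 𝔠)
      (fun m => s' (μ' m) (mfderiv 𝓘(ℝ, EM') 𝓘(ℝ, EN') μ' m (X' m)))
      (fun m => s' (μ' m) (mfderiv 𝓘(ℝ, EM') 𝓘(ℝ, EN') μ' m (Y' m))) (qM p) (X' (qM p)) (Y' (qM p))
      (s' (μ' (qM p)) (mfderiv 𝓘(ℝ, EM') 𝓘(ℝ, EN') μ' (qM p) (Z' (qM p)))) (Z' (qM p)) := by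
  have hv := fun (x : TangentSpace 𝓘(ℝ, EP) p) η =>
    hred.form_vecDeriv_adaptedLift hs'i hs' hμ' hμq hF hX' hXX' p x η
  have hv' := hred.form_vecDeriv_adaptedLift hs'i hs' hμ' hμq hG hY' hYY' p (X p) ⟨H p, hH.mem p⟩
  simp only [triple]
  rw [hv', hv (Y p) ⟨H p, hH.mem p⟩, hv (Z p) ⟨G p, hG.mem p⟩, hXX', hYY', hZZ']
  rw [← hred.toReduced_adaptedLift hs' hμ' hμq hF hXX', ← hred.toReduced_adaptedLift hs' hμ' hμq hG hYY',
    ← hred.toReduced_adaptedLift hs' hμ' hμq hH hZZ']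
  rfl

include hred hμ hexact hs hθ hφ hρ' hs'i hs' hμ' hμq in
/-- Invariance of `Ω = i_M^* φ - μ^* B`: for a vertical field `V` the triple product in the integrability
condition is a triple product on `M'` with first argument zero, so `dΩ(V, X, Y) = 0`, and for projectable
`X`, `Y` this is `V (Ω(X, Y)) = 0`. -/
theorem dirDeriv_correctedForm (hC : CurvatureEq D ρ s μ φ)
    {X Y : ∀ p : P, TangentSpace 𝓘(ℝ, EP) p} {X' Y' : ∀ m : M', TangentSpace 𝓘(ℝ, EM') m}
    (hX : SmoothField 𝓘(ℝ, EP) X) (hY : SmoothField 𝓘(ℝ, EP) Y)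
    (hX' : SmoothField 𝓘(ℝ, EM') X') (hY' : SmoothField 𝓘(ℝ, EM') Y')
    (hXX' : ∀ p, mfderiv 𝓘(ℝ, EP) 𝓘(ℝ, EM') qM p (X p) = X' (qM p))
    (hYY' : ∀ p, mfderiv 𝓘(ℝ, EP) 𝓘(ℝ, EM') qM p (Y p) = Y' (qM p)) (p : P)
    (v : TangentSpace 𝓘(ℝ, EP) p) (hv : mfderiv 𝓘(ℝ, EP) 𝓘(ℝ, EM') qM p v = 0) :
    dirDeriv 𝓘(ℝ, EP) (fun p => correctedForm D ρ s φ iN iM μP θ p (X p) (Y p)) p v = 0 := by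
  have hΩ := hred.isTwoForm_correctedForm hs hθ hφ
  have hΩv := fun (p : P) (v w : TangentSpace 𝓘(ℝ, EP) p)
    (hv : mfderiv 𝓘(ℝ, EP) 𝓘(ℝ, EM') qM p v = 0) =>
      hred.correctedForm_of_vertical (φ := φ) hμ hexact hs hθ hv w
  obtain ⟨V, hV, rfl, hV0⟩ := exists_lift_field hred.quotient_M.smooth hred.quotient_M.submersion
    (Y := fun _ => 0) SmoothField.zero p v hv
  have hlift := fun {X : ∀ p : P, TangentSpace 𝓘(ℝ, EP) p} (hX : SmoothField 𝓘(ℝ, EP) X) =>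
    IsTransitiveQuotient.exists_adaptedLift (hT := hred.isTransitiveQuotient) hθ hred.smooth_μP hρ' hs'i hs' hX
  obtain ⟨FV, hFV⟩ := hlift hV
  obtain ⟨F, hF⟩ := hlift hX
  obtain ⟨G, hG⟩ := hlift hY
  have h1 := hred.triple_add_correctedForm hexact hs hθ hφ hC hV hX hY hFV hF hG hμ p
  rw [hred.triple_adaptedLift_reduced hs'i hs' hμ' hμq hFV hF hG SmoothField.zero hX' hV0 hXX' hYY']
    at h1
  have hbr : ∀ {X : ∀ p : P, TangentSpace 𝓘(ℝ, EP) p} {X' : ∀ m : M', TangentSpace 𝓘(ℝ, EM') m},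
      SmoothField 𝓘(ℝ, EP) X → SmoothField 𝓘(ℝ, EM') X' →
      (∀ p, mfderiv 𝓘(ℝ, EP) 𝓘(ℝ, EM') qM p (X p) = X' (qM p)) →
      mfderiv 𝓘(ℝ, EP) 𝓘(ℝ, EM') qM p (VectorField.mlieBracket 𝓘(ℝ, EP) V X p) = 0 :=
    fun hX hX' hXX' => by
      rw [mfderiv_mlieBracket_of_related hred.quotient_M.smooth hV hX SmoothField.zero hX' hV0 hXX']
      exact congrFun (VectorField.mlieBracket_zero_left (W := _)) _
  simp only [formDeriv, hΩv _ _ _ (hV0 _), dirDeriv_const, hΩ.swap p (Y p), hΩ.swap p (X p),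
    hΩv p _ _ (hbr hX hX' hXX'), hΩv p _ _ (hbr hY hY' hYY')] at h1
  simp only [triple, map_zero, zero_lie, LinearMap.zero_apply, vecDeriv_map_zero, vecDeriv_const] at h1
  linarith

end Related

end IsTransitiveReductiveData

end ReducedForm

/-! ### The reduced relation -/

section LinearAlgebra

/-- A covector that vanishes on `A⁻¹(range B)` is the pullback under `A` of a covector that annihilates
`range B`. -/
theorem exists_dual_comp {V W U : Type*} [AddCommGroup V] [Module ℝ V] [AddCommGroup W] [Module ℝ W]
    [AddCommGroup U] [Module ℝ U] (A : V →ₗ[ℝ] W) (B : U →ₗ[ℝ] W) (β : Module.Dual ℝ V)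
    (h : ∀ v u, A v = B u → β v = 0) :
    ∃ α : Module.Dual ℝ W, (∀ u, α (B u) = 0) ∧ ∀ v, α (A v) = β v := by
  have h1 : β ∈ LinearMap.range ((LinearMap.range B).mkQ ∘ₗ A).dualMap := by
    rw [LinearMap.range_dualMap_eq_dualAnnihilator_ker, Submodule.mem_dualAnnihilator]
    intro v hv
    obtain ⟨u, hu⟩ := (Submodule.Quotient.mk_eq_zero _).1 (LinearMap.mem_ker.1 hv)
    exact h v u hu.symm
  obtain ⟨α, hα⟩ := h1
  refine ⟨α ∘ₗ (LinearMap.range B).mkQ, fun u => ?_, fun v => LinearMap.congr_fun hα v⟩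
  have h2 : (LinearMap.range B).mkQ (B u) = 0 := (Submodule.Quotient.mk_eq_zero _).2 ⟨u, rfl⟩
  rw [LinearMap.comp_apply, h2, map_zero]

variable {𝔡 : Type*} [LieRing 𝔡] [LieAlgebra ℝ 𝔡] [FiniteDimensional ℝ 𝔡]
  {D : InvariantMetric 𝔡} {𝔥 𝔠 : LieSubalgebra ℝ 𝔡}

variable (D) in
/-- `𝔥_𝔠` is Lagrangian in `𝔡_𝔠`. -/
theorem InvariantMetric.mem_reducedSub_iff (h𝔥 : D.perp 𝔥 = 𝔥.toSubmodule)
    (hc : D.perp 𝔠 ≤ 𝔠.toSubmodule) (u : D.Reduced 𝔠) :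
    u ∈ D.reducedSub 𝔠 𝔥 ↔ ∀ v ∈ D.reducedSub 𝔠 𝔥, (D.reduced 𝔠).form u v = 0 := by
  have hmem : ∀ ζ, ζ ∈ D.perp 𝔥 ↔ ζ ∈ 𝔥 := fun ζ => by rw [h𝔥]; rfl
  constructor
  · rintro ⟨η, hη, rfl⟩ v ⟨ξ, hξ, rfl⟩
    exact (InvariantMetric.form_of_mem_perp ((hmem _).2 hη) hξ : D.form η ξ = 0)
  · intro h
    obtain ⟨η, rfl⟩ := D.toReduced_surjective u
    -- `(𝔥 ∩ 𝔠)^⊥ = 𝔥 + 𝔠^⊥`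
    have h1 : (η : 𝔡) ∈ 𝔥.toSubmodule ⊔ D.perp 𝔠 := by
      refine D.mem_of_forall_form_eq_zero fun ζ hζ => ?_
      have h2 : ζ ∈ 𝔥 := (hmem ζ).1 fun y hy =>
        (D.symm y ζ).trans (hζ y (Submodule.mem_sup_left hy))
      have h3 : ζ ∈ 𝔠 := D.mem_of_forall_perp fun y hy => hζ y (Submodule.mem_sup_right hy)
      exact (D.symm ζ η).trans (h _ ⟨⟨ζ, h3⟩, h2, rfl⟩)
    obtain ⟨a, ha, b, hb, hab⟩ := Submodule.mem_sup.1 h1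
    refine ⟨η - ⟨b, hc hb⟩, ?_, ?_⟩
    · rw [eq_sub_of_add_eq hab] at ha
      exact ha
    · rw [InvariantMetric.toReduced_sub, InvariantMetric.toReduced_eq_zero (η := ⟨b, hc hb⟩) |>.2 hb,
        sub_zero]

theorem InvariantMetric.isDirac_reducedSub (h𝔥 : D.perp 𝔥 = 𝔥.toSubmodule)
    (hc : D.perp 𝔠 ≤ 𝔠.toSubmodule) {E : Type*} [NormedAddCommGroup E] [NormedSpace ℝ E]
    [FiniteDimensional ℝ E] {N' : Type*} [TopologicalSpace N'] [ChartedSpace E N']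
    [IsManifold 𝓘(ℝ, E) ∞ N'] [T2Space N'] (ρ' : LieAction 𝓘(ℝ, E) (D.Reduced 𝔠) N') :
    (actionCourant (D.reduced 𝔠) ρ').IsDirac id (fun _ => D.reducedSub 𝔠 𝔥) :=
  isDirac_lagrangian (D.mem_reducedSub_iff h𝔥 hc) fun _ ⟨η, hη, h1⟩ _ ⟨ξ, hξ, h2⟩ =>
    ⟨⁅η, ξ⁆, 𝔥.lie_mem hη hξ, by rw [← h1, ← h2]; rfl⟩

end LinearAlgebra

section ReducedRelation

variable {𝔡 : Type*} [LieRing 𝔡] [LieAlgebra ℝ 𝔡] [FiniteDimensional ℝ 𝔡]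
  {EN : Type*} [NormedAddCommGroup EN] [NormedSpace ℝ EN] [FiniteDimensional ℝ EN]
  {N : Type*} [TopologicalSpace N] [ChartedSpace EN N] [IsManifold 𝓘(ℝ, EN) ∞ N] [T2Space N]
  {EM : Type*} [NormedAddCommGroup EM] [NormedSpace ℝ EM] [FiniteDimensional ℝ EM]
  {M : Type*} [TopologicalSpace M] [ChartedSpace EM M] [IsManifold 𝓘(ℝ, EM) ∞ M] [T2Space M]
  {ES : Type*} [NormedAddCommGroup ES] [NormedSpace ℝ ES] [FiniteDimensional ℝ ES]
  {S : Type*} [TopologicalSpace S] [ChartedSpace ES S] [IsManifold 𝓘(ℝ, ES) ∞ S] [T2Space S]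
  [SecondCountableTopology S]
  {EP : Type*} [NormedAddCommGroup EP] [NormedSpace ℝ EP] [FiniteDimensional ℝ EP]
  {P : Type*} [TopologicalSpace P] [ChartedSpace EP P] [IsManifold 𝓘(ℝ, EP) ∞ P] [T2Space P]
  [SecondCountableTopology P]
  {EN' : Type*} [NormedAddCommGroup EN'] [NormedSpace ℝ EN'] [FiniteDimensional ℝ EN']
  {N' : Type*} [TopologicalSpace N'] [ChartedSpace EN' N'] [IsManifold 𝓘(ℝ, EN') ∞ N'] [T2Space N']
  {EM' : Type*} [NormedAddCommGroup EM'] [NormedSpace ℝ EM'] [FiniteDimensional ℝ EM']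
  {M' : Type*} [TopologicalSpace M'] [ChartedSpace EM' M'] [IsManifold 𝓘(ℝ, EM') ∞ M'] [T2Space M']
  {D : InvariantMetric 𝔡} {ρ : LieAction 𝓘(ℝ, EN) 𝔡 N} {𝔥 𝔠 : LieSubalgebra ℝ 𝔡}
  {s : ∀ x : N, TangentSpace 𝓘(ℝ, EN) x →ₗ[ℝ] 𝔡} {μ : M → N}
  {φ : ∀ m : M, TangentSpace 𝓘(ℝ, EM) m →ₗ[ℝ] TangentSpace 𝓘(ℝ, EM) m →ₗ[ℝ] ℝ}
  {iN : S → N} {qN : S → N'} {iM : P → M} {μP : P → S} {qM : P → M'}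
  {θ : ∀ x : S, TangentSpace 𝓘(ℝ, ES) x →ₗ[ℝ] 𝔡}

namespace IsTransitiveReductiveData

variable (hred : IsTransitiveReductiveData (ES := ES) (EP := EP) (EN' := EN') (EM' := EM')
    D ρ 𝔥 𝔠 μ (splitFormRel D ρ s μ φ) iN qN iM μP qM)
  (hμ : ContMDiff 𝓘(ℝ, EM) 𝓘(ℝ, EN) ∞ μ)
  (hexact : (actionCourant D ρ).IsExact) (hs : (actionCourant D ρ).IsIsotropicSplitting s)
  (hθ : IsConnectionForm D ρ 𝔠 iN θ) (hφ : IsTwoForm 𝓘(ℝ, EM) φ)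
  (hC : CurvatureEq D ρ s μ φ)
  {ρ' : LieAction 𝓘(ℝ, EN') (D.Reduced 𝔠) N'}
  (hρ' : IsReducedAction (ES := ES) D ρ 𝔠 iN qN ρ')
  {s' : ∀ y : N', TangentSpace 𝓘(ℝ, EN') y →ₗ[ℝ] D.Reduced 𝔠}
  (hs'i : (actionCourant (D.reduced 𝔠) ρ').IsIsotropicSplitting s')
  (hs' : ∀ x w (η : 𝔠), (D.reduced 𝔠).form
    (s' (qN x) (mfderiv 𝓘(ℝ, ES) 𝓘(ℝ, EN') qN x w)) (D.toReduced 𝔠 η) =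
      hred.isTransitiveQuotient.splitPairing s θ x w η)
  {μ' : M' → N'} (hμ' : ContMDiff 𝓘(ℝ, EM') 𝓘(ℝ, EN') ∞ μ') (hμq : ∀ p, μ' (qM p) = qN (μP p))

include hred hμ hexact hs hθ hφ hC hρ' hs'i hs' hμ' hμq

/-- The 2-form `φ'` on the quotient of `P`. -/
theorem exists_reducedForm :
    ∃ φ' : ∀ m : M', TangentSpace 𝓘(ℝ, EM') m →ₗ[ℝ] TangentSpace 𝓘(ℝ, EM') m →ₗ[ℝ] ℝ,
      IsTwoForm 𝓘(ℝ, EM') φ' ∧ ∀ p (v w : TangentSpace 𝓘(ℝ, EP) p),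
        φ' (qM p) (mfderiv 𝓘(ℝ, EP) 𝓘(ℝ, EM') qM p v) (mfderiv 𝓘(ℝ, EP) 𝓘(ℝ, EM') qM p w) =
          correctedForm D ρ s φ iN iM μP θ p v w :=
  hred.quotient_M.exists_twoForm_descent (hred.isTwoForm_correctedForm hs hθ hφ)
    (fun _ _ w hv => hred.correctedForm_of_vertical hμ hexact hs hθ hv w)
    fun _ _ _ _ hX hY hX' hY' hXX' hYY' p v hv =>
      hred.dirDeriv_correctedForm hμ hexact hs hθ hφ hρ' hs'i hs' hμ' hμq hC hX hY hX' hY' hXX' hYY'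
        p v hv

variable {φ' : ∀ m : M', TangentSpace 𝓘(ℝ, EM') m →ₗ[ℝ] TangentSpace 𝓘(ℝ, EM') m →ₗ[ℝ] ℝ}
  (hφ' : IsTwoForm 𝓘(ℝ, EM') φ') (hφq : ∀ p (v w : TangentSpace 𝓘(ℝ, EP) p),
    φ' (qM p) (mfderiv 𝓘(ℝ, EP) 𝓘(ℝ, EM') qM p v) (mfderiv 𝓘(ℝ, EP) 𝓘(ℝ, EM') qM p w) =
      correctedForm D ρ s φ iN iM μP θ p v w)

include hφ' hφq

/-- The integrability condition for the reduced data. -/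
theorem curvatureEq_reduced : CurvatureEq (D.reduced 𝔠) ρ' s' μ' φ' := by
  intro X' Y' Z' hX' hY' hZ' m
  obtain ⟨p, rfl⟩ := hred.quotient_M.surjective m
  obtain ⟨X, hX, hXX'⟩ := hred.quotient_M.exists_lift hX'
  obtain ⟨Y, hY, hYY'⟩ := hred.quotient_M.exists_lift hY'
  obtain ⟨Z, hZ, hZZ'⟩ := hred.quotient_M.exists_lift hZ'
  have hlift := fun {X : ∀ p : P, TangentSpace 𝓘(ℝ, EP) p} (hX : SmoothField 𝓘(ℝ, EP) X) =>
    IsTransitiveQuotient.exists_adaptedLift (hT := hred.isTransitiveQuotient) hθ hred.smooth_μP hρ'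
      hs'i hs' hX
  obtain ⟨F, hF⟩ := hlift hX
  obtain ⟨G, hG⟩ := hlift hY
  obtain ⟨H, hH⟩ := hlift hZ
  have h1 := hred.triple_add_correctedForm hexact hs hθ hφ hC hX hY hZ hF hG hH hμ p
  have h2 : correctedForm D ρ s φ iN iM μP θ = pullbackForm qM φ' :=
    funext fun p => LinearMap.ext fun v => LinearMap.ext fun w => (hφq p v w).symm
  rwa [hred.triple_adaptedLift_reduced hs'i hs' hμ' hμq hF hG hH hX' hY' hXX' hYY' hZZ',
    triple_split hs'i hμ' hX' hY', h2,
    formDeriv_pullback hφ' hred.quotient_M.smooth hX hY hZ hX' hY' hZ' (hXX' p) (hYY' p) (hZZ' p)]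
    at h1

omit hC hs'i hφ' hφ hexact hs hθ hρ' in
/-- Elements of `R` over `P` and their images in the reduced relation have the same covector part. -/
theorem form_sub_reduced {p : P} {w : TangentSpace 𝓘(ℝ, EP) p} {η : 𝔠}
    (hw : mfderiv 𝓘(ℝ, EP) 𝓘(ℝ, ES) μP p w = hred.isTransitiveQuotient.fieldS η (μP p))
    (hs : (actionCourant D ρ).IsIsotropicSplitting s) (hθ : IsConnectionForm D ρ 𝔠 iN θ)
    (v : TangentSpace 𝓘(ℝ, EP) p) :
    (D.reduced 𝔠).form (D.toReduced 𝔠 η) (s' (μ' (qM p)) (mfderiv 𝓘(ℝ, EM') 𝓘(ℝ, EN') μ' (qM p)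
        (mfderiv 𝓘(ℝ, EP) 𝓘(ℝ, EM') qM p v))) -
      φ' (qM p) (mfderiv 𝓘(ℝ, EP) 𝓘(ℝ, EM') qM p w) (mfderiv 𝓘(ℝ, EP) 𝓘(ℝ, EM') qM p v) =
    D.form η (s (μ (iM p)) (mfderiv 𝓘(ℝ, EM) 𝓘(ℝ, EN) μ (iM p)
        (mfderiv 𝓘(ℝ, EP) 𝓘(ℝ, EM) iM p v))) -
      φ (iM p) (mfderiv 𝓘(ℝ, EP) 𝓘(ℝ, EM) iM p w) (mfderiv 𝓘(ℝ, EP) 𝓘(ℝ, EM) iM p v) := by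
  have h1 := split_mfderiv_comp (s := s') hμ' hred.quotient_M.smooth (fun p => (hμq p).symm) p v
  have h2 := split_mfderiv_comp (s := s') hred.quotient_N.smooth hred.smooth_μP (fun _ => rfl) p v
  have h3 : correctedForm D ρ s φ iN iM μP θ p w v =
    φ (iM p) (mfderiv 𝓘(ℝ, EP) 𝓘(ℝ, EM) iM p w) (mfderiv 𝓘(ℝ, EP) 𝓘(ℝ, EM) iM p v) -
    corrForm D ρ s iN θ (μP p) (mfderiv 𝓘(ℝ, EP) 𝓘(ℝ, ES) μP p w)
      (mfderiv 𝓘(ℝ, EP) 𝓘(ℝ, ES) μP p v) := rfl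
  rw [← h1, h2, hφq, (D.reduced 𝔠).symm, hs', h3, hred.split_map_eq hμ,
    hred.isTransitiveQuotient.splitPairing_apply, hw,
    (isTwoForm_corrForm hs hθ hred.smooth_iN).swap (μP p) (hred.isTransitiveQuotient.fieldS η (μP p)),
    D.symm (η : 𝔡)]
  ring

omit hC hs'i hφ' hφ hexact in
/-- The image of an element of `R` over `P` lies in the reduced relation. -/
theorem mem_momentFibre_reduced {p : P} {w : TangentSpace 𝓘(ℝ, EP) p} {η : 𝔠}
    {β : CotangentFibre 𝓘(ℝ, EM) (iM p)} {β' : CotangentFibre 𝓘(ℝ, EM') (qM p)}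
    (hβ : ∀ v, β' (mfderiv 𝓘(ℝ, EP) 𝓘(ℝ, EM') qM p v) = β (mfderiv 𝓘(ℝ, EP) 𝓘(ℝ, EM) iM p v))
    (h : (((η : 𝔡), (mfderiv 𝓘(ℝ, EP) 𝓘(ℝ, EM) iM p w, β)) :
      𝔡 × GenTangent 𝓘(ℝ, EM) (iM p)) ∈ momentFibre D ρ s μ φ (iM p)) :
    ((D.toReduced 𝔠 η, (mfderiv 𝓘(ℝ, EP) 𝓘(ℝ, EM') qM p w, β')) :
      D.Reduced 𝔠 × GenTangent 𝓘(ℝ, EM') (qM p)) ∈ momentFibre (D.reduced 𝔠) ρ' s' μ' φ' (qM p) := by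
  have hw := hred.isTransitiveQuotient.eq_fieldS ((hred.map_eq_field_iff hμ p w η).1 h.1)
  refine ⟨?_, fun v' => ?_⟩
  · refine (mfderiv_comp_eq_field_iff (ρ := ρ') hμ' hred.quotient_M.smooth (fun p => (hμq p).symm)
      p w _).1 ((mfderiv_comp_eq_field_iff hred.quotient_N.smooth hred.smooth_μP (fun _ => rfl)
      p w _).2 ?_)
    rw [hw, hred.isTransitiveQuotient.field_toReduced hρ']
  · obtain ⟨v, rfl⟩ := hred.quotient_M.submersion p v'
    rw [hβ]
    exact (h.2 _).trans (hred.form_sub_reduced hμ hs' hμ' hμq hφq hw hs hθ v).symm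

omit hC hs'i hφ' hφ hexact in
/-- Every element of the reduced relation is the image of an element of `R` over `P`. -/
theorem exists_mem_momentFibre {p : P} {w : TangentSpace 𝓘(ℝ, EP) p} {u : D.Reduced 𝔠}
    {β' : CotangentFibre 𝓘(ℝ, EM') (qM p)}
    (h : ((u, (mfderiv 𝓘(ℝ, EP) 𝓘(ℝ, EM') qM p w, β')) :
      D.Reduced 𝔠 × GenTangent 𝓘(ℝ, EM') (qM p)) ∈ momentFibre (D.reduced 𝔠) ρ' s' μ' φ' (qM p)) :
    ∃ (η : 𝔠) (β : CotangentFibre 𝓘(ℝ, EM) (iM p)), D.toReduced 𝔠 η = u ∧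
      (∀ v, β' (mfderiv 𝓘(ℝ, EP) 𝓘(ℝ, EM') qM p v) = β (mfderiv 𝓘(ℝ, EP) 𝓘(ℝ, EM) iM p v)) ∧
      (((η : 𝔡), (mfderiv 𝓘(ℝ, EP) 𝓘(ℝ, EM) iM p w, β)) :
        𝔡 × GenTangent 𝓘(ℝ, EM) (iM p)) ∈ momentFibre D ρ s μ φ (iM p) := by
  obtain ⟨η₀, rfl⟩ := D.toReduced_surjective u
  have h1 := (mfderiv_comp_eq_field_iff hred.quotient_N.smooth hred.smooth_μP (fun _ => rfl)
    p w _).1 ((mfderiv_comp_eq_field_iff (ρ := ρ') hμ' hred.quotient_M.smooth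
      (fun p => (hμq p).symm) p w _).2 h.1)
  rw [hred.isTransitiveQuotient.field_toReduced hρ', ← sub_eq_zero, ← map_sub] at h1
  obtain ⟨ζ, hζ, hζw⟩ := hred.isTransitiveQuotient.exists_perp_of_vertical h1
  have hw : mfderiv 𝓘(ℝ, EP) 𝓘(ℝ, ES) μP p w =
      hred.isTransitiveQuotient.fieldS (η₀ + ζ) (μP p) := by
    rw [hred.isTransitiveQuotient.fieldS_add, ← hζw]
    exact (add_sub_cancel _ _).symm
  have hη : D.toReduced 𝔠 (η₀ + ζ) = D.toReduced 𝔠 η₀ := by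
    rw [InvariantMetric.toReduced_add, InvariantMetric.toReduced_eq_zero.2 hζ, add_zero]
  refine ⟨η₀ + ζ, (D.form ((η₀ + ζ : 𝔠) : 𝔡) ∘ₗ s (μ (iM p)) ∘ₗ
    (mfderiv 𝓘(ℝ, EM) 𝓘(ℝ, EN) μ (iM p) : _ →ₗ[ℝ] _)) -
      φ (iM p) (mfderiv 𝓘(ℝ, EP) 𝓘(ℝ, EM) iM p w), hη, fun v => ?_,
    (hred.map_eq_field_iff hμ p w _).2 ?_, fun v => rfl⟩
  · refine (h.2 _).trans ?_
    have h2 := hred.form_sub_reduced hμ hs' hμ' hμq hφq hw hs hθ v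
    rw [hη] at h2
    exact h2
  · rw [hw, hred.isTransitiveQuotient.map_fieldS]

end IsTransitiveReductiveData

end ReducedRelation

/-! ### The reduced morphism of Manin pairs -/

section ReducedMorphism

variable {𝔡 : Type*} [LieRing 𝔡] [LieAlgebra ℝ 𝔡] [FiniteDimensional ℝ 𝔡]
  {EN : Type*} [NormedAddCommGroup EN] [NormedSpace ℝ EN] [FiniteDimensional ℝ EN]
  {N : Type*} [TopologicalSpace N] [ChartedSpace EN N] [IsManifold 𝓘(ℝ, EN) ∞ N] [T2Space N]
  {EM : Type*} [NormedAddCommGroup EM] [NormedSpace ℝ EM] [FiniteDimensional ℝ EM]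
  {M : Type*} [TopologicalSpace M] [ChartedSpace EM M] [IsManifold 𝓘(ℝ, EM) ∞ M] [T2Space M]
  {ES : Type*} [NormedAddCommGroup ES] [NormedSpace ℝ ES] [FiniteDimensional ℝ ES]
  {S : Type*} [TopologicalSpace S] [ChartedSpace ES S] [IsManifold 𝓘(ℝ, ES) ∞ S] [T2Space S]
  [SecondCountableTopology S]
  {EP : Type*} [NormedAddCommGroup EP] [NormedSpace ℝ EP] [FiniteDimensional ℝ EP]
  {P : Type*} [TopologicalSpace P] [ChartedSpace EP P] [IsManifold 𝓘(ℝ, EP) ∞ P] [T2Space P]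
  [SecondCountableTopology P]
  {EN' : Type*} [NormedAddCommGroup EN'] [NormedSpace ℝ EN'] [FiniteDimensional ℝ EN']
  {N' : Type*} [TopologicalSpace N'] [ChartedSpace EN' N'] [IsManifold 𝓘(ℝ, EN') ∞ N'] [T2Space N']
  {EM' : Type*} [NormedAddCommGroup EM'] [NormedSpace ℝ EM'] [FiniteDimensional ℝ EM']
  {M' : Type*} [TopologicalSpace M'] [ChartedSpace EM' M'] [IsManifold 𝓘(ℝ, EM') ∞ M'] [T2Space M']
  {D : InvariantMetric 𝔡} {ρ : LieAction 𝓘(ℝ, EN) 𝔡 N} {𝔥 𝔠 : LieSubalgebra ℝ 𝔡}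
  {s : ∀ x : N, TangentSpace 𝓘(ℝ, EN) x →ₗ[ℝ] 𝔡} {μ : M → N}
  {φ : ∀ m : M, TangentSpace 𝓘(ℝ, EM) m →ₗ[ℝ] TangentSpace 𝓘(ℝ, EM) m →ₗ[ℝ] ℝ}
  {iN : S → N} {qN : S → N'} {iM : P → M} {μP : P → S} {qM : P → M'}
  {θ : ∀ x : S, TangentSpace 𝓘(ℝ, ES) x →ₗ[ℝ] 𝔡}

namespace IsTransitiveReductiveData

variable (hred : IsTransitiveReductiveData (ES := ES) (EP := EP) (EN' := EN') (EM' := EM')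
    D ρ 𝔥 𝔠 μ (splitFormRel D ρ s μ φ) iN qN iM μP qM)
  (hμ : ContMDiff 𝓘(ℝ, EM) 𝓘(ℝ, EN) ∞ μ)
  (hexact : (actionCourant D ρ).IsExact) (hs : (actionCourant D ρ).IsIsotropicSplitting s)
  (hθ : IsConnectionForm D ρ 𝔠 iN θ) (hφ : IsTwoForm 𝓘(ℝ, EM) φ)
  (hC : CurvatureEq D ρ s μ φ)
  {ρ' : LieAction 𝓘(ℝ, EN') (D.Reduced 𝔠) N'}
  (hρ' : IsReducedAction (ES := ES) D ρ 𝔠 iN qN ρ')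
  {s' : ∀ y : N', TangentSpace 𝓘(ℝ, EN') y →ₗ[ℝ] D.Reduced 𝔠}
  (hs'i : (actionCourant (D.reduced 𝔠) ρ').IsIsotropicSplitting s')
  (hs' : ∀ x w (η : 𝔠), (D.reduced 𝔠).form
    (s' (qN x) (mfderiv 𝓘(ℝ, ES) 𝓘(ℝ, EN') qN x w)) (D.toReduced 𝔠 η) =
      hred.isTransitiveQuotient.splitPairing s θ x w η)
  {μ' : M' → N'} (hμ' : ContMDiff 𝓘(ℝ, EM') 𝓘(ℝ, EN') ∞ μ') (hμq : ∀ p, μ' (qM p) = qN (μP p))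

variable {φ' : ∀ m : M', TangentSpace 𝓘(ℝ, EM') m →ₗ[ℝ] TangentSpace 𝓘(ℝ, EM') m →ₗ[ℝ] ℝ}
  (hφ' : IsTwoForm 𝓘(ℝ, EM') φ') (hφq : ∀ p (v w : TangentSpace 𝓘(ℝ, EP) p),
    φ' (qM p) (mfderiv 𝓘(ℝ, EP) 𝓘(ℝ, EM') qM p v) (mfderiv 𝓘(ℝ, EP) 𝓘(ℝ, EM') qM p w) =
      correctedForm D ρ s φ iN iM μP θ p v w)

include hred hμ hexact hs in
/-- An element of `R` over `P` whose covector part vanishes on `TP` differs by an element of `𝔠^⊥` from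
one without covector part: by cleanness the covector is the pullback of an annihilator of `TS`. -/
theorem exists_sub_mem_momentFibre {p : P} {X : TangentSpace 𝓘(ℝ, EM) (iM p)} {η : 𝔡}
    {β : CotangentFibre 𝓘(ℝ, EM) (iM p)}
    (hβ : ∀ v : TangentSpace 𝓘(ℝ, EP) p, β (mfderiv 𝓘(ℝ, EP) 𝓘(ℝ, EM) iM p v) = 0)
    (h : ((η, (X, β)) : 𝔡 × GenTangent 𝓘(ℝ, EM) (iM p)) ∈ momentFibre D ρ s μ φ (iM p)) :
    ∃ κ ∈ D.perp 𝔠, ((η - κ, (X, 0)) : 𝔡 × GenTangent 𝓘(ℝ, EM) (iM p)) ∈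
      momentFibre D ρ s μ φ (iM p) := by
  have hfield : ∀ u, (ρ.field u (iN (μP p)) : EN) = ρ.field u (μ (iM p)) := fun u =>
    congrArg (fun y => (ρ.field u y : EN)) (hred.apply_eq p)
  let B : TangentSpace 𝓘(ℝ, ES) (μP p) →L[ℝ] TangentSpace 𝓘(ℝ, EN) (μ (iM p)) :=
    mfderiv 𝓘(ℝ, ES) 𝓘(ℝ, EN) iN (μP p)
  obtain ⟨α, hα, hαβ⟩ := exists_dual_comp
    (mfderiv 𝓘(ℝ, EM) 𝓘(ℝ, EN) μ (iM p) : _ →ₗ[ℝ] TangentSpace 𝓘(ℝ, EN) (μ (iM p)))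
    (B : TangentSpace 𝓘(ℝ, ES) (μP p) →ₗ[ℝ] TangentSpace 𝓘(ℝ, EN) (μ (iM p))) β fun v u hvu => by
      obtain ⟨z, -, rfl⟩ := hred.clean p u v hvu.symm
      exact hβ z
  obtain ⟨κ, hκ⟩ := D.exists_form_eq (α ∘ₗ ρ.evalAt (μ (iM p)))
  have hκ0 : ρ.field κ (μ (iM p)) = 0 := hexact.range_le_ker (μ (iM p)) α κ hκ
  refine ⟨κ, fun y hy => ?_, ?_, fun v => ?_⟩
  · rw [D.symm, hκ]
    have h1 := hα (hred.isTransitiveQuotient.fieldS ⟨y, hy⟩ (μP p))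
    have h2 : (mfderiv 𝓘(ℝ, ES) 𝓘(ℝ, EN) iN (μP p)
      (hred.isTransitiveQuotient.fieldS ⟨y, hy⟩ (μP p)) : EN) = ρ.field y (μ (iM p)) :=
        (hred.isTransitiveQuotient.map_fieldS ⟨y, hy⟩ (μP p)).trans (hfield y)
    exact (congrArg α h2).symm.trans h1
  · refine h.1.trans ?_
    rw [ρ.field_sub, hκ0, sub_zero]
  · have h1 : β v = D.form η (s (μ (iM p)) (mfderiv 𝓘(ℝ, EM) 𝓘(ℝ, EN) μ (iM p) v)) -
      φ (iM p) X v := h.2 v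
    have h2 : D.form κ (s (μ (iM p)) (mfderiv 𝓘(ℝ, EM) 𝓘(ℝ, EN) μ (iM p) v)) = β v := by
      rw [hκ, ← hαβ v]
      exact congrArg α (hs.field_apply (μ (iM p)) _)
    have h3 : D.form (η - κ) (s (μ (iM p)) (mfderiv 𝓘(ℝ, EM) 𝓘(ℝ, EN) μ (iM p) v)) -
      φ (iM p) X v = 0 := by
      rw [map_sub, LinearMap.sub_apply, h2, h1]
      ring
    exact h3.symm

include hred hμ hexact hs hθ hρ' hs' hμ' hμq hφq

/-- An element of the reduced relation with a tangent vector as source comes from an element of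
`R_{μ,φ}` with a tangent vector as source. -/
theorem exists_mem_momentFibre_of_tangent {p : P} {w : TangentSpace 𝓘(ℝ, EP) p} {u : D.Reduced 𝔠}
    (h : ((u, (mfderiv 𝓘(ℝ, EP) 𝓘(ℝ, EM') qM p w, 0)) :
      D.Reduced 𝔠 × GenTangent 𝓘(ℝ, EM') (qM p)) ∈ momentFibre (D.reduced 𝔠) ρ' s' μ' φ' (qM p)) :
    ∃ η : 𝔠, D.toReduced 𝔠 η = u ∧ (((η : 𝔡), (mfderiv 𝓘(ℝ, EP) 𝓘(ℝ, EM) iM p w, 0)) :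
        𝔡 × GenTangent 𝓘(ℝ, EM) (iM p)) ∈ momentFibre D ρ s μ φ (iM p) := by
  obtain ⟨η, β, rfl, h1, h2⟩ := hred.exists_mem_momentFibre hμ hs hθ hρ' hs' hμ' hμq hφq h
  obtain ⟨κ, hκ, h3⟩ := hred.exists_sub_mem_momentFibre hμ hexact hs (fun v => (h1 v).symm) h2
  refine ⟨η - ⟨κ, hred.coisotropic hκ⟩, ?_, h3⟩
  rw [InvariantMetric.toReduced_sub,
    InvariantMetric.toReduced_eq_zero (η := ⟨κ, hred.coisotropic hκ⟩) |>.2 hκ, sub_zero]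

variable (hm1 : ∀ m u X,
  ((u, (X, 0)) : 𝔡 × GenTangent 𝓘(ℝ, EM) m) ∈ momentFibre D ρ s μ φ m → u ∈ 𝔥)
include hm1

/-- The reduced relation maps `TM'` to `𝔥_𝔠`. -/
theorem mem_reducedSub_of_mem_momentFibre (m : M') (u : D.Reduced 𝔠) (X' : TangentSpace 𝓘(ℝ, EM') m)
    (h : ((u, (X', 0)) : D.Reduced 𝔠 × GenTangent 𝓘(ℝ, EM') m) ∈
      momentFibre (D.reduced 𝔠) ρ' s' μ' φ' m) : u ∈ D.reducedSub 𝔠 𝔥 := by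
  obtain ⟨p, rfl⟩ := hred.quotient_M.surjective m
  obtain ⟨w, rfl⟩ := hred.quotient_M.submersion p X'
  obtain ⟨η, hη, h1⟩ :=
    hred.exists_mem_momentFibre_of_tangent hμ hexact hs hθ hρ' hs' hμ' hμq hφq h
  exact ⟨η, hm1 _ _ _ h1, hη⟩

/-- The kernel of the reduced relation meets `TM'` in zero. -/
theorem eq_zero_of_mem_momentFibre (m : M') (X' : TangentSpace 𝓘(ℝ, EM') m)
    (h : ((0, (X', 0)) : D.Reduced 𝔠 × GenTangent 𝓘(ℝ, EM') m) ∈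
      momentFibre (D.reduced 𝔠) ρ' s' μ' φ' m) : X' = 0 := by
  obtain ⟨p, rfl⟩ := hred.quotient_M.surjective m
  obtain ⟨w, rfl⟩ := hred.quotient_M.submersion p X'
  obtain ⟨η, hη, h1⟩ :=
    hred.exists_mem_momentFibre_of_tangent hμ hexact hs hθ hρ' hs' hμ' hμq hφq h
  exact (hred.vertical_iff p w).2 ⟨η, hm1 _ _ _ h1, InvariantMetric.toReduced_eq_zero.1 hη, h1⟩

omit hm1 hexact in
/-- The reduced relation is `R_{μ',φ'}`. -/
theorem reducedRel_iff (u : Σ m : M', GenTangent 𝓘(ℝ, EM') m) (v : Σ _ : N', D.Reduced 𝔠) :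
    reducedRel (EP := EP) D 𝔠 (splitFormRel D ρ s μ φ) iN qN iM qM u v ↔
      splitFormRel (D.reduced 𝔠) ρ' s' μ' φ' u v := by
  constructor
  · rintro ⟨a, b, ⟨t, ⟨p, w, β, rfl, rfl⟩, p', w', β', h1, rfl⟩, hR, x, ξ, rfl, rfl⟩
    obtain ⟨rfl, h2⟩ := Sigma.mk.inj_iff.1 h1
    obtain ⟨rfl, h3⟩ := Prod.mk.inj (eq_of_heq h2)
    have hx : x = μP p := hred.injective_iN ((formRel_support hR).trans (hred.apply_eq p).symm)
    subst hx
    have hv : (⟨qN (μP p), D.toReduced 𝔠 ξ⟩ : Σ _ : N', D.Reduced 𝔠) =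
        ⟨μ' (qM p), D.toReduced 𝔠 ξ⟩ :=
      congrArg (fun y => (⟨y, D.toReduced 𝔠 ξ⟩ : Σ _ : N', D.Reduced 𝔠)) (hμq p).symm
    have hn : (⟨iN (μP p), ξ⟩ : Σ _ : N, 𝔡) = ⟨μ (iM p), ξ⟩ :=
      congrArg (fun y => (⟨y, ξ⟩ : Σ _ : N, 𝔡)) (hred.apply_eq p)
    rw [hn] at hR
    rw [hv]
    exact (splitFormRel_iff _ _ _ _ _ _ _ _).2 (hred.mem_momentFibre_reduced hμ hs hθ hρ' hs' hμ'
      hμq hφq (fun v => (LinearMap.congr_fun h3 v).symm) ((splitFormRel_iff _ _ _ _ _ _ _ _).1 hR))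
  · intro h
    obtain ⟨m, X', β'⟩ := u
    obtain ⟨y, e⟩ := v
    obtain rfl : y = μ' m := formRel_support h
    obtain ⟨p, rfl⟩ := hred.quotient_M.surjective m
    obtain ⟨w, rfl⟩ := hred.quotient_M.submersion p X'
    obtain ⟨η, β, rfl, h1, h2⟩ := hred.exists_mem_momentFibre hμ hs hθ hρ' hs' hμ' hμq hφq
      ((splitFormRel_iff _ _ _ _ _ _ _ _).1 h)
    refine ⟨⟨iM p, mfderiv 𝓘(ℝ, EP) 𝓘(ℝ, EM) iM p w, β⟩, ⟨μ (iM p), η⟩,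
      ⟨⟨p, w, β ∘ₗ (mfderiv 𝓘(ℝ, EP) 𝓘(ℝ, EM) iM p : _ →ₗ[ℝ] _)⟩, ⟨p, w, β, rfl, rfl⟩,
        ⟨p, w, β', ?_, rfl⟩⟩, (splitFormRel_iff _ _ _ _ _ _ _ _).2 h2, μP p, η, ?_, ?_⟩
    · have h3 : β ∘ₗ (mfderiv 𝓘(ℝ, EP) 𝓘(ℝ, EM) iM p : _ →ₗ[ℝ] _) =
          β' ∘ₗ (mfderiv 𝓘(ℝ, EP) 𝓘(ℝ, EM') qM p : _ →ₗ[ℝ] _) :=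
        LinearMap.ext fun v => (h1 v).symm
      rw [h3]
    · exact congrArg (fun y => (⟨y, η⟩ : Σ _ : N, 𝔡)) (hred.apply_eq p).symm
    · exact congrArg (fun y => (⟨y, D.toReduced 𝔠 η⟩ : Σ _ : N', D.Reduced 𝔠)) (hμq p)

end IsTransitiveReductiveData

end ReducedMorphism

/-! ### Reduction of exact morphisms of Manin pairs -/

section Vanishing

variable {𝔡 : Type*} [LieRing 𝔡] [LieAlgebra ℝ 𝔡] [FiniteDimensional ℝ 𝔡]
  {EN : Type*} [NormedAddCommGroup EN] [NormedSpace ℝ EN] [FiniteDimensional ℝ EN]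
  {N : Type*} [TopologicalSpace N] [ChartedSpace EN N] [IsManifold 𝓘(ℝ, EN) ∞ N] [T2Space N]
  {EM : Type*} [NormedAddCommGroup EM] [NormedSpace ℝ EM] [FiniteDimensional ℝ EM]
  {M : Type*} [TopologicalSpace M] [ChartedSpace EM M] [IsManifold 𝓘(ℝ, EM) ∞ M] [T2Space M]
  {ES : Type*} [NormedAddCommGroup ES] [NormedSpace ℝ ES] [FiniteDimensional ℝ ES]
  {S : Type*} [TopologicalSpace S] [ChartedSpace ES S] [IsManifold 𝓘(ℝ, ES) ∞ S] [T2Space S]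
  [SecondCountableTopology S]
  {EP : Type*} [NormedAddCommGroup EP] [NormedSpace ℝ EP] [FiniteDimensional ℝ EP]
  {P : Type*} [TopologicalSpace P] [ChartedSpace EP P] [IsManifold 𝓘(ℝ, EP) ∞ P] [T2Space P]
  [SecondCountableTopology P]
  {EN' : Type*} [NormedAddCommGroup EN'] [NormedSpace ℝ EN'] [FiniteDimensional ℝ EN']
  {N' : Type*} [TopologicalSpace N'] [ChartedSpace EN' N'] [IsManifold 𝓘(ℝ, EN') ∞ N'] [T2Space N']
  {EM' : Type*} [NormedAddCommGroup EM'] [NormedSpace ℝ EM'] [FiniteDimensional ℝ EM']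
  {M' : Type*} [TopologicalSpace M'] [ChartedSpace EM' M'] [IsManifold 𝓘(ℝ, EM') ∞ M'] [T2Space M']
  {D : InvariantMetric 𝔡} {ρ : LieAction 𝓘(ℝ, EN) 𝔡 N} {𝔥 𝔠 : LieSubalgebra ℝ 𝔡}
  {s : ∀ x : N, TangentSpace 𝓘(ℝ, EN) x →ₗ[ℝ] 𝔡} {μ : M → N}
  {φ : ∀ m : M, TangentSpace 𝓘(ℝ, EM) m →ₗ[ℝ] TangentSpace 𝓘(ℝ, EM) m →ₗ[ℝ] ℝ}
  {iN : S → N} {qN : S → N'} {iM : P → M} {μP : P → S} {qM : P → M'}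
  {θ : ∀ x : S, TangentSpace 𝓘(ℝ, ES) x →ₗ[ℝ] 𝔡}

/-- Both terms of the correction form pair the values of `θ`, which lie in `𝔠^⊥`, with values of `s` on
`TS`. -/
theorem IsTransitiveQuotient.correctionForm_eq_zero
    (hT : IsTransitiveQuotient (ES := ES) (EN' := EN') D ρ 𝔠 iN qN)
    (hθ : IsConnectionForm D ρ 𝔠 iN θ) (h : ∀ (x : S) (w : TangentSpace 𝓘(ℝ, ES) x),
      s (iN x) (mfderiv 𝓘(ℝ, ES) 𝓘(ℝ, EN) iN x w) ∈ 𝔠) (x : S) (X Y : TangentSpace 𝓘(ℝ, ES) x) :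
    correctionForm D ρ s iN θ x X Y = 0 := by
  have h1 : ∀ X Y : TangentSpace 𝓘(ℝ, ES) x,
      D.form (θ x X) (s (iN x) (mfderiv 𝓘(ℝ, ES) 𝓘(ℝ, EN) iN x Y)) = 0 := fun X Y =>
    InvariantMetric.form_of_mem_perp (hθ.mem x X) (h x Y)
  have h2 : ∀ X Y : TangentSpace 𝓘(ℝ, ES) x,
      D.form (θ x X) (s (iN x) (ρ.field (θ x Y) (iN x))) = 0 := fun X Y => by
    rw [← hT.map_fieldS ⟨θ x Y, hT.coisotropic (hθ.mem x Y)⟩, h1]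
  rw [correctionForm, connectionPairing, connectionSquare]
  simp only [h1, h2, sub_zero, mul_zero]

end Vanishing

theorem mainTheorem5
    -- the quadratic Lie algebra `𝔡`, a Lagrangian subalgebra `𝔥` and a subalgebra `𝔠`
    {𝔡 : Type*} [LieRing 𝔡] [LieAlgebra ℝ 𝔡] [FiniteDimensional ℝ 𝔡]
    (D : InvariantMetric 𝔡) (𝔥 𝔠 : LieSubalgebra ℝ 𝔡) (h𝔥 : D.perp 𝔥 = 𝔥.toSubmodule)
    -- the manifolds `N`, `M`, `S ⊆ N`, `P = μ⁻¹(S) ⊆ M` and the quotients `N'`, `M'` of `S`, `P`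
    {EN : Type*} [NormedAddCommGroup EN] [NormedSpace ℝ EN] [FiniteDimensional ℝ EN]
    {N : Type*} [TopologicalSpace N] [ChartedSpace EN N] [IsManifold 𝓘(ℝ, EN) ∞ N]
    [T2Space N] [SecondCountableTopology N]
    {EM : Type*} [NormedAddCommGroup EM] [NormedSpace ℝ EM] [FiniteDimensional ℝ EM]
    {M : Type*} [TopologicalSpace M] [ChartedSpace EM M] [IsManifold 𝓘(ℝ, EM) ∞ M]
    [T2Space M] [SecondCountableTopology M]
    {ES : Type*} [NormedAddCommGroup ES] [NormedSpace ℝ ES] [FiniteDimensional ℝ ES]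
    {S : Type*} [TopologicalSpace S] [ChartedSpace ES S] [IsManifold 𝓘(ℝ, ES) ∞ S]
    [T2Space S] [SecondCountableTopology S]
    {EP : Type*} [NormedAddCommGroup EP] [NormedSpace ℝ EP] [FiniteDimensional ℝ EP]
    {P : Type*} [TopologicalSpace P] [ChartedSpace EP P] [IsManifold 𝓘(ℝ, EP) ∞ P]
    [T2Space P] [SecondCountableTopology P]
    {EN' : Type*} [NormedAddCommGroup EN'] [NormedSpace ℝ EN'] [FiniteDimensional ℝ EN']
    {N' : Type*} [TopologicalSpace N'] [ChartedSpace EN' N'] [IsManifold 𝓘(ℝ, EN') ∞ N']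
    [T2Space N'] [SecondCountableTopology N']
    {EM' : Type*} [NormedAddCommGroup EM'] [NormedSpace ℝ EM'] [FiniteDimensional ℝ EM']
    {M' : Type*} [TopologicalSpace M'] [ChartedSpace EM' M'] [IsManifold 𝓘(ℝ, EM') ∞ M']
    [T2Space M'] [SecondCountableTopology M']
    -- the exact action Courant algebroid `𝔡 × N` with its `𝔡`-invariant isotropic splitting `s`
    (ρ : LieAction 𝓘(ℝ, EN) 𝔡 N) (hexact : (actionCourant D ρ).IsExact)
    (s : ∀ x : N, TangentSpace 𝓘(ℝ, EN) x →ₗ[ℝ] 𝔡)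
    (hs : (actionCourant D ρ).IsIsotropicSplitting s) (hs_inv : IsInvariantSplitting ρ s)
    -- the exact morphism of Manin pairs `R_{μ,ω} : (𝕋M, TM) ⇢ (𝕋_γ N, E) ≅ (𝔡, 𝔥) × N`
    (μ : M → N)
    (φ : ∀ m : M, TangentSpace 𝓘(ℝ, EM) m →ₗ[ℝ] TangentSpace 𝓘(ℝ, EM) m →ₗ[ℝ] ℝ)
    (hφ : IsTwoForm 𝓘(ℝ, EM) φ)
    (hR : IsExactManinMorphism (tangentCourant 𝓘(ℝ, EM) (B := M) 0) (tangentDirac 𝓘(ℝ, EM))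
      (actionCourant D ρ) (fun _ => (𝔥 : Set 𝔡)) μ (splitFormRel D ρ s μ φ))
    -- the reductive data `(𝔠, S)`
    (iN : S → N) (qN : S → N') (iM : P → M) (μP : P → S) (qM : P → M')
    (hred : IsTransitiveReductiveData (ES := ES) (EP := EP)
      (EN' := EN') (EM' := EM') D ρ 𝔥 𝔠 μ (splitFormRel D ρ s μ φ) iN qN iM μP qM)
    -- the `𝔠^⊥`-invariant connection `θ`
    (θ : ∀ x : S, TangentSpace 𝓘(ℝ, ES) x →ₗ[ℝ] 𝔡) (hθ : IsConnectionForm D ρ 𝔠 iN θ) :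
    -- the exact Courant algebroid `𝔡_𝔠 × N'`
    (∃! ρ' : LieAction 𝓘(ℝ, EN') (D.Reduced 𝔠) N', IsReducedAction (ES := ES) D ρ 𝔠 iN qN ρ' ∧
      (actionCourant (D.reduced 𝔠) ρ').IsExact ∧
      -- the isotropic splitting `s̃_θ`
      ∃! s' : ∀ y : N', TangentSpace 𝓘(ℝ, EN') y →ₗ[ℝ] D.Reduced 𝔠,
        IsReducedSplitting D ρ 𝔠 s iN qN θ s' ∧
        (actionCourant (D.reduced 𝔠) ρ').IsIsotropicSplitting s' ∧
        -- its curvature `γ̃_θ` and the isomorphism `𝔡_𝔠 × N' ≅ 𝕋_{γ̃_θ} N'`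
        ∃! γ' : ∀ y : N', TangentSpace 𝓘(ℝ, EN') y →ₗ[ℝ] TangentSpace 𝓘(ℝ, EN') y →ₗ[ℝ]
            TangentSpace 𝓘(ℝ, EN') y →ₗ[ℝ] ℝ,
          (actionCourant (D.reduced 𝔠) ρ').IsCurvature s' γ' ∧
          (actionCourant (D.reduced 𝔠) ρ').IsIso (tangentCourant 𝓘(ℝ, EN') γ')
            ((actionCourant (D.reduced 𝔠) ρ').splitMap s') ∧
          -- the map `μ̃`
          ∃! μ' : M' → N', ContMDiff 𝓘(ℝ, EM') 𝓘(ℝ, EN') ∞ μ' ∧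
            (∀ p, μ' (qM p) = qN (μP p)) ∧
            -- the 2-form `ω̃_θ`
            ∃! φ' : ∀ m : M', TangentSpace 𝓘(ℝ, EM') m →ₗ[ℝ] TangentSpace 𝓘(ℝ, EM') m →ₗ[ℝ] ℝ,
              IsTwoForm 𝓘(ℝ, EM') φ' ∧
              (∀ p (X Y : TangentSpace 𝓘(ℝ, EP) p),
                φ' (qM p) (mfderiv 𝓘(ℝ, EP) 𝓘(ℝ, EM') qM p X)
                    (mfderiv 𝓘(ℝ, EP) 𝓘(ℝ, EM') qM p Y) =
                  φ (iM p) (mfderiv 𝓘(ℝ, EP) 𝓘(ℝ, EM) iM p X)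
                    (mfderiv 𝓘(ℝ, EP) 𝓘(ℝ, EM) iM p Y) -
                  correctionForm D ρ s iN θ (μP p) (mfderiv 𝓘(ℝ, EP) 𝓘(ℝ, ES) μP p X)
                    (mfderiv 𝓘(ℝ, EP) 𝓘(ℝ, ES) μP p Y)) ∧
              -- the reduced relation is `R_{μ̃, ω̃_θ}`
              (∀ u v, reducedRel (EP := EP) D 𝔠 (splitFormRel D ρ s μ φ) iN qN iM qM u v ↔
                formRel 𝓘(ℝ, EM') 𝓘(ℝ, EN') μ' φ' u
                  ⟨v.1, (actionCourant (D.reduced 𝔠) ρ').splitMap s' v.1 v.2⟩) ∧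
              -- `R_{μ̃, ω̃_θ} : (𝕋M', TM') ⇢ (𝕋_{γ̃_θ} N', E_{𝔠,S})`
              IsExactManinMorphism (tangentCourant 𝓘(ℝ, EM') (B := M') 0)
                (tangentDirac 𝓘(ℝ, EM')) (tangentCourant 𝓘(ℝ, EN') γ')
                (fun y => (actionCourant (D.reduced 𝔠) ρ').splitMap s' y '' D.reducedSub 𝔠 𝔥)
                μ' (formRel 𝓘(ℝ, EM') 𝓘(ℝ, EN') μ' φ')) ∧
    -- the correction term vanishes if `s(TS) ⊆ 𝔠`
    ((∀ (x : S) (w : TangentSpace 𝓘(ℝ, ES) x),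
        s (iN x) (mfderiv 𝓘(ℝ, ES) 𝓘(ℝ, EN) iN x w) ∈ 𝔠) →
      ∀ p (X Y : TangentSpace 𝓘(ℝ, EP) p),
        correctionForm D ρ s iN θ (μP p) (mfderiv 𝓘(ℝ, EP) 𝓘(ℝ, ES) μP p X)
          (mfderiv 𝓘(ℝ, EP) 𝓘(ℝ, ES) μP p Y) = 0) := by
  have hμ := hR.smooth
  have hC : CurvatureEq D ρ s μ φ := by
    refine curvatureEq_of_isDirac hexact hs hμ hφ ?_
    rw [← graphFibre_splitFormRel]
    exact hR.exactDirac.toIsDirac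
  have hm1 : ∀ m u X,
      ((u, (X, 0)) : 𝔡 × GenTangent 𝓘(ℝ, EM) m) ∈ momentFibre D ρ s μ φ m → u ∈ 𝔥 :=
    fun m u X h => hR.m1 m (X, 0) rfl u ((splitFormRel_iff D ρ s μ φ _ _ _).2 h)
  have hT := hred.isTransitiveQuotient
  refine ⟨?_, fun h p X Y => hT.correctionForm_eq_zero hθ h (μP p) _ _⟩
  obtain ⟨ρ', hρ'⟩ := hT.exists_reducedAction
  have hexact' := hT.isExact_reduced hρ' hexact
  obtain ⟨s', hsm, hs'⟩ := hT.exists_reducedSplitting hexact hs hs_inv hθ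
  have hs'i := hT.isIsotropicSplitting_reduced hexact hs hθ hρ' hs' hsm
  have hs'r := hT.isReducedSplitting hexact hs hθ hs'
  obtain ⟨μ', hμ', hμq⟩ := hred.exists_reducedMap hμ
  obtain ⟨φ', hφ', hφq⟩ :=
    hred.exists_reducedForm hμ hexact hs hθ hφ hC hρ' hs'i hs' hμ' hμq
  have hC' := hred.curvatureEq_reduced hμ hexact hs hθ hφ hC hρ' hs'i hs' hμ' hμq hφ' hφq
  refine ⟨ρ', ⟨hρ', hexact', s', ⟨hs'r, hs'i, curvForm hs'i, ⟨isCurvature_curvForm hs'i,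
    isIso_splitMap hexact' hs'i, μ', ⟨hμ', hμq, φ', ⟨hφ', hφq,
      hred.reducedRel_iff hμ hs hθ hρ' hs' hμ' hμq hφq,
      isExactManinMorphism_formRel hexact' hs'i hμ' hφ' hC'
        (D.isDirac_reducedSub h𝔥 hred.coisotropic ρ')
        (hred.mem_reducedSub_of_mem_momentFibre hμ hexact hs hθ hρ' hs' hμ' hμq hφq hm1)
        (hred.eq_zero_of_mem_momentFibre hμ hexact hs hθ hρ' hs' hμ' hμq hφq hm1)⟩,
      ?_⟩, ?_⟩, ?_⟩, ?_⟩, ?_⟩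
  · rintro φ'' ⟨-, h, -⟩
    refine funext fun m => ?_
    obtain ⟨p, rfl⟩ := hred.quotient_M.surjective m
    refine LinearMap.ext fun v => LinearMap.ext fun w => ?_
    obtain ⟨v, rfl⟩ := hred.quotient_M.submersion p v
    obtain ⟨w, rfl⟩ := hred.quotient_M.submersion p w
    exact (h p v w).trans (hφq p v w).symm
  · rintro μ'' ⟨-, h, -⟩
    refine funext fun m => ?_
    obtain ⟨p, rfl⟩ := hred.quotient_M.surjective m
    rw [h, hμq]
  · rintro γ'' ⟨h, -⟩
    exact CourantData.IsCurvature.unique hs'i h (isCurvature_curvForm hs'i)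
  · rintro s'' ⟨h, -⟩
    exact hT.reducedSplitting_unique hexact hθ h hs'r
  · rintro ρ'' ⟨h, -⟩
    exact hT.reducedAction_unique hρ' h
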